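/- **Setting.** Let $\Sigma=\{1,\dots,\sigma\}$, $n\ge 2$ and $T=T[1,n]\in\Sigma^n$, where every character of $\Sigma$ occurs in $T$ and $T[1]=\$$ is smaller than every other character of $T$ and occurs only at position $1$. A substring $T[i,j]$ (possibly empty) is *right-maximal* if it is a suffix of $T$ or there are characters $a\ne b$ such that both $T[i,j]\,a$ and $T[i,j]\,b$ occur in $T$. A set $S\subseteq[n]$ is *suffixient* for $T$ if for all $1\le i\le j\le n$ with $T[i,j-1]$ right-maximal there is $x\in S$ such that $T[i,j]$ is a suffix of $T[1,x]$. Let $T^{rev}=T[n]\cdots T[1]$, let $SA_r$ be the suffix array of $T^{rev}$ (the starting positions $1,\dots,n$ in lexicographic order of the suffixes), let $BWT_r[i]$ be the character of $T^{rev}$ that cyclically precedes position $SA_r[i]$, and let $LCP_r[1]=0$ and $LCP_r[i]$, for $2\le i\le n$, be the length of the longest common prefix of the suffixes of $T^{rev}$ starting at $SA_r[i-1]$ and $SA_r[i]$. For $x\in[n]$ let $bwt(x)$ be the position in $BWT_r$ of the character $T[x]$, i.e. $bwt(x)=SA_r^{-1}[n+2-x]$ if $x\ge2$ and $bwt(1)=SA_r^{-1}[1]$.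 For $i\in[n]$ let $$PSV[i]=\max(\{j\in[n] : j<i,\ LCP_r[j]<LCP_r[i]\}\cup\{0\}),\qquad NSV[i]=\min(\{j\in[n] : j>i,\ LCP_r[j]<LCP_r[i]\}\cup\{n+1\}),$$ and $box(i)=[PSV[i]+1,\,NSV[i]-1]$. If $BWT_r[i-a-1]\ne BWT_r[i-a]=\dots=BWT_r[i]$ for some $a\in[0,i-2]$, let $SBPR[i]=\max\arg\min LCP_r[i-a,i]$, and otherwise $SBPR[i]=1$. If $BWT_r[i]=\dots=BWT_r[i+b]\ne BWT_r[i+b+1]$ for some $b\in[0,n-i-1]$, let $SAPR[i]=\max\arg\min LCP_r[i+1,i+b+1]$, and otherwise $SAPR[i]=1$. Here $\max\arg\min LCP_r[J]$ (resp. $\max\arg\max LCP_r[J]$) is the largest index in $J$ at which $LCP_r$ attains its minimum (resp. maximum) over $J$. Let $SLPR[i]=\max\arg\max LCP_r[\{SBPR[i],SAPR[i]\}]$. **The algorithm.** Given $T$ and $S\subseteq[n]$ (listed in an arbitrary order, without repetition): 1. compute $BWT_r$, $SA_r^{-1}$, $LCP_r$, $PSV$, $NSV$ and $SLPR$; 2.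 compute $\mathcal A=\{bwt(x): x\in S\}$, sort it into a list $\mathcal B$, and set $\mathcal C[c]$ to the empty list for every $c\in\Sigma$; 3. for $k=1,\dots,|\mathcal B|$ append $SLPR[\mathcal B[k]]$ to the bucket $\mathcal C[BWT_r[\mathcal B[k]]]$; 4. for $c=1,\dots,\sigma$ and $j=2,\dots,|\mathcal C[c]|$: if $PSV[\mathcal C[c][j]]<NSV[\mathcal C[c][j-1]]$, return *false*; 5. return *true*. **Statement.** Step 1 can be implemented so that the whole algorithm (with a bucket sort in step 2 and linked lists in step 3) is a single program, independent of $n,\sigma,T,S$, for a word RAM with unit-cost operations on words of $O(\log n)$ bits, and, for all $n,\sigma,T$ as above and all $S\subseteq[n]$: * the program halts after $O(n)$ steps and uses $O(n)$ words of space, with absolute constants; * it returns *false* if some bucket $\mathcal C[c]$ has two consecutive entries $p,q$ with $box(p)\cap box(q)\neq\emptyset$, and otherwise it returns *true*; * if $S$ is suffixient for $T$, it returns *true* if and only if $S$ has minimum cardinality among all suffixient sets for $T$. -/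

import Mathlib

namespace SuffixientSets

/-! ### Strings and suffixient sets

A string of length `n` is a function `ℕ → ℕ` of which only the values at `1, …, n` matter. -/

/-- The substring `X[i, j]`, which is empty when `j < i`. -/
def sub (X : ℕ → ℕ) (i j : ℕ) : List ℕ :=
  (List.range' i (j + 1 - i)).map X

/-- `T[1, n]` is a text over the effective alphabet `{1, …, σ}` that starts with a character
which is smaller than every other character and occurs nowhere else. -/
structure IsText (n σ : ℕ) (T : ℕ → ℕ) : Prop where
  two_le : 2 ≤ n
  mem_alphabet : ∀ i ∈ Finset.Icc 1 n, T i ∈ Finset.Icc 1 σ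
  effective : ∀ c ∈ Finset.Icc 1 σ, ∃ i ∈ Finset.Icc 1 n, T i = c
  first_lt : ∀ i ∈ Finset.Icc 2 n, T 1 < T i

/-- `α` is a right-maximal string of `T[1, n]`. -/
def RightMaximal (n : ℕ) (T : ℕ → ℕ) (α : List ℕ) : Prop :=
  α <:+ sub T 1 n ∨
    ∃ a b : ℕ, a ≠ b ∧ (α ++ [a]) <:+: sub T 1 n ∧ (α ++ [b]) <:+: sub T 1 n

/-- `S` is suffixient: every one-character right-extension `T[i, j]` of a right-maximal string
`T[i, j - 1]` is a suffix of `T[1, x]` for some `x ∈ S`. -/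
def IsSuffixient (n : ℕ) (T : ℕ → ℕ) (S : Finset ℕ) : Prop :=
  ∀ i j : ℕ, 1 ≤ i → i ≤ j → j ≤ n → RightMaximal n T (sub T i (j - 1)) →
    ∃ x ∈ S, sub T i j <:+ sub T 1 x

/-- `S` is a suffixient set of minimum cardinality. -/
def IsMinSuffixient (n : ℕ) (T : ℕ → ℕ) (S : Finset ℕ) : Prop :=
  S ⊆ Finset.Icc 1 n ∧ IsSuffixient n T S ∧
    ∀ S' : Finset ℕ, S' ⊆ Finset.Icc 1 n → IsSuffixient n T S' → S.card ≤ S'.card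

/-! ### Suffix array, Burrows-Wheeler transform and related arrays

All arrays are indexed by `1, …, n`. -/

/-- The reversed string `X[n] ⋯ X[1]`. -/
def rev (n : ℕ) (X : ℕ → ℕ) : ℕ → ℕ := fun i => X (n + 1 - i)

/-- The starting positions `1, …, n`, sorted by the lexicographic order of the suffixes. -/
def saList (n : ℕ) (X : ℕ → ℕ) : List ℕ :=
  (List.range' 1 n).mergeSort (fun p q => decide (sub X p n ≤ sub X q n))

/-- The suffix array. -/
def SA (n : ℕ) (X : ℕ → ℕ) (i : ℕ) : ℕ := (saList n X).getD (i - 1) 0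

/-- The inverse suffix array. -/
def ISA (n : ℕ) (X : ℕ → ℕ) (p : ℕ) : ℕ := (saList n X).idxOf p + 1

/-- The Burrows-Wheeler transform: the character that cyclically precedes the `i`-th suffix. -/
def BWT (n : ℕ) (X : ℕ → ℕ) (i : ℕ) : ℕ :=
  if SA n X i = 1 then X n else X (SA n X i - 1)

/-- The length of the longest common prefix. -/
def lcp : List ℕ → List ℕ → ℕ
  | a :: as, b :: bs => if a = b then lcp as bs + 1 else 0
  | _, _ => 0

/-- The longest common prefix array, with first entry `0`. -/
def LCP (n : ℕ) (X : ℕ → ℕ) (i : ℕ) : ℕ :=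
  if i ≤ 1 then 0 else lcp (sub X (SA n X (i - 1)) n) (sub X (SA n X i) n)

/-- The previous smaller value array of `A[1, n]`; the entry is `0` if there is none. -/
def PSV (A : ℕ → ℕ) (i : ℕ) : ℕ := ((Finset.Ico 1 i).filter (fun j => A j < A i)).sup id

/-- The next smaller value array of `A[1, n]`; the entry is `n + 1` if there is none. -/
def NSV (n : ℕ) (A : ℕ → ℕ) (i : ℕ) : ℕ :=
  (insert (n + 1) ((Finset.Ioc i n).filter (fun j => A j < A i))).min'
    (Finset.insert_nonempty _ _)

/-- `max argmin A[s]`. -/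
def maxArgmin (A : ℕ → ℕ) (s : Finset ℕ) : ℕ :=
  (s.filter (fun a => ∀ b ∈ s, A a ≤ A b)).sup id

/-- `max argmax A[s]`. -/
def maxArgmax (A : ℕ → ℕ) (s : Finset ℕ) : ℕ :=
  (s.filter (fun a => ∀ b ∈ s, A b ≤ A a)).sup id

/-! The arrays of the reversed text. -/

def BWTr (n : ℕ) (T : ℕ → ℕ) : ℕ → ℕ := BWT n (rev n T)

def LCPr (n : ℕ) (T : ℕ → ℕ) : ℕ → ℕ := LCP n (rev n T)

/-- The position in `BWTr` of the character `T[x]`. The suffix of the reversed text that this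
character cyclically precedes starts at `n + 2 - x` if `2 ≤ x`, and at `1` if `x = 1`. -/
def bwt (n : ℕ) (T : ℕ → ℕ) (x : ℕ) : ℕ :=
  ISA n (rev n T) (if x = 1 then 1 else n + 2 - x)

/-- The `a ∈ [0, i - 2]` with `BWTr[i - a - 1] ≠ BWTr[i - a] = ⋯ = BWTr[i]`.
There is at most one. -/
def belowSet (n : ℕ) (T : ℕ → ℕ) (i : ℕ) : Finset ℕ :=
  (Finset.range (i - 1)).filter (fun a =>
    BWTr n T (i - a - 1) ≠ BWTr n T (i - a) ∧
      ∀ h ∈ Finset.Icc (i - a) i, BWTr n T h = BWTr n T i)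

/-- The `b ∈ [0, n - i - 1]` with `BWTr[i] = ⋯ = BWTr[i + b] ≠ BWTr[i + b + 1]`.
There is at most one. -/
def aboveSet (n : ℕ) (T : ℕ → ℕ) (i : ℕ) : Finset ℕ :=
  (Finset.range (n - i)).filter (fun b =>
    BWTr n T (i + b) ≠ BWTr n T (i + b + 1) ∧
      ∀ h ∈ Finset.Icc i (i + b), BWTr n T h = BWTr n T i)

def SBPR (n : ℕ) (T : ℕ → ℕ) (i : ℕ) : ℕ :=
  if (belowSet n T i).Nonempty then
    maxArgmin (LCPr n T) (Finset.Icc (i - (belowSet n T i).sup id) i)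
  else 1

def SAPR (n : ℕ) (T : ℕ → ℕ) (i : ℕ) : ℕ :=
  if (aboveSet n T i).Nonempty then
    maxArgmin (LCPr n T) (Finset.Icc (i + 1) (i + (aboveSet n T i).sup id + 1))
  else 1

def SLPR (n : ℕ) (T : ℕ → ℕ) (i : ℕ) : ℕ :=
  maxArgmax (LCPr n T) {SBPR n T i, SAPR n T i}

/-- The interval `[PSV[i] + 1, NSV[i] - 1]` over `LCPr`. -/
def box (n : ℕ) (T : ℕ → ℕ) (i : ℕ) : Finset ℕ :=
  Finset.Icc (PSV (LCPr n T) i + 1) (NSV n (LCPr n T) i - 1)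

/-- The bucket of the character `c`: the `SLPR` values of those positions `bwt(x)`, `x ∈ S`,
that carry the character `c` in `BWTr`, listed by increasing position. -/
def bucket (n : ℕ) (T : ℕ → ℕ) (S : Finset ℕ) (c : ℕ) : List ℕ :=
  (((S.image (bwt n T)).filter (fun i => BWTr n T i = c)).sort (· ≤ ·)).map (SLPR n T)

/-- Some bucket has two consecutive entries whose boxes overlap. -/
def ConsecutiveOverlap (n σ : ℕ) (T : ℕ → ℕ) (S : Finset ℕ) : Prop :=
  ∃ c ∈ Finset.Icc 1 σ, ∃ (l₁ l₂ : List ℕ) (p q : ℕ),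
    bucket n T S c = l₁ ++ p :: q :: l₂ ∧ (box n T p ∩ box n T q).Nonempty

/-! ### A word RAM

A program has finitely many registers and arrays. A word holds a number below `N`, and an array
has `N` cells, indexed by `0, …, N - 1`. A program that produces a larger number, or that
addresses a cell outside of this range, gets stuck. Every operation costs one step. -/

/-- Names of registers. -/
inductive Reg
  | n | sigma | m | i | k | c | p | q | cnt | res
  | aux (j : ℕ)
  deriving DecidableEq

/-- Names of arrays. -/
inductive Arr
  | T | S | BWT | ISA | LCP | PSV | NSV | SLPR
  | A | mark | B | val | next | head | tail
  | aux (j : ℕ)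
  deriving DecidableEq

inductive Op
  | add | sub | mul | div | mod | lt | le | eq

/-- Subtraction is truncated; comparisons return `1` or `0`. -/
def Op.apply : Op → ℕ → ℕ → ℕ
  | .add, a, b => a + b
  | .sub, a, b => a - b
  | .mul, a, b => a * b
  | .div, a, b => a / b
  | .mod, a, b => a % b
  | .lt, a, b => if a < b then 1 else 0
  | .le, a, b => if a ≤ b then 1 else 0
  | .eq, a, b => if a = b then 1 else 0

inductive Expr
  | lit (v : ℕ)
  | reg (r : Reg)
  | get (a : Arr) (e : Expr)
  | bin (o : Op) (e f : Expr)

inductive Com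
  | skip
  | assign (r : Reg) (e : Expr)
  | put (a : Arr) (e f : Expr)
  | seq (c d : Com)
  | cond (e : Expr) (c d : Com)
  | loop (e : Expr) (c : Com)

structure Store where
  reg : Reg → ℕ
  arr : Arr → ℕ → ℕ

def Store.setReg (s : Store) (r : Reg) (v : ℕ) : Store :=
  { s with reg := fun r' => if r' = r then v else s.reg r' }

def Store.setArr (s : Store) (a : Arr) (j v : ℕ) : Store :=
  { s with arr := fun a' j' => if a' = a ∧ j' = j then v else s.arr a' j' }

/-- The number `v`, if it fits into a word. -/
def word (N v : ℕ) : Option ℕ := if v < N then some v else none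

/-- The value of an expression; `none` if the evaluation gets stuck. -/
def Expr.eval (N : ℕ) (s : Store) : Expr → Option ℕ
  | .lit v => word N v
  | .reg r => word N (s.reg r)
  | .get a e => (e.eval N s).bind fun j => word N (s.arr a j)
  | .bin o e f => (e.eval N s).bind fun x => (f.eval N s).bind fun y => word N (o.apply x y)

/-- The number of steps of the evaluation. -/
def Expr.cost : Expr → ℕ
  | .lit _ => 1
  | .reg _ => 1
  | .get _ e => e.cost + 1
  | .bin _ e f => e.cost + f.cost + 1

/-- `Exec N c s t s'`: started in `s`, the program `c` halts in `s'` after exactly `t` steps. -/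
inductive Exec (N : ℕ) : Com → Store → ℕ → Store → Prop
  | skip (s : Store) : Exec N .skip s 1 s
  | assign {r : Reg} {e : Expr} {s : Store} {v : ℕ} (h : e.eval N s = some v) :
      Exec N (.assign r e) s (e.cost + 1) (s.setReg r v)
  | put {a : Arr} {e f : Expr} {s : Store} {j v : ℕ}
      (he : e.eval N s = some j) (hf : f.eval N s = some v) :
      Exec N (.put a e f) s (e.cost + f.cost + 1) (s.setArr a j v)
  | seq {c d : Com} {s s' s'' : Store} {t t' : ℕ}
      (hc : Exec N c s t s') (hd : Exec N d s' t' s'') :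
      Exec N (.seq c d) s (t + t') s''
  | condTrue {e : Expr} {c d : Com} {s s' : Store} {v t : ℕ}
      (he : e.eval N s = some v) (hv : v ≠ 0) (hc : Exec N c s t s') :
      Exec N (.cond e c d) s (e.cost + 1 + t) s'
  | condFalse {e : Expr} {c d : Com} {s s' : Store} {t : ℕ}
      (he : e.eval N s = some 0) (hd : Exec N d s t s') :
      Exec N (.cond e c d) s (e.cost + 1 + t) s'
  | loopDone {e : Expr} {c : Com} {s : Store} (he : e.eval N s = some 0) :
      Exec N (.loop e c) s (e.cost + 1) s
  | loopStep {e : Expr} {c : Com} {s s' s'' : Store} {v t t' : ℕ}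
      (he : e.eval N s = some v) (hv : v ≠ 0) (hc : Exec N c s t s')
      (hl : Exec N (.loop e c) s' t' s'') :
      Exec N (.loop e c) s (e.cost + 1 + t + t') s''

def Expr.regs : Expr → Finset Reg
  | .lit _ => ∅
  | .reg r => {r}
  | .get _ e => e.regs
  | .bin _ e f => e.regs ∪ f.regs

def Expr.arrs : Expr → Finset Arr
  | .lit _ => ∅
  | .reg _ => ∅
  | .get a e => insert a e.arrs
  | .bin _ e f => e.arrs ∪ f.arrs

/-- The registers that occur in a program. -/
def Com.regs : Com → Finset Reg
  | .skip => ∅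
  | .assign r e => insert r e.regs
  | .put _ e f => e.regs ∪ f.regs
  | .seq c d => c.regs ∪ d.regs
  | .cond e c d => e.regs ∪ c.regs ∪ d.regs
  | .loop e c => e.regs ∪ c.regs

/-- The arrays that occur in a program. -/
def Com.arrs : Com → Finset Arr
  | .skip => ∅
  | .assign _ e => e.arrs
  | .put a e f => insert a (e.arrs ∪ f.arrs)
  | .seq c d => c.arrs ∪ d.arrs
  | .cond e c d => e.arrs ∪ c.arrs ∪ d.arrs
  | .loop e c => e.arrs ∪ c.arrs

/-- The number of words that a program occupies when each of its arrays has `N` cells. -/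
def Com.space (N : ℕ) (c : Com) : ℕ := c.arrs.card * N + c.regs.card

/-! ### The algorithm as a program -/

/-- The initial memory: `n`, `σ` and the number `m` of elements of the list `L`, the text in
`T[1, n]` and `L` in `S[1, m]`; everything else is `0`. -/
def input (n σ : ℕ) (T : ℕ → ℕ) (L : List ℕ) : Store where
  reg := fun
    | .n => n
    | .sigma => σ
    | .m => L.length
    | _ => 0
  arr := fun
    | .T => fun j => if 1 ≤ j ∧ j ≤ n then T j else 0
    | .S => fun j => if 1 ≤ j ∧ j ≤ L.length then L.getD (j - 1) 0 else 0
    | _ => fun _ => 0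

/-- In the memory `s` the arrays of the reversed text have been computed, and the input is still
present. -/
structure Prepared (n σ : ℕ) (T : ℕ → ℕ) (L : List ℕ) (s : Store) : Prop where
  bwt : ∀ i ∈ Finset.Icc 1 n, s.arr .BWT i = BWTr n T i
  isa : ∀ i ∈ Finset.Icc 1 n, s.arr .ISA i = ISA n (rev n T) i
  lcp : ∀ i ∈ Finset.Icc 1 n, s.arr .LCP i = LCPr n T i
  psv : ∀ i ∈ Finset.Icc 1 n, s.arr .PSV i = PSV (LCPr n T) i
  nsv : ∀ i ∈ Finset.Icc 1 n, s.arr .NSV i = NSV n (LCPr n T) i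
  slpr : ∀ i ∈ Finset.Icc 1 n, s.arr .SLPR i = SLPR n T i
  reg_n : s.reg .n = n
  reg_sigma : s.reg .sigma = σ
  reg_m : s.reg .m = L.length
  arr_T : ∀ j ∈ Finset.Icc 1 n, s.arr .T j = T j
  arr_S : ∀ j ∈ Finset.Icc 1 L.length, s.arr .S j = L.getD (j - 1) 0

/-- `for r = lo, …, hi do c`. -/
def forUp (r : Reg) (lo hi : Expr) (c : Com) : Com :=
  .seq (.assign r lo)
    (.loop (.bin .le (.reg r) hi)
      (.seq c (.assign r (.bin .add (.reg r) (.lit 1)))))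

/-- `A ← {bwt(s) | s ∈ S}`, where `bwt(s) = ISA[((n + 1 - s) mod n) + 1]`. -/
def computeA : Com :=
  forUp .k (.lit 1) (.reg .m)
    (.put .A (.reg .k)
      (.get .ISA (.bin .add
        (.bin .mod (.bin .sub (.bin .add (.reg .n) (.lit 1)) (.get .S (.reg .k))) (.reg .n))
        (.lit 1))))

/-- `B[1, |A|] ← sort(A)`, by a bucket sort with one bucket for each number in `[1, n]`. -/
def sortA : Com :=
  .seq (forUp .i (.lit 1) (.reg .n) (.put .mark (.reg .i) (.lit 0)))
  (.seq (forUp .k (.lit 1) (.reg .m) (.put .mark (.get .A (.reg .k)) (.lit 1)))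
  (.seq (.assign .cnt (.lit 0))
    (forUp .i (.lit 1) (.reg .n)
      (.cond (.get .mark (.reg .i))
        (.seq (.assign .cnt (.bin .add (.reg .cnt) (.lit 1)))
          (.put .B (.reg .cnt) (.reg .i)))
        .skip))))

/-- `C[1, σ] ← ([ ], …, [ ])`, and then, for `k = 1, …, |B|`,
`C[BWT[B[k]]].append(SLPR[B[k]])`.
The bucket `C[c]` is a linked list: its cells are numbers `k ≥ 1`, the entry in the cell `k` is
`val[k]`, the cell after `k` is `next[k]`, its first and last cells are `head[c]` and `tail[c]`,
and `0` stands for a missing cell. -/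
def fillBuckets : Com :=
  .seq (.put .next (.lit 0) (.lit 0))
  (.seq
    (forUp .c (.lit 1) (.reg .sigma)
      (.seq (.put .head (.reg .c) (.lit 0)) (.put .tail (.reg .c) (.lit 0))))
    (forUp .k (.lit 1) (.reg .cnt)
      (.seq (.assign .c (.get .BWT (.get .B (.reg .k))))
      (.seq (.put .val (.reg .k) (.get .SLPR (.get .B (.reg .k))))
      (.seq (.put .next (.reg .k) (.lit 0))
      (.seq
        (.cond (.get .tail (.reg .c))
          (.put .next (.get .tail (.reg .c)) (.reg .k))
          (.put .head (.reg .c) (.reg .k)))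
        (.put .tail (.reg .c) (.reg .k))))))))

/-- For `i = 1, …, σ` and for all consecutive entries `p`, `q` of `C[i]`: return `false` if
`PSV[q] < NSV[p]`. Otherwise return `true`. The register `res` holds the answer. -/
def scanBuckets : Com :=
  .seq (.assign .res (.lit 1))
  (.seq (.assign .i (.lit 1))
    (.loop (.bin .mul (.bin .le (.reg .i) (.reg .sigma)) (.reg .res))
      (.seq (.assign .p (.get .head (.reg .i)))
      (.seq
        (.loop (.bin .mul (.reg .res) (.get .next (.reg .p)))
          (.seq (.assign .q (.get .next (.reg .p)))
            (.cond
              (.bin .lt (.get .PSV (.get .val (.reg .q))) (.get .NSV (.get .val (.reg .p))))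
              (.assign .res (.lit 0))
              (.assign .p (.reg .q)))))
        (.assign .i (.bin .add (.reg .i) (.lit 1)))))))

/-- The minimality test. The program `pre` computes the arrays `BWTr`, `SAr⁻¹`, `LCPr`, `PSV`,
`NSV` and `SLPR`. -/
def minimalityTest (pre : Com) : Com :=
  .seq pre (.seq computeA (.seq sortA (.seq fillBuckets scanBuckets)))

end SuffixientSets

open SuffixientSets

/-!
The right-maximal contexts of a position `x ≥ 2` of the text, read from right to left, are
prefixes of the row `bwt(x)` of the sorted suffixes of the reversed text. Such a prefix is
right-maximal exactly if it is shared by a row that carries another character in the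
Burrows-Wheeler transform. The rows of a run of equal characters are adjacent, so the longest
shared prefix is found at one of the two ends of the run, and its length is the entry of the LCP
array at `SLPR[bwt(x)]` (`slprSpec`, `IsText.rightMaximal_iff`). Hence every position `x` has a
*longest extension* `longestExt n T x`, and `S` is suffixient if and only if the longest extension
of every position is a suffix of `T[1, y]` for some `y ∈ S` (`IsText.isSuffixient_iff`). If the
longest extension of `x ∈ S` is a suffix of that of another `y ∈ S`, then `x` is redundant. If no
two elements of `S` are comparable in this way, then each of them needs its own element in any
suffixient set. So a suffixient set has minimum cardinality if and only if it contains no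
comparable elements (`IsText.isMinSuffixient_iff`). In terms of the LCP array, two positions with
the same character are comparable if and only if no entry between their rows drops below the
smaller one of the two lengths (`IsText.near_iff`), and this happens if and only if their boxes
overlap (`box_inter_iff_near`). A comparable pair at minimum distance is consecutive in its bucket
(`IsText.comparable_iff`), and for consecutive entries the comparison of a `PSV` with an `NSV`
value detects the overlap (`PSV_lt_NSV_iff`). This gives `IsText.isMinSuffixient_iff_not_overlap`
and `IsText.consecutiveOverlap_iff_lt`.

Programs are verified by a total correctness logic with running times. `Runs N c s Q` says that
`c` halts from `s`, and that `Q` holds for the number of steps and the final memory. Programs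
without loops are treated by weakest preconditions (`Runs.straight`), loops by an invariant
together with a potential that pays for every step (`Runs.loop`), and counting loops by
`Runs.forUp`. Since running a program includes that every number and every address is below `N`,
the word size and the space bound come with it.

The arrays are prepared in linear time. The suffixes of the reversed text are sorted by the
difference cover method, without recursion: the level `j` consists of the positions `sample n j`,
between which steps have the length `3 ^ j`, and each level has at most two thirds of the positions
of the level before (`card_sample_succ`). Descending, the windows of length `3 ^ (j + 1)` at the
positions of the next level are ranked by a radix sort with three passes, as each of them consists
of three windows of the current level (`descendStep_runs`). At the last level the windows are whole
suffixes (`turn_runs`). Ascending, the positions dropped at a level are sorted by their window and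
the rank of the rest, which starts at a position of the next level, and they are merged with the
latter, where every comparison takes constant time (`merge_compare`, `ascendStep_runs`). The time
of a level is proportional to its number of positions, and these numbers decrease geometrically.
The LCP array is filled in the order of the positions, where the length of the match decreases by
at most one from a position to the next (`LCP_ISA_succ`, `fillLCP_runs`). Previous and next smaller
values are found by following those already known (`fillPSV_runs`, `fillNSV_runs`), and `SBPR`,
`SAPR` and `SLPR` by scans. Finally, `test_runs` verifies the test on the prepared arrays.
-/

set_option linter.unusedSimpArgs false

namespace SuffixientSets

/-! ### Reasoning about programs -/

/-- Every register and every array cell of `s` holds a word. -/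
def Fits (N : ℕ) (s : Store) : Prop := (∀ r, s.reg r < N) ∧ ∀ a j, s.arr a j < N

/-- The value of an expression when no intermediate result overflows. -/
def Expr.val (s : Store) : Expr → ℕ
  | .lit v => v
  | .reg r => s.reg r
  | .get a e => s.arr a (e.val s)
  | .bin o e f => o.apply (e.val s) (f.val s)

/-- The condition under which applying `o` to two words yields a word again: only sums and
products can overflow. -/
def Op.Safe (N : ℕ) : Op → ℕ → ℕ → Prop
  | .add, a, b => a + b < N
  | .mul, a, b => a * b < N
  | _, _, _ => True

/-- The evaluation of an expression does not get stuck in a memory that holds only words. -/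
def Expr.Safe (N : ℕ) (s : Store) : Expr → Prop
  | .lit v => v < N
  | .reg _ => True
  | .get _ e => e.Safe N s
  | .bin o e f => e.Safe N s ∧ f.Safe N s ∧ o.Safe N (e.val s) (f.val s)

theorem Op.Safe.apply_lt {N : ℕ} (hN : 2 ≤ N) {o : Op} {a b : ℕ} (h : o.Safe N a b)
    (ha : a < N) : o.apply a b < N := by
  cases o <;> simp only [Op.Safe, Op.apply] at * <;> try assumption
  · omega
  · exact (Nat.div_le_self _ _).trans_lt ha
  · exact (Nat.mod_le _ _).trans_lt ha
  all_goals split <;> omega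

/-- An expression that is `Safe` evaluates to its value `Expr.val`, which is a word. -/
theorem Expr.Safe.eval_eq {N : ℕ} (hN : 2 ≤ N) {s : Store} (hs : Fits N s) {e : Expr}
    (h : e.Safe N s) : e.eval N s = some (e.val s) ∧ e.val s < N := by
  induction e with
  | lit v => simp_all [Expr.Safe, Expr.eval, Expr.val, word]
  | reg r => simp [Expr.eval, Expr.val, word, hs.1]
  | get a e ih => simp [Expr.eval, Expr.val, word, hs.2, ih h]
  | bin o e f ihe ihf =>
    have := h.2.2.apply_lt hN (ihe h.1).2
    simp [Expr.eval, Expr.val, word, ihe h.1, ihf h.2.1, this]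

theorem Expr.eval_lt {N v : ℕ} {s : Store} {e : Expr} (h : e.eval N s = some v) : v < N := by
  cases e <;> simp only [Expr.eval, word, Option.bind_eq_some_iff, Option.ite_none_right_eq_some,
    Option.some.injEq] at h
  · omega
  · omega
  · obtain ⟨_, _, h⟩ := h; omega
  · obtain ⟨_, _, _, _, h⟩ := h; omega

@[simp] theorem Store.setReg_reg (s : Store) (r r' : Reg) (v : ℕ) :
    (s.setReg r v).reg r' = if r' = r then v else s.reg r' := rfl

@[simp] theorem Store.setReg_arr (s : Store) (r : Reg) (v : ℕ) :
    (s.setReg r v).arr = s.arr := rfl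

@[simp] theorem Store.setArr_reg (s : Store) (a : Arr) (j v : ℕ) :
    (s.setArr a j v).reg = s.reg := rfl

@[simp] theorem Store.setArr_arr (s : Store) (a a' : Arr) (j v : ℕ) :
    (s.setArr a j v).arr a' = if a' = a then Function.update (s.arr a) j v else s.arr a' := by
  funext j'
  by_cases h : a' = a
  · subst h; simp [Store.setArr, Function.update_apply]
  · simp [Store.setArr, h]

theorem Fits.setReg {N : ℕ} {s : Store} (h : Fits N s) (r : Reg) {v : ℕ} (hv : v < N) :
    Fits N (s.setReg r v) := by
  refine ⟨fun r' => ?_, h.2⟩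
  simp only [Store.setReg_reg]; split
  exacts [hv, h.1 _]

theorem Fits.setArr {N : ℕ} {s : Store} (h : Fits N s) (a : Arr) (j : ℕ) {v : ℕ} (hv : v < N) :
    Fits N (s.setArr a j v) := by
  refine ⟨h.1, fun a' j' => ?_⟩
  simp only [Store.setArr]; split
  exacts [hv, h.2 _ _]

theorem Exec.fits {N : ℕ} {c : Com} {s s' : Store} {t : ℕ} (h : Exec N c s t s')
    (hs : Fits N s) : Fits N s' := by
  induction h with
  | skip => exact hs
  | assign h => exact hs.setReg _ (Expr.eval_lt h)
  | put he hf => exact hs.setArr _ _ (Expr.eval_lt hf)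
  | seq _ _ ih₁ ih₂ => exact ih₂ (ih₁ hs)
  | condTrue _ _ _ ih => exact ih hs
  | condFalse _ _ ih => exact ih hs
  | loopDone => exact hs
  | loopStep _ _ _ _ ih₁ ih₂ => exact ih₂ (ih₁ hs)

/-- `c` contains an assignment to the array `b`. -/
def Com.writesArr : Com → Arr → Bool
  | .skip, _ => false
  | .assign _ _, _ => false
  | .put a _ _, b => decide (b = a)
  | .seq c d, b => c.writesArr b || d.writesArr b
  | .cond _ c d, b => c.writesArr b || d.writesArr b
  | .loop _ c, b => c.writesArr b

/-- `c` contains an assignment to the register `r`. -/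
def Com.writesReg : Com → Reg → Bool
  | .skip, _ => false
  | .assign r' _, r => decide (r = r')
  | .put _ _ _, _ => false
  | .seq c d, r => c.writesReg r || d.writesReg r
  | .cond _ c d, r => c.writesReg r || d.writesReg r
  | .loop _ c, r => c.writesReg r

/-- `s'` agrees with `s` on everything that `c` has no assignment to. -/
structure Agree (c : Com) (s s' : Store) : Prop where
  arr : ∀ a, c.writesArr a = false → s'.arr a = s.arr a
  reg : ∀ r, c.writesReg r = false → s'.reg r = s.reg r

theorem Agree.refl (c : Com) (s : Store) : Agree c s s := ⟨fun _ _ => rfl, fun _ _ => rfl⟩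

theorem Agree.trans {c : Com} {s s' s'' : Store} (h : Agree c s s') (h' : Agree c s' s'') :
    Agree c s s'' :=
  ⟨fun a ha => (h'.arr a ha).trans (h.arr a ha), fun r hr => (h'.reg r hr).trans (h.reg r hr)⟩

theorem Exec.agree {N : ℕ} {c : Com} {s s' : Store} {t : ℕ} (h : Exec N c s t s') :
    Agree c s s' := by
  induction h with
  | skip => exact .refl _ _
  | assign h => 
    refine ⟨fun a _ => rfl, fun r hr => ?_⟩
    simp only [Com.writesReg, decide_eq_false_iff_not] at hr
    simp [hr]
  | put he hf =>
    refine ⟨fun a ha => ?_, fun r _ => rfl⟩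
    simp only [Com.writesArr, decide_eq_false_iff_not] at ha
    simp [ha]
  | seq _ _ ih₁ ih₂ =>
    refine ⟨fun a ha => ?_, fun r hr => ?_⟩
    · simp only [Com.writesArr, Bool.or_eq_false_iff] at ha
      rw [ih₂.arr a ha.2, ih₁.arr a ha.1]
    · simp only [Com.writesReg, Bool.or_eq_false_iff] at hr
      rw [ih₂.reg r hr.2, ih₁.reg r hr.1]
  | condTrue _ _ _ ih =>
    refine ⟨fun a ha => ?_, fun r hr => ?_⟩
    · simp only [Com.writesArr, Bool.or_eq_false_iff] at ha
      exact ih.arr a ha.1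
    · simp only [Com.writesReg, Bool.or_eq_false_iff] at hr
      exact ih.reg r hr.1
  | condFalse _ _ ih =>
    refine ⟨fun a ha => ?_, fun r hr => ?_⟩
    · simp only [Com.writesArr, Bool.or_eq_false_iff] at ha
      exact ih.arr a ha.2
    · simp only [Com.writesReg, Bool.or_eq_false_iff] at hr
      exact ih.reg r hr.2
  | loopDone => exact .refl _ _
  | loopStep _ _ _ _ ih₁ ih₂ => exact Agree.trans ⟨ih₁.arr, ih₁.reg⟩ ih₂

/-- Total correctness with a running time: started in `s`, a memory that holds only words, the
program `c` halts after some number `t` of steps in some memory `s'` with `Q t s'`. -/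
def Runs (N : ℕ) (c : Com) (s : Store) (Q : ℕ → Store → Prop) : Prop :=
  Fits N s → ∃ t s', Exec N c s t s' ∧ Q t s'

/-- The rule of consequence. It also provides that the final memory holds only words and that
what `c` does not assign to is unchanged. -/
theorem Runs.mono {N : ℕ} {c : Com} {s : Store} {Q Q' : ℕ → Store → Prop} (h : Runs N c s Q)
    (hQ : ∀ t s', Fits N s' → Agree c s s' → Q t s' → Q' t s') : Runs N c s Q' := by
  intro hs
  obtain ⟨t, s', he, hq⟩ := h hs
  exact ⟨t, s', he, hQ t s' (he.fits hs) he.agree hq⟩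

theorem Runs.seq {N : ℕ} {c d : Com} {s : Store} {Q : ℕ → Store → Prop}
    (h : Runs N c s fun t s' => Runs N d s' fun t' s'' => Q (t + t') s'') :
    Runs N (.seq c d) s Q := by
  intro hs
  obtain ⟨t, s', he, hd⟩ := h hs
  obtain ⟨t', s'', he', hq⟩ := hd (he.fits hs)
  exact ⟨_, _, .seq he he', hq⟩

/-- An upper bound for the number of steps of a program without loops. -/
def Com.cost : Com → ℕ
  | .skip => 1
  | .assign _ e => e.cost + 1
  | .put _ e f => e.cost + f.cost + 1
  | .seq c d => c.cost + d.cost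
  | .cond e c d => e.cost + 1 + max c.cost d.cost
  | .loop _ _ => 0

/-- The weakest precondition of a program without loops. -/
def Com.wp (N : ℕ) : Com → (Store → Prop) → Store → Prop
  | .skip, Q, s => Q s
  | .assign r e, Q, s => e.Safe N s ∧ Q (s.setReg r (e.val s))
  | .put a e f, Q, s => e.Safe N s ∧ f.Safe N s ∧ Q (s.setArr a (e.val s) (f.val s))
  | .seq c d, Q, s => c.wp N (d.wp N Q) s
  | .cond e c d, Q, s =>
      e.Safe N s ∧ (e.val s ≠ 0 → c.wp N Q s) ∧ (e.val s = 0 → d.wp N Q s)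
  | .loop _ _, _, _ => False

/-- The rule for programs without loops. -/
theorem Runs.straight {N : ℕ} (hN : 2 ≤ N) {c : Com} {s : Store} {Q : Store → Prop}
    (h : c.wp N Q s) : Runs N c s fun t s' => t ≤ c.cost ∧ Q s' := by
  intro hs
  induction c generalizing s Q with
  | skip => exact ⟨_, _, .skip s, le_rfl, h⟩
  | assign r e => exact ⟨_, _, .assign (h.1.eval_eq hN hs).1, le_rfl, h.2⟩
  | put a e f =>
    exact ⟨_, _, .put (h.1.eval_eq hN hs).1 (h.2.1.eval_eq hN hs).1, le_rfl, h.2.2⟩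
  | seq c d ihc ihd =>
    obtain ⟨t, s', he, ht, h'⟩ := ihc h hs
    obtain ⟨t', s'', he', ht', h''⟩ := ihd h' (he.fits hs)
    exact ⟨_, _, .seq he he', Nat.add_le_add ht ht', h''⟩
  | cond e c d ihc ihd =>
    by_cases hv : e.val s = 0
    · obtain ⟨t, s', he, ht, h'⟩ := ihd (h.2.2 hv) hs
      have h0 := (h.1.eval_eq hN hs).1
      rw [hv] at h0
      refine ⟨_, _, .condFalse h0 he, ?_, h'⟩
      simp only [Com.cost]; omega
    · obtain ⟨t, s', he, ht, h'⟩ := ihc (h.2.1 hv) hs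
      refine ⟨_, _, .condTrue (h.1.eval_eq hN hs).1 hv he, ?_, h'⟩
      simp only [Com.cost]; omega
  | loop => exact h.elim

/-- The rule for loops, with an invariant `I` and a potential `Φ` that pays for every step. -/
theorem Runs.loop {N : ℕ} (hN : 2 ≤ N) {e : Expr} {c : Com} {s : Store} (I : Store → Prop)
    (Φ : Store → ℕ) (h0 : I s)
    (hstep : ∀ s', Fits N s' → Agree c s s' → I s' → e.Safe N s' ∧ (e.val s' ≠ 0 →
      Runs N c s' fun t s'' => I s'' ∧ e.cost + 1 + t + Φ s'' ≤ Φ s')) :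
    Runs N (.loop e c) s fun t s' => I s' ∧ e.val s' = 0 ∧ t + Φ s' ≤ Φ s + (e.cost + 1) := by
  -- Every round costs at least one step, so the potential decreases.
  have key : ∀ n s', Φ s' ≤ n → Fits N s' → Agree c s s' → I s' →
      ∃ t s'', Exec N (.loop e c) s' t s'' ∧
        I s'' ∧ e.val s'' = 0 ∧ t + Φ s'' ≤ Φ s' + (e.cost + 1) := by
    intro n
    induction n using Nat.strong_induction_on with
    | _ n ih =>
      intro s' hn hf ha hI
      obtain ⟨hs, hr⟩ := hstep s' hf ha hI
      have hev := (hs.eval_eq hN hf).1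
      by_cases hv : e.val s' = 0
      · rw [hv] at hev
        exact ⟨_, _, .loopDone hev, hI, hv, by omega⟩
      · obtain ⟨t, s₁, hc, hI₁, ht⟩ := hr hv hf
        obtain ⟨t', s₂, hl, hI₂, hv₂, ht'⟩ :=
          ih (Φ s₁) (by omega) s₁ le_rfl (hc.fits hf) (ha.trans hc.agree) hI₁
        exact ⟨_, _, .loopStep hev hv hc hl, hI₂, hv₂, by omega⟩
  exact fun hs => key _ s le_rfl hs (.refl _ _) h0

/-- The rule for counting loops; `I k` holds before the round in which the counter is `k`. -/
theorem Runs.forUp {N : ℕ} (hN : 2 ≤ N) {r R : Reg} {c : Com} {s : Store} {L b : ℕ}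
    (I : ℕ → Store → Prop)
    (hR : c.writesReg R = false) (hr : c.writesReg r = false) (hne : R ≠ r)
    (hLN : L < N) (hL : L ≤ s.reg R + 1) (hH : s.reg R + 1 < N)
    (h0 : I L (s.setReg r L))
    (hstep : ∀ k s', L ≤ k → k ≤ s.reg R → Fits N s' →
      Agree (.seq c (.assign r (.lit 0))) s s' → s'.reg r = k → I k s' →
      Runs N c s' fun t s'' => t ≤ b ∧ I (k + 1) (s''.setReg r (k + 1))) :
    Runs N (SuffixientSets.forUp r (.lit L) (.reg R) c) s fun t s' =>
      t ≤ (b + 8) * (s.reg R + 1 - L) + 6 ∧ s'.reg r = s.reg R + 1 ∧ I (s.reg R + 1) s' := by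
  have hag0 : Agree (.seq c (.assign r (.lit 0))) s (s.setReg r L) := by
    refine ⟨fun _ _ => rfl, fun r' hr' => ?_⟩
    simp only [Com.writesReg, Bool.or_eq_false_iff, decide_eq_false_iff_not] at hr'
    simp [hr'.2]
  have hRw : (Com.seq c (.assign r (.lit 0))).writesReg R = false := by
    simp [Com.writesReg, hR, hne]
  refine Runs.seq ?_
  refine (Runs.straight hN (c := .assign r (.lit L)) (Q := fun s' => s' = s.setReg r L)
    ⟨hLN, rfl⟩).mono ?_
  rintro t₀ s₀ - - ⟨ht₀, rfl⟩
  have hloop := Runs.loop hN (e := .bin .le (.reg r) (.reg R))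
    (c := .seq c (.assign r (.bin .add (.reg r) (.lit 1)))) (s := s.setReg r L)
    (fun s' => L ≤ s'.reg r ∧ s'.reg r ≤ s.reg R + 1 ∧ I (s'.reg r) s')
    (fun s' => (b + 8) * (s.reg R + 1 - s'.reg r)) (by simpa using ⟨hL, h0⟩) ?_
  · refine hloop.mono ?_
    rintro t s' - hag ⟨⟨h1, h2, h3⟩, hv, ht⟩
    have hag' : Agree (.seq c (.assign r (.lit 0))) s s' :=
      hag0.trans ⟨fun a ha => hag.arr a ha, fun r ha => hag.reg r ha⟩
    simp only [Expr.val, Op.apply, hag'.reg R hRw] at hv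
    have h4 : s'.reg r = s.reg R + 1 := by
      split at hv <;> omega
    refine ⟨?_, h4, h4 ▸ h3⟩
    simp only [Com.cost, Expr.cost, Store.setReg_reg, if_true] at ht ht₀
    omega
  · rintro s' hf hag ⟨h1, h2, h3⟩
    have hag' : Agree (.seq c (.assign r (.lit 0))) s s' :=
      hag0.trans ⟨fun a ha => hag.arr a ha, fun r ha => hag.reg r ha⟩
    refine ⟨by simp [Expr.Safe, Op.Safe], fun hv => ?_⟩
    simp only [Expr.val, Op.apply, hag'.reg R hRw] at hv
    have h4 : s'.reg r ≤ s.reg R := by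
      by_contra hcon
      simp [hcon] at hv
    refine Runs.seq ?_
    refine (hstep _ s' h1 h4 hf hag' rfl h3).mono ?_
    rintro t s₁ - hag₁ ⟨ht, hI⟩
    have hr₁ : s₁.reg r = s'.reg r := hag₁.reg r hr
    refine (Runs.straight hN (c := .assign r (.bin .add (.reg r) (.lit 1)))
      (Q := fun s₂ => s₂ = s₁.setReg r (s'.reg r + 1)) ?_).mono ?_
    · refine ⟨⟨trivial, ?_, ?_⟩, ?_⟩
      · show 1 < N
        omega
      · show s₁.reg r + 1 < N
        omega
      · simp [Expr.val, Op.apply, hr₁]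
    · rintro t' s₂ - - ⟨ht', rfl⟩
      simp only [Com.cost, Expr.cost, Store.setReg_reg, if_true] at ht' ⊢
      refine ⟨⟨by omega, by omega, hI⟩, ?_⟩
      have : s.reg R + 1 - s'.reg r = (s.reg R + 1 - (s'.reg r + 1)) + 1 := by omega
      rw [this, Nat.mul_add]
      omega

/-! ### Lexicographic order and longest common prefixes -/

/-- Lexicographic comparison of two strings by their prefixes of length `h` and then by the
rest. -/
theorem list_lt_iff_take_drop (h : ℕ) (l l' : List ℕ) :
    l < l' ↔ l.take h < l'.take h ∨ (l.take h = l'.take h ∧ l.drop h < l'.drop h) := by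
  induction h generalizing l l' with
  | zero => simp
  | succ h ih =>
    cases l with
    | nil => cases l' <;> simp
    | cons a l =>
      cases l' with
      | nil => simp
      | cons b l' =>
        simp only [List.take_succ_cons, List.drop_succ_cons, List.cons_lt_cons_iff, ih l l',
          List.cons.injEq]
        tauto

theorem take_le_take {l l' : List ℕ} (h : l ≤ l') (k : ℕ) : l.take k ≤ l'.take k := by
  by_contra hc
  exact absurd h (not_le.mpr ((list_lt_iff_take_drop k l' l).mpr (.inl (not_le.mp hc))))

theorem le_lcp_iff {k : ℕ} {a b : List ℕ} :
    k ≤ lcp a b ↔ k ≤ a.length ∧ k ≤ b.length ∧ a.take k = b.take k := by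
  induction a generalizing b k with
  | nil => cases k <;> simp [lcp]
  | cons x a ih =>
    cases b with
    | nil => cases k <;> simp [lcp]
    | cons y b =>
      cases k with
      | zero => simp
      | succ k =>
        by_cases hxy : x = y
        · simp [lcp, hxy, ih]
        · simp [lcp, hxy]

theorem lcp_comm (a b : List ℕ) : lcp a b = lcp b a :=
  eq_of_forall_le_iff fun k => by rw [le_lcp_iff, le_lcp_iff]; tauto

theorem lcp_of_le_of_le {a b c : List ℕ} (hab : a ≤ b) (hbc : b ≤ c) :
    lcp a c = min (lcp a b) (lcp b c) := by
  refine eq_of_forall_le_iff fun k => ?_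
  rw [le_min_iff, le_lcp_iff, le_lcp_iff, le_lcp_iff]
  constructor
  · rintro ⟨ha, hc, hac⟩
    have h1 := take_le_take hab k
    have h2 := take_le_take hbc k
    rw [← hac] at h2
    have h3 := le_antisymm h1 h2
    have h4 := congrArg List.length h3
    simp only [List.length_take] at h4
    exact ⟨⟨ha, by omega, h3⟩, by omega, hc, h3 ▸ hac⟩
  · rintro ⟨⟨h1, h2, h3⟩, h4, h5, h6⟩
    exact ⟨h1, h5, h3.trans h6⟩

theorem length_sub (X : ℕ → ℕ) (i j : ℕ) : (sub X i j).length = j + 1 - i := by simp [sub]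

theorem getElem_sub (X : ℕ → ℕ) (i j k : ℕ) (h : k < (sub X i j).length) :
    (sub X i j)[k] = X (i + k) := by simp [sub]

theorem drop_sub (X : ℕ → ℕ) (i j h : ℕ) : (sub X i j).drop h = sub X (i + h) j := by
  refine List.ext_getElem (by simp [length_sub]; omega) fun k h1 h2 => ?_
  simp [getElem_sub, Nat.add_assoc]

theorem sub_concat (X : ℕ → ℕ) {i j : ℕ} (h1 : 1 ≤ j) (h : i ≤ j) :
    sub X i j = sub X i (j - 1) ++ [X j] := by
  refine List.ext_getElem (by simp [length_sub]; omega) fun k h1 h2 => ?_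
  simp only [getElem_sub, List.getElem_append]
  split
  · rfl
  · rw [length_sub] at *
    simp only [List.getElem_singleton]
    congr 1; omega

theorem sub_append (X : ℕ → ℕ) {i j k : ℕ} (h : i ≤ j + 1) (hk : j ≤ k) :
    sub X i k = sub X i j ++ sub X (j + 1) k := by
  refine List.ext_getElem (by simp [length_sub]; omega) fun m h1 h2 => ?_
  simp only [getElem_sub, List.getElem_append]
  split
  · rfl
  · simp only [length_sub] at *
    congr 1; omega

theorem sub_eq_nil (X : ℕ → ℕ) {i j : ℕ} (h : j < i) : sub X i j = [] := by
  rw [← List.length_eq_zero_iff, length_sub]; omega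

theorem sub_suffix {X : ℕ → ℕ} {i i' j : ℕ} (h : i' ≤ i) : sub X i j <:+ sub X i' j := by
  have := List.drop_suffix (i - i') (sub X i' j)
  rwa [drop_sub, Nat.add_sub_cancel' h] at this

theorem suffix_sub_iff {X : ℕ → ℕ} {l : List ℕ} {j : ℕ} :
    l <:+ sub X 1 j ↔ l.length ≤ j ∧ l = sub X (j + 1 - l.length) j := by
  rw [List.suffix_iff_eq_drop, drop_sub, length_sub]
  constructor
  · intro h
    have h1 := congrArg List.length h
    simp only [length_sub] at h1
    have h2 : l.length ≤ j := by omega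
    refine ⟨h2, ?_⟩
    have h3 : 1 + (j + 1 - 1 - l.length) = j + 1 - l.length := by omega
    rwa [h3] at h
  · rintro ⟨h1, h2⟩
    have h3 : 1 + (j + 1 - 1 - l.length) = j + 1 - l.length := by omega
    rwa [h3]

theorem reverse_sub_rev (n : ℕ) (T : ℕ → ℕ) (p : ℕ) :
    sub (rev n T) p n = (sub T 1 (n + 1 - p)).reverse := by
  refine List.ext_getElem (by simp [length_sub]) fun k h1 h2 => ?_
  rw [length_sub] at h1
  simp only [getElem_sub, List.getElem_reverse, length_sub, rev]
  congr 1; omega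

/-- Common prefixes of two suffixes, character by character. The bounds say that neither suffix
ends before the common prefix. -/
theorem le_lcp_sub_iff {X : ℕ → ℕ} {n p q k : ℕ} :
    k ≤ lcp (sub X p n) (sub X q n) ↔
      k ≤ n + 1 - p ∧ k ≤ n + 1 - q ∧ ∀ l < k, X (p + l) = X (q + l) := by
  rw [le_lcp_iff, length_sub, length_sub]
  refine and_congr_right fun h1 => and_congr_right fun h2 => ?_
  constructor
  · intro h l hl
    have := List.getElem_of_eq h (i := l) (by simp [length_sub]; omega)
    simpa [getElem_sub] using this
  · intro h
    refine List.ext_getElem (by simp [length_sub]; omega) fun l h3 h4 => ?_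
    simp only [List.getElem_take, getElem_sub]
    exact h l (by simp at h3; omega)

/-! ### The suffix array -/

section SuffixArray

variable (n : ℕ) (X : ℕ → ℕ)

theorem sub_inj {p q : ℕ} (hp : p ∈ Finset.Icc 1 n) (hq : q ∈ Finset.Icc 1 n)
    (h : sub X p n = sub X q n) : p = q := by
  have := congrArg List.length h
  simp only [length_sub, Finset.mem_Icc] at *
  omega

theorem saList_perm : (saList n X).Perm (List.range' 1 n) := List.mergeSort_perm _ _

theorem length_saList : (saList n X).length = n := by
  rw [(saList_perm n X).length_eq]; simp

theorem mem_saList {p : ℕ} : p ∈ saList n X ↔ p ∈ Finset.Icc 1 n := by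
  rw [(saList_perm n X).mem_iff, List.mem_range'_1, Finset.mem_Icc]; omega

theorem nodup_saList : (saList n X).Nodup :=
  (saList_perm n X).nodup_iff.mpr List.nodup_range'

theorem pairwise_saList : (saList n X).Pairwise fun p q => sub X p n ≤ sub X q n := by
  have := List.pairwise_mergeSort (le := fun p q => decide (sub X p n ≤ sub X q n))
    (fun a b c h1 h2 => by simp only [decide_eq_true_eq] at *; exact h1.trans h2)
    (fun a b => by simpa using le_total _ _) (List.range' 1 n)
  exact this.imp fun h => by simpa using h

variable {n}

theorem SA_eq_getElem {i : ℕ} (hi : i ∈ Finset.Icc 1 n) :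
    SA n X i = (saList n X)[i - 1]'(by rw [length_saList]; simp at hi; omega) := by
  rw [SA, List.getD_eq_getElem]

theorem SA_mem {i : ℕ} (hi : i ∈ Finset.Icc 1 n) : SA n X i ∈ Finset.Icc 1 n := by
  rw [SA_eq_getElem X hi, ← mem_saList n X]
  exact List.getElem_mem _

theorem ISA_mem {p : ℕ} (hp : p ∈ Finset.Icc 1 n) : ISA n X p ∈ Finset.Icc 1 n := by
  have := List.idxOf_lt_length_iff.mpr ((mem_saList n X).mpr hp)
  rw [length_saList] at this
  rw [ISA, Finset.mem_Icc]
  omega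

theorem SA_ISA {p : ℕ} (hp : p ∈ Finset.Icc 1 n) : SA n X (ISA n X p) = p := by
  rw [SA_eq_getElem X (ISA_mem X hp)]
  simp [ISA]

theorem ISA_SA {i : ℕ} (hi : i ∈ Finset.Icc 1 n) : ISA n X (SA n X i) = i := by
  rw [SA_eq_getElem X hi, ISA, (nodup_saList n X).idxOf_getElem]
  simp at hi; omega

theorem sub_SA_lt {i j : ℕ} (hi : 1 ≤ i) (hij : i < j) (hj : j ≤ n) :
    sub X (SA n X i) n < sub X (SA n X j) n := by
  have hi' : i ∈ Finset.Icc 1 n := by simp; omega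
  have hj' : j ∈ Finset.Icc 1 n := by simp; omega
  refine lt_of_le_of_ne ?_ fun h => ?_
  · rw [SA_eq_getElem X hi', SA_eq_getElem X hj']
    exact List.pairwise_iff_getElem.mp (pairwise_saList n X) _ _ _ _ (by omega)
  · have := sub_inj n X (SA_mem X hi') (SA_mem X hj') h
    have := congrArg (ISA n X) this
    rw [ISA_SA X hi', ISA_SA X hj'] at this
    omega

/-- A numbering of the suffixes by `1, …, n` that respects the lexicographic order is the inverse
suffix array. -/
theorem eq_ISA {f : ℕ → ℕ} (hf : ∀ p ∈ Finset.Icc 1 n, f p ∈ Finset.Icc 1 n)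
    (hlt : ∀ p ∈ Finset.Icc 1 n, ∀ q ∈ Finset.Icc 1 n, f p < f q ↔ sub X p n < sub X q n)
    {p : ℕ} (hp : p ∈ Finset.Icc 1 n) : f p = ISA n X p := by
  have hmono : ∀ i j, 1 ≤ i → i < j → j ≤ n → f (SA n X i) < f (SA n X j) := by
    intro i j hi hij hj
    exact (hlt _ (SA_mem X (by simp; omega)) _ (SA_mem X (by simp; omega))).mpr
      (sub_SA_lt X hi hij hj)
  have hlow : ∀ i, 1 ≤ i → i ≤ n → i ≤ f (SA n X i) := by
    intro i hi
    induction i, hi using Nat.le_induction with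
    | base => intro h; exact (Finset.mem_Icc.mp (hf _ (SA_mem X (by simp; omega)))).1
    | succ i hi ih => intro h; have := hmono i (i + 1) hi (by omega) h; have := ih (by omega); omega
  have hup : ∀ d i, 1 ≤ i → i + d = n → f (SA n X i) ≤ i := by
    intro d
    induction d with
    | zero => 
      intro i hi h
      have := (Finset.mem_Icc.mp (hf _ (SA_mem X (i := i) (by simp; omega)))).2
      omega
    | succ d ih =>
      intro i hi h
      have := hmono i (i + 1) hi (by omega) (by omega)
      have := ih (i + 1) (by omega) (by omega)
      omega
  have hI := ISA_mem X hp
  rw [Finset.mem_Icc] at hI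
  have h1 := hlow _ hI.1 hI.2
  have h2 := hup (n - ISA n X p) _ hI.1 (by omega)
  rw [SA_ISA X hp] at h1 h2
  omega

theorem LCP_one : LCP n X 1 = 0 := by simp [LCP]

/-- The longest common prefix of two suffixes is a range minimum of the LCP array. -/
theorem le_lcp_SA_iff {i j k : ℕ} (hi : 1 ≤ i) (hij : i < j) (hj : j ≤ n) :
    k ≤ lcp (sub X (SA n X i) n) (sub X (SA n X j) n) ↔ ∀ h ∈ Finset.Ioc i j, k ≤ LCP n X h := by
  induction j, hij using Nat.le_induction with
  | base =>
    simp [LCP, show ¬ (i = 0) by omega]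
  | succ j hij ih =>
    have h1 := (sub_SA_lt X hi hij (by omega : j ≤ n)).le
    have h2 := (sub_SA_lt X (by omega : 1 ≤ j) (by omega : j < j + 1) hj).le
    rw [lcp_of_le_of_le h1 h2, le_min_iff, ih (by omega)]
    have h3 : lcp (sub X (SA n X j) n) (sub X (SA n X (j + 1)) n) = LCP n X (j + 1) := by
      simp [LCP, show ¬ (j = 0) by omega]
    rw [h3]
    constructor
    · rintro ⟨h4, h5⟩ h hh
      rw [Finset.mem_Ioc] at hh
      rcases Nat.lt_or_ge j h with h6 | h6
      · rwa [show h = j + 1 by omega]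
      · exact h4 h (by simp; omega)
    · intro h4
      refine ⟨fun h hh => h4 h ?_, h4 _ ?_⟩ <;> simp at * <;> omega

end SuffixArray

/-! ### Arrays of extremal positions -/

theorem PSV_lt {A : ℕ → ℕ} {i : ℕ} (hi : 1 ≤ i) : PSV A i < i := by
  rw [PSV, Finset.sup_lt_iff (by simpa [Nat.pos_iff_ne_zero] using Nat.one_le_iff_ne_zero.mp hi)]
  intro j hj
  simp at hj
  exact hj.1.2

theorem lt_of_PSV_pos {A : ℕ → ℕ} {i : ℕ} (h : PSV A i ≠ 0) : A (PSV A i) < A i := by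
  have hne : ((Finset.Ico 1 i).filter (fun j => A j < A i)).Nonempty := by
    rw [Finset.nonempty_iff_ne_empty]
    intro he
    simp [PSV, he] at h
  obtain ⟨j, hj, hs⟩ := Finset.exists_mem_eq_sup _ hne id
  rw [PSV, hs]
  simp at hj
  exact hj.2

theorem le_of_PSV_lt {A : ℕ → ℕ} {i h : ℕ} (h1 : PSV A i < h) (h2 : h ≤ i) : A i ≤ A h := by
  by_contra hc
  rcases Nat.lt_or_ge h i with h3 | h3
  · have : h ≤ PSV A i := by
      refine Finset.le_sup (f := id) ?_
      simp; omega
    omega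
  · rw [show h = i by omega] at hc
    exact hc le_rfl

theorem PSV_eq {A : ℕ → ℕ} {i j : ℕ} (hj : j < i) (h0 : j ≠ 0 → A j < A i)
    (h : ∀ h, j < h → h < i → A i ≤ A h) : PSV A i = j := by
  rcases Nat.lt_trichotomy (PSV A i) j with h1 | h1 | h1
  · have := le_of_PSV_lt h1 hj.le
    have := h0 (by omega)
    omega
  · exact h1
  · have := lt_of_PSV_pos (A := A) (i := i) (by omega)
    have := h _ h1 (PSV_lt (by omega))
    omega

theorem NSV_mem {n : ℕ} {A : ℕ → ℕ} {i : ℕ} :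
    NSV n A i ∈ insert (n + 1) ((Finset.Ioc i n).filter (fun j => A j < A i)) :=
  Finset.min'_mem _ _

theorem lt_NSV {n : ℕ} {A : ℕ → ℕ} {i : ℕ} (hi : i ≤ n) : i < NSV n A i := by
  have := NSV_mem (n := n) (A := A) (i := i)
  simp at this
  omega

theorem NSV_le {n : ℕ} {A : ℕ → ℕ} {i : ℕ} : NSV n A i ≤ n + 1 :=
  Finset.min'_le _ _ (by simp)

theorem lt_of_NSV_le {n : ℕ} {A : ℕ → ℕ} {i : ℕ} (h : NSV n A i ≤ n) : A (NSV n A i) < A i := by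
  have := NSV_mem (n := n) (A := A) (i := i)
  simp at this
  rcases this with h1 | h1
  · omega
  · exact h1.2

theorem le_of_lt_NSV {n : ℕ} {A : ℕ → ℕ} {i h : ℕ} (h1 : h < NSV n A i) (h2 : i ≤ h) :
    A i ≤ A h := by
  by_contra hc
  rcases Nat.lt_or_ge i h with h3 | h3
  · have h4 := NSV_le (n := n) (A := A) (i := i)
    have : NSV n A i ≤ h := by
      refine Finset.min'_le _ _ ?_
      simp; omega
    omega
  · rw [show h = i by omega] at hc
    exact hc le_rfl

theorem NSV_eq {n : ℕ} {A : ℕ → ℕ} {i j : ℕ} (hj : i < j) (hjn : j ≤ n + 1)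
    (h0 : j ≠ n + 1 → A j < A i)
    (h : ∀ h, i < h → h < j → A i ≤ A h) : NSV n A i = j := by
  rcases Nat.lt_trichotomy (NSV n A i) j with h1 | h1 | h1
  · have := lt_of_NSV_le (n := n) (A := A) (i := i) (by omega)
    have := h _ (lt_NSV (by omega)) h1
    omega
  · exact h1
  · have := le_of_lt_NSV h1 hj.le
    have := h0 (by have := NSV_le (n := n) (A := A) (i := i); omega)
    omega

theorem maxArgmin_mem {A : ℕ → ℕ} {s : Finset ℕ} (hs : s.Nonempty) : maxArgmin A s ∈ s := by
  obtain ⟨a, ha, hmin⟩ := Finset.exists_min_image s A hs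
  have hne : (s.filter (fun a => ∀ b ∈ s, A a ≤ A b)).Nonempty := ⟨a, by simp; exact ⟨ha, hmin⟩⟩
  obtain ⟨j, hj, hs⟩ := Finset.exists_mem_eq_sup _ hne id
  rw [maxArgmin, hs]
  exact (Finset.mem_filter.mp hj).1

theorem maxArgmin_le {A : ℕ → ℕ} {s : Finset ℕ} {b : ℕ} (hb : b ∈ s) :
    A (maxArgmin A s) ≤ A b := by
  obtain ⟨a, ha, hmin⟩ := Finset.exists_min_image s A ⟨b, hb⟩
  have hne : (s.filter (fun a => ∀ b ∈ s, A a ≤ A b)).Nonempty := ⟨a, by simp; exact ⟨ha, hmin⟩⟩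
  obtain ⟨j, hj, hs⟩ := Finset.exists_mem_eq_sup _ hne id
  rw [maxArgmin, hs]
  exact (Finset.mem_filter.mp hj).2 b hb

theorem le_maxArgmin {A : ℕ → ℕ} {s : Finset ℕ} {a : ℕ} (ha : a ∈ s)
    (h : ∀ b ∈ s, A a ≤ A b) : a ≤ maxArgmin A s :=
  Finset.le_sup (f := id) (by simp; exact ⟨ha, h⟩)

theorem maxArgmin_eq {A : ℕ → ℕ} {s : Finset ℕ} {a : ℕ} (ha : a ∈ s) (h : ∀ b ∈ s, A a ≤ A b)
    (hlt : ∀ b ∈ s, a < b → A a < A b) : maxArgmin A s = a := by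
  have h1 := le_maxArgmin ha h
  rcases h1.lt_or_eq with h2 | h2
  · have := hlt _ (maxArgmin_mem ⟨a, ha⟩) h2
    have := maxArgmin_le (A := A) ha
    omega
  · exact h2.symm

theorem maxArgmax_pair (A : ℕ → ℕ) (a b : ℕ) :
    maxArgmax A {a, b} =
      if A a < A b then b else if A b < A a then a else max a b := by
  have hfil : ∀ x, x ∈ ({a, b} : Finset ℕ).filter (fun y => ∀ z ∈ ({a, b} : Finset ℕ), A z ≤ A y) ↔
      (x = a ∨ x = b) ∧ A a ≤ A x ∧ A b ≤ A x := by
    intro x; simp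
  refine le_antisymm (Finset.sup_le fun x hx => ?_) ?_
  · rw [hfil] at hx
    obtain ⟨rfl | rfl, h2, h3⟩ := hx <;> simp only [id] <;> split_ifs <;> omega
  · split_ifs with h1 h2
    · exact Finset.le_sup (f := id) ((hfil b).mpr ⟨.inr rfl, h1.le, le_rfl⟩)
    · exact Finset.le_sup (f := id) ((hfil a).mpr ⟨.inl rfl, le_rfl, h2.le⟩)
    · refine max_le ?_ ?_
      · exact Finset.le_sup (f := id) ((hfil a).mpr ⟨.inl rfl, by omega, by omega⟩)
      · exact Finset.le_sup (f := id) ((hfil b).mpr ⟨.inr rfl, by omega, by omega⟩)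

/-! ### Rows of the Burrows-Wheeler matrix of the reversed text -/

section Rows

variable (n : ℕ) (T : ℕ → ℕ)

/-- The `i`-th suffix of the reversed text in lexicographic order. -/
def row (i : ℕ) : List ℕ := sub (rev n T) (SA n (rev n T) i) n

variable {n T}

theorem le_lcp_row_iff {i j k : ℕ} (hi : 1 ≤ i) (hij : i < j) (hj : j ≤ n) :
    k ≤ lcp (row n T i) (row n T j) ↔ ∀ h ∈ Finset.Ioc i j, k ≤ LCPr n T h :=
  le_lcp_SA_iff (rev n T) hi hij hj

theorem LCPr_one : LCPr n T 1 = 0 := LCP_one _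

/-! ### The arrays `SBPR`, `SAPR` and `SLPR` -/

/-- If the run of equal characters of the row `i` starts at the row `s ≥ 2`, then `SBPR[i]` is the
last minimum of the LCP values in `[s, i]`. -/
theorem SBPR_of_run {i s : ℕ} (hs : 2 ≤ s) (hsi : s ≤ i) (hne : BWTr n T (s - 1) ≠ BWTr n T i)
    (heq : ∀ h ∈ Finset.Icc s i, BWTr n T h = BWTr n T i) :
    SBPR n T i = maxArgmin (LCPr n T) (Finset.Icc s i) := by
  have hset : belowSet n T i = {i - s} := by
    ext a
    simp only [belowSet, Finset.mem_filter, Finset.mem_range, Finset.mem_singleton]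
    constructor
    · rintro ⟨h1, h2, h3⟩
      by_contra hc
      rcases Nat.lt_or_ge a (i - s) with h4 | h4
      · apply h2
        exact (heq _ (by simp; omega)).trans (heq _ (by simp; omega)).symm
      · exact hne (h3 _ (by simp; omega))
    · rintro rfl
      rw [show i - (i - s) = s by omega]
      exact ⟨by omega, by rwa [heq s (by simp; omega)], heq⟩
  rw [SBPR, hset, if_pos (by simp), Finset.sup_singleton, id, show i - (i - s) = s by omega]

/-- If the run of equal characters of the row `i` is the first one, `SBPR[i]` is the dummy value
`1`. -/
theorem SBPR_of_first {i : ℕ} (heq : ∀ h ∈ Finset.Icc 1 i, BWTr n T h = BWTr n T i) :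
    SBPR n T i = 1 := by
  rw [SBPR, if_neg]
  rintro ⟨a, ha⟩
  simp only [belowSet, Finset.mem_filter, Finset.mem_range] at ha
  apply ha.2.1
  exact (heq _ (by simp; omega)).trans (heq _ (by simp; omega)).symm

/-- If the run of equal characters of the row `i` ends at the row `e < n`, then `SAPR[i]` is the
last minimum of the LCP values in `[i + 1, e + 1]`. -/
theorem SAPR_of_run {i e : ℕ} (he : e + 1 ≤ n) (hie : i ≤ e)
    (hne : BWTr n T (e + 1) ≠ BWTr n T i)
    (heq : ∀ h ∈ Finset.Icc i e, BWTr n T h = BWTr n T i) :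
    SAPR n T i = maxArgmin (LCPr n T) (Finset.Icc (i + 1) (e + 1)) := by
  have hset : aboveSet n T i = {e - i} := by
    ext a
    simp only [aboveSet, Finset.mem_filter, Finset.mem_range, Finset.mem_singleton]
    constructor
    · rintro ⟨h1, h2, h3⟩
      by_contra hc
      rcases Nat.lt_or_ge a (e - i) with h4 | h4
      · apply h2
        exact (heq _ (by simp; omega)).trans (heq _ (by simp; omega)).symm
      · exact hne (h3 _ (by simp; omega))
    · rintro rfl
      rw [show i + (e - i) = e by omega]
      exact ⟨by omega, by rw [heq e (by simp; omega)]; exact hne.symm, heq⟩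
  rw [SAPR, hset, if_pos (by simp), Finset.sup_singleton, id, show i + (e - i) = e by omega]

/-- If the run of equal characters of the row `i` is the last one, `SAPR[i]` is the dummy value
`1`. -/
theorem SAPR_of_last {i : ℕ} (heq : ∀ h ∈ Finset.Icc i n, BWTr n T h = BWTr n T i) :
    SAPR n T i = 1 := by
  rw [SAPR, if_neg]
  rintro ⟨a, ha⟩
  simp only [aboveSet, Finset.mem_filter, Finset.mem_range] at ha
  apply ha.2.1
  exact (heq _ (by simp; omega)).trans (heq _ (by simp; omega)).symm

theorem exists_run_start {A : ℕ → ℕ} {i : ℕ} (hi : 1 ≤ i) :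
    (∀ h ∈ Finset.Icc 1 i, A h = A i) ∨
      ∃ s, 2 ≤ s ∧ s ≤ i ∧ A (s - 1) ≠ A i ∧ ∀ h ∈ Finset.Icc s i, A h = A i := by
  induction i, hi using Nat.le_induction with
  | base => left; intro h hh; rw [show h = 1 by simpa using hh]
  | succ i hi ih =>
    by_cases he : A i = A (i + 1)
    · rcases ih with h1 | ⟨s, h1, h2, h3, h4⟩
      · left
        intro h hh
        rw [Finset.mem_Icc] at hh
        rcases Nat.lt_or_ge i h with h2 | h2
        · rw [show h = i + 1 by omega]
        · rw [h1 h (by simp; omega), he]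
      · right
        refine ⟨s, h1, by omega, he ▸ h3, fun h hh => ?_⟩
        rw [Finset.mem_Icc] at hh
        rcases Nat.lt_or_ge i h with h2 | h2
        · rw [show h = i + 1 by omega]
        · rw [h4 h (by simp; omega), he]
    · right
      refine ⟨i + 1, by omega, le_rfl, by simpa using he, fun h hh => ?_⟩
      rw [show h = i + 1 by simp at hh; omega]

theorem exists_run_end {A : ℕ → ℕ} {n i : ℕ} (hi : i ≤ n) :
    (∀ h ∈ Finset.Icc i n, A h = A i) ∨
      ∃ e, i ≤ e ∧ e + 1 ≤ n ∧ A (e + 1) ≠ A i ∧ ∀ h ∈ Finset.Icc i e, A h = A i := by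
  induction n, hi using Nat.le_induction with
  | base => left; intro h hh; rw [show h = i by simp at hh; omega]
  | succ n hi ih =>
    rcases ih with h1 | ⟨e, h1, h2, h3, h4⟩
    · by_cases he : A (n + 1) = A i
      · left
        intro h hh
        rw [Finset.mem_Icc] at hh
        rcases Nat.lt_or_ge n h with h2 | h2
        · rw [show h = n + 1 by omega, he]
        · rw [h1 h (by simp; omega)]
      · exact .inr ⟨n, hi, le_rfl, he, h1⟩
    · exact .inr ⟨e, h1, by omega, h3, h4⟩

/-- Either no row before `i` carries a different character, and `SBPR[i] = 1`. Or the LCP value at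
`SBPR[i]`, which is minimal up to the row `i`, is the largest length of a common prefix of the row
`i` with a row before it that carries a different character. -/
theorem SBPR_cases {i : ℕ} (hi : 1 ≤ i) (hin : i ≤ n) :
    (SBPR n T i = 1 ∧ ∀ j, 1 ≤ j → j < i → BWTr n T j = BWTr n T i) ∨
    (2 ≤ SBPR n T i ∧ SBPR n T i ≤ i ∧
      (∀ h, SBPR n T i ≤ h → h ≤ i → LCPr n T (SBPR n T i) ≤ LCPr n T h) ∧
      ∀ k, k ≤ LCPr n T (SBPR n T i) ↔ ∃ j, 1 ≤ j ∧ j < i ∧ BWTr n T j ≠ BWTr n T i ∧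
        k ≤ lcp (row n T i) (row n T j)) := by
  rcases exists_run_start (A := BWTr n T) hi with h1 | ⟨s, h1, h2, h3, h4⟩
  · exact .inl ⟨SBPR_of_first h1, fun j hj hji => h1 j (by simp; omega)⟩
  · right
    rw [SBPR_of_run h1 h2 h3 h4]
    have hm := maxArgmin_mem (A := LCPr n T) (s := Finset.Icc s i) ⟨s, by simp; omega⟩
    have hle := fun b hb => maxArgmin_le (A := LCPr n T) (s := Finset.Icc s i) (b := b) hb
    generalize maxArgmin (LCPr n T) (Finset.Icc s i) = p at *
    rw [Finset.mem_Icc] at hm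
    refine ⟨by omega, hm.2, fun h hp hh => hle h (by simp; omega), fun k => ⟨fun hk => ?_, ?_⟩⟩
    · refine ⟨s - 1, by omega, by omega, h3, ?_⟩
      rw [lcp_comm, le_lcp_row_iff (by omega) (by omega) hin]
      exact fun h hh => hk.trans (hle h (by simp at *; omega))
    · rintro ⟨j, hj, hji, hne, hk⟩
      rw [lcp_comm, le_lcp_row_iff (by omega) (by omega) hin] at hk
      refine hk p ?_
      have : j < s := by
        by_contra hc
        exact hne (h4 j (by simp; omega))
      simp; omega

/-- The counterpart of `SBPR_cases` for the rows after `i`. -/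
theorem SAPR_cases {i : ℕ} (hi : 1 ≤ i) (hin : i ≤ n) :
    (SAPR n T i = 1 ∧ ∀ j, i < j → j ≤ n → BWTr n T j = BWTr n T i) ∨
    (i < SAPR n T i ∧ SAPR n T i ≤ n ∧
      (∀ h, i < h → h ≤ SAPR n T i → LCPr n T (SAPR n T i) ≤ LCPr n T h) ∧
      ∀ k, k ≤ LCPr n T (SAPR n T i) ↔ ∃ j, i < j ∧ j ≤ n ∧ BWTr n T j ≠ BWTr n T i ∧
        k ≤ lcp (row n T i) (row n T j)) := by
  rcases exists_run_end (A := BWTr n T) hin with h1 | ⟨e, h1, h2, h3, h4⟩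
  · exact .inl ⟨SAPR_of_last h1, fun j hj hji => h1 j (by simp; omega)⟩
  · right
    rw [SAPR_of_run h2 h1 h3 h4]
    have hm := maxArgmin_mem (A := LCPr n T) (s := Finset.Icc (i + 1) (e + 1))
      ⟨e + 1, by simp; omega⟩
    have hle := fun b hb => maxArgmin_le (A := LCPr n T) (s := Finset.Icc (i + 1) (e + 1))
      (b := b) hb
    generalize maxArgmin (LCPr n T) (Finset.Icc (i + 1) (e + 1)) = p at *
    rw [Finset.mem_Icc] at hm
    refine ⟨by omega, by omega, fun h hp hh => hle h (by simp; omega),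
      fun k => ⟨fun hk => ?_, ?_⟩⟩
    · refine ⟨e + 1, by omega, by omega, h3, ?_⟩
      rw [le_lcp_row_iff (by omega) (by omega) h2]
      exact fun h hh => hk.trans (hle h (by simp at *; omega))
    · rintro ⟨j, hj, hji, hne, hk⟩
      rw [le_lcp_row_iff (by omega) (by omega) hji] at hk
      refine hk p ?_
      have : e < j := by
        by_contra hc
        exact hne (h4 j (by simp; omega))
      simp; omega

/-- What the position `p = SLPR[i]` is good for: the LCP values between `i` and `p` are at least
`LCP[p]`, and `LCP[p]` is the largest length of a common prefix of the `i`-th row with a row that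
carries a different character. -/
structure SLPRSpec (n : ℕ) (T : ℕ → ℕ) (i p : ℕ) : Prop where
  two_le : 2 ≤ p
  le : p ≤ n
  below : ∀ h, p ≤ h → h ≤ i → LCPr n T p ≤ LCPr n T h
  above : ∀ h, i < h → h ≤ p → LCPr n T p ≤ LCPr n T h
  iff : ∀ k, k ≤ LCPr n T p ↔ ∃ j ∈ Finset.Icc 1 n, BWTr n T j ≠ BWTr n T i ∧
    k ≤ lcp (row n T i) (row n T j)

/-- `SLPR[i]` combines the rows before and after `i`. The dummy value `1` has the LCP value `0` and
loses every tie against a proper value, and it cannot occur on both sides, because some row carries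
a different character. -/
theorem slprSpec {i : ℕ} (hi : i ∈ Finset.Icc 1 n)
    (hne : ∃ j ∈ Finset.Icc 1 n, BWTr n T j ≠ BWTr n T i) : SLPRSpec n T i (SLPR n T i) := by
  rw [Finset.mem_Icc] at hi
  have h1 := LCPr_one (n := n) (T := T)
  rw [SLPR, maxArgmax_pair]
  rcases SBPR_cases (T := T) hi.1 hi.2 with ⟨hb, hb'⟩ | ⟨hb1, hb2, hb3, hb4⟩ <;>
    rcases SAPR_cases (T := T) hi.1 hi.2 with ⟨ha, ha'⟩ | ⟨ha1, ha2, ha3, ha4⟩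
  · obtain ⟨j, hj, hne⟩ := hne
    rw [Finset.mem_Icc] at hj
    rcases Nat.lt_trichotomy j i with h | h | h
    · exact absurd (hb' j hj.1 h) hne
    · exact absurd (h ▸ rfl) hne
    · exact absurd (ha' j h hj.2) hne
  · have : (if LCPr n T (SBPR n T i) < LCPr n T (SAPR n T i) then SAPR n T i
        else if LCPr n T (SAPR n T i) < LCPr n T (SBPR n T i) then SBPR n T i
        else max (SBPR n T i) (SAPR n T i)) = SAPR n T i := by
      rw [hb]; split_ifs <;> omega
    rw [this]
    refine ⟨by omega, ha2, fun h _ _ => by omega, ha3, fun k => ?_⟩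
    rw [ha4]
    constructor
    · rintro ⟨j, h2, h3, h4⟩
      exact ⟨j, by simp; omega, h4⟩
    · rintro ⟨j, h2, h3, h4⟩
      rw [Finset.mem_Icc] at h2
      refine ⟨j, ?_, h2.2, h3, h4⟩
      by_contra hc
      rcases Nat.lt_trichotomy j i with h | h | h
      · exact absurd (hb' j h2.1 h) h3
      · exact absurd (h ▸ rfl) h3
      · omega
  · have : (if LCPr n T (SBPR n T i) < LCPr n T (SAPR n T i) then SAPR n T i
        else if LCPr n T (SAPR n T i) < LCPr n T (SBPR n T i) then SBPR n T i
        else max (SBPR n T i) (SAPR n T i)) = SBPR n T i := by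
      rw [ha]; split_ifs <;> omega
    rw [this]
    refine ⟨by omega, by omega, hb3, fun h _ _ => by omega, fun k => ?_⟩
    rw [hb4]
    constructor
    · rintro ⟨j, h2, h3, h4⟩
      exact ⟨j, by simp; omega, h4⟩
    · rintro ⟨j, h2, h3, h4⟩
      rw [Finset.mem_Icc] at h2
      refine ⟨j, h2.1, ?_, h3, h4⟩
      by_contra hc
      rcases Nat.lt_trichotomy j i with h | h | h
      · omega
      · exact absurd (h ▸ rfl) h3
      · exact absurd (ha' j h h2.2) h3
  · have hiff : ∀ k, (∃ j ∈ Finset.Icc 1 n, BWTr n T j ≠ BWTr n T i ∧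
        k ≤ lcp (row n T i) (row n T j)) ↔
        k ≤ LCPr n T (SBPR n T i) ∨ k ≤ LCPr n T (SAPR n T i) := by
      intro k
      rw [hb4, ha4]
      constructor
      · rintro ⟨j, h2, h3, h4⟩
        rw [Finset.mem_Icc] at h2
        rcases Nat.lt_trichotomy j i with h | h | h
        · exact .inl ⟨j, h2.1, h, h3, h4⟩
        · exact absurd (h ▸ rfl) h3
        · exact .inr ⟨j, h, h2.2, h3, h4⟩
      · rintro (⟨j, h2, h3, h4⟩ | ⟨j, h2, h3, h4⟩)
        · exact ⟨j, by simp; omega, h4⟩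
        · exact ⟨j, by simp; omega, h4⟩
    have hcase : (if LCPr n T (SBPR n T i) < LCPr n T (SAPR n T i) then SAPR n T i
        else if LCPr n T (SAPR n T i) < LCPr n T (SBPR n T i) then SBPR n T i
        else max (SBPR n T i) (SAPR n T i)) =
        if LCPr n T (SAPR n T i) < LCPr n T (SBPR n T i) then SBPR n T i else SAPR n T i := by
      split_ifs <;> omega
    rw [hcase]
    split_ifs with h5
    · exact ⟨by omega, by omega, hb3, fun h _ _ => by omega, fun k => by rw [hiff]; omega⟩
    · exact ⟨by omega, by omega, fun h _ _ => by omega, ha3, fun k => by rw [hiff]; omega⟩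

/-! ### Overlapping boxes -/

/-- All LCP values between the rows `i < j` are at least the smaller one of `LCP[SLPR[i]]` and
`LCP[SLPR[j]]`. -/
def Near (n : ℕ) (T : ℕ → ℕ) (i j : ℕ) : Prop :=
  ∀ h ∈ Finset.Ioc i j, min (LCPr n T (SLPR n T i)) (LCPr n T (SLPR n T j)) ≤ LCPr n T h

theorem mem_box {p h : ℕ} :
    h ∈ box n T p ↔ PSV (LCPr n T) p < h ∧ h < NSV n (LCPr n T) p := by
  rw [box, Finset.mem_Icc]; omega

theorem mem_box_self {p : ℕ} (h1 : 1 ≤ p) (h2 : p ≤ n) : p ∈ box n T p :=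
  mem_box.mpr ⟨PSV_lt h1, lt_NSV h2⟩

theorem le_of_mem_box {p h : ℕ} (hh : h ∈ box n T p) : LCPr n T p ≤ LCPr n T h := by
  rw [mem_box] at hh
  rcases le_total h p with h1 | h1
  · exact le_of_PSV_lt hh.1 h1
  · exact le_of_lt_NSV hh.2 h1

theorem mem_box_of_le {p q : ℕ} (hq : q ∈ Finset.Icc 1 n)
    (h : ∀ h, min p q ≤ h → h ≤ max p q → LCPr n T p ≤ LCPr n T h) : q ∈ box n T p := by
  rw [Finset.mem_Icc] at hq
  rw [mem_box]
  constructor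
  · by_contra hc
    rcases Nat.lt_or_ge p q with h1 | h1
    · have := PSV_lt (A := LCPr n T) (i := p)
        (by by_contra h0; simp [PSV, show p = 0 by omega] at hc; omega)
      omega
    · have := lt_of_PSV_pos (A := LCPr n T) (i := p) (by omega)
      have := h (PSV (LCPr n T) p) (by omega)
        (by have := PSV_lt (A := LCPr n T) (i := p) (by omega); omega)
      omega
  · by_contra hc
    have h2 := lt_of_NSV_le (n := n) (A := LCPr n T) (i := p) (by omega)
    rcases Nat.lt_or_ge n p with h3 | h3
    · have h4 : p ≠ NSV n (LCPr n T) p := fun h => by rw [← h] at h2; omega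
      have h5 := h (NSV n (LCPr n T) p)
      have h6 := NSV_mem (n := n) (A := LCPr n T) (i := p)
      simp at h6
      omega
    · have := h (NSV n (LCPr n T) p) (by have := lt_NSV (A := LCPr n T) h3; omega) (by omega)
      omega

theorem box_inter_nonempty_iff {p q : ℕ} (hp : p ∈ Finset.Icc 1 n) (hq : q ∈ Finset.Icc 1 n) :
    (box n T p ∩ box n T q).Nonempty ↔
      ∀ h, min p q ≤ h → h ≤ max p q → min (LCPr n T p) (LCPr n T q) ≤ LCPr n T h := by
  have hp' := Finset.mem_Icc.mp hp
  have hq' := Finset.mem_Icc.mp hq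
  constructor
  · rintro ⟨v, hv⟩ h h1 h2
    rw [Finset.mem_inter, mem_box, mem_box] at hv
    have hcov : h ∈ box n T p ∨ h ∈ box n T q := by
      have h3 := mem_box.mp (mem_box_self (n := n) (T := T) hp'.1 hp'.2)
      have h4 := mem_box.mp (mem_box_self (n := n) (T := T) hq'.1 hq'.2)
      rw [mem_box, mem_box]
      omega
    rcases hcov with h3 | h3
    · exact (min_le_left _ _).trans (le_of_mem_box h3)
    · exact (min_le_right _ _).trans (le_of_mem_box h3)
  · intro h
    rcases le_total (LCPr n T p) (LCPr n T q) with h1 | h1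
    · rw [min_eq_left h1] at h
      exact ⟨q, Finset.mem_inter.mpr ⟨mem_box_of_le hq h, mem_box_self hq'.1 hq'.2⟩⟩
    · rw [min_eq_right h1, min_comm p, max_comm p] at h
      exact ⟨p, Finset.mem_inter.mpr ⟨mem_box_self hp'.1 hp'.2, mem_box_of_le hp h⟩⟩

/-- The boxes of two rows overlap if and only if the rows are near. -/
theorem box_inter_iff_near {i j : ℕ} (hij : i < j)
    (hp : SLPRSpec n T i (SLPR n T i)) (hq : SLPRSpec n T j (SLPR n T j)) :
    (box n T (SLPR n T i) ∩ box n T (SLPR n T j)).Nonempty ↔ Near n T i j := by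
  obtain ⟨hp1, hp2, hp3, hp4, -⟩ := hp
  obtain ⟨hq1, hq2, hq3, hq4, -⟩ := hq
  rw [box_inter_nonempty_iff (by simp; omega) (by simp; omega), Near]
  generalize SLPR n T i = p at *
  generalize SLPR n T j = q at *
  constructor
  · intro h v hv
    rw [Finset.mem_Ioc] at hv
    by_cases h1 : v ≤ p
    · exact (min_le_left _ _).trans (hp4 v hv.1 h1)
    · by_cases h2 : q ≤ v
      · exact (min_le_right _ _).trans (hq3 v h2 hv.2)
      · exact h v (by omega) (by omega)
  · intro h v hv1 hv2
    by_cases h1 : i < v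
    · by_cases h2 : v ≤ j
      · exact h v (by simp; omega)
      · by_cases h3 : v ≤ q
        · exact (min_le_right _ _).trans (hq4 v (by omega) h3)
        · exact (min_le_left _ _).trans (hp4 v h1 (by omega))
    · by_cases h3 : p ≤ v
      · exact (min_le_left _ _).trans (hp3 v h3 (by omega))
      · exact (min_le_right _ _).trans (hq3 v (by omega) (by omega))

/-- The test of the algorithm detects overlapping boxes. -/
theorem PSV_lt_NSV_iff {i j : ℕ} (hij : i < j)
    (hp : SLPRSpec n T i (SLPR n T i)) (hq : SLPRSpec n T j (SLPR n T j)) :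
    PSV (LCPr n T) (SLPR n T j) < NSV n (LCPr n T) (SLPR n T i) ↔
      (box n T (SLPR n T i) ∩ box n T (SLPR n T j)).Nonempty := by
  obtain ⟨hp1, hp2, -, hp4, -⟩ := id hp
  obtain ⟨hq1, hq2, hq3, -, -⟩ := id hq
  rcases le_or_gt (SLPR n T i) (SLPR n T j) with h | h
  · generalize SLPR n T i = p at *
    generalize SLPR n T j = q at *
    have h1 := lt_NSV (A := LCPr n T) hp2
    have h2 := PSV_lt (A := LCPr n T) (i := q) (by omega)
    have h3 := lt_NSV (A := LCPr n T) hq2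
    have h4 := PSV_lt (A := LCPr n T) (i := p) (by omega)
    constructor
    · intro h5
      -- The boxes are not merely adjacent: the LCP values at `PSV[q]` and at `NSV[p]`, which
      -- would be the last index of one box and the first index of the other one, would both be
      -- smaller than the one at the other place.
      have h6 : PSV (LCPr n T) q + 1 ≠ NSV n (LCPr n T) p := by
        intro h6
        by_cases h0 : PSV (LCPr n T) q < p
        · omega
        have h7 := lt_of_PSV_pos (A := LCPr n T) (i := q) (by omega)
        have h8 := lt_of_NSV_le (n := n) (A := LCPr n T) (i := p) (by omega)
        have h9 := le_of_PSV_lt (A := LCPr n T) (i := q) (h := NSV n (LCPr n T) p)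
          (by omega) (by omega)
        have h10 := le_of_lt_NSV (n := n) (A := LCPr n T) (i := p) (h := PSV (LCPr n T) q)
          (by omega) (by omega)
        omega
      refine ⟨max p (PSV (LCPr n T) q + 1), ?_⟩
      rw [Finset.mem_inter, mem_box, mem_box]
      omega
    · rintro ⟨v, hv⟩
      rw [Finset.mem_inter, mem_box, mem_box] at hv
      omega
  -- If the two entries are in reverse order, the rows are near and the comparison holds.
  · refine iff_of_true ?_ ?_
    · have h1 := lt_NSV (A := LCPr n T) hp2
      have h2 := PSV_lt (A := LCPr n T) (i := SLPR n T j) (by omega)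
      omega
    · rw [box_inter_iff_near hij hp hq, Near]
      intro v hv
      rw [Finset.mem_Ioc] at hv
      by_cases h1 : v ≤ SLPR n T i
      · exact (min_le_left _ _).trans (hp4 v hv.1 h1)
      · exact (min_le_right _ _).trans (hq3 v (by omega) hv.2)

end Rows

/-! ### Right-maximal contexts -/

section Contexts

variable {n σ : ℕ} {T : ℕ → ℕ}

/-- The part of the text that precedes the character `T[x]`; the first character is preceded
cyclically by the whole text. -/
def context (n : ℕ) (T : ℕ → ℕ) (x : ℕ) : List ℕ :=
  if x = 1 then sub T 1 n else sub T 1 (x - 1)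

theorem bwt_start_mem (n x : ℕ) (hx : x ∈ Finset.Icc 1 n) :
    (if x = 1 then 1 else n + 2 - x) ∈ Finset.Icc 1 n := by
  rw [Finset.mem_Icc] at *
  split <;> omega

theorem bwt_mem {x : ℕ} (hx : x ∈ Finset.Icc 1 n) : bwt n T x ∈ Finset.Icc 1 n :=
  ISA_mem _ (bwt_start_mem n x hx)

theorem SA_bwt {x : ℕ} (hx : x ∈ Finset.Icc 1 n) :
    SA n (rev n T) (bwt n T x) = if x = 1 then 1 else n + 2 - x :=
  SA_ISA _ (bwt_start_mem n x hx)

theorem bwt_injOn : Set.InjOn (bwt n T) (Finset.Icc 1 n) := by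
  intro x hx y hy h
  have := congrArg (SA n (rev n T)) h
  rw [SA_bwt hx, SA_bwt hy] at this
  simp at hx hy
  split at this <;> split at this <;> omega

theorem exists_bwt_eq {i : ℕ} (hi : i ∈ Finset.Icc 1 n) :
    ∃ x ∈ Finset.Icc 1 n, bwt n T x = i := by
  have h := SA_mem (rev n T) hi
  refine ⟨if SA n (rev n T) i = 1 then 1 else n + 2 - SA n (rev n T) i, bwt_start_mem _ _ h, ?_⟩
  rw [Finset.mem_Icc] at h
  conv_rhs => rw [← ISA_SA (rev n T) hi]
  rw [bwt]
  congr 1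
  split_ifs <;> omega

theorem BWTr_bwt {x : ℕ} (hx : x ∈ Finset.Icc 1 n) : BWTr n T (bwt n T x) = T x := by
  rw [BWTr, BWT, SA_bwt hx]
  rw [Finset.mem_Icc] at hx
  simp only [rev]
  split_ifs <;> first | omega | (congr 1; omega)

theorem row_bwt {x : ℕ} (hx : x ∈ Finset.Icc 1 n) :
    row n T (bwt n T x) = (context n T x).reverse := by
  rw [row, SA_bwt hx, reverse_sub_rev, context]
  rw [Finset.mem_Icc] at hx
  split_ifs
  · simp
  · congr 2; omega

theorem IsText.exists_ne (hT : IsText n σ T) {i : ℕ} (hi : i ∈ Finset.Icc 1 n) :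
    ∃ j ∈ Finset.Icc 1 n, BWTr n T j ≠ BWTr n T i := by
  obtain ⟨x, hx, rfl⟩ := exists_bwt_eq (T := T) hi
  have h2 := hT.two_le
  have h12 := hT.first_lt 2 (by simp; omega)
  by_cases h : T x = T 1
  · refine ⟨bwt n T 2, bwt_mem (by simp; omega), ?_⟩
    rw [BWTr_bwt hx, BWTr_bwt (by simp; omega)]
    omega
  · refine ⟨bwt n T 1, bwt_mem (by simp; omega), ?_⟩
    rw [BWTr_bwt hx, BWTr_bwt (by simp; omega)]
    exact Ne.symm h

theorem IsText.slprSpec (hT : IsText n σ T) {i : ℕ} (hi : i ∈ Finset.Icc 1 n) :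
    SLPRSpec n T i (SLPR n T i) :=
  SuffixientSets.slprSpec hi (hT.exists_ne hi)

/-- A common prefix of two rows is, reversed, a common suffix of two contexts. -/
theorem le_lcp_reverse_iff {k : ℕ} {a b : List ℕ} :
    k ≤ lcp a.reverse b.reverse ↔ ∃ w, w.length = k ∧ w <:+ a ∧ w <:+ b := by
  rw [le_lcp_iff]
  simp only [List.length_reverse]
  constructor
  · rintro ⟨h1, h2, h3⟩
    refine ⟨(a.reverse.take k).reverse, by simp; omega, ?_, ?_⟩
    · rw [← List.reverse_prefix, List.reverse_reverse]
      exact List.take_prefix _ _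
    · rw [← List.reverse_prefix, List.reverse_reverse, h3]
      exact List.take_prefix _ _
  · rintro ⟨w, rfl, h1, h2⟩
    refine ⟨h1.length_le, h2.length_le, ?_⟩
    rw [← List.reverse_prefix] at h1 h2
    rw [List.prefix_iff_eq_take] at h1 h2
    simpa using h1.symm.trans h2

theorem suffix_append_infix {x : ℕ} {α : List ℕ} (hx : x ∈ Finset.Icc 2 n)
    (h : α <:+ sub T 1 (x - 1)) : α ++ [T x] <:+: sub T 1 n := by
  rw [Finset.mem_Icc] at hx
  have h1 : α ++ [T x] <:+ sub T 1 x := by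
    rw [sub_concat T (by omega : 1 ≤ x) (by omega)]
    obtain ⟨w, hw⟩ := h
    exact ⟨w, by rw [← hw]; simp⟩
  refine h1.isInfix.trans ?_
  rw [sub_append T (by omega : 1 ≤ x + 1) hx.2]
  exact (List.prefix_append _ _).isInfix

theorem exists_of_append_infix {a : ℕ} {α : List ℕ} (h : α ++ [a] <:+: sub T 1 n) :
    ∃ y ∈ Finset.Icc 1 n, T y = a ∧ α <:+ sub T 1 (y - 1) := by
  obtain ⟨u, v, huv⟩ := h
  have hlen := congrArg List.length huv
  simp only [List.length_append, List.length_singleton, length_sub] at hlen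
  refine ⟨u.length + α.length + 1, by simp; omega, ?_, u, ?_⟩
  · have := List.getElem_of_eq huv (i := u.length + α.length) (by simp)
    rw [getElem_sub] at this
    rw [Nat.add_comm, ← this]
    simp
  · have := congrArg (List.take (u.length + α.length)) huv
    rw [sub_append T (by omega : 1 ≤ u.length + α.length + 1) (by omega : _ ≤ n)] at this
    have h3 : u ++ (α ++ [a]) ++ v = (u ++ α) ++ ([a] ++ v) := by simp
    rw [h3, List.take_left' (by simp), List.take_left' (by simp [length_sub])] at this
    rwa [Nat.add_sub_cancel]

/-- The right-maximal contexts of the character `T[x]` are those of length at most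
`LCP[SLPR[bwt(x)]]`. -/
theorem IsText.rightMaximal_iff (hT : IsText n σ T) {x k : ℕ} (hx : x ∈ Finset.Icc 2 n)
    (hk : k ≤ x - 1) :
    RightMaximal n T (sub T (x - k) (x - 1)) ↔ k ≤ LCPr n T (SLPR n T (bwt n T x)) := by
  have hx2 := Finset.mem_Icc.mp hx
  have hx1 : x ∈ Finset.Icc 1 n := by simp; omega
  have hne1 : T 1 ≠ T x := (hT.first_lt x hx).ne
  have h1m : 1 ∈ Finset.Icc 1 n := by simp; omega
  have hlen : (sub T (x - k) (x - 1)).length = k := by rw [length_sub]; omega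
  have hsuf : sub T (x - k) (x - 1) <:+ context n T x := by
    rw [context, if_neg (by omega)]
    exact sub_suffix (by omega)
  rw [(hT.slprSpec (bwt_mem hx1)).iff, BWTr_bwt hx1, row_bwt hx1]
  constructor
  · intro h
    have key : ∃ y ∈ Finset.Icc 1 n, T y ≠ T x ∧ sub T (x - k) (x - 1) <:+ context n T y := by
      rcases h with h | ⟨a, b, hab, ha, hb⟩
      · exact ⟨1, h1m, hne1, by rwa [context, if_pos rfl]⟩
      · have : ∃ c, c ≠ T x ∧ sub T (x - k) (x - 1) ++ [c] <:+: sub T 1 n := by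
          by_cases h : a = T x
          · exact ⟨b, by rw [← h]; exact hab.symm, hb⟩
          · exact ⟨a, h, ha⟩
        obtain ⟨c, hc, hinf⟩ := this
        obtain ⟨y, hy, rfl, hsuf⟩ := exists_of_append_infix hinf
        refine ⟨y, hy, hc, ?_⟩
        rw [context]
        split
        · next h1 =>
          rw [h1] at hsuf
          rw [sub_eq_nil T (by omega : 1 - 1 < 1)] at hsuf
          rw [List.suffix_nil.mp hsuf]
          exact List.nil_suffix
        · exact hsuf
    obtain ⟨y, hy, hne, hs⟩ := key
    refine ⟨bwt n T y, bwt_mem hy, by rwa [BWTr_bwt hy], ?_⟩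
    rw [row_bwt hy, le_lcp_reverse_iff]
    exact ⟨_, hlen, hsuf, hs⟩
  · rintro ⟨j, hj, hne, hle⟩
    obtain ⟨y, hy, rfl⟩ := exists_bwt_eq (T := T) hj
    rw [BWTr_bwt hy] at hne
    rw [row_bwt hy, le_lcp_reverse_iff] at hle
    obtain ⟨w, hw, hwx, hwy⟩ := hle
    have hw' : sub T (x - k) (x - 1) = w :=
      (List.suffix_of_suffix_length_le hsuf hwx (by omega)).eq_of_length (by omega)
    rw [hw']
    by_cases hy1 : y = 1
    · left
      rwa [context, if_pos hy1] at hwy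
    · right
      rw [context, if_neg hy1] at hwy
      rw [context, if_neg (by omega)] at hwx
      simp at hy
      exact ⟨T y, T x, hne, suffix_append_infix (by simp; omega) hwy,
        suffix_append_infix hx hwx⟩

/-- The longest right-maximal context of `x` fits in `T[1, x - 1]`. -/
theorem IsText.ell_lt (hT : IsText n σ T) {x : ℕ} (hx : x ∈ Finset.Icc 2 n) :
    LCPr n T (SLPR n T (bwt n T x)) < x := by
  have hx2 := Finset.mem_Icc.mp hx
  have hx1 : x ∈ Finset.Icc 1 n := by simp; omega
  obtain ⟨j, hj, -, hle⟩ := ((hT.slprSpec (bwt_mem hx1)).iff _).mp le_rfl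
  rw [row_bwt hx1, le_lcp_iff, context, if_neg (by omega)] at hle
  have := hle.1
  simp [length_sub] at this
  omega

/-- The longest one-character right-extension of a right-maximal string that ends at the
position `x`. -/
def longestExt (n : ℕ) (T : ℕ → ℕ) (x : ℕ) : List ℕ :=
  sub T (if x = 1 then 1 else x - LCPr n T (SLPR n T (bwt n T x))) x

theorem longestExt_suffix {x : ℕ} (hT : IsText n σ T) (hx : x ∈ Finset.Icc 1 n) :
    longestExt n T x <:+ sub T 1 x := by
  rw [longestExt]
  rw [Finset.mem_Icc] at hx
  split
  · exact List.suffix_rfl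
  · have := hT.ell_lt (x := x) (by simp; omega)
    exact sub_suffix (by omega)

/-- It suffices to cover the longest extension of every position, because by
`IsText.rightMaximal_iff` the right-maximal contexts of a position are closed under suffixes. -/
theorem IsText.isSuffixient_iff (hT : IsText n σ T) {S : Finset ℕ} :
    IsSuffixient n T S ↔
      ∀ x ∈ Finset.Icc 1 n, ∃ y ∈ S, longestExt n T x <:+ sub T 1 y := by
  constructor
  · intro h x hx
    have hx1 := Finset.mem_Icc.mp hx
    rw [longestExt]
    by_cases h1 : x = 1
    · rw [if_pos h1]
      refine h 1 x le_rfl hx1.1 hx1.2 (.inl ?_)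
      rw [sub_eq_nil T (by omega)]
      exact List.nil_suffix
    · rw [if_neg h1]
      have hx2 : x ∈ Finset.Icc 2 n := by simp; omega
      have := hT.ell_lt hx2
      exact h _ x (by omega) (by omega) hx1.2
        ((hT.rightMaximal_iff hx2 (by omega)).mpr le_rfl)
  · intro h i j hi hij hj hrm
    obtain ⟨y, hy, hs⟩ := h j (by simp; omega)
    refine ⟨y, hy, .trans ?_ hs⟩
    rw [longestExt]
    by_cases h1 : j = 1
    · rw [if_pos h1]
      exact sub_suffix (by omega)
    · rw [if_neg h1]
      have h2 := (hT.rightMaximal_iff (x := j) (k := j - i) (by simp; omega) (by omega)).mp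
        (by rwa [show j - (j - i) = i by omega])
      exact sub_suffix (by omega)

theorem IsText.eq_one (hT : IsText n σ T) {x : ℕ} (hx : x ∈ Finset.Icc 1 n) (h : T x = T 1) :
    x = 1 := by
  by_contra hc
  rw [Finset.mem_Icc] at hx
  have := hT.first_lt x (by simp; omega)
  omega

/-- Two positions with the same character are near if and only if one of their longest extensions
is a suffix of the other one. -/
theorem IsText.near_iff (hT : IsText n σ T) {x y : ℕ} (hx : x ∈ Finset.Icc 2 n)
    (hy : y ∈ Finset.Icc 2 n) (hxy : bwt n T x < bwt n T y) :
    T x = T y ∧ Near n T (bwt n T x) (bwt n T y) ↔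
      longestExt n T x <:+ longestExt n T y ∨ longestExt n T y <:+ longestExt n T x := by
  have hx2 := Finset.mem_Icc.mp hx
  have hy2 := Finset.mem_Icc.mp hy
  have hx1 : x ∈ Finset.Icc 1 n := by simp; omega
  have hy1 : y ∈ Finset.Icc 1 n := by simp; omega
  have hbx := Finset.mem_Icc.mp (bwt_mem (T := T) hx1)
  have hby := Finset.mem_Icc.mp (bwt_mem (T := T) hy1)
  have hlx := hT.ell_lt hx
  have hly := hT.ell_lt hy
  rw [Near, ← le_lcp_row_iff hbx.1 hxy hby.2, row_bwt hx1, row_bwt hy1, le_lcp_reverse_iff]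
  simp only [longestExt, context, show x ≠ 1 by omega, show y ≠ 1 by omega, if_false]
  generalize LCPr n T (SLPR n T (bwt n T x)) = k at *
  generalize LCPr n T (SLPR n T (bwt n T y)) = l at *
  rw [sub_concat T (by omega : 1 ≤ x) (by omega), sub_concat T (by omega : 1 ≤ y) (by omega)]
  have hu : sub T (x - k) (x - 1) <:+ sub T 1 (x - 1) := sub_suffix (by omega)
  have hv : sub T (y - l) (y - 1) <:+ sub T 1 (y - 1) := sub_suffix (by omega)
  have hul : (sub T (x - k) (x - 1)).length = k := by rw [length_sub]; omega
  have hvl : (sub T (y - l) (y - 1)).length = l := by rw [length_sub]; omega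
  generalize sub T (x - k) (x - 1) = u at *
  generalize sub T (y - l) (y - 1) = v at *
  have hcc : ∀ (u v : List ℕ) (a b : ℕ), u ++ [a] <:+ v ++ [b] ↔ a = b ∧ u <:+ v := by
    intro u v a b
    rw [← List.reverse_prefix, ← List.reverse_prefix]
    simp [List.cons_prefix_cons]
  rw [hcc, hcc]
  constructor
  · rintro ⟨h1, w, hw, hwx, hwy⟩
    rcases le_total k l with h | h
    · left
      refine ⟨h1, ?_⟩
      have : w = u := (List.suffix_of_suffix_length_le hwx hu (by omega)).eq_of_length (by omega)
      exact List.suffix_of_suffix_length_le (this ▸ hwy) hv (by omega)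
    · right
      refine ⟨h1.symm, ?_⟩
      have : w = v := (List.suffix_of_suffix_length_le hwy hv (by omega)).eq_of_length (by omega)
      exact List.suffix_of_suffix_length_le (this ▸ hwx) hu (by omega)
  · rintro (⟨h1, h2⟩ | ⟨h1, h2⟩)
    · have := h2.length_le
      exact ⟨h1, u, by omega, hu, h2.trans hv⟩
    · have := h2.length_le
      exact ⟨h1.symm, v, by omega, h2.trans hu, hv⟩

/-! ### Minimum cardinality -/

/-- Some two positions of `S` have comparable longest extensions. -/
def Comparable (n : ℕ) (T : ℕ → ℕ) (S : Finset ℕ) : Prop :=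
  ∃ x ∈ S, ∃ y ∈ S, x ≠ y ∧ longestExt n T x <:+ longestExt n T y

/-- A suffixient set has minimum cardinality if and only if the longest extensions of its elements
are pairwise incomparable. -/
theorem IsText.isMinSuffixient_iff (hT : IsText n σ T) {S : Finset ℕ} (hS : S ⊆ Finset.Icc 1 n)
    (h : IsSuffixient n T S) : IsMinSuffixient n T S ↔ ¬ Comparable n T S := by
  constructor
  · rintro ⟨-, -, hmin⟩ ⟨x, hx, y, hy, hne, hs⟩
    -- the position `x` is redundant, because `y` covers all that `x` covers
    have h1 : IsSuffixient n T (S.erase x) := by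
      rw [hT.isSuffixient_iff] at h ⊢
      intro z hz
      obtain ⟨u, hu, hzu⟩ := h z hz
      by_cases hux : u = x
      · refine ⟨y, Finset.mem_erase.mpr ⟨hne.symm, hy⟩, ?_⟩
        refine .trans ?_ (hs.trans (longestExt_suffix hT (hS hy)))
        subst hux
        have hu1 := Finset.mem_Icc.mp (hS hx)
        have hz1 := Finset.mem_Icc.mp hz
        by_cases h1 : u = 1
        · simpa [longestExt, h1] using hzu
        · have hzl := longestExt_suffix hT hz
          have hne : longestExt n T z ≠ [] := by
            intro h0
            have := congrArg List.length h0
            simp [longestExt, length_sub] at this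
            split at this <;> omega
          have hzz : T z = T u := by
            have h2 := hzu.getLast hne
            have h3 := hzl.getLast hne
            rw [List.getLast_eq_getElem, List.getLast_eq_getElem, getElem_sub] at h2 h3
            simp only [length_sub] at h2 h3
            rw [show 1 + (z + 1 - 1 - 1) = z by omega] at h3
            rw [show 1 + (u + 1 - 1 - 1) = u by omega] at h2
            rw [← h2, ← h3]
          have hz2 : z ≠ 1 := by
            intro h3
            subst h3
            exact h1 (hT.eq_one (hS hx) hzz.symm)
          have hzm : z ∈ Finset.Icc 2 n := by simp; omega
          have hum : u ∈ Finset.Icc 2 n := by simp; omega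
          have hlz := hT.ell_lt hzm
          simp only [longestExt, h1, hz2, if_false] at hzu ⊢
          have hlu := hT.ell_lt hum
          have hrz := (hT.rightMaximal_iff hzm (by omega)).mpr le_rfl
          rw [suffix_sub_iff, length_sub] at hzu
          generalize LCPr n T (SLPR n T (bwt n T z)) = k at *
          obtain ⟨hku, heq⟩ := hzu
          have hk1 : z + 1 - (z - k) = k + 1 := by omega
          rw [hk1] at heq hku
          have heq' : sub T (z - k) (z - 1) = sub T (u - k) (u - 1) := by
            rw [sub_concat T (by omega : 1 ≤ z) (by omega),
              sub_concat T (by omega : 1 ≤ u) (by omega)] at heq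
            have := (List.append_inj' heq rfl).1
            rwa [show u + 1 - (k + 1) = u - k by omega] at this
          rw [heq'] at hrz
          have := (hT.rightMaximal_iff hum (by omega)).mp hrz
          rw [heq]
          exact sub_suffix (by omega)
      · exact ⟨u, Finset.mem_erase.mpr ⟨hux, hu⟩, hzu⟩
    have h2 := hmin _ ((Finset.erase_subset _ _).trans hS) h1
    rw [Finset.card_erase_of_mem hx] at h2
    have := Finset.card_pos.mpr ⟨x, hx⟩
    omega
  · intro hc
    refine ⟨hS, h, fun S' hS' h' => ?_⟩
    rw [hT.isSuffixient_iff] at h'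
    -- `f x` is an element of `S'` that covers the longest extension of `x`. If it covers those of
    -- `x` and `y`, both are suffixes of the same string, and so they are comparable.
    choose! f hf using h'
    refine Finset.card_le_card_of_injOn f (fun x hx => (hf x (hS hx)).1) ?_
    intro x hx y hy hxy
    by_contra hne
    have hsx := (hf x (hS hx)).2
    have hsy := (hf y (hS hy)).2
    rw [← hxy] at hsy
    rcases le_total (longestExt n T x).length (longestExt n T y).length with hl | hl
    · exact hc ⟨x, hx, y, hy, hne, List.suffix_of_suffix_length_le hsx hsy hl⟩
    · exact hc ⟨y, hy, x, hx, Ne.symm hne, List.suffix_of_suffix_length_le hsy hsx hl⟩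

/-- The rows `i < j` carry the same character and belong to `S`, and no row in between does. -/
def Consecutive (n : ℕ) (T : ℕ → ℕ) (S : Finset ℕ) (i j : ℕ) : Prop :=
  i ∈ S.image (bwt n T) ∧ j ∈ S.image (bwt n T) ∧ i < j ∧ BWTr n T i = BWTr n T j ∧
    ∀ h ∈ S.image (bwt n T), i < h → h < j → BWTr n T h ≠ BWTr n T i

/-- Comparable positions carry the same character, and it suffices to look at consecutive rows: a
row of `S` with the same character between two near rows is near to the one of them that has the
smaller LCP value. -/
theorem IsText.comparable_iff (hT : IsText n σ T) {S : Finset ℕ} (hS : S ⊆ Finset.Icc 1 n) :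
    Comparable n T S ↔ ∃ i j, Consecutive n T S i j ∧ Near n T i j := by
  have key : Comparable n T S ↔ ∃ i ∈ S.image (bwt n T), ∃ j ∈ S.image (bwt n T),
      i < j ∧ BWTr n T i = BWTr n T j ∧ Near n T i j := by
    constructor
    · rintro ⟨x, hx, y, hy, hne, hs⟩
      have hx1 := Finset.mem_Icc.mp (hS hx)
      have hy1 := Finset.mem_Icc.mp (hS hy)
      have hTxy : T x = T y := by
        have hne : longestExt n T x ≠ [] := by
          intro h0
          have := congrArg List.length h0
          simp [longestExt, length_sub] at this
          split at this <;> omega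
        have h2 := (longestExt_suffix hT (hS hx)).getLast hne
        have h3 := (hs.trans (longestExt_suffix hT (hS hy))).getLast hne
        rw [List.getLast_eq_getElem, List.getLast_eq_getElem, getElem_sub] at h2 h3
        simp only [length_sub] at h2 h3
        rw [show 1 + (x + 1 - 1 - 1) = x by omega] at h2
        rw [show 1 + (y + 1 - 1 - 1) = y by omega] at h3
        rw [← h2, ← h3]
      have hx2 : x ≠ 1 := fun h => hne (by
        rw [h, hT.eq_one (hS hy) (by rw [← hTxy, h])])
      have hy2 : y ≠ 1 := fun h => hne (by
        rw [h, hT.eq_one (hS hx) (by rw [hTxy, h])])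
      have hxm : x ∈ Finset.Icc 2 n := by simp; omega
      have hym : y ∈ Finset.Icc 2 n := by simp; omega
      rcases Nat.lt_trichotomy (bwt n T x) (bwt n T y) with h | h | h
      · refine ⟨_, Finset.mem_image_of_mem _ hx, _, Finset.mem_image_of_mem _ hy, h, ?_⟩
        rw [BWTr_bwt (hS hx), BWTr_bwt (hS hy)]
        exact (hT.near_iff hxm hym h).mpr (.inl hs)
      · exact absurd (bwt_injOn (hS hx) (hS hy) h) hne
      · refine ⟨_, Finset.mem_image_of_mem _ hy, _, Finset.mem_image_of_mem _ hx, h, ?_⟩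
        rw [BWTr_bwt (hS hx), BWTr_bwt (hS hy)]
        exact (hT.near_iff hym hxm h).mpr (.inr hs)
    · rintro ⟨i, hi, j, hj, hij, heq, hnear⟩
      obtain ⟨x, hx, rfl⟩ := Finset.mem_image.mp hi
      obtain ⟨y, hy, rfl⟩ := Finset.mem_image.mp hj
      have hne : x ≠ y := fun h => by rw [h] at hij; omega
      rw [BWTr_bwt (hS hx), BWTr_bwt (hS hy)] at heq
      have hx1 := Finset.mem_Icc.mp (hS hx)
      have hy1 := Finset.mem_Icc.mp (hS hy)
      have hx2 : x ≠ 1 := fun h => hne (by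
        rw [h, hT.eq_one (hS hy) (by rw [← heq, h])])
      have hy2 : y ≠ 1 := fun h => hne (by
        rw [h, hT.eq_one (hS hx) (by rw [heq, h])])
      rcases (hT.near_iff (by simp; omega) (by simp; omega) hij).mp ⟨heq, hnear⟩ with h | h
      · exact ⟨x, hx, y, hy, hne, h⟩
      · exact ⟨y, hy, x, hx, Ne.symm hne, h⟩
  rw [key]
  constructor
  · rintro ⟨i, hi, j, hj, hij, heq, hnear⟩
    -- a pair of near rows at minimum distance is consecutive
    obtain ⟨d, hd⟩ : ∃ d, j - i = d := ⟨_, rfl⟩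
    induction d using Nat.strong_induction_on generalizing i j with
    | _ d ih =>
      by_cases hcons : Consecutive n T S i j
      · exact ⟨i, j, hcons, hnear⟩
      · simp only [Consecutive, not_and, not_forall] at hcons
        obtain ⟨h, hh, hih, hhj, hhe⟩ := hcons hi hj hij heq
        rw [not_not] at hhe
        rcases le_total (LCPr n T (SLPR n T i)) (LCPr n T (SLPR n T j)) with hl | hl
        · refine ih (h - i) (by omega) i hi h hh hih hhe.symm (fun v hv => ?_) rfl
          rw [Finset.mem_Ioc] at hv
          have := hnear v (by simp; omega)
          omega
        · refine ih (j - h) (by omega) h hh j hj hhj (hhe.trans heq) (fun v hv => ?_) rfl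
          rw [Finset.mem_Ioc] at hv
          have := hnear v (by simp; omega)
          omega
  · rintro ⟨i, j, ⟨hi, hj, hij, heq, -⟩, hnear⟩
    exact ⟨i, hi, j, hj, hij, heq, hnear⟩

/-- The consecutive entries of a sorted list are the consecutive elements of the set. -/
theorem exists_split_sort_iff {s : Finset ℕ} {i j : ℕ} :
    (∃ l₁ l₂, s.sort (· ≤ ·) = l₁ ++ i :: j :: l₂) ↔
      i ∈ s ∧ j ∈ s ∧ i < j ∧ ∀ h ∈ s, i < h → j ≤ h := by
  have hs := Finset.sortedLT_sort s
  have hmem : ∀ x, x ∈ s.sort (· ≤ ·) ↔ x ∈ s := fun x => Finset.mem_sort _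
  generalize s.sort (· ≤ ·) = l at *
  rw [List.sortedLT_iff_pairwise] at hs
  simp only [← hmem]
  clear hmem
  constructor
  · rintro ⟨l₁, l₂, rfl⟩
    rw [List.pairwise_append] at hs
    simp only [List.pairwise_cons, List.mem_cons] at hs
    refine ⟨by simp, by simp, hs.2.1.1 j (.inl rfl), fun h hh hih => ?_⟩
    simp only [List.mem_append, List.mem_cons] at hh
    rcases hh with hh | rfl | rfl | hh
    · have := hs.2.2 h hh i (.inl rfl); omega
    · omega
    · exact le_rfl
    · exact (hs.2.1.2.1 h hh).le
  · rintro ⟨hi, hj, hij, hall⟩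
    obtain ⟨l₁, l₂, rfl⟩ := List.append_of_mem hi
    rw [List.pairwise_append, List.pairwise_cons] at hs
    cases l₂ with
    | nil =>
      simp only [List.mem_append, List.mem_cons, List.not_mem_nil, or_false] at hj
      rcases hj with hj | hj
      · have := hs.2.2 j hj i (by simp); omega
      · omega
    | cons k l₂ =>
      have hk : k = j := by
        have h1 := hall k (by simp) (hs.2.1.1 k (by simp))
        simp only [List.mem_append, List.mem_cons] at hj
        rcases hj with hj | rfl | rfl | hj
        · have := hs.2.2 j hj i (by simp); omega
        · omega
        · rfl
        · have := (List.pairwise_cons.mp hs.2.1.2).1 j hj; omega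
      exact ⟨l₁, l₂, by rw [hk]⟩

/-- Consecutive entries of a bucket come from consecutive rows of `S` with the same character. -/
theorem consecutiveOverlap_iff (hT : IsText n σ T) {S : Finset ℕ} (hS : S ⊆ Finset.Icc 1 n) :
    ConsecutiveOverlap n σ T S ↔ ∃ i j, Consecutive n T S i j ∧
      (box n T (SLPR n T i) ∩ box n T (SLPR n T j)).Nonempty := by
  constructor
  · rintro ⟨c, -, l₁, l₂, p, q, hb, hov⟩
    rw [bucket, List.map_eq_append_iff] at hb
    obtain ⟨m₁, m₂, hm, -, hm₂⟩ := hb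
    rw [List.map_eq_cons_iff] at hm₂
    obtain ⟨i, m₃, rfl, rfl, hm₃⟩ := hm₂
    rw [List.map_eq_cons_iff] at hm₃
    obtain ⟨j, m₄, rfl, rfl, -⟩ := hm₃
    obtain ⟨h1, h2, h3, h4⟩ := exists_split_sort_iff.mp ⟨_, _, hm⟩
    rw [Finset.mem_filter] at h1 h2
    refine ⟨i, j, ⟨h1.1, h2.1, h3, h1.2.trans h2.2.symm, fun h hh hih hhj he => ?_⟩, hov⟩
    have := h4 h (Finset.mem_filter.mpr ⟨hh, he.trans h1.2⟩) hih
    omega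
  · rintro ⟨i, j, ⟨h1, h2, h3, h4, h5⟩, hov⟩
    obtain ⟨l₁, l₂, hl⟩ := (exists_split_sort_iff
      (s := (S.image (bwt n T)).filter (fun h => BWTr n T h = BWTr n T i)) (i := i) (j := j)).mpr
      ⟨by simp only [Finset.mem_filter]; exact ⟨h1, trivial⟩,
       by simp only [Finset.mem_filter]; exact ⟨h2, h4.symm⟩, h3, fun h hh hih => by
        rw [Finset.mem_filter] at hh
        by_contra hc
        exact h5 h hh.1 hih (by omega) hh.2⟩
    refine ⟨BWTr n T i, ?_, l₁.map (SLPR n T), l₂.map (SLPR n T), SLPR n T i, SLPR n T j, ?_, hov⟩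
    · obtain ⟨x, hx, rfl⟩ := Finset.mem_image.mp h1
      rw [BWTr_bwt (hS hx)]
      exact hT.mem_alphabet x (hS hx)
    · rw [bucket, hl]; simp

theorem Consecutive.mem {S : Finset ℕ} (hS : S ⊆ Finset.Icc 1 n) {i j : ℕ}
    (h : Consecutive n T S i j) : i ∈ Finset.Icc 1 n ∧ j ∈ Finset.Icc 1 n := by
  obtain ⟨x, hx, rfl⟩ := Finset.mem_image.mp h.1
  obtain ⟨y, hy, rfl⟩ := Finset.mem_image.mp h.2.1
  exact ⟨bwt_mem (hS hx), bwt_mem (hS hy)⟩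

/-- A suffixient set has minimum cardinality if and only if no two consecutive boxes of a bucket
overlap. -/
theorem IsText.isMinSuffixient_iff_not_overlap (hT : IsText n σ T) {S : Finset ℕ}
    (hS : S ⊆ Finset.Icc 1 n) (h : IsSuffixient n T S) :
    IsMinSuffixient n T S ↔ ¬ ConsecutiveOverlap n σ T S := by
  rw [hT.isMinSuffixient_iff hS h, hT.comparable_iff hS, consecutiveOverlap_iff hT hS, not_iff_not]
  refine exists_congr fun i => exists_congr fun j => and_congr_right fun hc => ?_
  have hm := hc.mem hS
  exact (box_inter_iff_near hc.2.2.1 (hT.slprSpec hm.1) (hT.slprSpec hm.2)).symm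

/-- The comparison of the algorithm finds exactly the overlapping consecutive boxes. -/
theorem IsText.consecutiveOverlap_iff_lt (hT : IsText n σ T) {S : Finset ℕ}
    (hS : S ⊆ Finset.Icc 1 n) :
    ConsecutiveOverlap n σ T S ↔ ∃ i j, Consecutive n T S i j ∧
      PSV (LCPr n T) (SLPR n T j) < NSV n (LCPr n T) (SLPR n T i) := by
  rw [consecutiveOverlap_iff hT hS]
  refine exists_congr fun i => exists_congr fun j => and_congr_right fun hc => ?_
  have hm := hc.mem hS
  exact (PSV_lt_NSV_iff hc.2.2.1 (hT.slprSpec hm.1) (hT.slprSpec hm.2)).symm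

end Contexts

attribute [simp] Com.wp Expr.val Expr.Safe Op.Safe Op.apply

/-! ### Sorting the positions -/

theorem computeA_runs {N n m : ℕ} {s : Store} (hn : 2 ≤ n) (hN : 2 * n + 10 < N)
    (hm : m ≤ n) (hrn : s.reg .n = n) (hrm : s.reg .m = m) :
    Runs N computeA s fun t s' => t ≤ 50 * n + 50 ∧ ∀ i ∈ Finset.Icc 1 m,
      s'.arr .A i = s.arr .ISA ((n + 1 - s.arr .S i) % n + 1) := by
  refine (Runs.forUp (by omega) (L := 1) (b := 15) (fun k s' => ∀ i ∈ Finset.Icc 1 (k - 1),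
    s'.arr .A i = s.arr .ISA ((n + 1 - s.arr .S i) % n + 1)) rfl rfl (by decide) (by omega)
    (by omega) (by omega) (by simp) ?_).mono ?_
  · intro k s' hk1 hk2 hf hag hk hI
    have h1 : s'.reg .n = n := (hag.reg .n rfl).trans hrn
    have h2 : s'.arr .S = s.arr .S := hag.arr .S rfl
    have h3 : s'.arr .ISA = s.arr .ISA := hag.arr .ISA rfl
    have h4 : (n + 1 - s.arr .S k) % n < n := Nat.mod_lt _ (by omega)
    refine (Runs.straight (by omega) (Q := fun s'' => ∀ i ∈ Finset.Icc 1 k,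
      s''.arr .A i = s.arr .ISA ((n + 1 - s.arr .S i) % n + 1)) ?_).mono ?_
    · simp only [Com.wp, Expr.Safe, Expr.val, Op.Safe, Op.apply, h1, h2, h3, hk, true_and, and_true]
      refine ⟨by omega, fun i hi => ?_⟩
      simp only [Store.setArr_arr, if_true, Function.update_apply]
      split
      · next h => rw [h]
      · exact hI i (by simp at *; omega)
    · rintro t s'' - - ⟨ht, h⟩
      exact ⟨ht.trans (by decide), h⟩
  · rintro t s' - - ⟨ht, -, h⟩
    rw [hrm] at ht h
    exact ⟨by omega, h⟩

/-- `B[1, cnt]` lists the set of the values `A[1], …, A[m]` in increasing order. -/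
theorem sortA_runs {N n m : ℕ} {s : Store} (hn : 2 ≤ n) (hN : 2 * n + 10 < N)
    (hm : m ≤ n) (hrn : s.reg .n = n) (hrm : s.reg .m = m)
    (hA : ∀ i ∈ Finset.Icc 1 m, s.arr .A i ∈ Finset.Icc 1 n) :
    Runs N sortA s fun t s' => t ≤ 100 * n + 100 ∧ s'.reg .cnt ≤ n ∧
      (∀ j ∈ Finset.Icc 1 (s'.reg .cnt), ∃ i ∈ Finset.Icc 1 m, s'.arr .B j = s.arr .A i) ∧
      (∀ i ∈ Finset.Icc 1 m, ∃ j ∈ Finset.Icc 1 (s'.reg .cnt), s'.arr .B j = s.arr .A i) ∧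
      (∀ j j', 1 ≤ j → j < j' → j' ≤ s'.reg .cnt → s'.arr .B j < s'.arr .B j') := by
  refine Runs.seq ?_
  refine (Runs.forUp (by omega) (L := 1) (b := 3) (fun k s' => ∀ i ∈ Finset.Icc 1 (k - 1),
    s'.arr .mark i = 0) rfl rfl (by decide) (by omega)
    (by omega) (by omega) (by simp) ?_).mono ?_
  · intro k s' hk1 hk2 hf hag hk hI
    refine (Runs.straight (by omega) (Q := fun s'' => ∀ i ∈ Finset.Icc 1 k,
      s''.arr .mark i = 0) ?_).mono ?_
    · simp only [Com.wp, Expr.Safe, Expr.val, hk, true_and]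
      refine ⟨by omega, fun i hi => ?_⟩
      simp only [Store.setArr_arr, if_true, Function.update_apply]
      split
      · rfl
      · exact hI i (by simp at *; omega)
    · rintro t s'' - - ⟨ht, h⟩
      exact ⟨ht, h⟩
  rintro t₁ s₁ - hag₁ ⟨ht₁, -, hI₁⟩
  rw [hrn] at ht₁ hI₁
  have hrn₁ : s₁.reg .n = n := (hag₁.reg .n rfl).trans hrn
  have hrm₁ : s₁.reg .m = m := (hag₁.reg .m rfl).trans hrm
  have hA₁ : s₁.arr .A = s.arr .A := hag₁.arr .A rfl
  refine Runs.seq ?_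
  refine (Runs.forUp (by omega) (L := 1) (b := 4) (fun k s' => ∀ i ∈ Finset.Icc 1 n,
    s'.arr .mark i ≠ 0 ↔ ∃ j ∈ Finset.Icc 1 (k - 1), s.arr .A j = i) rfl rfl (by decide) (by omega)
    (by omega) (by omega) (by simpa using hI₁) ?_).mono ?_
  · intro k s' hk1 hk2 hf hag hk hI
    have h1 : s'.arr .A = s.arr .A := (hag.arr .A rfl).trans hA₁
    refine (Runs.straight (by omega) (Q := fun s'' => ∀ i ∈ Finset.Icc 1 n,
      s''.arr .mark i ≠ 0 ↔ ∃ j ∈ Finset.Icc 1 k, s.arr .A j = i) ?_).mono ?_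
    · simp only [Com.wp, Expr.Safe, Expr.val, hk, true_and, h1]
      refine ⟨by omega, fun i hi => ?_⟩
      simp only [Store.setArr_arr, if_true, Function.update_apply]
      split
      · next h =>
        simp only [ne_eq, one_ne_zero, not_false_eq_true, true_iff]
        exact ⟨k, by simp; omega, h.symm⟩
      · next h =>
        rw [hI i hi]
        constructor
        · rintro ⟨j, hj, hji⟩
          exact ⟨j, by simp at *; omega, hji⟩
        · rintro ⟨j, hj, hji⟩
          have : j ≠ k := fun hjk => h (by rw [← hji, hjk])
          exact ⟨j, by simp at *; omega, hji⟩
    · rintro t s'' - - ⟨ht, h⟩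
      exact ⟨ht, h⟩
  rintro t₂ s₂ - hag₂ ⟨ht₂, -, hI₂⟩
  rw [hrm₁] at ht₂ hI₂
  have hrn₂ : s₂.reg .n = n := (hag₂.reg .n rfl).trans hrn₁
  refine Runs.seq ?_
  refine (Runs.straight (by omega) (c := .assign .cnt (.lit 0))
    (Q := fun s' => s' = s₂.setReg .cnt 0) (by simp; omega)).mono ?_
  rintro t₃ s₃ - hag₃ ⟨ht₃, rfl⟩
  refine (Runs.forUp (by omega) (L := 1) (b := 10) (fun k s' => s'.reg .cnt < k ∧
    (∀ j ∈ Finset.Icc 1 (s'.reg .cnt), s'.arr .B j < k ∧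
      ∃ i ∈ Finset.Icc 1 m, s'.arr .B j = s.arr .A i) ∧
    (∀ i ∈ Finset.Icc 1 m, s.arr .A i < k →
      ∃ j ∈ Finset.Icc 1 (s'.reg .cnt), s'.arr .B j = s.arr .A i) ∧
    (∀ j j', 1 ≤ j → j < j' → j' ≤ s'.reg .cnt → s'.arr .B j < s'.arr .B j')) rfl rfl (by decide)
    (by omega) (by omega) (by simp [hrn₂]; omega) ?_ ?_).mono ?_
  · refine ⟨by simp, by simp, fun i hi h => ?_, fun j j' h1 h2 h3 => ?_⟩
    · have := Finset.mem_Icc.mp (hA i hi); omega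
    · simp at h3; omega
  · intro k s' hk1 hk2 hf hag hk hI
    obtain ⟨hI1, hI2, hI3, hI4⟩ := hI
    have h1 : s'.arr .mark = s₂.arr .mark := hag.arr .mark rfl
    simp [hrn₂] at hk2
    refine (Runs.straight (by omega) (Q := fun s'' => s''.reg .cnt < k + 1 ∧
      (∀ j ∈ Finset.Icc 1 (s''.reg .cnt), s''.arr .B j < k + 1 ∧
        ∃ i ∈ Finset.Icc 1 m, s''.arr .B j = s.arr .A i) ∧
      (∀ i ∈ Finset.Icc 1 m, s.arr .A i < k + 1 →
        ∃ j ∈ Finset.Icc 1 (s''.reg .cnt), s''.arr .B j = s.arr .A i) ∧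
      (∀ j j', 1 ≤ j → j < j' → j' ≤ s''.reg .cnt → s''.arr .B j < s''.arr .B j')) ?_).mono ?_
    · simp only [Com.wp, Expr.Safe, Expr.val, hk, true_and, h1, Op.Safe, Op.apply,
        Store.setReg_reg, Store.setReg_arr, Store.setArr_arr, Store.setArr_reg, if_true,
          reduceCtorEq, if_false]
      refine ⟨fun hmk => ?_, fun hmk => ?_⟩
      · obtain ⟨j₀, hj₀, hj₀k⟩ := (hI₂ k (by simp; omega)).mp hmk
        simp only [Nat.add_sub_cancel] at hj₀
        refine ⟨⟨by omega, by omega⟩, by omega, ?_, ?_, ?_⟩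
        · intro j hj
          rw [Finset.mem_Icc] at hj
          rw [Function.update_apply]
          split
          · exact ⟨by omega, j₀, hj₀, hj₀k.symm⟩
          · have := hI2 j (by simp; omega)
            exact ⟨by omega, this.2⟩
        · intro i hi hik
          by_cases h : s.arr .A i = k
          · exact ⟨s'.reg .cnt + 1, by simp, by simp [h]⟩
          · obtain ⟨j, hj, hji⟩ := hI3 i hi (by omega)
            rw [Finset.mem_Icc] at hj
            refine ⟨j, by simp; omega, ?_⟩
            rw [Function.update_of_ne (by omega), hji]
        · intro j j' h2 h3 h4
          rw [Function.update_of_ne (by omega : j ≠ s'.reg .cnt + 1), Function.update_apply]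
          split
          · exact (hI2 j (by simp; omega)).1
          · exact hI4 j j' h2 h3 (by omega)
      · refine ⟨by omega, fun j hj => ?_, fun i hi hik => hI3 i hi ?_, hI4⟩
        · have := hI2 j hj
          exact ⟨by omega, this.2⟩
        · have : s.arr .A i ≠ k := fun h => absurd hmk
            ((hI₂ k (by simp; omega)).mpr ⟨i, by simpa using hi, h⟩)
          omega
    · rintro t s'' - - ⟨ht, h⟩
      exact ⟨ht, by simpa using h⟩
  · rintro t₄ s₄ - - ⟨ht₄, -, hI1, hI2, hI3, hI4⟩
    simp [hrn₂] at ht₄ hI1 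
    simp only [Com.cost, Expr.cost] at ht₃
    refine ⟨by omega, by omega, fun j hj => (hI2 j hj).2, fun i hi => hI3 i hi ?_, hI4⟩
    have := Finset.mem_Icc.mp (hA i hi)
    simp [hrn₂]; omega

/-! ### Buckets as linked lists -/

/-- `v` is the first index strictly between `lo` and `hi` at which `f` takes the value `c`, or `0`
if there is no such index. -/
def IsNext (f : ℕ → ℕ) (lo hi c v : ℕ) : Prop :=
  (v = 0 ∧ ∀ j, lo < j → j < hi → f j ≠ c) ∨
    (lo < v ∧ v < hi ∧ f v = c ∧ ∀ j, lo < j → j < v → f j ≠ c)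

/-- `v` is the last index strictly between `0` and `hi` at which `f` takes the value `c`, or `0`
if there is no such index. -/
def IsLast (f : ℕ → ℕ) (hi c v : ℕ) : Prop :=
  (v = 0 ∧ ∀ j, 0 < j → j < hi → f j ≠ c) ∨
    (0 < v ∧ v < hi ∧ f v = c ∧ ∀ j, v < j → j < hi → f j ≠ c)

theorem IsNext.succ_of_ne {f : ℕ → ℕ} {lo hi c v : ℕ} (h : IsNext f lo hi c v)
    (hv : f hi ≠ c ∨ v ≠ 0) : IsNext f lo (hi + 1) c v := by
  rcases h with ⟨h1, h2⟩ | ⟨h1, h2, h3, h4⟩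
  · left
    refine ⟨h1, fun j hj hj' => ?_⟩
    rcases Nat.lt_or_ge j hi with h3 | h3
    · exact h2 j hj h3
    · rw [show j = hi by omega]
      tauto
  · exact .inr ⟨h1, by omega, h3, h4⟩

theorem IsNext.succ_of_eq {f : ℕ → ℕ} {lo hi : ℕ} (h : IsNext f lo hi (f hi) 0) (hlo : lo < hi) :
    IsNext f lo (hi + 1) (f hi) hi := by
  rcases h with ⟨-, h2⟩ | ⟨h1, -⟩
  · exact .inr ⟨hlo, by omega, rfl, h2⟩
  · omega

theorem IsLast.succ_of_ne {f : ℕ → ℕ} {hi c v : ℕ} (h : IsLast f hi c v)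
    (hv : f hi ≠ c) : IsLast f (hi + 1) c v := by
  rcases h with ⟨h1, h2⟩ | ⟨h1, h2, h3, h4⟩
  · left
    refine ⟨h1, fun j hj hj' => ?_⟩
    rcases Nat.lt_or_ge j hi with h3 | h3
    · exact h2 j hj h3
    · rwa [show j = hi by omega]
  · refine .inr ⟨h1, by omega, h3, fun j hj hj' => ?_⟩
    rcases Nat.lt_or_ge j hi with h3 | h3
    · exact h4 j hj h3
    · rwa [show j = hi by omega]

theorem isLast_succ_self {f : ℕ → ℕ} {hi : ℕ} (h : 0 < hi) :
    IsLast f (hi + 1) (f hi) hi :=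
  .inr ⟨h, by omega, rfl, fun j h1 h2 => by omega⟩

/-- If the index `j` has no successor so far, it is the last one of its bucket. -/
theorem IsNext.eq_last {f : ℕ → ℕ} {hi c j v : ℕ} (h : IsNext f j hi c 0) (hj : 0 < j)
    (hjh : j < hi) (hc : f j = c) (hl : IsLast f hi c v) : v = j := by
  rcases h with ⟨-, h2⟩ | ⟨h1, -⟩
  · rcases hl with ⟨-, h3⟩ | ⟨h3, h4, h5, h6⟩
    · exact absurd hc (h3 j hj hjh)
    · rcases Nat.lt_trichotomy v j with h | h | h
      · exact absurd hc (h6 j h hjh)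
      · exact h
      · exact absurd h5 (h2 v h h4)
  · omega

/-- The list of the character `c` runs through the indices `j` with `f j = c` in increasing order,
where `f j` is the character at the `j`-th sorted position. -/
theorem fillBuckets_runs {N n σ m : ℕ} {s : Store} {f : ℕ → ℕ} (hN : 2 * n + 10 < N)
    (hm : m ≤ n) (hσ : σ ≤ n) (hrσ : s.reg .sigma = σ) (hrm : s.reg .cnt = m)
    (hf : ∀ j, f j = s.arr .BWT (s.arr .B j))
    (hfσ : ∀ j, 1 ≤ j → j ≤ m → 1 ≤ f j ∧ f j ≤ σ) :
    Runs N fillBuckets s fun t s' => t ≤ 100 * n + 100 ∧ s'.arr .next 0 = 0 ∧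
      (∀ j, 1 ≤ j → j ≤ m → s'.arr .val j = s.arr .SLPR (s.arr .B j)) ∧
      (∀ c, 1 ≤ c → c ≤ σ → IsNext f 0 (m + 1) c (s'.arr .head c)) ∧
      (∀ j, 1 ≤ j → j ≤ m → IsNext f j (m + 1) (f j) (s'.arr .next j)) := by
  refine Runs.seq ?_
  refine (Runs.straight (by omega) (c := .put .next (.lit 0) (.lit 0))
    (Q := fun s' => s' = s.setArr .next 0 0) (by simp; omega)).mono ?_
  rintro t₁ s₁ - hag₁ ⟨ht₁, rfl⟩
  refine Runs.seq ?_
  refine (Runs.forUp (by omega) (L := 1) (b := 6) (fun k s' => ∀ c, 1 ≤ c → c < k →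
    s'.arr .head c = 0 ∧ s'.arr .tail c = 0) rfl rfl (by decide) (by omega) (by omega)
    (by simp; omega) (by intro c h1 h2; omega) ?_).mono ?_
  · intro k s' hk1 hk2 hf hag hk hI
    refine (Runs.straight (by omega) (Q := fun s'' => ∀ c, 1 ≤ c → c < k + 1 →
      s''.arr .head c = 0 ∧ s''.arr .tail c = 0) ?_).mono ?_
    · simp only [Com.wp, Expr.Safe, Expr.val, hk, true_and, Store.setArr_reg]
      refine ⟨by omega, by omega, fun c hc hck => ?_⟩
      simp only [Store.setArr_arr, if_true, reduceCtorEq, if_false, Function.update_apply]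
      by_cases h : c = k
      · simp [h]
      · simpa [h] using hI c hc (by omega)
    · rintro t s'' - - ⟨ht, h⟩
      exact ⟨ht.trans (by decide), h⟩
  rintro t₂ s₂ - hag₂ ⟨ht₂, -, hI₂⟩
  simp only [Store.setArr_reg, hrσ] at ht₂ hI₂
  have hr₂ : s₂.reg .cnt = m := (hag₂.reg .cnt rfl).trans hrm
  have hnx : s₂.arr .next 0 = 0 := by rw [hag₂.arr .next rfl]; simp
  have hB₂ : s₂.arr .B = s.arr .B := (hag₂.arr .B rfl).trans (hag₁.arr .B rfl)
  have hS₂ : s₂.arr .SLPR = s.arr .SLPR := (hag₂.arr .SLPR rfl).trans (hag₁.arr .SLPR rfl)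
  have hW₂ : s₂.arr .BWT = s.arr .BWT := (hag₂.arr .BWT rfl).trans (hag₁.arr .BWT rfl)
  -- Before the round `k`, the lists consist of the indices below `k`.
  let I : ℕ → Store → Prop := fun k s' => s'.arr .next 0 = 0 ∧
      (∀ j, 1 ≤ j → j < k → s'.arr .val j = s.arr .SLPR (s.arr .B j)) ∧
      (∀ c, 1 ≤ c → c ≤ σ → IsNext f 0 k c (s'.arr .head c)) ∧
      (∀ c, 1 ≤ c → c ≤ σ → IsLast f k c (s'.arr .tail c)) ∧
      (∀ j, 1 ≤ j → j < k → IsNext f j k (f j) (s'.arr .next j))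
  refine (Runs.forUp (by omega) (L := 1) (b := 28) I rfl rfl (by decide) (by omega) (by omega)
    (by omega) ?_ ?_).mono ?_
  · refine ⟨hnx, fun j h1 h2 => by omega, fun c h1 h2 => .inl ⟨(hI₂ c h1 (by omega)).1, by omega⟩,
      fun c h1 h2 => .inl ⟨(hI₂ c h1 (by omega)).2, by omega⟩, fun j h1 h2 => by omega⟩
  · rintro k s' hk1 hk2 hf' hag hk ⟨hI1, hI2, hI3, hI4, hI5⟩
    have hB : s'.arr .B = s.arr .B := (hag.arr .B rfl).trans hB₂
    have hS : s'.arr .SLPR = s.arr .SLPR := (hag.arr .SLPR rfl).trans hS₂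
    have hW : s'.arr .BWT = s.arr .BWT := (hag.arr .BWT rfl).trans hW₂
    rw [hr₂] at hk2
    have hfk := hfσ k hk1 hk2
    have hlast := hI4 (f k) hfk.1 hfk.2
    have hfk' := hf k
    refine (Runs.straight (by omega) (Q := I (k + 1)) ?_).mono ?_
    · simp only [Com.wp, Expr.Safe, Expr.val, Store.setReg_reg, Store.setReg_arr, if_true,
        reduceCtorEq, if_false, true_and, hk, hB, hW, hS, ← hfk', Store.setArr_arr,
        Store.setArr_reg]
      refine ⟨by omega, fun htl => ?_, fun htl => ?_⟩
      · have hne : s'.arr .tail (f k) ≠ k := by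
          rcases hlast with h | h <;> omega
        refine ⟨?_, ?_, ?_, ?_, ?_⟩ <;>
          simp only [Store.setReg_reg, Store.setReg_arr, if_true, reduceCtorEq, if_false,
            Store.setArr_arr, Store.setArr_reg]
        · rw [Function.update_of_ne (Ne.symm htl), Function.update_of_ne (by omega), hI1]
        · intro j h1 h2
          rw [Function.update_apply]
          split
          · next h => rw [h]
          · exact hI2 j h1 (by omega)
        · intro c h1 h2
          refine (hI3 c h1 h2).succ_of_ne ?_
          by_cases hc : f k = c
          · right
            subst hc
            intro h0
            rcases hlast with h | h
            · exact htl h.1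
            · rcases hI3 (f k) h1 h2 with h' | h'
              · exact h'.2 _ h.1 h.2.1 h.2.2.1
              · omega
          · exact .inl hc
        · intro c h1 h2
          rw [Function.update_apply]
          split
          · next h => rw [h]; exact isLast_succ_self (by omega)
          · next h => exact (hI4 c h1 h2).succ_of_ne (Ne.symm h)
        · intro j h1 h2
          rw [Function.update_apply]
          split
          · next h =>
            rw [h]
            rcases hlast with h' | h'
            · omega
            · rw [h'.2.2.1]
              refine IsNext.succ_of_eq (.inl ⟨rfl, h'.2.2.2⟩) h'.2.1
          · next h =>
            rw [Function.update_apply]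
            split
            · next h => rw [h]; exact .inl ⟨rfl, fun i _ _ => by omega⟩
            · next h' =>
              refine (hI5 j h1 (by omega)).succ_of_ne ?_
              by_cases h3 : f k = f j
              · right
                intro h4
                have h5 := hI5 j h1 (by omega)
                rw [h4] at h5
                exact h (h5.eq_last h1 (by omega) rfl (h3 ▸ hlast)).symm
              · exact .inl h3
      · refine ⟨?_, ?_, ?_, ?_, ?_⟩ <;>
          simp only [Store.setReg_reg, Store.setReg_arr, if_true, reduceCtorEq, if_false,
            Store.setArr_arr, Store.setArr_reg]
        · rw [Function.update_of_ne (by omega), hI1]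
        · intro j h1 h2
          rw [Function.update_apply]
          split
          · next h => rw [h]
          · exact hI2 j h1 (by omega)
        · intro c h1 h2
          rw [Function.update_apply]
          split
          · next h =>
            rw [h]
            refine IsNext.succ_of_eq (.inl ⟨rfl, ?_⟩) hk1
            rcases hlast with h' | h'
            · exact h'.2
            · omega
          · next h => exact (hI3 c h1 h2).succ_of_ne (.inl (Ne.symm h))
        · intro c h1 h2
          rw [Function.update_apply]
          split
          · next h => rw [h]; exact isLast_succ_self (by omega)
          · next h => exact (hI4 c h1 h2).succ_of_ne (Ne.symm h)
        · intro j h1 h2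
          rw [Function.update_apply]
          split
          · next h => rw [h]; exact .inl ⟨rfl, fun i _ _ => by omega⟩
          · next h =>
            refine (hI5 j h1 (by omega)).succ_of_ne (.inl fun h3 => ?_)
            rcases hlast with h' | h'
            · exact h'.2 j h1 (by omega) h3.symm
            · omega
    · rintro t s'' - - ⟨ht, h⟩
      exact ⟨ht.trans (by decide), h⟩
  · rintro t₄ s₄ - - ⟨ht₄, -, hI1, hI2, hI3, hI4, hI5⟩
    rw [hr₂] at ht₄ hI2 hI3 hI5
    simp only [Com.cost, Expr.cost] at ht₁
    exact ⟨by omega, hI1, fun j h1 h2 => hI2 j h1 (by omega), hI3, fun j h1 h2 => hI5 j h1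
      (by omega)⟩

/-- The answer is negative if and only if the comparison succeeds for some index `j` that has a
successor in its list. -/
theorem scanBuckets_runs {N n σ m : ℕ} {s : Store} {f : ℕ → ℕ} (hN : 2 * n + 10 < N)
    (hm : m ≤ n) (hσ : σ ≤ n) (hrσ : s.reg .sigma = σ)
    (hnext0 : s.arr .next 0 = 0)
    (hhead : ∀ c, 1 ≤ c → c ≤ σ → IsNext f 0 (m + 1) c (s.arr .head c))
    (hnext : ∀ j, 1 ≤ j → j ≤ m → IsNext f j (m + 1) (f j) (s.arr .next j))
    (hfσ : ∀ j, 1 ≤ j → j ≤ m → 1 ≤ f j ∧ f j ≤ σ) :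
    Runs N scanBuckets s fun t s' => t ≤ 200 * n + 200 ∧
      (s'.reg .res = 0 ∨ s'.reg .res = 1) ∧
      (s'.reg .res = 0 ↔ ∃ j, 1 ≤ j ∧ j ≤ m ∧ s.arr .next j ≠ 0 ∧
        s.arr .PSV (s.arr .val (s.arr .next j)) < s.arr .NSV (s.arr .val j)) := by
  set Bad : ℕ → Prop := fun j => s.arr .next j ≠ 0 ∧
    s.arr .PSV (s.arr .val (s.arr .next j)) < s.arr .NSV (s.arr .val j) with hBad
  refine Runs.seq ?_
  refine (Runs.straight (by omega) (c := .assign .res (.lit 1))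
    (Q := fun s' => s' = s.setReg .res 1) (by simp; omega)).mono ?_
  rintro t₁ s₁ - hag₁ ⟨ht₁, rfl⟩
  refine Runs.seq ?_
  refine (Runs.straight (by omega) (c := .assign .i (.lit 1))
    (Q := fun s' => s' = (s.setReg .res 1).setReg .i 1) (by simp; omega)).mono ?_
  rintro t₂ s₂ - hag₂ ⟨ht₂, rfl⟩
  -- The potential pays for every bucket and for every entry in a bucket not yet inspected.
  refine (Runs.loop (by omega)
    (fun s' => 1 ≤ s'.reg .i ∧ s'.reg .i ≤ σ + 1 ∧
      ((s'.reg .res = 0 ∧ ∃ j, 1 ≤ j ∧ j ≤ m ∧ Bad j) ∨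
        (s'.reg .res = 1 ∧ ∀ j, 1 ≤ j → j ≤ m → f j < s'.reg .i → ¬ Bad j)))
    (fun s' => 60 * (σ + 1 - s'.reg .i) +
      60 * ((Finset.Icc 1 m).filter (fun j => s'.reg .i ≤ f j)).card) ?_ ?_).mono ?_
  · refine ⟨by simp, by simp, .inr ⟨by simp, fun j h1 h2 h3 => ?_⟩⟩
    have := hfσ j h1 h2
    simp at h3; omega
  · rintro s₃ hf₃ hag₃ ⟨hi1, hi2, hres⟩
    have hσ₃ : s₃.reg .sigma = σ := (hag₃.reg .sigma rfl).trans hrσ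
    have hres1 : s₃.reg .res ≤ 1 := by rcases hres with h | h <;> omega
    refine ⟨?_, fun hv => ?_⟩
    · simp only [Expr.Safe, Op.Safe, Expr.val, Op.apply, true_and]
      by_cases h : s₃.reg .i ≤ s₃.reg .sigma <;> simp [h] <;> omega
    simp only [Expr.val, Op.apply, hσ₃] at hv
    have hiσ : s₃.reg .i ≤ σ := by
      by_contra hc; simp [hc] at hv
    have hr1 : s₃.reg .res = 1 := by
      by_contra hc; simp [show s₃.reg .res = 0 by omega] at hv
    have hgood : ∀ j, 1 ≤ j → j ≤ m → f j < s₃.reg .i → ¬ Bad j := by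
      rcases hres with h | h
      · omega
      · exact h.2
    clear hres hv
    obtain ⟨i, hi⟩ : ∃ i, s₃.reg .i = i := ⟨_, rfl⟩
    rw [hi] at hi1 hi2 hiσ hgood
    have ha : ∀ a, s₃.arr a = s.arr a := fun a => hag₃.arr a rfl
    refine Runs.seq ?_
    refine (Runs.straight (by omega) (c := .assign .p (.get .head (.reg .i)))
      (Q := fun s' => s' = s₃.setReg .p (s.arr .head i)) (by simp [hi, ha])).mono ?_
    rintro t₄ s₄ - hag₄ ⟨ht₄, rfl⟩
    refine Runs.seq ?_
    -- The potential pays for the remaining entries of the bucket `i`. A negative answer, which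
    -- ends the scan without advancing in the list, is paid for by the term with `res`.
    refine (Runs.loop (by omega)
      (fun s' => (s'.reg .res = 0 ∧ ∃ j, 1 ≤ j ∧ j ≤ m ∧ Bad j) ∨
        (s'.reg .res = 1 ∧ ((s'.reg .p = 0 ∧ ∀ j, 1 ≤ j → j ≤ m → f j ≠ i) ∨
          (1 ≤ s'.reg .p ∧ s'.reg .p ≤ m ∧ f (s'.reg .p) = i ∧
            ∀ j, 1 ≤ j → j < s'.reg .p → f j = i → ¬ Bad j))))
      (fun s' => 30 * s'.reg .res +
        30 * ((Finset.Icc 1 m).filter (fun j => f j = i ∧ s'.reg .p < j)).card) ?_ ?_).mono ?_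
    · right
      refine ⟨by simp [hr1], ?_⟩
      simp only [Store.setReg_reg, if_true]
      rcases hhead i hi1 hiσ with h | h
      · exact .inl ⟨h.1, fun j h1 h2 => h.2 j h1 (by omega)⟩
      · exact .inr ⟨by omega, by omega, h.2.2.1, fun j h1 h2 h3 => absurd h3 (h.2.2.2 j h1 h2)⟩
    · rintro s₅ hf₅ hag₅ hI₅
      have ha₅ : ∀ a, s₅.arr a = s.arr a := fun a => (hag₅.arr a rfl).trans (ha a)
      have hres1 : s₅.reg .res ≤ 1 := by rcases hI₅ with h | h <;> omega
      refine ⟨?_, fun hv => ?_⟩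
      · simp only [Expr.Safe, Op.Safe, Expr.val, Op.apply, true_and]
        have := hf₅.2 .next (s₅.reg .p)
        interval_cases s₅.reg .res <;> omega
      simp only [Expr.val, Op.apply, ha₅] at hv
      have hr1 : s₅.reg .res = 1 := by
        by_contra hc; simp [show s₅.reg .res = 0 by omega] at hv
      have hnx : s.arr .next (s₅.reg .p) ≠ 0 := by
        intro hc; simp [hc] at hv
      obtain ⟨p, hp⟩ : ∃ p, s₅.reg .p = p := ⟨_, rfl⟩
      rw [hp] at hI₅ hnx hv
      have hI : 1 ≤ p ∧ p ≤ m ∧ f p = i ∧ ∀ j, 1 ≤ j → j < p → f j = i → ¬ Bad j := by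
        rcases hI₅ with h | ⟨-, h | h⟩
        · omega
        · rw [h.1] at hnx; exact absurd hnext0 hnx
        · exact h
      obtain ⟨hp1, hp2, hp3, hp4⟩ := hI
      obtain ⟨q, hq⟩ : ∃ q, s.arr .next p = q := ⟨_, rfl⟩
      have hqn : p < q ∧ q < m + 1 ∧ f q = i ∧ ∀ j, p < j → j < q → f j ≠ i := by
        rcases hnext p hp1 hp2 with h | h
        · exact absurd h.1 hnx
        · rwa [hq, hp3] at h
      refine (Runs.straight (by omega) (Q := fun s' =>
        (s.arr .PSV (s.arr .val q) < s.arr .NSV (s.arr .val p) ∧ s'.reg .res = 0 ∧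
          s'.reg .p = p) ∨
        (¬ s.arr .PSV (s.arr .val q) < s.arr .NSV (s.arr .val p) ∧ s'.reg .res = 1 ∧
          s'.reg .p = q)) ?_).mono ?_
      · simp only [Com.wp, Expr.Safe, Expr.val, Op.Safe, Op.apply, Store.setReg_reg,
          Store.setReg_arr, if_true, reduceCtorEq, if_false, ha₅, hp, hq, true_and, hr1]
        split
        · next h => simp [h]; omega
        · next h => simp [h]
      · rintro t₆ s₆ - - ⟨ht₆, h⟩
        replace ht₆ := ht₆.trans (show _ ≤ 16 by decide)
        simp only [Expr.cost]
        rcases h with ⟨h1, h2, h3⟩ | ⟨h1, h2, h3⟩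
        · refine ⟨.inl ⟨h2, p, hp1, hp2, hnx, by rwa [hq]⟩, ?_⟩
          rw [h2, h3, hr1, hp]
          omega
        · refine ⟨.inr ⟨h2, .inr ⟨by omega, by omega, by rw [h3]; exact hqn.2.2.1, ?_⟩⟩, ?_⟩
          · intro j hj1 hj2 hj3
            rw [h3] at hj2
            rcases Nat.lt_trichotomy j p with h | h | h
            · exact hp4 j hj1 h hj3
            · rintro ⟨-, hb⟩
              rw [h, hq] at hb
              exact h1 hb
            · exact absurd hj3 (hqn.2.2.2 j h hj2)
          · rw [h2, h3, hr1, hp]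
            have hlt : ((Finset.Icc 1 m).filter (fun j => f j = i ∧ q < j)).card <
                ((Finset.Icc 1 m).filter (fun j => f j = i ∧ p < j)).card := by
              refine Finset.card_lt_card (Finset.ssubset_iff_of_subset ?_ |>.mpr ⟨q, ?_, ?_⟩)
              · intro j hj
                simp only [Finset.mem_filter] at hj ⊢
                exact ⟨hj.1, hj.2.1, by omega⟩
              · simp only [Finset.mem_filter, Finset.mem_Icc]
                exact ⟨by omega, hqn.2.2.1, hqn.1⟩
              · simp
            omega
    · rintro t₇ s₇ - hag₇ ⟨hI₇, hv₇, ht₇⟩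
      have ha₇ : ∀ a, s₇.arr a = s.arr a := fun a => (hag₇.arr a rfl).trans (ha a)
      have hi₇ : s₇.reg .i = i := (hag₇.reg .i rfl).trans (by simpa using hi)
      simp only [Expr.val, Op.apply, ha₇] at hv₇
      refine (Runs.straight (by omega) (c := .assign .i (.bin .add (.reg .i) (.lit 1)))
        (Q := fun s' => s' = s₇.setReg .i (i + 1)) (by simp [hi₇]; omega)).mono ?_
      rintro t₈ s₈ - - ⟨ht₈, rfl⟩
      simp only [Com.cost, Expr.cost, Store.setReg_reg, if_true, reduceCtorEq, if_false, hr1]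
        at ht₁ ht₂ ht₄ ht₇ ht₈ ⊢
      refine ⟨⟨by omega, by omega, ?_⟩, ?_⟩
      · rcases hI₇ with h | ⟨h1, h2⟩
        · exact .inl h
        · right
          refine ⟨h1, fun j hj1 hj2 hj3 => ?_⟩
          rcases Nat.lt_or_ge (f j) i with h3 | h3
          · exact hgood j hj1 hj2 h3
          have h4 : f j = i := by omega
          rcases h2 with h2 | ⟨h5, h6, h7, h8⟩
          · exact absurd h4 (h2.2 j hj1 hj2)
          rw [h1, one_mul] at hv₇
          rcases hnext _ h5 h6 with h9 | h9
          · rcases Nat.lt_trichotomy j (s₇.reg .p) with h | h | h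
            · exact h8 j hj1 h h4
            · rintro ⟨hb, -⟩
              rw [h] at hb
              exact hb hv₇
            · exact absurd (h4.trans h7.symm) (h9.2 j h (by omega))
          · omega
      · have hsplit : ((Finset.Icc 1 m).filter (fun j => i ≤ f j)).card =
            ((Finset.Icc 1 m).filter (fun j => f j = i)).card +
            ((Finset.Icc 1 m).filter (fun j => i + 1 ≤ f j)).card := by
          rw [← Finset.card_union_of_disjoint]
          · congr 1
            ext j
            simp only [Finset.mem_filter, Finset.mem_union]
            constructor
            · rintro ⟨h1, h2⟩
              rcases h2.eq_or_lt with h | h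
              · exact .inl ⟨h1, h.symm⟩
              · exact .inr ⟨h1, h⟩
            · rintro (⟨h1, h2⟩ | ⟨h1, h2⟩) <;> exact ⟨h1, by omega⟩
          · rw [Finset.disjoint_left]
            intro j hj hj'
            simp only [Finset.mem_filter] at hj hj'
            omega
        have hle : ((Finset.Icc 1 m).filter (fun j => f j = i ∧ s.arr .head i < j)).card ≤
            ((Finset.Icc 1 m).filter (fun j => f j = i)).card :=
          Finset.card_le_card (Finset.monotone_filter_right _ fun j _ hj => hj.1)
        rw [hi]
        omega
  · rintro t₉ s₉ - hag₉ ⟨⟨h1, h2, h3⟩, hv, ht⟩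
    have hσ₉ : s₉.reg .sigma = σ := (hag₉.reg .sigma rfl).trans hrσ
    simp only [Expr.val, Op.apply, hσ₉] at hv
    simp only [Com.cost, Expr.cost, Store.setReg_reg, if_true] at ht₁ ht₂ ht
    have hcard : ((Finset.Icc 1 m).filter (fun j => 1 ≤ f j)).card ≤ m :=
      (Finset.card_filter_le _ _).trans (by simp)
    refine ⟨by omega, by rcases h3 with h | h <;> omega, ?_⟩
    rcases h3 with ⟨h3, h4⟩ | ⟨h3, h4⟩
    · exact iff_of_true h3 h4
    · refine iff_of_false (by omega) ?_
      rintro ⟨j, hj1, hj2, hb⟩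
      refine h4 j hj1 hj2 ?_ hb
      have := hfσ j hj1 hj2
      by_contra hc
      rw [h3, if_pos (by omega)] at hv
      omega

/-! ### The test on prepared arrays -/

/-- The alphabet is effective, so it has at most `n` characters. -/
theorem IsText.sigma_le {n σ : ℕ} {T : ℕ → ℕ} (hT : IsText n σ T) : σ ≤ n := by
  have h : Finset.Icc 1 σ ⊆ (Finset.Icc 1 n).image T := by
    intro c hc
    obtain ⟨i, hi, rfl⟩ := hT.effective c hc
    exact Finset.mem_image_of_mem _ hi
  have := (Finset.card_le_card h).trans Finset.card_image_le
  simpa using this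

theorem nodup_length_le {n : ℕ} {L : List ℕ} (hL : L.Nodup) (hmem : ∀ x ∈ L, x ∈ Finset.Icc 1 n) :
    L.length ≤ n := by
  rw [← List.toFinset_card_of_nodup hL]
  have : L.toFinset ⊆ Finset.Icc 1 n := fun x hx => hmem x (List.mem_toFinset.mp hx)
  simpa using Finset.card_le_card this

theorem getD_mem_iff {L : List ℕ} {x : ℕ} :
    x ∈ L ↔ ∃ i ∈ Finset.Icc 1 L.length, L.getD (i - 1) 0 = x := by
  rw [List.mem_iff_getElem]
  constructor
  · rintro ⟨i, hi, rfl⟩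
    exact ⟨i + 1, by simp; omega, by simp [hi]⟩
  · rintro ⟨i, hi, rfl⟩
    rw [Finset.mem_Icc] at hi
    exact ⟨i - 1, by omega, by rw [List.getD_eq_getElem _ _ (by omega)]⟩

/-- Once the arrays have been prepared, the remaining program decides in linear time whether two
consecutive boxes overlap. -/
theorem test_runs {N n σ : ℕ} {T : ℕ → ℕ} {L : List ℕ} {s : Store} (hT : IsText n σ T)
    (hN : 2 * n + 10 < N) (hL : L.Nodup) (hmem : ∀ x ∈ L, x ∈ Finset.Icc 1 n)
    (hs : Prepared n σ T L s) :
    Runs N (.seq computeA (.seq sortA (.seq fillBuckets scanBuckets))) s fun t s' =>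
      t ≤ 450 * n + 450 ∧ (s'.reg .res = 0 ∨ s'.reg .res = 1) ∧
        (s'.reg .res = 0 ↔ ConsecutiveOverlap n σ T L.toFinset) := by
  have hn := hT.two_le
  have hσ := hT.sigma_le
  have hm := nodup_length_le hL hmem
  have hSub : L.toFinset ⊆ Finset.Icc 1 n := fun x hx => hmem x (List.mem_toFinset.mp hx)
  have hx : ∀ i ∈ Finset.Icc 1 L.length, L.getD (i - 1) 0 ∈ Finset.Icc 1 n :=
    fun i hi => hmem _ (getD_mem_iff.mpr ⟨i, hi, rfl⟩)
  have hbwt : ∀ x ∈ Finset.Icc 1 n, ISA n (rev n T) ((n + 1 - x) % n + 1) = bwt n T x := by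
    intro x hx
    rw [Finset.mem_Icc] at hx
    rw [bwt]
    congr 1
    split
    · next h => rw [h]; simp
    · rw [Nat.mod_eq_of_lt (by omega)]; omega
  refine Runs.seq ((computeA_runs hn hN hm hs.reg_n hs.reg_m).mono ?_)
  rintro t₁ s₁ - hag₁ ⟨ht₁, hA⟩
  have hA' : ∀ i ∈ Finset.Icc 1 L.length, s₁.arr .A i = bwt n T (L.getD (i - 1) 0) := by
    intro i hi
    rw [hA i hi, hs.arr_S i hi, hs.isa, hbwt _ (hx i hi)]
    have := Nat.mod_lt (n + 1 - L.getD (i - 1) 0) (by omega : 0 < n)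
    rw [Finset.mem_Icc]; omega
  clear hA
  refine Runs.seq ((sortA_runs hn hN hm ((hag₁.reg .n rfl).trans hs.reg_n)
    ((hag₁.reg .m rfl).trans hs.reg_m)
    (fun i hi => by rw [hA' i hi]; exact bwt_mem (hx i hi))).mono ?_)
  rintro t₂ s₂ - hag₂ ⟨ht₂, hc, hB1, hB2, hB3⟩
  obtain ⟨m, hm'⟩ : ∃ m, s₂.reg .cnt = m := ⟨_, rfl⟩
  rw [hm'] at hc hB1 hB2 hB3
  have hBimg : ∀ i, i ∈ L.toFinset.image (bwt n T) ↔ ∃ j, 1 ≤ j ∧ j ≤ m ∧ s₂.arr .B j = i := by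
    intro i
    rw [Finset.mem_image]
    constructor
    · rintro ⟨x, hx, rfl⟩
      obtain ⟨i, hi, rfl⟩ := getD_mem_iff.mp (List.mem_toFinset.mp hx)
      obtain ⟨j, hj, hji⟩ := hB2 i hi
      rw [Finset.mem_Icc] at hj
      exact ⟨j, hj.1, hj.2, by rw [hji, hA' i hi]⟩
    · rintro ⟨j, hj1, hj2, rfl⟩
      obtain ⟨i, hi, hji⟩ := hB1 j (by simp; omega)
      exact ⟨_, List.mem_toFinset.mpr (getD_mem_iff.mpr ⟨i, hi, rfl⟩), by rw [hji, hA' i hi]⟩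
  have hBmem : ∀ j, 1 ≤ j → j ≤ m → s₂.arr .B j ∈ Finset.Icc 1 n := by
    intro j h1 h2
    obtain ⟨i, hi, hji⟩ := hB1 j (by simp; omega)
    rw [hji, hA' i hi]
    exact bwt_mem (hx i hi)
  have hBlt : ∀ j j', 1 ≤ j → j ≤ m → 1 ≤ j' → j' ≤ m →
      (s₂.arr .B j < s₂.arr .B j' ↔ j < j') := by
    intro j j' h1 h2 h3 h4
    rcases Nat.lt_trichotomy j j' with h | h | h
    · exact iff_of_true (hB3 j j' h1 h h4) h
    · subst h; simp
    · have := hB3 j' j h3 h h2; omega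
  have ha₂ : ∀ a, computeA.writesArr a = false → sortA.writesArr a = false →
      s₂.arr a = s.arr a := fun a h1 h2 => (hag₂.arr a h2).trans (hag₁.arr a h1)
  have hW₂ : ∀ j, 1 ≤ j → j ≤ m → s₂.arr .BWT (s₂.arr .B j) = BWTr n T (s₂.arr .B j) := by
    intro j h1 h2
    rw [ha₂ .BWT rfl rfl, hs.bwt _ (hBmem j h1 h2)]
  have hfσ : ∀ j, 1 ≤ j → j ≤ m →
      1 ≤ s₂.arr .BWT (s₂.arr .B j) ∧ s₂.arr .BWT (s₂.arr .B j) ≤ σ := by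
    intro j h1 h2
    rw [hW₂ j h1 h2]
    obtain ⟨x, hx, hxj⟩ := exists_bwt_eq (T := T) (hBmem j h1 h2)
    rw [← hxj, BWTr_bwt hx]
    exact Finset.mem_Icc.mp (hT.mem_alphabet x hx)
  refine Runs.seq ((fillBuckets_runs hN hc hσ
    ((hag₂.reg .sigma rfl).trans ((hag₁.reg .sigma rfl).trans hs.reg_sigma)) hm'
    (f := fun j => s₂.arr .BWT (s₂.arr .B j)) (fun _ => rfl) hfσ).mono ?_)
  rintro t₃ s₃ - hag₃ ⟨ht₃, hn0, hval, hhead, hnext⟩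
  refine (scanBuckets_runs hN hc hσ ((hag₃.reg .sigma rfl).trans
    ((hag₂.reg .sigma rfl).trans ((hag₁.reg .sigma rfl).trans hs.reg_sigma))) hn0 hhead hnext
    hfσ).mono ?_
  rintro t₄ s₄ - - ⟨ht₄, hres, hiff⟩
  refine ⟨by omega, hres, ?_⟩
  rw [hiff, hT.consecutiveOverlap_iff_lt hSub]
  have hSL : ∀ j, 1 ≤ j → j ≤ m → s₃.arr .val j = SLPR n T (s₂.arr .B j) ∧
      s₃.arr .val j ∈ Finset.Icc 1 n := by
    intro j h1 h2
    rw [hval j h1 h2, ha₂ .SLPR rfl rfl, hs.slpr _ (hBmem j h1 h2)]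
    have := hT.slprSpec (hBmem j h1 h2)
    exact ⟨rfl, by simp; exact ⟨by have := this.two_le; omega, this.le⟩⟩
  have hPSV : ∀ j, 1 ≤ j → j ≤ m →
      s₃.arr .PSV (s₃.arr .val j) = PSV (LCPr n T) (SLPR n T (s₂.arr .B j)) := by
    intro j h1 h2
    have := hSL j h1 h2
    rw [hag₃.arr .PSV rfl, ha₂ .PSV rfl rfl, hs.psv _ this.2, this.1]
  have hNSV : ∀ j, 1 ≤ j → j ≤ m →
      s₃.arr .NSV (s₃.arr .val j) = NSV n (LCPr n T) (SLPR n T (s₂.arr .B j)) := by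
    intro j h1 h2
    have := hSL j h1 h2
    rw [hag₃.arr .NSV rfl, ha₂ .NSV rfl rfl, hs.nsv _ this.2, this.1]
  constructor
  · rintro ⟨j, hj1, hj2, hne, hlt⟩
    rcases hnext j hj1 hj2 with h | ⟨h1, h2, h3, h4⟩
    · exact absurd h.1 hne
    · generalize s₃.arr .next j = q at *
      rw [hPSV q (by omega) (by omega), hNSV j hj1 hj2] at hlt
      refine ⟨_, _, ⟨(hBimg _).mpr ⟨j, hj1, hj2, rfl⟩, (hBimg _).mpr ⟨q, by omega, by omega, rfl⟩,
        hB3 j q hj1 h1 (by omega), ?_, fun h hh hjh hhq => ?_⟩, hlt⟩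
      · rw [← hW₂ j hj1 hj2, ← hW₂ q (by omega) (by omega)]
        exact h3.symm
      · obtain ⟨k, hk1, hk2, rfl⟩ := (hBimg _).mp hh
        rw [hBlt _ _ (by omega) (by omega) (by omega) (by omega)] at hjh hhq
        rw [← hW₂ j hj1 hj2, ← hW₂ k (by omega) (by omega)]
        exact h4 k hjh hhq
  · rintro ⟨i, i', ⟨hi, hi', hii, heq, hno⟩, hlt⟩
    obtain ⟨j, hj1, hj2, rfl⟩ := (hBimg _).mp hi
    obtain ⟨q, hq1, hq2, rfl⟩ := (hBimg _).mp hi'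
    rw [hBlt _ _ (by omega) (by omega) (by omega) (by omega)] at hii
    rw [← hW₂ j hj1 hj2, ← hW₂ q hq1 hq2] at heq
    have hq : s₃.arr .next j = q := by
      rcases hnext j hj1 hj2 with ⟨h1, h2⟩ | ⟨h1, h2, h3, h4⟩
      · exact absurd heq.symm (h2 q hii (by omega))
      · rcases Nat.lt_trichotomy (s₃.arr .next j) q with h | h | h
        · have h5 := hno _ ((hBimg _).mpr ⟨s₃.arr .next j, by omega, by omega, rfl⟩)
            (hB3 _ _ hj1 h1 (by omega)) (hB3 _ _ (by omega) h hq2)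
          rw [← hW₂ j hj1 hj2, ← hW₂ _ (by omega) (by omega)] at h5
          exact absurd h3 h5
        · exact h
        · exact absurd heq.symm (h4 q hii h)
    refine ⟨j, hj1, hj2, by omega, ?_⟩
    rw [hq, hPSV q hq1 hq2, hNSV j hj1 hj2]
    exact hlt

/-! ### Stable counting sort -/

section Position

variable (m : ℕ) (κ : ℕ → ℕ)

/-- The position of the `i`-th of `m` items after they have been sorted stably by their keys. -/
def sortPos (i : ℕ) : ℕ :=
  ((Finset.Icc 1 m).filter (fun j => κ j < κ i ∨ (κ j = κ i ∧ j ≤ i))).card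

variable {m κ}

theorem sortPos_lt {i j : ℕ} (hj : j ∈ Finset.Icc 1 m) (h : κ i < κ j ∨ (κ i = κ j ∧ i < j)) :
    sortPos m κ i < sortPos m κ j := by
  refine Finset.card_lt_card (Finset.ssubset_iff_of_subset ?_ |>.mpr ⟨j, ?_, ?_⟩)
  · intro l hl
    simp only [Finset.mem_filter] at hl ⊢
    exact ⟨hl.1, by omega⟩
  · simpa using hj
  · simp only [Finset.mem_filter, not_and]
    intro; omega

theorem sortPos_lt_iff {i j : ℕ} (hi : i ∈ Finset.Icc 1 m) (hj : j ∈ Finset.Icc 1 m) :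
    sortPos m κ i < sortPos m κ j ↔ κ i < κ j ∨ (κ i = κ j ∧ i < j) := by
  refine ⟨fun h => ?_, sortPos_lt hj⟩
  by_contra hc
  by_cases hij : i = j
  · subst hij; omega
  · have := sortPos_lt hi (κ := κ) (i := j) (by omega)
    omega

theorem sortPos_mem {i : ℕ} (hi : i ∈ Finset.Icc 1 m) : sortPos m κ i ∈ Finset.Icc 1 m := by
  rw [Finset.mem_Icc]
  constructor
  · exact Finset.card_pos.mpr ⟨i, by simpa using hi⟩
  · exact (Finset.card_filter_le _ _).trans (by simp)

theorem sortPos_injOn : Set.InjOn (sortPos m κ) (Finset.Icc 1 m) := by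
  intro i hi j hj h
  by_contra hc
  rcases Nat.lt_trichotomy (κ i) (κ j) with h1 | h1 | h1
  · have := sortPos_lt hj (κ := κ) (i := i) (.inl h1); omega
  · rcases Nat.lt_or_gt_of_ne hc with h2 | h2
    · have := sortPos_lt hj (κ := κ) (i := i) (.inr ⟨h1, h2⟩); omega
    · have := sortPos_lt hi (κ := κ) (i := j) (.inr ⟨h1.symm, h2⟩); omega
  · have := sortPos_lt hi (κ := κ) (i := j) (.inl h1); omega

theorem exists_sortPos_eq {t : ℕ} (ht : t ∈ Finset.Icc 1 m) :
    ∃ i ∈ Finset.Icc 1 m, sortPos m κ i = t := by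
  have := Finset.surj_on_of_inj_on_of_card_le (s := Finset.Icc 1 m) (t := Finset.Icc 1 m)
    (fun i _ => sortPos m κ i) (fun i hi => sortPos_mem hi)
    (fun i j hi hj h => sortPos_injOn hi hj h) le_rfl t ht
  obtain ⟨i, hi, h⟩ := this
  exact ⟨i, hi, h.symm⟩

theorem card_lt_succ (v : ℕ) :
    ((Finset.Icc 1 m).filter (fun j => κ j < v + 1)).card =
      ((Finset.Icc 1 m).filter (fun j => κ j < v)).card +
      ((Finset.Icc 1 m).filter (fun j => κ j = v)).card := by
  rw [← Finset.card_union_of_disjoint]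
  · congr 1
    ext j
    simp only [Finset.mem_filter, Finset.mem_union, ← and_or_left]
    refine and_congr_right fun _ => by omega
  · rw [Finset.disjoint_left]
    intro j hj hj'
    simp only [Finset.mem_filter] at hj hj'
    omega

theorem card_eq_Icc_succ (k v : ℕ) :
    ((Finset.Icc 1 (k + 1)).filter (fun j => κ j = v)).card =
      ((Finset.Icc 1 k).filter (fun j => κ j = v)).card + if κ (k + 1) = v then 1 else 0 := by
  rw [← Finset.insert_Icc_right_eq_Icc_add_one (by omega), Finset.filter_insert]
  split
  · rw [Finset.card_insert_of_notMem (by simp)]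
  · rfl

/-- The place of an item, as the program computes it: behind all items with a smaller key and those
items before it that have the same key. -/
theorem sortPos_eq {i : ℕ} (hi : i ∈ Finset.Icc 1 m) :
    sortPos m κ i = ((Finset.Icc 1 m).filter (fun j => κ j < κ i)).card +
      ((Finset.Icc 1 (i - 1)).filter (fun j => κ j = κ i)).card + 1 := by
  rw [Finset.mem_Icc] at hi
  have h1 : ((Finset.Icc 1 (i - 1)).filter (fun j => κ j = κ i)).card + 1 =
      ((Finset.Icc 1 i).filter (fun j => κ j = κ i)).card := by
    have := card_eq_Icc_succ (κ := κ) (i - 1) (κ i)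
    rw [Nat.sub_add_cancel hi.1] at this
    simpa using this.symm
  rw [add_assoc, h1, sortPos, ← Finset.card_union_of_disjoint]
  · congr 1
    ext j
    simp only [Finset.mem_filter, Finset.mem_union, Finset.mem_Icc]
    omega
  · rw [Finset.disjoint_left]
    intro j hj hj'
    simp only [Finset.mem_filter] at hj hj'
    omega

end Position

/-! ### Registers and arrays of the suffix sorting program -/

/-- A loop counter. -/
abbrev rI : Reg := .aux 0
/-- The number of items that are sorted. -/
abbrev rM : Reg := .aux 1
/-- An upper bound for the keys. -/
abbrev rK : Reg := .aux 2
/-- The offset from an item to the place of its key. -/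
abbrev rD : Reg := .aux 3
/-- A temporary value. -/
abbrev rT : Reg := .aux 4
/-- A second temporary value, or a running count. -/
abbrev rU : Reg := .aux 5

/-- The items that are sorted. -/
abbrev aX : Arr := .aux 0
/-- The items in sorted order. -/
abbrev aY : Arr := .aux 1
/-- The counters of the sort. -/
abbrev aCnt : Arr := .aux 2

/-- Sorts the items `x = aX[1], …, aX[rM]` stably by the keys `a[x + rD]`, which are numbers in
`[0, rK]`. -/
def sortBy (a : Arr) : Com :=
  .seq (forUp rI (.lit 0) (.reg rK) (.put aCnt (.reg rI) (.lit 0)))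
  (.seq (forUp rI (.lit 1) (.reg rM)
    (.seq (.assign rT (.get a (.bin .add (.get aX (.reg rI)) (.reg rD))))
      (.put aCnt (.reg rT) (.bin .add (.get aCnt (.reg rT)) (.lit 1)))))
  (.seq (.assign rU (.lit 1))
  (.seq (forUp rI (.lit 0) (.reg rK)
    (.seq (.assign rT (.get aCnt (.reg rI)))
    (.seq (.put aCnt (.reg rI) (.reg rU))
      (.assign rU (.bin .add (.reg rU) (.reg rT))))))
  (.seq (forUp rI (.lit 1) (.reg rM)
    (.seq (.assign rT (.get a (.bin .add (.get aX (.reg rI)) (.reg rD))))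
    (.seq (.put aY (.get aCnt (.reg rT)) (.get aX (.reg rI)))
      (.put aCnt (.reg rT) (.bin .add (.get aCnt (.reg rT)) (.lit 1))))))
  (forUp rI (.lit 1) (.reg rM) (.put aX (.reg rI) (.get aY (.reg rI))))))))

/-- `Y[1, m]` results from `X[1, m]` by a stable sort with respect to `key`: it has the same
entries, and a relation that holds between any two entries of `X` from left to right still holds
between entries of `Y` with the same key. -/
structure StablySorted (m : ℕ) (key : ℕ → ℕ) (X Y : ℕ → ℕ) : Prop where
  mem : ∀ t, 1 ≤ t → t ≤ m → ∃ i, 1 ≤ i ∧ i ≤ m ∧ Y t = X i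
  surj : ∀ i, 1 ≤ i → i ≤ m → ∃ t, 1 ≤ t ∧ t ≤ m ∧ Y t = X i
  sorted : ∀ R : ℕ → ℕ → Prop, (∀ i j, 1 ≤ i → i < j → j ≤ m → R (X i) (X j)) →
    ∀ t t', 1 ≤ t → t < t' → t' ≤ m →
      key (Y t) < key (Y t') ∨ (key (Y t) = key (Y t') ∧ R (Y t) (Y t'))

theorem stablySorted_of_sortPos {m : ℕ} {key X Y : ℕ → ℕ}
    (h : ∀ i, 1 ≤ i → i ≤ m → Y (sortPos m (fun j => key (X j)) i) = X i) :
    StablySorted m key X Y := by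
  refine ⟨fun t h1 h2 => ?_, fun i h1 h2 => ?_, fun R hR t t' h1 h2 h3 => ?_⟩
  · obtain ⟨i, hi, rfl⟩ := exists_sortPos_eq (κ := fun j => key (X j))
      (show t ∈ Finset.Icc 1 m by simp; omega)
    rw [Finset.mem_Icc] at hi
    exact ⟨i, hi.1, hi.2, h i hi.1 hi.2⟩
  · have := sortPos_mem (κ := fun j => key (X j)) (show i ∈ Finset.Icc 1 m by simp; omega)
    rw [Finset.mem_Icc] at this
    exact ⟨_, this.1, this.2, h i h1 h2⟩
  · obtain ⟨i, hi, rfl⟩ := exists_sortPos_eq (κ := fun j => key (X j))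
      (show t ∈ Finset.Icc 1 m by simp; omega)
    obtain ⟨j, hj, rfl⟩ := exists_sortPos_eq (κ := fun j => key (X j))
      (show t' ∈ Finset.Icc 1 m by simp; omega)
    rw [sortPos_lt_iff hi hj] at h2
    rw [Finset.mem_Icc] at hi hj
    rw [h i hi.1 hi.2, h j hj.1 hj.2]
    rcases h2 with h2 | h2
    · exact .inl h2
    · exact .inr ⟨h2.1, hR i j hi.1 h2.2 hj.2⟩

theorem sortBy_runs {N m K D : ℕ} {s : Store} {a : Arr} (ha1 : a ≠ aY)
    (ha2 : a ≠ aCnt) (hN : 10 < N) (hmN : m + 2 < N) (hKN : K + 1 < N)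
    (hm : s.reg rM = m) (hK : s.reg rK = K) (hD : s.reg rD = D)
    (hX : ∀ i, 1 ≤ i → i ≤ m → s.arr aX i + D < N)
    (hkey : ∀ i, 1 ≤ i → i ≤ m → s.arr a (s.arr aX i + D) ≤ K) :
    Runs N (sortBy a) s fun t s' => t ≤ 100 * (m + K + 1) ∧
      StablySorted m (fun x => s.arr a (x + D)) (s.arr aX) (s'.arr aX) := by
  set κ : ℕ → ℕ := fun i => s.arr a (s.arr aX i + D) with hκ
  refine Runs.seq ?_
  refine (Runs.forUp (by omega) (L := 0) (b := 3) (fun k s' => ∀ v, v < k →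
    s'.arr aCnt v = 0) rfl rfl (by decide) (by omega) (by omega) (by omega)
    (fun v hv => by omega) ?_).mono ?_
  · intro k s' hk1 hk2 hf hag hk hI
    refine (Runs.straight (by omega) (Q := fun s'' => ∀ v, v < k + 1 →
      s''.arr aCnt v = 0) ?_).mono ?_
    · simp only [Com.wp, Expr.Safe, Expr.val, hk, true_and, Store.setArr_arr, if_true,
        Function.update_apply]
      refine ⟨by omega, fun v hv => ?_⟩
      split
      · rfl
      · exact hI v (by omega)
    · rintro t s'' - - ⟨ht, h⟩
      exact ⟨ht, h⟩
  rintro t₁ s₁ - hag₁ ⟨ht₁, -, hI₁⟩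
  rw [hK] at hI₁ ht₁
  have hm₁ : s₁.reg rM = m := (hag₁.reg rM rfl).trans hm
  refine Runs.seq ?_
  refine (Runs.forUp (by omega) (L := 1) (b := 12) (fun k s' => ∀ v, v ≤ K →
    s'.arr aCnt v = ((Finset.Icc 1 (k - 1)).filter (fun j => κ j = v)).card)
    rfl rfl (by decide) (by omega) (by omega) (by omega) ?_ ?_).mono ?_
  · intro v hv
    simpa using hI₁ v (by omega)
  · intro k s' hk1 hk2 hf hag hk hI
    rw [hm₁] at hk2
    have h1 : s'.reg rD = D := (hag.reg rD rfl).trans ((hag₁.reg rD rfl).trans hD)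
    have h2 : s'.arr a = s.arr a := (hag.arr a (by simp [Com.writesArr, ha2])).trans
      (hag₁.arr a (by simp [forUp, Com.writesArr, ha2]))
    have h3 : s'.arr aX = s.arr aX := (hag.arr aX rfl).trans (hag₁.arr aX rfl)
    have h4 := hX k hk1 hk2
    have h5 : κ k ≤ K := hkey k hk1 hk2
    have h6 : s'.arr aCnt (κ k) ≤ m := by
      rw [hI _ h5]
      exact (Finset.card_filter_le _ _).trans (by simp; omega)
    refine (Runs.straight (by omega) (Q := fun s'' => ∀ v, v ≤ K →
      s''.arr aCnt v = ((Finset.Icc 1 k).filter (fun j => κ j = v)).card) ?_).mono ?_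
    · simp only [Com.wp, Expr.Safe, Expr.val, Op.Safe, Op.apply, hk, true_and, and_true, h1, h2, h3,
        Store.setReg_reg, Store.setReg_arr, Store.setArr_arr, if_true,
        Function.update_apply, reduceCtorEq, if_false, Reg.aux.injEq, Nat.reduceEqDiff]
      have h7 : s.arr a (s.arr aX k + D) = κ k := rfl
      rw [h7]
      refine ⟨h4, ⟨by omega, by omega⟩, fun v hv => ?_⟩
      have h8 := card_eq_Icc_succ (κ := κ) (k - 1) v
      rw [Nat.sub_add_cancel hk1] at h8
      rw [h8, hI _ h5, hI _ hv]
      split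
      · next h => subst h; simp
      · next h => rw [if_neg (Ne.symm h)]; rfl
    · rintro t s'' - - ⟨ht, h⟩
      exact ⟨ht.trans (show _ ≤ 12 from (by simp only [Com.cost, Expr.cost]; omega)), h⟩
  rintro t₂ s₂ - hag₂ ⟨ht₂, -, hI₂⟩
  rw [hm₁] at ht₂ hI₂
  simp only [Nat.add_sub_cancel] at hI₂ ht₂
  have hK₂ : s₂.reg rK = K := (hag₂.reg rK rfl).trans ((hag₁.reg rK rfl).trans hK)
  refine Runs.seq ?_
  refine (Runs.straight (by omega) (c := .assign rU (.lit 1))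
    (Q := fun s' => s' = s₂.setReg rU 1) (by simp; omega)).mono ?_
  rintro t₃ s₃ - hag₃ ⟨ht₃, rfl⟩
  refine Runs.seq ?_
  refine (Runs.forUp (by omega) (L := 0) (b := 10) (fun k s' =>
    s'.reg rU = ((Finset.Icc 1 m).filter (fun j => κ j < k)).card + 1 ∧
    (∀ v, v < k → s'.arr aCnt v = ((Finset.Icc 1 m).filter (fun j => κ j < v)).card + 1) ∧
    (∀ v, k ≤ v → v ≤ K → s'.arr aCnt v = ((Finset.Icc 1 m).filter (fun j => κ j = v)).card))
    rfl rfl (by decide) (by omega) (by omega) (by simp [hK₂]; omega) ?_ ?_).mono ?_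
  · exact ⟨by simp, fun v hv => by omega, fun v _ hv => hI₂ v hv⟩
  · rintro k s' hk1 hk2 hf hag hk ⟨hI1, hI2, hI3⟩
    have hk2' : k ≤ K := by simpa [hK₂] using hk2
    have h1 := card_lt_succ (m := m) (κ := κ) k
    have h2 : ((Finset.Icc 1 m).filter (fun j => κ j < k + 1)).card ≤ m :=
      (Finset.card_filter_le _ _).trans (by simp)
    have h3 := hI3 k le_rfl hk2'
    refine (Runs.straight (by omega) (Q := fun s'' =>
      s''.reg rU = ((Finset.Icc 1 m).filter (fun j => κ j < k + 1)).card + 1 ∧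
      (∀ v, v < k + 1 →
        s''.arr aCnt v = ((Finset.Icc 1 m).filter (fun j => κ j < v)).card + 1) ∧
      (∀ v, k + 1 ≤ v → v ≤ K →
        s''.arr aCnt v = ((Finset.Icc 1 m).filter (fun j => κ j = v)).card)) ?_).mono ?_
    · simp only [Com.wp, Expr.Safe, Expr.val, Op.Safe, Op.apply, hk, true_and, and_true,
        Store.setReg_reg, Store.setReg_arr, Store.setArr_arr, Store.setArr_reg, if_true,
        Function.update_apply, reduceCtorEq, if_false, Reg.aux.injEq, Nat.reduceEqDiff, hI1, h3]
      refine ⟨by omega, by omega, fun v hv => ?_, fun v hv1 hv2 => ?_⟩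
      · split
        · next h => rw [h]
        · exact hI2 v (by omega)
      · rw [if_neg (by omega)]
        exact hI3 v (by omega) hv2
    · rintro t s'' - - ⟨ht, h⟩
      exact ⟨ht.trans (by decide), by simpa using h⟩
  rintro t₄ s₄ - hag₄ ⟨ht₄, -, -, hI₄, -⟩
  simp only [Store.setReg_reg, hK₂, reduceCtorEq, if_false, Reg.aux.injEq,
    Nat.reduceEqDiff] at ht₄ hI₄
  have hm₄ : s₄.reg rM = m := (hag₄.reg rM rfl).trans (by simpa using (hag₂.reg rM rfl).trans hm₁)
  have hD₄ : s₄.reg rD = D := (hag₄.reg rD rfl).trans (by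
    simpa using (hag₂.reg rD rfl).trans ((hag₁.reg rD rfl).trans hD))
  have hX₄ : s₄.arr aX = s.arr aX := (hag₄.arr aX rfl).trans
    ((hag₂.arr aX rfl).trans (hag₁.arr aX rfl))
  have ha₄ : s₄.arr a = s.arr a := (hag₄.arr a (by simp [forUp, Com.writesArr, ha2])).trans
    ((hag₂.arr a (by simp [forUp, Com.writesArr, ha2])).trans
      (hag₁.arr a (by simp [forUp, Com.writesArr, ha2])))
  refine Runs.seq ?_
  refine (Runs.forUp (by omega) (L := 1) (b := 17) (fun k s' =>
    (∀ v, v ≤ K → s'.arr aCnt v = ((Finset.Icc 1 m).filter (fun j => κ j < v)).card +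
      ((Finset.Icc 1 (k - 1)).filter (fun j => κ j = v)).card + 1) ∧
    (∀ i, 1 ≤ i → i < k → s'.arr aY (sortPos m κ i) = s.arr aX i))
    rfl rfl (by decide) (by omega) (by omega) (by omega) ?_ ?_).mono ?_
  · refine ⟨fun v hv => ?_, fun i h1 h2 => by omega⟩
    simpa using hI₄ v (by omega)
  · rintro k s' hk1 hk2 hf hag hk ⟨hI1, hI2⟩
    rw [hm₄] at hk2
    have h1 : s'.reg rD = D := (hag.reg rD rfl).trans hD₄
    have h2 : s'.arr a = s.arr a := (hag.arr a (by simp [Com.writesArr, ha2, ha1])).trans ha₄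
    have h3 : s'.arr aX = s.arr aX := (hag.arr aX rfl).trans hX₄
    have h4 := hX k hk1 hk2
    have h5 : κ k ≤ K := hkey k hk1 hk2
    have hkm : k ∈ Finset.Icc 1 m := by simp; omega
    have h6 : s'.arr aCnt (κ k) = sortPos m κ k := by rw [hI1 _ h5, sortPos_eq hkm]
    have h7 := Finset.mem_Icc.mp (sortPos_mem (κ := κ) hkm)
    refine (Runs.straight (by omega) (Q := fun s'' =>
      (∀ v, v ≤ K → s''.arr aCnt v = ((Finset.Icc 1 m).filter (fun j => κ j < v)).card +
        ((Finset.Icc 1 k).filter (fun j => κ j = v)).card + 1) ∧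
      (∀ i, 1 ≤ i → i < k + 1 → s''.arr aY (sortPos m κ i) = s.arr aX i)) ?_).mono ?_
    · simp only [Com.wp, Expr.Safe, Expr.val, Op.Safe, Op.apply, hk, true_and, and_true, h1, h2, h3,
        Store.setReg_reg, Store.setReg_arr, Store.setArr_arr, Store.setArr_reg, if_true,
        Function.update_apply, reduceCtorEq, if_false, Reg.aux.injEq, Nat.reduceEqDiff,
          Arr.aux.injEq]
      have h8 : s.arr a (s.arr aX k + D) = κ k := rfl
      rw [h8, h6]
      refine ⟨h4, ⟨by omega, by omega⟩, fun v hv => ?_, fun i hi1 hi2 => ?_⟩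
      · have h8 := card_eq_Icc_succ (κ := κ) (k - 1) v
        rw [Nat.sub_add_cancel hk1] at h8
        rw [h8, ← h6, hI1 _ h5, hI1 _ hv]
        split
        · next h => subst h; simp; omega
        · next h => rw [if_neg (Ne.symm h)]; rfl
      · split
        · next h =>
          rw [sortPos_injOn (by simp; omega) (by simp; omega) h]
        · next h =>
          refine hI2 i hi1 ?_
          by_contra hc
          exact h (by rw [show i = k by omega])
    · rintro t s'' - - ⟨ht, h⟩
      exact ⟨ht.trans (show _ ≤ 17 from (by simp only [Com.cost, Expr.cost]; omega)), h⟩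
  rintro t₅ s₅ - hag₅ ⟨ht₅, -, -, hI₅⟩
  rw [hm₄] at ht₅ hI₅
  have hm₅ : s₅.reg rM = m := (hag₅.reg rM rfl).trans hm₄
  refine (Runs.forUp (by omega) (L := 1) (b := 4) (fun k s' => ∀ i, 1 ≤ i → i < k →
    s'.arr aX i = s₅.arr aY i) rfl rfl (by decide) (by omega) (by omega) (by omega)
    (fun i _ _ => by omega) ?_).mono ?_
  · intro k s' hk1 hk2 hf hag hk hI
    have h1 : s'.arr aY = s₅.arr aY := hag.arr aY rfl
    refine (Runs.straight (by omega) (Q := fun s'' => ∀ i, 1 ≤ i → i < k + 1 →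
      s''.arr aX i = s₅.arr aY i) ?_).mono ?_
    · simp only [Com.wp, Expr.Safe, Expr.val, hk, true_and, Store.setArr_arr, if_true,
        Function.update_apply, h1]
      intro i hi1 hi2
      split
      · next h => rw [h]
      · exact hI i hi1 (by omega)
    · rintro t s'' - - ⟨ht, h⟩
      exact ⟨ht, h⟩
  rintro t₆ s₆ - - ⟨ht₆, -, hI₆⟩
  rw [hm₅] at ht₆ hI₆
  simp only [Com.cost, Expr.cost] at ht₃
  refine ⟨by omega, stablySorted_of_sortPos fun i hi1 hi2 => ?_⟩
  have := Finset.mem_Icc.mp (sortPos_mem (κ := κ) (show i ∈ Finset.Icc 1 m by simp; omega))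
  change s₆.arr aX (sortPos m κ i) = s.arr aX i
  have h2 := hI₅ i hi1 (by omega)
  rw [← h2]
  exact hI₆ _ this.1 (by omega)

/-! ### Samples of the positions -/

theorem sub_div_step {n p h : ℕ} (hh : 0 < h) (hp : p + h ≤ n) :
    (n - p) / h = (n - (p + h)) / h + 1 := by
  rw [← Nat.add_div_right _ hh]
  congr 1; omega

theorem le_of_div_pos {n p h : ℕ} (hp : p ≤ n) (h0 : (n - p) / h ≠ 0) : p + h ≤ n := by
  by_contra hc
  exact h0 (Nat.div_eq_of_lt (by omega))

/-- The positions of the `j`-th level of the suffix sorting program. With `h = 3 ^ j`, a position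
`p` belongs to the next level unless the number of steps of length `h` from `p` to the end of the
string is divisible by three. -/
def sample (n : ℕ) : ℕ → Finset ℕ
  | 0 => Finset.Icc 1 n
  | j + 1 => (sample n j).filter (fun p => (n - p) / 3 ^ j % 3 ≠ 0)

theorem mem_sample_succ {n j p : ℕ} :
    p ∈ sample n (j + 1) ↔ p ∈ sample n j ∧ (n - p) / 3 ^ j % 3 ≠ 0 := Finset.mem_filter

theorem sample_subset (n j : ℕ) : sample n j ⊆ Finset.Icc 1 n := by
  induction j with
  | zero => exact subset_rfl
  | succ j ih => exact (Finset.filter_subset _ _).trans ih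

/-- A level is closed under steps of its step length, up to the end of the string. -/
theorem add_mem_sample {n j p : ℕ} (hp : p ∈ sample n j) (h : p + 3 ^ j ≤ n) :
    p + 3 ^ j ∈ sample n j := by
  induction j generalizing p with
  | zero =>
    have := Finset.mem_Icc.mp (sample_subset _ _ hp)
    simp only [sample, Finset.mem_Icc, pow_zero] at *
    omega
  | succ j ih =>
    have hpos : 0 < 3 ^ j := by positivity
    rw [pow_succ] at *
    rw [mem_sample_succ] at *
    have h1 := ih hp.1 (by omega)
    have h2 := ih h1 (by omega)
    have h3 := ih h2 (by omega)
    have e1 := sub_div_step (n := n) (p := p) hpos (by omega)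
    have e2 := sub_div_step (n := n) (p := p + 3 ^ j) hpos (by omega)
    have e3 := sub_div_step (n := n) (p := p + 3 ^ j + 3 ^ j) hpos (by omega)
    rw [show p + 3 ^ j * 3 = p + 3 ^ j + 3 ^ j + 3 ^ j by omega]
    exact ⟨h3, by omega⟩

/-- A level has at most two thirds of the positions of the level before: the step of length `h`
maps the positions whose number of steps is `1` modulo three injectively to dropped ones, and two
steps do so for those whose number of steps is `2` modulo three. -/
theorem card_sample_succ (n j : ℕ) : 3 * (sample n (j + 1)).card ≤ 2 * (sample n j).card := by
  have hpos : 0 < 3 ^ j := by positivity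
  set c : ℕ → Finset ℕ := fun r => (sample n j).filter (fun p => (n - p) / 3 ^ j % 3 = r) with hc
  have hmem : ∀ r p, p ∈ c r ↔ p ∈ sample n j ∧ (n - p) / 3 ^ j % 3 = r := by simp [hc]
  have h1 : (c 1).card ≤ (c 0).card := by
    refine Finset.card_le_card_of_injOn (fun p => p + 3 ^ j) (fun p hp => ?_)
      (fun p _ q _ h => by simpa using h)
    rw [Finset.mem_coe, hmem] at hp
    have hpn := Finset.mem_Icc.mp (sample_subset _ _ hp.1)
    have hle := le_of_div_pos hpn.2 (fun h0 => by rw [h0] at hp; omega)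
    have := sub_div_step hpos hle
    rw [Finset.mem_coe, hmem]
    exact ⟨add_mem_sample hp.1 hle, by dsimp only; omega⟩
  have h2 : (c 2).card ≤ (c 0).card := by
    refine Finset.card_le_card_of_injOn (fun p => p + 3 ^ j + 3 ^ j) (fun p hp => ?_)
      (fun p _ q _ h => by simpa using h)
    rw [Finset.mem_coe, hmem] at hp
    have hpn := Finset.mem_Icc.mp (sample_subset _ _ hp.1)
    have hle := le_of_div_pos hpn.2 (fun h0 => by rw [h0] at hp; omega)
    have e1 := sub_div_step hpos hle
    have hle' := le_of_div_pos hle (fun h0 => by rw [h0] at e1; omega)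
    have e2 := sub_div_step hpos hle'
    rw [Finset.mem_coe, hmem]
    exact ⟨add_mem_sample (add_mem_sample hp.1 hle) hle', by dsimp only; omega⟩
  have hs : sample n (j + 1) = c 1 ∪ c 2 := by
    ext p
    rw [mem_sample_succ, Finset.mem_union, hmem, hmem, ← and_or_left]
    exact and_congr_right fun _ => by omega
  have hs' : sample n j = c 0 ∪ sample n (j + 1) := by
    ext p
    rw [Finset.mem_union, mem_sample_succ, hmem, ← and_or_left]
    refine ⟨fun h => ⟨h, by omega⟩, fun h => h.1⟩
  have h3 : (sample n (j + 1)).card ≤ (c 1).card + (c 2).card := by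
    rw [hs]; exact Finset.card_union_le _ _
  have h4 : (sample n j).card = (c 0).card + (sample n (j + 1)).card := by
    conv_lhs => rw [hs']
    rw [Finset.card_union_of_disjoint]
    rw [Finset.disjoint_left]
    intro p hp hp'
    rw [hmem] at hp
    rw [mem_sample_succ] at hp'
    exact hp'.2 hp.2
  omega

/-- The positions of the level `j` are stored behind those of all levels before. -/
def sampleOffset (n j : ℕ) : ℕ := ∑ i ∈ Finset.range j, (sample n i).card

theorem sampleOffset_succ (n j : ℕ) :
    sampleOffset n (j + 1) = sampleOffset n j + (sample n j).card := Finset.sum_range_succ _ _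

theorem card_sample_zero (n : ℕ) : (sample n 0).card = n := by simp [sample]

/-- The levels together need at most `3 n` cells, since their sizes decrease geometrically. The
second summand makes the bound inductive. -/
theorem sampleOffset_le (n j : ℕ) : sampleOffset n j + 3 * (sample n j).card ≤ 3 * n := by
  induction j with
  | zero => simp [sampleOffset, card_sample_zero]
  | succ j ih =>
    have := card_sample_succ n j
    rw [sampleOffset_succ]
    omega

/-! ### Ranks of suffixes -/

/-- `l[1], …, l[m]` are the elements of `S` without repetition. -/
structure Enum (m : ℕ) (l : ℕ → ℕ) (S : Finset ℕ) : Prop where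
  mem : ∀ k, 1 ≤ k → k ≤ m → l k ∈ S
  surj : ∀ p ∈ S, ∃ k, 1 ≤ k ∧ k ≤ m ∧ l k = p
  inj : ∀ k k', 1 ≤ k → k < k' → k' ≤ m → l k ≠ l k'

theorem Enum.injOn {m : ℕ} {l : ℕ → ℕ} {S : Finset ℕ} (h : Enum m l S) :
    Set.InjOn l (Finset.Icc 1 m) := by
  intro k hk k' hk' heq
  simp at hk hk'
  by_contra hc
  rcases Nat.lt_or_gt_of_ne hc with h1 | h1
  · exact h.inj k k' hk.1 h1 hk'.2 heq
  · exact h.inj k' k hk'.1 h1 hk.2 heq.symm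

theorem Enum.card_eq {m : ℕ} {l : ℕ → ℕ} {S : Finset ℕ} (h : Enum m l S) : m = S.card := by
  have : S = (Finset.Icc 1 m).image l := by
    ext p
    rw [Finset.mem_image]
    constructor
    · intro hp
      obtain ⟨k, h1, h2, h3⟩ := h.surj p hp
      exact ⟨k, by simp; omega, h3⟩
    · rintro ⟨k, hk, rfl⟩
      rw [Finset.mem_Icc] at hk
      exact h.mem k hk.1 hk.2
  rw [this, Finset.card_image_of_injOn h.injOn]
  simp

theorem Enum.congr {m : ℕ} {l l' : ℕ → ℕ} {S : Finset ℕ} (h : Enum m l S)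
    (hl : ∀ k, 1 ≤ k → k ≤ m → l' k = l k) : Enum m l' S := by
  refine ⟨fun k h1 h2 => hl k h1 h2 ▸ h.mem k h1 h2, fun p hp => ?_, fun k k' h1 h2 h3 => ?_⟩
  · obtain ⟨k, h1, h2, h3⟩ := h.surj p hp
    exact ⟨k, h1, h2, by rw [hl k h1 h2, h3]⟩
  · rw [hl k h1 (by omega), hl k' (by omega) h3]
    exact h.inj k k' h1 h2 h3

theorem Enum.of_stablySorted {m : ℕ} {key X Y : ℕ → ℕ} {S : Finset ℕ} (h : Enum m X S)
    (hs : StablySorted m key X Y) : Enum m Y S := by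
  refine ⟨fun k h1 h2 => ?_, fun p hp => ?_, fun k k' h1 h2 h3 => ?_⟩
  · obtain ⟨i, h3, h4, h5⟩ := hs.mem k h1 h2
    rw [h5]
    exact h.mem i h3 h4
  · obtain ⟨i, h3, h4, rfl⟩ := h.surj p hp
    exact hs.surj i h3 h4
  · rcases hs.sorted (fun a b => a ≠ b) h.inj k k' h1 h2 h3 with h4 | h4
    · intro h5; rw [h5] at h4; omega
    · exact h4.2

/-- The rule for extending an enumeration while a list is filtered. -/
theorem Enum.filter_step {m x : ℕ} {l l' : ℕ → ℕ} {S : Finset ℕ} (h : Enum x l S) {p : ℕ}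
    (hp : p ∉ S) (hl : ∀ k, 1 ≤ k → k ≤ x → l' k = l k) (hx : l' (x + 1) = p) (hm : m = x + 1) :
    Enum m l' (insert p S) := by
  subst hm
  have h' := h.congr hl
  refine ⟨fun k h1 h2 => ?_, fun q hq => ?_, fun k k' h1 h2 h3 => ?_⟩
  · rcases Nat.lt_or_ge x k with h3 | h3
    · rw [show k = x + 1 by omega, hx]; exact Finset.mem_insert_self _ _
    · exact Finset.mem_insert_of_mem (h'.mem k h1 h3)
  · rcases Finset.mem_insert.mp hq with rfl | hq
    · exact ⟨x + 1, by omega, le_rfl, hx⟩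
    · obtain ⟨k, h1, h2, h3⟩ := h'.surj q hq
      exact ⟨k, h1, by omega, h3⟩
  · rcases Nat.lt_or_ge x k' with h4 | h4
    · rw [show k' = x + 1 by omega, hx]
      intro h5
      exact hp (h5 ▸ h'.mem k h1 (by omega))
    · exact h'.inj k k' h1 h2 h4

section Ranks

variable (n : ℕ) (X : ℕ → ℕ)

/-- `f` orders the positions in `S`, and those beyond the end of the string, in the same way as
`W` does. It vanishes beyond the end and is at most `|S|` on `S`. -/
structure Ranks (S : Finset ℕ) (W : ℕ → List ℕ) (f : ℕ → ℕ) : Prop where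
  lt_iff : ∀ p q, (p ∈ S ∨ n < p) → (q ∈ S ∨ n < q) → (f p < f q ↔ W p < W q)
  zero : ∀ p, n < p → f p = 0
  le : ∀ p, p ∈ S → f p ≤ S.card

/-- The prefix of length `h` of the suffix at the position `p`. -/
def window (h p : ℕ) : List ℕ := (sub X p n).take h

variable {n X}

theorem Ranks.eq_iff {S : Finset ℕ} {W : ℕ → List ℕ} {f : ℕ → ℕ} (h : Ranks n S W f) {p q : ℕ}
    (hp : p ∈ S ∨ n < p) (hq : q ∈ S ∨ n < q) : f p = f q ↔ W p = W q := by
  have h1 := h.lt_iff p q hp hq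
  have h2 := h.lt_iff q p hq hp
  constructor
  · intro h3
    refine le_antisymm (not_lt.mp fun h4 => ?_) (not_lt.mp fun h4 => ?_)
    · have := h2.mpr h4; omega
    · have := h1.mpr h4; omega
  · intro h3
    rw [h3] at h1 h2
    simp only [lt_self_iff_false, iff_false] at h1 h2
    omega

/-- A window of length `a + b` is compared by its first `a` characters, and then by the window of
length `b` that follows. -/
theorem window_add_lt_iff {a b p q : ℕ} :
    window n X (a + b) p < window n X (a + b) q ↔ window n X a p < window n X a q ∨
      (window n X a p = window n X a q ∧ window n X b (p + a) < window n X b (q + a)) := by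
  rw [list_lt_iff_take_drop a]
  simp only [window, List.take_take, List.drop_take, drop_sub, Nat.min_eq_left
    (Nat.le_add_right a b),
    Nat.add_sub_cancel_left]

theorem window_add_eq_iff {a b p q : ℕ} :
    window n X (a + b) p = window n X (a + b) q ↔
      window n X a p = window n X a q ∧ window n X b (p + a) = window n X b (q + a) := by
  constructor
  · intro h
    have h1 := congrArg (List.take a) h
    have h2 := congrArg (List.drop a) h
    simp only [window, List.take_take, List.drop_take, drop_sub,
      Nat.min_eq_left (Nat.le_add_right a b), Nat.add_sub_cancel_left] at h1 h2
    exact ⟨h1, h2⟩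
  · rintro ⟨h1, h2⟩
    simp only [window] at *
    rw [List.take_add, List.take_add, drop_sub, drop_sub, h1, h2]

/-- A suffix is compared by its first `a` characters, and then by the suffix that follows. -/
theorem suffix_lt_iff {a p q : ℕ} :
    sub X p n < sub X q n ↔ window n X a p < window n X a q ∨
      (window n X a p = window n X a q ∧ sub X (p + a) n < sub X (q + a) n) := by
  rw [list_lt_iff_take_drop a, drop_sub, drop_sub]
  rfl

theorem window_of_lt {h p : ℕ} (hp : n < p) : window n X h p = [] := by
  simp [window, sub_eq_nil X hp]

theorem window_ne_nil {h p : ℕ} (hh : 0 < h) (hp : p ≤ n) : window n X h p ≠ [] := by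
  intro h0
  have := congrArg List.length h0
  simp only [window, List.length_take, length_sub, List.length_nil] at this
  omega

theorem window_of_le {h p : ℕ} (hh : n ≤ h) (hp : 1 ≤ p) : window n X h p = sub X p n :=
  List.take_of_length_le (by rw [length_sub]; omega)

theorem nil_lt_iff {l : List ℕ} : [] < l ↔ l ≠ [] := by
  cases l <;> simp

/-- A numbering that vanishes beyond the end and is positive on `S` needs to be compared with `W`
on `S` only. -/
theorem Ranks.of_mem {S : Finset ℕ} {W : ℕ → List ℕ} {f : ℕ → ℕ}
    (hW : ∀ p, n < p → W p = []) (hW' : ∀ p ∈ S, W p ≠ []) (hz : ∀ p, n < p → f p = 0)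
    (hpos : ∀ p ∈ S, 1 ≤ f p) (hle : ∀ p ∈ S, f p ≤ S.card)
    (hlt : ∀ p ∈ S, ∀ q ∈ S, f p < f q ↔ W p < W q) : Ranks n S W f := by
  refine ⟨fun p q hp hq => ?_, hz, hle⟩
  rcases hp with hp | hp
  · rcases hq with hq | hq
    · exact hlt p hp q hq
    · rw [hW q hq, hz q hq]
      simp
  · rw [hW p hp, hz p hp, nil_lt_iff]
    rcases hq with hq | hq
    · have := hpos q hq
      exact iff_of_true (by omega) (hW' q hq)
    · simp [hW q hq, hz q hq]

theorem Ranks.pos {S : Finset ℕ} {W : ℕ → List ℕ} {f : ℕ → ℕ} (h : Ranks n S W f)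
    (hW : W (n + 1) = []) {p : ℕ} (hp : p ∈ S) (hW' : W p ≠ []) : 1 ≤ f p := by
  have h1 := (h.lt_iff (n + 1) p (.inr (by omega)) (.inl hp)).mpr (by rwa [hW, nil_lt_iff])
  omega

/-- Numbering the entries of a sorted list consecutively, with equal numbers for equal keys,
yields ranks. -/
theorem Ranks.of_sorted {m : ℕ} {l : ℕ → ℕ} {S : Finset ℕ} {W : ℕ → List ℕ} {f : ℕ → ℕ}
    (hl : Enum m l S) (hsort : ∀ t t', 1 ≤ t → t < t' → t' ≤ m → ¬ W (l t') < W (l t))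
    (h1 : 1 ≤ m → f (l 1) = 1)
    (hstep : ∀ t, 1 ≤ t → t < m →
      f (l (t + 1)) = if W (l (t + 1)) = W (l t) then f (l t) else f (l t) + 1)
    (hW : ∀ p, n < p → W p = []) (hW' : ∀ p ∈ S, W p ≠ []) (hz : ∀ p, n < p → f p = 0) :
    Ranks n S W f := by
  have hle : ∀ t, 1 ≤ t → t ≤ m → 1 ≤ f (l t) ∧ f (l t) ≤ t := by
    intro t ht
    induction t, ht using Nat.le_induction with
    | base => intro h; have := h1 h; omega
    | succ t ht ih =>
      intro h
      have := ih (by omega)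
      have := hstep t ht (by omega)
      split at this <;> omega
  have hmono : ∀ t t', 1 ≤ t → t ≤ t' → t' ≤ m → f (l t) ≤ f (l t') ∧
      (f (l t) = f (l t') → W (l t) = W (l t')) ∧
      (W (l t) = W (l t') → f (l t) = f (l t')) := by
    intro t t' ht htt
    induction t', htt using Nat.le_induction with
    | base => intro _; simp
    | succ t' htt ih =>
      intro h
      obtain ⟨h2, h3, h4⟩ := ih (by omega)
      have h5 := hstep t' (by omega) (by omega)
      split at h5
      · next h6 => rw [h5, h6]; exact ⟨h2, h3, h4⟩
      · next h6 =>
        refine ⟨by omega, by omega, fun h7 => ?_⟩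
        -- a key between two equal keys is equal to both
        exfalso
        have h8 := not_lt.mp (hsort t' (t' + 1) (by omega) (by omega) h)
        rcases htt.eq_or_lt with rfl | h9
        · exact h6 h7.symm
        · have h10 := not_lt.mp (hsort t t' ht h9 (by omega))
          exact h6 (le_antisymm (h7 ▸ h10) h8)
  have hm := hl.card_eq
  refine Ranks.of_mem hW hW' hz ?_ ?_ ?_
  · intro p hp
    obtain ⟨t, h2, h3, rfl⟩ := hl.surj p hp
    exact (hle t h2 h3).1
  · intro p hp
    obtain ⟨t, h2, h3, rfl⟩ := hl.surj p hp
    have := hle t h2 h3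
    omega
  · intro p hp q hq
    obtain ⟨t, h2, h3, rfl⟩ := hl.surj p hp
    obtain ⟨t', h4, h5, rfl⟩ := hl.surj q hq
    rcases Nat.lt_trichotomy t t' with h | h | h
    · have h6 := hmono t t' h2 h.le h5
      have h7 := not_lt.mp (hsort t t' h2 h h5)
      constructor
      · intro h8
        exact lt_of_le_of_ne h7 fun h9 => by have := h6.2.2 h9; omega
      · intro h8
        refine lt_of_le_of_ne h6.1 fun h9 => ?_
        exact absurd (h6.2.1 h9) h8.ne
    · subst h; simp
    · have h6 := hmono t' t h4 h.le h3
      exact iff_of_false (by omega) (hsort t' t h4 h h3)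

end Ranks

section Compare

variable {n : ℕ} {X : ℕ → ℕ} {j : ℕ} {f : ℕ → ℕ}

theorem sample_add (n : ℕ) {j p : ℕ} (hp : p ∈ sample n j ∨ n < p) :
    p + 3 ^ j ∈ sample n j ∨ n < p + 3 ^ j := by
  rcases hp with hp | hp
  · rcases Nat.lt_or_ge n (p + 3 ^ j) with h | h
    · exact .inr h
    · exact .inl (add_mem_sample hp h)
  · exact .inr (Nat.lt_add_right _ hp)

/-- Windows of the next level are compared by the ranks of the three windows they consist of. -/
theorem Ranks.triple_lt_iff (hf : Ranks n (sample n j) (window n X (3 ^ j)) f) {p q : ℕ}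
    (hp : p ∈ sample n j) (hq : q ∈ sample n j) :
    window n X (3 ^ (j + 1)) p < window n X (3 ^ (j + 1)) q ↔
      f p < f q ∨ (f p = f q ∧ (f (p + 3 ^ j) < f (q + 3 ^ j) ∨
        (f (p + 3 ^ j) = f (q + 3 ^ j) ∧ f (p + 3 ^ j + 3 ^ j) < f (q + 3 ^ j + 3 ^ j)))) := by
  have hp' := sample_add n (.inl hp)
  have hq' := sample_add n (.inl hq)
  rw [show 3 ^ (j + 1) = 3 ^ j + (3 ^ j + 3 ^ j) by ring, window_add_lt_iff, window_add_lt_iff,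
    hf.lt_iff p q (.inl hp) (.inl hq), hf.eq_iff (.inl hp) (.inl hq), hf.lt_iff _ _ hp' hq',
    hf.eq_iff hp' hq', hf.lt_iff _ _ (sample_add n hp') (sample_add n hq')]

theorem Ranks.triple_eq_iff (hf : Ranks n (sample n j) (window n X (3 ^ j)) f) {p q : ℕ}
    (hp : p ∈ sample n j) (hq : q ∈ sample n j) :
    window n X (3 ^ (j + 1)) p = window n X (3 ^ (j + 1)) q ↔
      f p = f q ∧ f (p + 3 ^ j) = f (q + 3 ^ j) ∧
        f (p + 3 ^ j + 3 ^ j) = f (q + 3 ^ j + 3 ^ j) := by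
  have hp' := sample_add n (.inl hp)
  have hq' := sample_add n (.inl hq)
  rw [show 3 ^ (j + 1) = 3 ^ j + (3 ^ j + 3 ^ j) by ring, window_add_eq_iff, window_add_eq_iff,
    hf.eq_iff (.inl hp) (.inl hq), hf.eq_iff hp' hq',
    hf.eq_iff (sample_add n hp') (sample_add n hq')]

theorem Ranks.le_card {S : Finset ℕ} {W : ℕ → List ℕ} (hf : Ranks n S W f) {p : ℕ}
    (hp : p ∈ S ∨ n < p) : f p ≤ S.card := by
  rcases hp with hp | hp
  · exact hf.le p hp
  · rw [hf.zero p hp]; omega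

end Compare

/-! ### Descending one level -/

/-- The current step length. -/
abbrev rH : Reg := .aux 6
/-- The offset of the current level. -/
abbrev rO : Reg := .aux 7
/-- The number of positions of the current level. -/
abbrev rC : Reg := .aux 8
/-- The current level. -/
abbrev rL : Reg := .aux 9
/-- The offset of the next level, or the position before the current one in a sorted list. -/
abbrev rP : Reg := .aux 10

/-- The ranks of the windows at the current level, by position. -/
abbrev aNm : Arr := .aux 4
/-- The ranks of the suffixes, by position. -/
abbrev aRk : Arr := .aux 5
/-- The positions of all levels, one level after the other. -/
abbrev aPos : Arr := .aux 6
/-- The ranks of the windows at these positions. -/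
abbrev aSav : Arr := .aux 7
/-- The numbers of positions of the levels above the current one. -/
abbrev aMs : Arr := .aux 8
/-- The ranks of the windows at the next level, by position. -/
abbrev aNm2 : Arr := .aux 9

/-- Selects the positions of the next level. -/
def descendFilter : Com :=
  .seq (.assign rM (.lit 0))
  (.seq (.assign rP (.bin .add (.reg rO) (.reg rC)))
  (forUp rI (.lit 1) (.reg rC)
    (.seq (.assign rT (.get aPos (.bin .add (.reg rO) (.reg rI))))
    (.cond (.bin .mod (.bin .div (.bin .sub (.reg .n) (.reg rT)) (.reg rH)) (.lit 3))
      (.seq (.assign rM (.bin .add (.reg rM) (.lit 1)))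
      (.seq (.put aPos (.bin .add (.reg rP) (.reg rM)) (.reg rT))
        (.put aX (.reg rM) (.reg rT))))
      .skip))))

theorem Enum.nil {l : ℕ → ℕ} : Enum 0 l ∅ :=
  ⟨fun k h1 h2 => by omega, fun p hp => by simp at hp, fun k k' h1 h2 h3 => by omega⟩

/-- An enumerated set is built up by adding its elements one after the other. -/
theorem filter_image_Icc {l : ℕ → ℕ} {P : ℕ → Prop} [DecidablePred P] {k : ℕ} (hk1 : 1 ≤ k) :
    ((Finset.Icc 1 k).image l).filter P =
      if P (l k) then insert (l k) (((Finset.Icc 1 (k - 1)).image l).filter P)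
      else ((Finset.Icc 1 (k - 1)).image l).filter P := by
  have h2 : Finset.Icc 1 k = insert k (Finset.Icc 1 (k - 1)) := by
    ext x; simp; omega
  rw [h2, Finset.image_insert, Finset.filter_insert]

theorem Enum.notMem_prefix {m : ℕ} {l : ℕ → ℕ} {S : Finset ℕ} (h : Enum m l S) {P : ℕ → Prop}
    [DecidablePred P] {k : ℕ} (hk1 : 1 ≤ k) (hk : k ≤ m) :
    l k ∉ ((Finset.Icc 1 (k - 1)).image l).filter P := by
  intro hc
  obtain ⟨i, hi, hil⟩ := Finset.mem_image.mp (Finset.mem_filter.mp hc).1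
  rw [Finset.mem_Icc] at hi
  exact h.inj i k hi.1 (by omega) hk hil

theorem Enum.image_eq {m : ℕ} {l : ℕ → ℕ} {S : Finset ℕ} (h : Enum m l S) :
    (Finset.Icc 1 m).image l = S := by
  ext p
  rw [Finset.mem_image]
  constructor
  · rintro ⟨k, hk, rfl⟩
    rw [Finset.mem_Icc] at hk
    exact h.mem k hk.1 hk.2
  · intro hp
    obtain ⟨k, h1, h2, h3⟩ := h.surj p hp
    exact ⟨k, by simp; omega, h3⟩

/-- The positions of the next level are listed in `aX`, and saved in `aPos` behind the earlier
levels, which are kept. -/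
theorem descendFilter_runs {N n j O : ℕ} {s : Store} (hN : 4 * n + 20 < N)
    (hO : O + 3 * (sample n j).card ≤ 3 * n)
    (hrn : s.reg .n = n) (hrO : s.reg rO = O) (hrC : s.reg rC = (sample n j).card)
    (hrH : s.reg rH = 3 ^ j)
    (hpos : Enum (sample n j).card (fun k => s.arr aPos (O + k)) (sample n j)) :
    Runs N descendFilter s fun t s' => t ≤ 40 * ((sample n j).card + 1) ∧
      s'.reg rM = (sample n (j + 1)).card ∧ s'.reg rP = O + (sample n j).card ∧
      Enum (sample n (j + 1)).card (s'.arr aX) (sample n (j + 1)) ∧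
      (∀ k, 1 ≤ k → k ≤ (sample n (j + 1)).card →
        s'.arr aPos (O + (sample n j).card + k) = s'.arr aX k) ∧
      ∀ i, i ≤ O + (sample n j).card → s'.arr aPos i = s.arr aPos i := by
  set m := (sample n j).card with hm
  refine Runs.seq ((Runs.straight (by omega) (c := .assign rM (.lit 0))
    (Q := fun s' => s' = s.setReg rM 0) (by simp; omega)).mono ?_)
  rintro t₁ s₁ - - ⟨ht₁, rfl⟩
  refine Runs.seq ((Runs.straight (by omega) (c := .assign rP (.bin .add (.reg rO) (.reg rC)))
    (Q := fun s' => s' = (s.setReg rM 0).setReg rP (O + m)) (by simp [hrO, hrC]; omega)).mono ?_)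
  rintro t₂ s₂ - - ⟨ht₂, rfl⟩
  let I : ℕ → Store → Prop := fun k s' => s'.reg rM ≤ k - 1 ∧
    Enum (s'.reg rM) (s'.arr aX)
      (((Finset.Icc 1 (k - 1)).image (fun k => s.arr aPos (O + k))).filter
      (fun p => (n - p) / 3 ^ j % 3 ≠ 0)) ∧
    (∀ k, 1 ≤ k → k ≤ s'.reg rM → s'.arr aPos (O + m + k) = s'.arr aX k) ∧
      ∀ i, i ≤ O + m → s'.arr aPos i = s.arr aPos i
  refine (Runs.forUp (by omega) (L := 1) (b := 25) I rfl rfl (by decide) (by omega)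
    (by omega) (by simp [hrC]; omega) ?_ ?_).mono ?_
  · refine ⟨by simp, ?_, ?_, by simp⟩
    · simpa using Enum.nil
    · intro k h1 h2; simp at h2; omega
  · rintro k s' hk1 hk2 hf hag hk ⟨hI1, hI2, hI3, hI4⟩
    have hk2' : k ≤ m := by simpa [hrC] using hk2
    have h1 : s'.reg .n = n := (hag.reg .n rfl).trans (by simp [hrn])
    have h2 : s'.reg rO = O := (hag.reg rO rfl).trans (by simp [hrO])
    have h3 : s'.reg rH = 3 ^ j := (hag.reg rH rfl).trans (by simp [hrH])
    have h4 : s'.reg rP = O + m := (hag.reg rP rfl).trans (by simp)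
    have h5 : s'.arr aPos (O + k) = s.arr aPos (O + k) := hI4 _ (by omega)
    have h6 := filter_image_Icc (l := fun k => s.arr aPos (O + k))
      (P := fun p => (n - p) / 3 ^ j % 3 ≠ 0) hk1
    have h7 := hpos.notMem_prefix (P := fun p => (n - p) / 3 ^ j % 3 ≠ 0) hk1 hk2'
    refine (Runs.straight (by omega) (Q := I (k + 1)) ?_).mono ?_
    · simp only [Com.wp, Expr.Safe, Expr.val, Op.Safe, Op.apply, Store.setReg_reg,
        Store.setReg_arr, Store.setArr_arr, Store.setArr_reg, if_true, if_false, reduceCtorEq,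
        Reg.aux.injEq, Arr.aux.injEq, Nat.reduceEqDiff, hk, h1, h2, h3, h4, h5, true_and, and_true]
      refine ⟨by omega, by omega, fun hv => ?_, fun hv => ?_⟩
      · rw [if_pos hv] at h6
        refine ⟨⟨by omega, by omega⟩, by omega, ?_⟩
        refine ⟨?_, ?_, ?_, ?_⟩ <;> simp only [Store.setReg_reg,
          Store.setReg_arr, Store.setArr_arr, Store.setArr_reg, if_true, if_false, reduceCtorEq,
          Reg.aux.injEq, Arr.aux.injEq, Nat.reduceEqDiff, OfNat.ofNat_ne_zero]
        · omega
        · rw [Nat.add_sub_cancel, h6]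
          refine hI2.filter_step h7 (fun i hi1 hi2 => ?_) ?_ rfl
          · rw [Function.update_of_ne (by omega)]
          · simp
        · intro i hi1 hi2
          rw [Function.update_apply, Function.update_apply]
          by_cases h : i = s'.reg rM + 1
          · rw [if_pos (by omega), if_pos h]
          · rw [if_neg (by omega), if_neg h]
            exact hI3 i hi1 (by omega)
        · intro i hi
          rw [Function.update_of_ne (by omega)]
          exact hI4 i hi
      · rw [if_neg (by rw [not_not]; exact hv)] at h6
        refine ⟨?_, ?_, hI3, hI4⟩
        · show s'.reg rM ≤ _
          omega
        · rw [Nat.add_sub_cancel, h6]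
          exact hI2
    · rintro t s'' - - ⟨ht, h⟩
      exact ⟨ht.trans (by decide), h⟩
  · rintro t₃ s₃ - hag₃ ⟨ht₃, -, hI1, hI2, hI3, hI4⟩
    have h4 : s₃.reg rP = O + m := (hag₃.reg rP rfl).trans (by simp)
    simp only [Store.setReg_reg, reduceCtorEq, Reg.aux.injEq, Nat.reduceEqDiff, if_false, hrC,
      Nat.add_sub_cancel, hpos.image_eq] at ht₃ hI2
    change Enum _ _ (sample n (j + 1)) at hI2
    have h5 := hI2.card_eq
    rw [h5] at hI2 hI3
    simp only [Com.cost, Expr.cost] at ht₁ ht₂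
    exact ⟨by omega, h5, h4, hI2, hI3, hI4⟩

/-- Sorts the positions of the next level by their windows, from the last third of the windows to
the first one. -/
def descendSort : Com :=
  .seq (.assign rK (.reg rC))
  (.seq (.assign rD (.bin .add (.reg rH) (.reg rH)))
  (.seq (sortBy aNm)
  (.seq (.assign rD (.reg rH))
  (.seq (sortBy aNm)
  (.seq (.assign rD (.lit 0))
  (sortBy aNm))))))

/-- By the stability of the sort, three passes order the positions by the triples of the ranks of
their windows, and thus by the windows of the next level. -/
theorem descendSort_runs {N n j : ℕ} {X : ℕ → ℕ} {s : Store} (hN : 4 * n + 20 < N)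
    (hjn : 3 ^ j < n) (hrM : s.reg rM = (sample n (j + 1)).card)
    (hrC : s.reg rC = (sample n j).card) (hrH : s.reg rH = 3 ^ j)
    (hX : Enum (sample n (j + 1)).card (s.arr aX) (sample n (j + 1)))
    (hf : Ranks n (sample n j) (window n X (3 ^ j)) (s.arr aNm)) :
    Runs N descendSort s fun t s' => t ≤ 800 * ((sample n j).card + 1) ∧
      Enum (sample n (j + 1)).card (s'.arr aX) (sample n (j + 1)) ∧
      ∀ t t', 1 ≤ t → t < t' → t' ≤ (sample n (j + 1)).card →
        ¬ window n X (3 ^ (j + 1)) (s'.arr aX t') < window n X (3 ^ (j + 1)) (s'.arr aX t) := by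
  have hm' := card_sample_succ n j
  have hm : (sample n j).card ≤ n := by
    have := sampleOffset_le n j; omega
  have hsub : sample n (j + 1) ⊆ sample n j := Finset.filter_subset _ _
  set S := sample n j with hS
  set S' := sample n (j + 1) with hS'
  have hin : ∀ p ∈ S', p ≤ n := fun p hp => (Finset.mem_Icc.mp (sample_subset _ _ hp)).2
  refine Runs.seq ((Runs.straight (by omega) (c := .assign rK (.reg rC))
    (Q := fun s' => s' = s.setReg rK S.card) (by simp [hrC])).mono ?_)
  rintro t₁ s₁ - - ⟨ht₁, rfl⟩
  refine Runs.seq ((Runs.straight (by omega) (c := .assign rD (.bin .add (.reg rH) (.reg rH)))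
    (Q := fun s' => s' = (s.setReg rK S.card).setReg rD (3 ^ j + 3 ^ j))
    (by simp [hrH]; omega)).mono ?_)
  rintro t₂ s₂ - - ⟨ht₂, rfl⟩
  refine Runs.seq
    ((sortBy_runs (m := S'.card) (K := S.card) (D := 3 ^ j + 3 ^ j) (by decide) (by decide)
    (by omega) (by omega) (by omega) (by simpa using hrM) (by simp) (by simp)
    (fun i h1 h2 => ?_) (fun i h1 h2 => ?_)).mono ?_)
  · have := hin _ (hX.mem i h1 h2)
    simp only [Store.setReg_arr]; omega
  · simp only [Store.setReg_arr]
    rw [← Nat.add_assoc]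
    exact hf.le_card (sample_add n (sample_add n (.inl (hsub (hX.mem i h1 h2)))))
  rintro t₃ s₃ - hag₃ ⟨ht₃, hs₃⟩
  simp only [Store.setReg_arr] at hs₃
  have hX₃ := hX.of_stablySorted hs₃
  have hn₃ : s₃.arr aNm = s.arr aNm := hag₃.arr aNm rfl
  have hM₃ : s₃.reg rM = S'.card := (hag₃.reg rM rfl).trans (by simpa using hrM)
  have hK₃ : s₃.reg rK = S.card := (hag₃.reg rK rfl).trans (by simp)
  have hH₃ : s₃.reg rH = 3 ^ j := (hag₃.reg rH rfl).trans (by simpa using hrH)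
  refine Runs.seq ((Runs.straight (by omega) (c := .assign rD (.reg rH))
    (Q := fun s' => s' = s₃.setReg rD (3 ^ j)) (by simp [hH₃])).mono ?_)
  rintro t₄ s₄ - - ⟨ht₄, rfl⟩
  refine Runs.seq ((sortBy_runs (m := S'.card) (K := S.card) (D := 3 ^ j) (by decide) (by decide)
    (by omega) (by omega) (by omega) (by simpa using hM₃) (by simpa using hK₃) (by simp)
    (fun i h1 h2 => ?_) (fun i h1 h2 => ?_)).mono ?_)
  · have := hin _ (hX₃.mem i h1 h2)
    simp only [Store.setReg_arr]; omega
  · simp only [Store.setReg_arr, hn₃]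
    exact hf.le_card (sample_add n (.inl (hsub (hX₃.mem i h1 h2))))
  rintro t₅ s₅ - hag₅ ⟨ht₅, hs₅⟩
  simp only [Store.setReg_arr, hn₃] at hs₅
  have hX₅ := hX₃.of_stablySorted hs₅
  have hn₅ : s₅.arr aNm = s.arr aNm := (hag₅.arr aNm rfl).trans hn₃
  have hM₅ : s₅.reg rM = S'.card := (hag₅.reg rM rfl).trans (by simpa using hM₃)
  have hK₅ : s₅.reg rK = S.card := (hag₅.reg rK rfl).trans (by simpa using hK₃)
  refine Runs.seq ((Runs.straight (by omega) (c := .assign rD (.lit 0))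
    (Q := fun s' => s' = s₅.setReg rD 0) (by simp; omega)).mono ?_)
  rintro t₆ s₆ - - ⟨ht₆, rfl⟩
  refine (sortBy_runs (m := S'.card) (K := S.card) (D := 0) (by decide) (by decide)
    (by omega) (by omega) (by omega) (by simpa using hM₅) (by simpa using hK₅) (by simp)
    (fun i h1 h2 => ?_) (fun i h1 h2 => ?_)).mono ?_
  · have := hin _ (hX₅.mem i h1 h2)
    simp only [Store.setReg_arr]; omega
  · simp only [Store.setReg_arr, hn₅]
    exact hf.le_card (.inl (hsub (hX₅.mem i h1 h2)))
  rintro t₇ s₇ - hag₇ ⟨ht₇, hs₇⟩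
  simp only [Store.setReg_arr, hn₅, Nat.add_zero] at hs₇
  have hX₇ := hX₅.of_stablySorted hs₇
  simp only [Com.cost, Expr.cost] at ht₁ ht₂ ht₄ ht₆
  refine ⟨by omega, hX₇, fun t t' h1 h2 h3 => ?_⟩
  have e₃ := hs₃.sorted (fun _ _ => True) (fun _ _ _ _ _ => trivial)
  have e₅ := hs₅.sorted
    (fun p q => s.arr aNm (p + (3 ^ j + 3 ^ j)) < s.arr aNm (q + (3 ^ j + 3 ^ j)) ∨
    (s.arr aNm (p + (3 ^ j + 3 ^ j)) = s.arr aNm (q + (3 ^ j + 3 ^ j)) ∧ True)) e₃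
  have h4 := hs₇.sorted (fun p q => s.arr aNm (p + 3 ^ j) < s.arr aNm (q + 3 ^ j) ∨
    (s.arr aNm (p + 3 ^ j) = s.arr aNm (q + 3 ^ j) ∧
      (s.arr aNm (p + (3 ^ j + 3 ^ j)) < s.arr aNm (q + (3 ^ j + 3 ^ j)) ∨
      (s.arr aNm (p + (3 ^ j + 3 ^ j)) = s.arr aNm (q + (3 ^ j + 3 ^ j)) ∧ True)))) e₅
    t t' h1 h2 h3
  have h5 := hsub (hX₇.mem t h1 (by omega))
  have h6 := hsub (hX₇.mem t' (by omega) h3)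
  rw [hf.triple_lt_iff h6 h5]
  simp only [← Nat.add_assoc] at h4
  omega

/-- Numbers the sorted positions of the next level by their windows, which are compared with those
of the position before in the list. The first position has none: what is read from `aX[0]` is not
used. -/
def descendRank : Com :=
  .seq (.assign rU (.lit 0))
  (forUp rI (.lit 1) (.reg rM)
    (.seq (.assign rT (.get aX (.reg rI)))
    (.seq (.assign rP (.get aX (.bin .sub (.reg rI) (.lit 1))))
    (.seq
      (.cond (.bin .lt (.lit 1) (.reg rI))
        (.cond (.bin .eq (.get aNm (.reg rT)) (.get aNm (.reg rP)))
          (.cond (.bin .eq (.get aNm (.bin .add (.reg rT) (.reg rH)))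
              (.get aNm (.bin .add (.reg rP) (.reg rH))))
            (.cond (.bin .eq (.get aNm (.bin .add (.bin .add (.reg rT) (.reg rH)) (.reg rH)))
                (.get aNm (.bin .add (.bin .add (.reg rP) (.reg rH)) (.reg rH))))
              .skip
              (.assign rU (.bin .add (.reg rU) (.lit 1))))
            (.assign rU (.bin .add (.reg rU) (.lit 1))))
          (.assign rU (.bin .add (.reg rU) (.lit 1))))
        (.assign rU (.bin .add (.reg rU) (.lit 1))))
      (.put aNm2 (.reg rT) (.reg rU))))))

/-- A sorted position gets the same number as the one before it if their windows agree, and the next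
number otherwise. -/
theorem descendRank_runs {N n j : ℕ} {X : ℕ → ℕ} {s : Store} (hN : 4 * n + 20 < N)
    (hjn : 3 ^ j < n) (hrM : s.reg rM = (sample n (j + 1)).card) (hrH : s.reg rH = 3 ^ j)
    (hX : Enum (sample n (j + 1)).card (s.arr aX) (sample n (j + 1)))
    (hsort : ∀ t t', 1 ≤ t → t < t' → t' ≤ (sample n (j + 1)).card →
      ¬ window n X (3 ^ (j + 1)) (s.arr aX t') < window n X (3 ^ (j + 1)) (s.arr aX t))
    (hf : Ranks n (sample n j) (window n X (3 ^ j)) (s.arr aNm))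
    (h0 : ∀ p, n < p → s.arr aNm2 p = 0) :
    Runs N descendRank s fun t s' => t ≤ 100 * ((sample n (j + 1)).card + 1) ∧
      Ranks n (sample n (j + 1)) (window n X (3 ^ (j + 1))) (s'.arr aNm2) := by
  have hm' := card_sample_succ n j
  have hm : (sample n j).card ≤ n := by
    have := sampleOffset_le n j; omega
  have hsub : sample n (j + 1) ⊆ sample n j := Finset.filter_subset _ _
  set S' := sample n (j + 1) with hS'
  have hin : ∀ p ∈ S', p ≤ n := fun p hp => (Finset.mem_Icc.mp (sample_subset _ _ hp)).2
  let W := window n X (3 ^ (j + 1))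
  let l := s.arr aX
  refine Runs.seq ((Runs.straight (by omega) (c := .assign rU (.lit 0))
    (Q := fun s' => s' = s.setReg rU 0) (by simp; omega)).mono ?_)
  rintro t₁ s₁ - - ⟨ht₁, rfl⟩
  let I : ℕ → Store → Prop := fun k s' => s'.reg rU ≤ k - 1 ∧
    (2 ≤ k → s'.reg rU = s'.arr aNm2 (l (k - 1))) ∧
    (2 ≤ k → s'.arr aNm2 (l 1) = 1) ∧
    (∀ t, 1 ≤ t → t + 1 < k → s'.arr aNm2 (l (t + 1)) =
      if W (l (t + 1)) = W (l t) then s'.arr aNm2 (l t) else s'.arr aNm2 (l t) + 1) ∧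
    ∀ p, n < p → s'.arr aNm2 p = 0
  refine (Runs.forUp (by omega) (L := 1) (b := 60) I rfl rfl (by decide) (by omega)
    (by omega) (by simp [hrM]; omega) ?_ ?_).mono ?_
  · exact ⟨by simp, by omega, by omega, fun t h1 h2 => by omega, h0⟩
  · rintro k s' hk1 hk2 hf' hag hk ⟨hI1, hI2, hI3, hI4, hI5⟩
    have hk2' : k ≤ S'.card := by simpa [hrM] using hk2
    have h1 : s'.reg rH = 3 ^ j := (hag.reg rH rfl).trans (by simpa using hrH)
    have h2 : s'.arr aNm = s.arr aNm := hag.arr aNm rfl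
    have h3 : s'.arr aX = l := hag.arr aX rfl
    have h4 := hin _ (hX.mem k hk1 hk2')
    change l k ≤ n at h4
    -- the number of the current position
    let v := if 1 < k then (if W (l k) = W (l (k - 1)) then s'.reg rU else s'.reg rU + 1)
      else s'.reg rU + 1
    have hv : 1 < k → l (k - 1) ≤ n ∧ (W (l k) = W (l (k - 1)) ↔
        s.arr aNm (l k) = s.arr aNm (l (k - 1)) ∧
        s.arr aNm (l k + 3 ^ j) = s.arr aNm (l (k - 1) + 3 ^ j) ∧
        s.arr aNm (l k + 3 ^ j + 3 ^ j) = s.arr aNm (l (k - 1) + 3 ^ j + 3 ^ j)) := by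
      intro h
      have h5 := hX.mem (k - 1) (by omega) (by omega)
      exact ⟨hin _ h5, hf.triple_eq_iff (hsub (hX.mem k hk1 hk2')) (hsub h5)⟩
    have hvI : ∀ u, u = v → I (k + 1) (((((s'.setReg rT (l k)).setReg rP (l (k - 1))).setReg rU
        u).setArr aNm2 (l k) u)) := by
      rintro u hu
      have hvk : v ≤ k := by dsimp only [v]; split_ifs <;> omega
      have hne : ∀ t, 1 ≤ t → t < k → l t ≠ l k := fun t h1 h2 => hX.inj t k h1 h2 hk2'
      refine ⟨?_, ?_, ?_, ?_, ?_⟩ <;> simp only [Store.setReg_reg,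
        Store.setReg_arr, Store.setArr_arr, Store.setArr_reg, if_true, Nat.add_sub_cancel]
      · omega
      · simp
      · intro _
        rw [Function.update_apply]
        split
        · next h =>
          have : k = 1 := by
            by_contra hc
            exact hne 1 le_rfl (by omega) h
          rw [hu]; dsimp only [v]; rw [if_neg (by omega)]; omega
        · next h => 
          refine hI3 ?_
          by_contra hc
          exact h (by rw [show k = 1 by omega])
      · intro t ht1 ht2
        rw [Function.update_of_ne (hne t ht1 (by omega))]
        by_cases ht : t + 1 = k
        · rw [ht, Function.update_self, hu]
          dsimp only [v]
          rw [if_pos (by omega), hI2 (by omega), show k - 1 = t by omega]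
        · rw [Function.update_of_ne (hne _ (by omega) (by omega))]
          exact hI4 t ht1 (by omega)
      · intro p hp
        rw [Function.update_of_ne (by omega)]
        exact hI5 p hp
    refine (Runs.straight (by omega) (Q := I (k + 1)) ?_).mono ?_
    · simp only [Com.wp, Expr.Safe, Expr.val, Op.Safe, Op.apply, Store.setReg_reg,
        Store.setReg_arr, Store.setArr_reg, if_true, if_false, reduceCtorEq,
        Reg.aux.injEq, Arr.aux.injEq, Nat.reduceEqDiff, hk, h1, h2, h3, true_and, and_true]
      refine ⟨by omega, by omega, fun hc => ?_, fun hc => ?_⟩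
      · have h1k : 1 < k := by by_contra h; simp [h] at hc
        obtain ⟨h5, h6⟩ := hv h1k
        refine ⟨fun hc1 =>
          ⟨by omega, fun hc2 => ⟨by omega, fun hc3 => ?_, fun hc3 => ⟨by omega, ?_⟩⟩,
          fun hc2 => ⟨by omega, ?_⟩⟩, fun hc1 => ⟨by omega, ?_⟩⟩
        · have := hvI (s'.reg rU) (by
            dsimp only [v]
            rw [if_pos h1k, if_pos]
            rw [h6]
            refine ⟨?_, ?_, ?_⟩
            · by_contra h; simp [h] at hc1
            · by_contra h; simp [h] at hc2
            · by_contra h; simp [h] at hc3)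
          refine ⟨this.1, this.2.1, this.2.2.1, this.2.2.2.1, this.2.2.2.2⟩
        · refine hvI _ ?_
          dsimp only [v]
          rw [if_pos h1k, if_neg]
          rw [h6]
          rintro ⟨-, -, h⟩
          simp [h] at hc3
        · refine hvI _ ?_
          dsimp only [v]
          rw [if_pos h1k, if_neg]
          rw [h6]
          rintro ⟨-, h, -⟩
          simp [h] at hc2
        · refine hvI _ ?_
          dsimp only [v]
          rw [if_pos h1k, if_neg]
          rw [h6]
          rintro ⟨h, -, -⟩
          simp [h] at hc1
      · have h1k : ¬ 1 < k := by intro h; simp [h] at hc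
        refine ⟨by omega, hvI _ ?_⟩
        dsimp only [v]
        rw [if_neg h1k]
    · rintro t s'' - - ⟨ht, h⟩
      exact ⟨ht.trans (by decide), h⟩
  · rintro t₂ s₂ - - ⟨ht₂, -, hI1, hI2, hI3, hI4, hI5⟩
    simp only [Store.setReg_reg, reduceCtorEq, Reg.aux.injEq, Nat.reduceEqDiff, if_false, hrM]
      at ht₂ hI1 hI2 hI3 hI4
    simp only [Com.cost, Expr.cost] at ht₁
    refine ⟨by omega, Ranks.of_sorted hX hsort (fun h => hI3 (by omega))
      (fun t h1 h2 => hI4 t h1 (by omega)) (fun p hp => window_of_lt hp)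
      (fun p hp => window_ne_nil (by positivity) (hin p hp)) hI5⟩

theorem Ranks.congr {n : ℕ} {S : Finset ℕ} {W : ℕ → List ℕ} {f g : ℕ → ℕ} (h : Ranks n S W f)
    (hg : ∀ p ∈ S, g p = f p) (hz : ∀ p, n < p → g p = 0) : Ranks n S W g := by
  have h1 : ∀ p, (p ∈ S ∨ n < p) → g p = f p := by
    rintro p (hp | hp)
    · exact hg p hp
    · rw [hz p hp, h.zero p hp]
  exact ⟨fun p q hp hq => by rw [h1 p hp, h1 q hq, h.lt_iff p q hp hq], hz,
    fun p hp => by rw [hg p hp]; exact h.le p hp⟩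

/-- The positions of the level `j` and the ranks of their windows are saved in `aPos` and
`aSav`. -/
def LevelSaved (n : ℕ) (X : ℕ → ℕ) (j : ℕ) (s : Store) : Prop :=
  Enum (sample n j).card (fun k => s.arr aPos (sampleOffset n j + k)) (sample n j) ∧
    ∃ f, Ranks n (sample n j) (window n X (3 ^ j)) f ∧ ∀ k, 1 ≤ k → k ≤ (sample n j).card →
      s.arr aSav (sampleOffset n j + k) = f (s.arr aPos (sampleOffset n j + k))

/-- The level `j` has been reached. -/
structure Descending (n : ℕ) (X : ℕ → ℕ) (j : ℕ) (s : Store) : Prop where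
  reg_n : s.reg .n = n
  reg_H : s.reg rH = 3 ^ j
  reg_O : s.reg rO = sampleOffset n j
  reg_C : s.reg rC = (sample n j).card
  reg_L : s.reg rL = j
  saved : ∀ i ≤ j, LevelSaved n X i s
  counts : ∀ i < j, s.arr aMs i = (sample n i).card
  ranks : Ranks n (sample n j) (window n X (3 ^ j)) (s.arr aNm)
  zero : ∀ p, n < p → s.arr aNm2 p = 0

theorem LevelSaved.congr {n j : ℕ} {X : ℕ → ℕ} {s s' : Store} (h : LevelSaved n X j s)
    (hp : ∀ i ≤ sampleOffset n (j + 1), s'.arr aPos i = s.arr aPos i)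
    (hs : ∀ i ≤ sampleOffset n (j + 1), s'.arr aSav i = s.arr aSav i) : LevelSaved n X j s' := by
  rw [sampleOffset_succ] at hp hs
  obtain ⟨h1, f, h2, h3⟩ := h
  refine ⟨h1.congr fun k _ hk => hp _ (by omega), f, h2, fun k hk1 hk2 => ?_⟩
  rw [hp _ (by omega), hs _ (by omega)]
  exact h3 k hk1 hk2

theorem sampleOffset_mono (n : ℕ) : Monotone (sampleOffset n) :=
  monotone_nat_of_le_succ fun j => by rw [sampleOffset_succ]; omega

/-- Makes the next level the current one. -/
def descendStore : Com :=
  .seq (.put aMs (.reg rL) (.reg rC))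
  (.seq (.assign rL (.bin .add (.reg rL) (.lit 1)))
  (.seq (.assign rO (.bin .add (.reg rO) (.reg rC)))
  (.seq (.assign rC (.reg rM))
  (.seq (.assign rH (.bin .add (.bin .add (.reg rH) (.reg rH)) (.reg rH)))
  (forUp rI (.lit 1) (.reg rC)
    (.seq (.assign rT (.get aPos (.bin .add (.reg rO) (.reg rI))))
    (.seq (.put aNm (.reg rT) (.get aNm2 (.reg rT)))
      (.put aSav (.bin .add (.reg rO) (.reg rI)) (.get aNm2 (.reg rT))))))))))

theorem descendStore_runs {N n j : ℕ} {X : ℕ → ℕ} {s : Store} (hN : 4 * n + 20 < N)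
    (hjn : 3 ^ j < n) (h : Descending n X j s) (hrM : s.reg rM = (sample n (j + 1)).card)
    (hpos : Enum (sample n (j + 1)).card (fun k => s.arr aPos (sampleOffset n (j + 1) + k))
      (sample n (j + 1)))
    (hf : Ranks n (sample n (j + 1)) (window n X (3 ^ (j + 1))) (s.arr aNm2)) :
    Runs N descendStore s fun t s' => t ≤ 100 * ((sample n (j + 1)).card + 1) ∧
      Descending n X (j + 1) s' := by
  have hm' := card_sample_succ n j
  have ho := sampleOffset_le n j
  have ho' := sampleOffset_le n (j + 1)
  have hoS := sampleOffset_succ n j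
  set m := (sample n j).card with hm
  set m' := (sample n (j + 1)).card with hmS'
  set O' := sampleOffset n (j + 1) with hO'
  have hpow : 3 ^ (j + 1) = 3 ^ j + 3 ^ j + 3 ^ j := by ring
  have hj3 : j < 3 ^ j := Nat.lt_pow_self (by omega)
  refine Runs.seq ((Runs.straight (by omega) (Q := fun s' => s' = s.setArr aMs j m)
    (by simp [Com.wp, Expr.Safe, Expr.val, h.reg_L, h.reg_C, ← hm])).mono ?_)
  rintro t₁ s₁ - - ⟨ht₁, rfl⟩
  refine Runs.seq
    ((Runs.straight (by omega) (Q := fun s' => s' = (s.setArr aMs j m).setReg rL (j + 1))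
    (by simp [Com.wp, Expr.Safe, Expr.val, Op.Safe, Op.apply, h.reg_L]; omega)).mono ?_)
  rintro t₂ s₂ - - ⟨ht₂, rfl⟩
  refine Runs.seq ((Runs.straight (by omega) (Q := fun s' => s' =
    ((s.setArr aMs j m).setReg rL (j + 1)).setReg rO O')
    (by simp [Com.wp, Expr.Safe, Expr.val, Op.Safe, Op.apply, h.reg_O, h.reg_C, ← hm,
      hoS]; omega)).mono ?_)
  rintro t₃ s₃ - - ⟨ht₃, rfl⟩
  refine Runs.seq ((Runs.straight (by omega) (Q := fun s' => s' =
    (((s.setArr aMs j m).setReg rL (j + 1)).setReg rO O').setReg rC m')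
    (by simp [Com.wp, Expr.Safe, Expr.val, Op.Safe, Op.apply, hrM])).mono ?_)
  rintro t₄ s₄ - - ⟨ht₄, rfl⟩
  refine Runs.seq ((Runs.straight (by omega) (Q := fun s' => s' =
    ((((s.setArr aMs j m).setReg rL (j + 1)).setReg rO O').setReg rC m').setReg rH (3 ^ (j + 1)))
    (by simp [Com.wp, Expr.Safe, Expr.val, Op.Safe, Op.apply, h.reg_H, hpow]; omega)).mono ?_)
  rintro t₅ s₅ - - ⟨ht₅, rfl⟩
  let P := s.arr aPos
  let I : ℕ → Store → Prop := fun k s' =>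
    (∀ t, 1 ≤ t → t < k → s'.arr aNm (P (O' + t)) = s.arr aNm2 (P (O' + t))) ∧
    (∀ t, 1 ≤ t → t < k → s'.arr aSav (O' + t) = s.arr aNm2 (P (O' + t))) ∧
    (∀ p, n < p → s'.arr aNm p = 0) ∧
    ∀ i ≤ O', s'.arr aSav i = s.arr aSav i
  have hin : ∀ k, 1 ≤ k → k ≤ m' → P (O' + k) ≤ n := fun k h1 h2 =>
    (Finset.mem_Icc.mp (sample_subset _ _ (hpos.mem k h1 h2))).2
  refine (Runs.forUp (by omega) (L := 1) (b := 20) I rfl rfl (by decide) (by omega)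
    (by omega) (by simp; omega) ?_ ?_).mono ?_
  · exact ⟨fun t h1 h2 => by omega, fun t h1 h2 => by omega,
      fun p hp => by simpa using h.ranks.zero p hp, fun i _ => by simp⟩
  · rintro k s' hk1 hk2 hf' hag hk ⟨hI1, hI2, hI3, hI4⟩
    have hk2' : k ≤ m' := by simpa using hk2
    have h1 : s'.reg rO = O' := (hag.reg rO rfl).trans (by simp)
    have h2 : s'.arr aNm2 = s.arr aNm2 := (hag.arr aNm2 rfl).trans (by simp)
    have h3 : s'.arr aPos = P := (hag.arr aPos rfl).trans (by simp [P])
    have h4 := hin k hk1 hk2'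
    refine (Runs.straight (by omega) (Q := I (k + 1)) ?_).mono ?_
    · simp only [Com.wp, Expr.Safe, Expr.val, Op.Safe, Op.apply, Store.setReg_reg,
        Store.setReg_arr, Store.setArr_arr, Store.setArr_reg, if_true, if_false, reduceCtorEq,
        Reg.aux.injEq, Arr.aux.injEq, Nat.reduceEqDiff, hk, h1, h2, h3, true_and, and_true]
      refine ⟨by omega, by omega, ?_, ?_, ?_, ?_⟩ <;> simp only [Store.setReg_reg,
        Store.setReg_arr, Store.setArr_arr, Store.setArr_reg, if_true, if_false, reduceCtorEq,
        Reg.aux.injEq, Arr.aux.injEq, Nat.reduceEqDiff]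
      · intro t ht1 ht2
        rw [Function.update_apply]
        split
        · next h => rw [h]
        · next h => exact hI1 t ht1 (by
            by_contra hc
            exact h (by rw [show t = k by omega]))
      · intro t ht1 ht2
        rw [Function.update_apply]
        split
        · next h => rw [show t = k by omega]
        · next h => exact hI2 t ht1 (by omega)
      · intro p hp
        rw [Function.update_of_ne (by omega)]
        exact hI3 p hp
      · intro i hi
        rw [Function.update_of_ne (by omega)]
        exact hI4 i hi
    · rintro t s'' - - ⟨ht, h⟩
      exact ⟨ht.trans (by decide), h⟩
  · rintro t₆ s₆ - hag₆ ⟨ht₆, -, hI1, hI2, hI3, hI4⟩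
    simp only [Store.setReg_reg, reduceCtorEq, Reg.aux.injEq, Nat.reduceEqDiff, if_false, if_true]
      at ht₆ hI1 hI2
    simp only [Com.cost, Expr.cost] at ht₁ ht₂ ht₃ ht₄ ht₅
    have h3 : s₆.arr aPos = P := (hag₆.arr aPos rfl).trans (by simp [P])
    have h4 : s₆.arr aMs = Function.update (s.arr aMs) j m := (hag₆.arr aMs rfl).trans (by simp)
    refine ⟨by omega, ?_, ?_, ?_, ?_, ?_, fun i hi => ?_, fun i hi => ?_, ?_, ?_⟩
    · exact (hag₆.reg .n rfl).trans (by simpa using h.reg_n)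
    · exact (hag₆.reg rH rfl).trans (by simp)
    · exact (hag₆.reg rO rfl).trans (by simp [← hO'])
    · exact (hag₆.reg rC rfl).trans (by simp [← hmS'])
    · exact (hag₆.reg rL rfl).trans (by simp)
    · rcases Nat.lt_or_ge j i with h5 | h5
      · obtain rfl : i = j + 1 := by omega
        refine ⟨hpos.congr fun k _ _ => by rw [h3], s.arr aNm2, hf, fun k hk1 hk2 => ?_⟩
        rw [h3]
        exact hI2 k hk1 (by omega)
      · have h6 := sampleOffset_mono n (show i + 1 ≤ j + 1 by omega)
        exact (h.saved i h5).congr (fun l _ => by rw [h3])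
          fun l hl => hI4 l (by omega)
    · rw [h4, Function.update_apply]
      split
      · next h5 => rw [h5]
      · exact h.counts i (by omega)
    · refine hf.congr (fun p hp => ?_) hI3
      obtain ⟨k, hk1, hk2, rfl⟩ := hpos.surj p hp
      exact hI1 k hk1 (by omega)
    · intro p hp
      rw [hag₆.arr aNm2 rfl]
      simpa using h.zero p hp

/-- Passes from a level to the next one. -/
def descendStep : Com :=
  .seq descendFilter (.seq descendSort (.seq descendRank descendStore))

theorem descendStep_runs {N n j : ℕ} {X : ℕ → ℕ} {s : Store} (hN : 4 * n + 20 < N)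
    (hjn : 3 ^ j < n) (h : Descending n X j s) :
    Runs N descendStep s fun t s' => t ≤ 1100 * ((sample n j).card + 1) ∧
      Descending n X (j + 1) s' := by
  have hm' := card_sample_succ n j
  refine Runs.seq ((descendFilter_runs hN (sampleOffset_le n j) h.reg_n h.reg_O h.reg_C h.reg_H
    (h.saved j le_rfl).1).mono ?_)
  rintro t₁ s₁ - hag₁ ⟨ht₁, hM₁, -, hX₁, hp₁, hq₁⟩
  rw [← sampleOffset_succ] at hp₁ hq₁
  have hr₁ : Ranks n (sample n j) (window n X (3 ^ j)) (s₁.arr aNm) := by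
    rw [hag₁.arr aNm rfl]; exact h.ranks
  refine Runs.seq ((descendSort_runs hN hjn hM₁ ((hag₁.reg rC rfl).trans h.reg_C)
    ((hag₁.reg rH rfl).trans h.reg_H) hX₁ hr₁).mono ?_)
  rintro t₂ s₂ - hag₂ ⟨ht₂, hX₂, hs₂⟩
  have hr₂ : Ranks n (sample n j) (window n X (3 ^ j)) (s₂.arr aNm) := by
    rw [hag₂.arr aNm rfl]; exact hr₁
  have hM₂ : s₂.reg rM = (sample n (j + 1)).card := (hag₂.reg rM rfl).trans hM₁
  refine Runs.seq ((descendRank_runs hN hjn hM₂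
    ((hag₂.reg rH rfl).trans ((hag₁.reg rH rfl).trans h.reg_H)) hX₂ hs₂ hr₂ fun p hp => ?_).mono ?_)
  · rw [hag₂.arr aNm2 rfl, hag₁.arr aNm2 rfl]
    exact h.zero p hp
  rintro t₃ s₃ - hag₃ ⟨ht₃, hr₃⟩
  have hM₃ : s₃.reg rM = (sample n (j + 1)).card := (hag₃.reg rM rfl).trans hM₂
  have hP₃ : s₃.arr aPos = s₁.arr aPos := (hag₃.arr aPos rfl).trans (hag₂.arr aPos rfl)
  have hS₃ : s₃.arr aSav = s.arr aSav :=
    (hag₃.arr aSav rfl).trans ((hag₂.arr aSav rfl).trans (hag₁.arr aSav rfl))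
  have hN₃ : s₃.arr aNm = s₁.arr aNm := (hag₃.arr aNm rfl).trans (hag₂.arr aNm rfl)
  have hD : Descending n X j s₃ :=
    ⟨(hag₃.reg .n rfl).trans ((hag₂.reg .n rfl).trans ((hag₁.reg .n rfl).trans h.reg_n)),
    (hag₃.reg rH rfl).trans ((hag₂.reg rH rfl).trans ((hag₁.reg rH rfl).trans h.reg_H)),
    (hag₃.reg rO rfl).trans ((hag₂.reg rO rfl).trans ((hag₁.reg rO rfl).trans h.reg_O)),
    (hag₃.reg rC rfl).trans ((hag₂.reg rC rfl).trans ((hag₁.reg rC rfl).trans h.reg_C)),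
    (hag₃.reg rL rfl).trans ((hag₂.reg rL rfl).trans ((hag₁.reg rL rfl).trans h.reg_L)),
    fun i hi => (h.saved i hi).congr
      (fun l hl => by
        rw [hP₃]
        exact hq₁ l (hl.trans (sampleOffset_mono n (show i + 1 ≤ j + 1 by omega))))
      (fun l _ => by rw [hS₃]),
    fun i hi => by
      rw [hag₃.arr aMs rfl, hag₂.arr aMs rfl, hag₁.arr aMs rfl]
      exact h.counts i hi,
    by rw [hN₃]; exact hr₁, hr₃.zero⟩
  refine (descendStore_runs hN hjn hD hM₃ (hX₁.congr fun k h1 h2 => ?_) hr₃).mono ?_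
  · rw [hP₃]
    exact hp₁ k h1 h2
  rintro t₄ s₄ - - ⟨ht₄, h₄⟩
  exact ⟨by omega, h₄⟩

/-- Descends until the windows cover the whole string. -/
def descend : Com := .loop (.bin .lt (.reg rH) (.reg .n)) descendStep

/-- The time of a step is proportional to the number of positions of the level, and at least a third
of them is dropped. -/
theorem descend_runs {N n : ℕ} {X : ℕ → ℕ} {s : Store} (hN : 4 * n + 20 < N)
    (h : Descending n X 0 s) :
    Runs N descend s fun t s' => t ≤ 8000 * (n + 1) ∧
      ∃ j, n ≤ 3 ^ j ∧ 3 ^ j ≤ 3 * n + 1 ∧ Descending n X j s' := by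
  -- The first summand of the potential pays for the positions, and the second one, which decreases
  -- with the growing step length, for the constant cost of a step.
  refine (Runs.loop (by omega) (fun s' => ∃ j, 3 ^ j ≤ 3 * n + 1 ∧ Descending n X j s')
    (fun s' => 2000 * (3 * s'.reg rC + (n - s'.reg rH))) ⟨0, by simp, h⟩ ?_).mono ?_
  · rintro s' - - ⟨j, hj3, hj⟩
    refine ⟨by simp [Expr.Safe, Op.Safe], fun hv => ?_⟩
    have hjn : 3 ^ j < n := by
      simp only [Expr.val, Op.apply, hj.reg_H, hj.reg_n] at hv
      by_contra hc
      simp [hc] at hv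
    refine (descendStep_runs hN hjn hj).mono ?_
    rintro t s'' - - ⟨ht, h''⟩
    have hpow : 3 ^ (j + 1) = 3 ^ j + 3 ^ j + 3 ^ j := by ring
    have hpos : 0 < 3 ^ j := by positivity
    have hm' := card_sample_succ n j
    refine ⟨⟨j + 1, by omega, h''⟩, ?_⟩
    rw [hj.reg_C, hj.reg_H, h''.reg_C, h''.reg_H, hpow]
    simp only [Expr.cost]
    omega
  · rintro t s' - - ⟨⟨j, hj3, hj⟩, hv, ht⟩
    have hjn : n ≤ 3 ^ j := by
      simp only [Expr.val, Op.apply, hj.reg_H, hj.reg_n] at hv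
      by_contra hc
      simp [not_le.mp hc] at hv
    rw [h.reg_C, h.reg_H, card_sample_zero] at ht
    simp only [Expr.cost] at ht
    exact ⟨by omega, j, hjn, hj3, hj⟩

/-! ### Ascending one level -/

/-- The offset of the level below the current one. -/
abbrev rQ : Reg := .aux 11
/-- The number of positions that belong to the level below. -/
abbrev rV : Reg := .aux 12
/-- A pointer into the sorted positions that belong to the level below. -/
abbrev rA : Reg := .aux 13
/-- A pointer into the sorted positions that do not belong to the level below. -/
abbrev rB : Reg := .aux 14
/-- The outcome of a comparison. -/
abbrev rF : Reg := .aux 15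

/-- The sorted positions that belong to the level below. -/
abbrev aA : Arr := .aux 10
/-- The sorted positions of the current level. -/
abbrev aOut : Arr := .aux 11

/-- The suffixes at the positions of the level `j` have been ranked. -/
structure Ascending (n : ℕ) (X : ℕ → ℕ) (j : ℕ) (s : Store) : Prop where
  reg_n : s.reg .n = n
  reg_H : s.reg rH = 3 ^ j
  reg_O : s.reg rO = sampleOffset n j
  reg_C : s.reg rC = (sample n j).card
  reg_L : s.reg rL = j
  saved : ∀ i ≤ j, LevelSaved n X i s
  counts : ∀ i < j, s.arr aMs i = (sample n i).card
  zero : ∀ p, n < p → s.arr aNm p = 0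
  ranks : Ranks n (sample n j) (fun p => sub X p n) (s.arr aRk)

/-- At the last level the windows are whole suffixes. -/
def turn : Com :=
  forUp rI (.lit 1) (.reg rC)
    (.seq (.assign rT (.get aPos (.bin .add (.reg rO) (.reg rI))))
      (.put aRk (.reg rT) (.get aNm (.reg rT))))

/-- A window whose length is at least `n` is the whole suffix, so its rank is the rank of the
suffix. -/
theorem turn_runs {N n j : ℕ} {X : ℕ → ℕ} {s : Store} (hN : 4 * n + 20 < N)
    (hjn : n ≤ 3 ^ j) (h : Descending n X j s) (h0 : ∀ p, n < p → s.arr aRk p = 0) :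
    Runs N turn s fun t s' => t ≤ 20 * (n + 1) ∧ Ascending n X j s' := by
  have ho := sampleOffset_le n j
  obtain ⟨hpos, -⟩ := h.saved j le_rfl
  set m := (sample n j).card with hm
  set O := sampleOffset n j with hO
  let P := s.arr aPos
  let I : ℕ → Store → Prop := fun k s' =>
    (∀ t, 1 ≤ t → t < k → s'.arr aRk (P (O + t)) = s.arr aNm (P (O + t))) ∧
    (∀ p, n < p → s'.arr aRk p = 0)
  have hin : ∀ k, 1 ≤ k → k ≤ m → P (O + k) ≤ n := fun k h1 h2 =>
    (Finset.mem_Icc.mp (sample_subset _ _ (hpos.mem k h1 h2))).2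
  refine (Runs.forUp (by omega) (L := 1) (b := 10) I rfl rfl (by decide) (by omega)
    (by omega) (by rw [h.reg_C]; omega) ⟨fun t h1 h2 => by omega, h0⟩ ?_).mono ?_
  · rintro k s' hk1 hk2 hf' hag hk ⟨hI1, hI2⟩
    rw [h.reg_C] at hk2
    have h1 : s'.reg rO = O := (hag.reg rO rfl).trans h.reg_O
    have h2 : s'.arr aNm = s.arr aNm := hag.arr aNm rfl
    have h3 : s'.arr aPos = P := hag.arr aPos rfl
    have h4 := hin k hk1 hk2
    refine (Runs.straight (by omega) (Q := I (k + 1)) ?_).mono ?_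
    · simp only [Com.wp, Expr.Safe, Expr.val, Op.Safe, Op.apply, Store.setReg_reg,
        Store.setReg_arr, Store.setArr_arr, Store.setArr_reg, if_true, if_false, reduceCtorEq,
        Reg.aux.injEq, Arr.aux.injEq, Nat.reduceEqDiff, hk, h1, h2, h3, true_and, and_true]
      refine ⟨by omega, ?_, ?_⟩ <;> simp only [Store.setReg_reg,
        Store.setReg_arr, Store.setArr_arr, Store.setArr_reg, if_true, if_false, reduceCtorEq,
        Reg.aux.injEq, Arr.aux.injEq, Nat.reduceEqDiff]
      · intro t ht1 ht2
        rw [Function.update_apply]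
        split
        · next h => rw [h]
        · next h => exact hI1 t ht1 (by
            by_contra hc
            exact h (by rw [show t = k by omega]))
      · intro p hp
        rw [Function.update_of_ne (by omega)]
        exact hI2 p hp
    · rintro t s'' - - ⟨ht, h⟩
      exact ⟨ht.trans (by decide), h⟩
  · rintro t s' - hag ⟨ht, -, hI1, hI2⟩
    rw [h.reg_C] at ht hI1
    have hr : Ranks n (sample n j) (fun p => sub X p n) (s.arr aNm) := by
      have hW : ∀ p, (p ∈ sample n j ∨ n < p) → window n X (3 ^ j) p = sub X p n := by
        rintro p (hp | hp)
        · exact window_of_le hjn (Finset.mem_Icc.mp (sample_subset _ _ hp)).1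
        · rw [window_of_lt hp, sub_eq_nil X hp]
      refine ⟨fun p q hp hq => ?_, h.ranks.zero, h.ranks.le⟩
      rw [h.ranks.lt_iff p q hp hq, hW p hp, hW q hq]
    refine ⟨by omega, (hag.reg .n rfl).trans h.reg_n, (hag.reg rH rfl).trans h.reg_H,
      (hag.reg rO rfl).trans h.reg_O, (hag.reg rC rfl).trans h.reg_C,
        (hag.reg rL rfl).trans h.reg_L,
      fun i hi => (h.saved i hi).congr (fun l _ => by rw [hag.arr aPos rfl])
        (fun l _ => by rw [hag.arr aSav rfl]),
      fun i hi => by rw [hag.arr aMs rfl]; exact h.counts i hi,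
      fun p hp => by rw [hag.arr aNm rfl]; exact h.ranks.zero p hp,
      hr.congr (fun p hp => ?_) hI2⟩
    obtain ⟨k, hk1, hk2, rfl⟩ := hpos.surj p hp
    exact hI1 k hk1 (by omega)

/-- Restores the data of the level above and lists the positions of the level left behind. -/
def ascendRestore : Com :=
  .seq (.assign rH (.bin .div (.reg rH) (.lit 3)))
  (.seq (.assign rL (.bin .sub (.reg rL) (.lit 1)))
  (.seq (.assign rQ (.reg rO))
  (.seq (.assign rM (.reg rC))
  (.seq (.assign rC (.get aMs (.reg rL)))
  (.seq (.assign rO (.bin .sub (.reg rO) (.reg rC)))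
  (.seq
    (forUp rI (.lit 1) (.reg rC)
      (.seq (.assign rT (.get aPos (.bin .add (.reg rO) (.reg rI))))
        (.put aNm (.reg rT) (.get aSav (.bin .add (.reg rO) (.reg rI))))))
    (forUp rI (.lit 1) (.reg rM)
      (.put aX (.reg rI) (.get aPos (.bin .add (.reg rQ) (.reg rI)))))))))))

theorem ascendRestore_runs {N n j : ℕ} {X : ℕ → ℕ} {s : Store} (hN : 4 * n + 20 < N)
    (h : Ascending n X (j + 1) s) :
    Runs N ascendRestore s fun t s' => t ≤ 50 * ((sample n j).card + 1) ∧
      s'.reg rH = 3 ^ j ∧ s'.reg rL = j ∧ s'.reg rO = sampleOffset n j ∧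
      s'.reg rC = (sample n j).card ∧ s'.reg rM = (sample n (j + 1)).card ∧
      Enum (sample n (j + 1)).card (s'.arr aX) (sample n (j + 1)) ∧
      Ranks n (sample n j) (window n X (3 ^ j)) (s'.arr aNm) := by
  have hm' := card_sample_succ n j
  have ho := sampleOffset_le n j
  have ho' := sampleOffset_le n (j + 1)
  have hoS := sampleOffset_succ n j
  obtain ⟨hpos, f, hf, hsav⟩ := h.saved j (by omega)
  obtain ⟨hpos', -⟩ := h.saved (j + 1) le_rfl
  set m := (sample n j).card with hm
  set m' := (sample n (j + 1)).card with hmS'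
  set O := sampleOffset n j with hO
  set O' := sampleOffset n (j + 1) with hO'
  have hpow : 3 ^ (j + 1) / 3 = 3 ^ j := by rw [pow_succ]; exact Nat.mul_div_cancel _ (by omega)
  let u :=
    (((((s.setReg rH (3 ^ j)).setReg rL j).setReg rQ O').setReg rM m').setReg rC m).setReg rO O
  let P := s.arr aPos
  have hin : ∀ k, 1 ≤ k → k ≤ m → P (O + k) ≤ n := fun k h1 h2 =>
    (Finset.mem_Icc.mp (sample_subset _ _ (hpos.mem k h1 h2))).2
  have hc := h.counts j (by omega)
  refine Runs.seq ((Runs.straight (by omega) (Q := fun s' => s' = s.setReg rH (3 ^ j)) (by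
    simp [Com.wp, Expr.Safe, Expr.val, Op.Safe, Op.apply, h.reg_H, hpow]; omega)).mono ?_)
  rintro t₁ s₁ - - ⟨ht₁, rfl⟩
  refine Runs.seq
    ((Runs.straight (by omega) (Q := fun s' => s' = (s.setReg rH (3 ^ j)).setReg rL j) (by
    simp [Com.wp, Expr.Safe, Expr.val, Op.Safe, Op.apply, h.reg_L]; omega)).mono ?_)
  rintro t₂ s₂ - - ⟨ht₂, rfl⟩
  refine Runs.seq ((Runs.straight (by omega) (Q := fun s' => s' =
    ((s.setReg rH (3 ^ j)).setReg rL j).setReg rQ O') (by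
    simp [Com.wp, Expr.Safe, Expr.val, Op.Safe, Op.apply, h.reg_O, ← hO'])).mono ?_)
  rintro t₃ s₃ - - ⟨ht₃, rfl⟩
  refine Runs.seq ((Runs.straight (by omega) (Q := fun s' => s' =
    (((s.setReg rH (3 ^ j)).setReg rL j).setReg rQ O').setReg rM m') (by
    simp [Com.wp, Expr.Safe, Expr.val, Op.Safe, Op.apply, h.reg_C, ← hmS'])).mono ?_)
  rintro t₄ s₄ - - ⟨ht₄, rfl⟩
  refine Runs.seq ((Runs.straight (by omega) (Q := fun s' => s' =
    ((((s.setReg rH (3 ^ j)).setReg rL j).setReg rQ O').setReg rM m').setReg rC m) (by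
    simp [Com.wp, Expr.Safe, Expr.val, Op.Safe, Op.apply, hc, ← hm])).mono ?_)
  rintro t₅ s₅ - - ⟨ht₅, rfl⟩
  refine Runs.seq ((Runs.straight (by omega) (Q := fun s' => s' = u) (by
    simp [Com.wp, Expr.Safe, Expr.val, Op.Safe, Op.apply, h.reg_O, ← hO', hoS, u])).mono ?_)
  rintro t₆ s₆ - - ⟨ht₆, rfl⟩
  simp only [Com.cost, Expr.cost] at ht₁ ht₂ ht₃ ht₄ ht₅ ht₆
  let I : ℕ → Store → Prop := fun k s' =>
    (∀ t, 1 ≤ t → t < k → s'.arr aNm (P (O + t)) = f (P (O + t))) ∧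
    (∀ p, n < p → s'.arr aNm p = 0)
  refine Runs.seq ?_
  refine (Runs.forUp (by omega) (L := 1) (b := 12) I rfl rfl (by decide) (by omega)
    (by omega) (by simp [u]; omega) ?_ ?_).mono ?_
  · exact ⟨fun t h1 h2 => by omega, h.zero⟩
  · rintro k s' hk1 hk2 hf' hag hk ⟨hI1, hI2⟩
    have hk2' : k ≤ m := by simpa [u] using hk2
    have h1 : s'.reg rO = O := (hag.reg rO rfl).trans (by simp [u])
    have h2 : s'.arr aSav = s.arr aSav := (hag.arr aSav rfl).trans (by simp [u])
    have h3 : s'.arr aPos = P := (hag.arr aPos rfl).trans (by simp [u, P])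
    have h4 := hin k hk1 hk2'
    have h5 := hsav k hk1 hk2'
    refine (Runs.straight (by omega) (Q := I (k + 1)) ?_).mono ?_
    · simp only [Com.wp, Expr.Safe, Expr.val, Op.Safe, Op.apply, Store.setReg_reg,
        Store.setReg_arr, Store.setArr_arr, Store.setArr_reg, if_true, if_false, reduceCtorEq,
        Reg.aux.injEq, Arr.aux.injEq, Nat.reduceEqDiff, hk, h1, h2, h3, true_and, and_true]
      refine ⟨by omega, by omega, ?_, ?_⟩ <;> simp only [Store.setReg_reg,
        Store.setReg_arr, Store.setArr_arr, Store.setArr_reg, if_true, if_false, reduceCtorEq,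
        Reg.aux.injEq, Arr.aux.injEq, Nat.reduceEqDiff]
      · intro t ht1 ht2
        rw [Function.update_apply]
        split
        · next h => rw [h, h5]
        · next h => exact hI1 t ht1 (by
            by_contra hc
            exact h (by rw [show t = k by omega]))
      · intro p hp
        rw [Function.update_of_ne (by omega)]
        exact hI2 p hp
    · rintro t s'' - - ⟨ht, h⟩
      exact ⟨ht.trans (by decide), h⟩
  rintro t₇ s₇ - hag₇ ⟨ht₇, -, hI1, hI2⟩
  simp only [u, Store.setReg_reg, reduceCtorEq, Reg.aux.injEq, Nat.reduceEqDiff, if_false, if_true]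
    at ht₇ hI1
  have hr : Ranks n (sample n j) (window n X (3 ^ j)) (s₇.arr aNm) := by
    refine hf.congr (fun p hp => ?_) hI2
    obtain ⟨k, hk1, hk2, rfl⟩ := hpos.surj p hp
    exact hI1 k hk1 (by omega)
  have hM₇ : s₇.reg rM = m' := (hag₇.reg rM rfl).trans (by simp [u])
  have hP₇ : s₇.arr aPos = P := (hag₇.arr aPos rfl).trans (by simp [u, P])
  have hQ₇ : s₇.reg rQ = O' := (hag₇.reg rQ rfl).trans (by simp [u])
  refine (Runs.forUp (by omega) (L := 1) (b := 10) (fun k s' => ∀ t, 1 ≤ t → t < k →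
    s'.arr aX t = P (O' + t)) rfl rfl (by decide) (by omega)
    (by omega) (by omega) (fun t h1 h2 => by omega) ?_).mono ?_
  · intro k s' hk1 hk2 hf' hag hk hI
    have h1 : s'.reg rQ = O' := (hag.reg rQ rfl).trans hQ₇
    have h3 : s'.arr aPos = P := (hag.arr aPos rfl).trans hP₇
    refine (Runs.straight (by omega) (Q := fun s' => ∀ t, 1 ≤ t → t < k + 1 →
      s'.arr aX t = P (O' + t)) ?_).mono ?_
    · simp only [Com.wp, Expr.Safe, Expr.val, Op.Safe, Op.apply, Store.setReg_reg,
        Store.setReg_arr, Store.setArr_arr, Store.setArr_reg, if_true, if_false, reduceCtorEq,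
        Reg.aux.injEq, Arr.aux.injEq, Nat.reduceEqDiff, hk, h1, h3, true_and, and_true]
      refine ⟨by omega, fun t ht1 ht2 => ?_⟩
      rw [Function.update_apply]
      split
      · next h => rw [h]
      · exact hI t ht1 (by omega)
    · rintro t s'' - - ⟨ht, h⟩
      exact ⟨ht.trans (by decide), h⟩
  rintro t₈ s₈ - hag₈ ⟨ht₈, -, hI⟩
  rw [hM₇] at ht₈ hI
  refine ⟨by omega, ?_, ?_, ?_, ?_, ?_, hpos'.congr fun k h1 h2 => hI k h1 (by omega), ?_⟩
  · exact (hag₈.reg rH rfl).trans ((hag₇.reg rH rfl).trans (by simp [u]))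
  · exact (hag₈.reg rL rfl).trans ((hag₇.reg rL rfl).trans (by simp [u]))
  · exact (hag₈.reg rO rfl).trans ((hag₇.reg rO rfl).trans (by simp [u]))
  · exact (hag₈.reg rC rfl).trans ((hag₇.reg rC rfl).trans (by simp [u]))
  · exact (hag₈.reg rM rfl).trans hM₇
  · rw [hag₈.arr aNm rfl]; exact hr

/-- The positions of the level `j` that do not belong to the next level. -/
def dropped (n j : ℕ) : Finset ℕ := (sample n j).filter (fun p => (n - p) / 3 ^ j % 3 = 0)

theorem mem_dropped {n j p : ℕ} :
    p ∈ dropped n j ↔ p ∈ sample n j ∧ (n - p) / 3 ^ j % 3 = 0 := Finset.mem_filter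

theorem sample_div_step {n j p : ℕ} (hp : p ∈ sample n j) :
    (n < p + 3 ^ j ∧ (n - p) / 3 ^ j = 0) ∨
      (p + 3 ^ j ∈ sample n j ∧ (n - p) / 3 ^ j = (n - (p + 3 ^ j)) / 3 ^ j + 1) := by
  have hpn := Finset.mem_Icc.mp (sample_subset _ _ hp)
  rcases Nat.lt_or_ge n (p + 3 ^ j) with h | h
  · exact .inl ⟨h, Nat.div_eq_of_lt (by omega)⟩
  · exact .inr ⟨add_mem_sample hp h, sub_div_step (by positivity) h⟩

/-- One step from a dropped position leads to the next level. -/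
theorem add_mem_of_dropped {n j p : ℕ} (hp : p ∈ dropped n j) :
    p + 3 ^ j ∈ sample n (j + 1) ∨ n < p + 3 ^ j := by
  rw [mem_dropped] at hp
  rcases sample_div_step hp.1 with h | h
  · exact .inr h.1
  · refine .inl (mem_sample_succ.mpr ⟨h.1, ?_⟩)
    omega

theorem sub_lt_sub_of_le {n : ℕ} {X : ℕ → ℕ} {p q : ℕ} (hp : p ∈ Finset.Icc 1 n)
    (hq : q ∈ Finset.Icc 1 n) (hne : p ≠ q) (h : ¬ sub X q n < sub X p n) :
    sub X p n < sub X q n := by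
  exact lt_of_le_of_ne (not_lt.mp h) fun h' => hne (sub_inj n X hp hq h')

/-- `l[1], …, l[m]` are the elements of `S`, listed by the lexicographic order of the suffixes. -/
structure SuffixSorted (n : ℕ) (X : ℕ → ℕ) (m : ℕ) (l : ℕ → ℕ) (S : Finset ℕ) : Prop where
  enum : Enum m l S
  lt : ∀ t t', 1 ≤ t → t < t' → t' ≤ m → sub X (l t) n < sub X (l t') n

/-- Sorts the positions of the level below by their ranks. -/
def ascendSamples : Com :=
  .seq (.assign rK (.reg rM))
  (.seq (.assign rD (.lit 0))
  (.seq (sortBy aRk)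
  (.seq (.assign rV (.reg rM))
  (forUp rI (.lit 1) (.reg rM) (.put aA (.reg rI) (.get aX (.reg rI)))))))

/-- The ranks of their suffixes are known for the positions of the level below. -/
theorem ascendSamples_runs {N n j : ℕ} {X : ℕ → ℕ} {s : Store} (hN : 4 * n + 20 < N)
    (hrM : s.reg rM = (sample n (j + 1)).card)
    (hX : Enum (sample n (j + 1)).card (s.arr aX) (sample n (j + 1)))
    (hf : Ranks n (sample n (j + 1)) (fun p => sub X p n) (s.arr aRk)) :
    Runs N ascendSamples s fun t s' => t ≤ 300 * ((sample n (j + 1)).card + 1) ∧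
      s'.reg rV = (sample n (j + 1)).card ∧
      SuffixSorted n X (sample n (j + 1)).card (s'.arr aA) (sample n (j + 1)) := by
  have ho := sampleOffset_le n (j + 1)
  have hsub := sample_subset n (j + 1)
  set S := sample n (j + 1) with hS
  have hin : ∀ p ∈ S, p ≤ n := fun p hp => (Finset.mem_Icc.mp (hsub hp)).2
  refine Runs.seq ((Runs.straight (by omega) (Q := fun s' => s' = s.setReg rK S.card)
    (by simp [Com.wp, Expr.Safe, Expr.val, hrM])).mono ?_)
  rintro t₁ s₁ - - ⟨ht₁, rfl⟩
  refine Runs.seq ((Runs.straight (by omega) (Q := fun s' => s' = (s.setReg rK S.card).setReg rD 0)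
    (by simp [Com.wp, Expr.Safe, Expr.val]; omega)).mono ?_)
  rintro t₂ s₂ - - ⟨ht₂, rfl⟩
  refine Runs.seq ((sortBy_runs (m := S.card) (K := S.card) (D := 0) (by decide) (by decide)
    (by omega) (by omega) (by omega) (by simpa using hrM) (by simp) (by simp)
    (fun i h1 h2 => ?_) (fun i h1 h2 => ?_)).mono ?_)
  · have := hin _ (hX.mem i h1 h2)
    simp only [Store.setReg_arr]; omega
  · simp only [Store.setReg_arr]
    exact hf.le _ (hX.mem i h1 h2)
  rintro t₃ s₃ - hag₃ ⟨ht₃, hs₃⟩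
  simp only [Store.setReg_arr, Nat.add_zero] at hs₃
  have hX₃ := hX.of_stablySorted hs₃
  have e₃ := hs₃.sorted (fun _ _ => True) (fun _ _ _ _ _ => trivial)
  have hM₃ : s₃.reg rM = S.card := (hag₃.reg rM rfl).trans (by simpa using hrM)
  refine Runs.seq ((Runs.straight (by omega) (Q := fun s' => s' = s₃.setReg rV S.card)
    (by simp [Com.wp, Expr.Safe, Expr.val, hM₃])).mono ?_)
  rintro t₄ s₄ - - ⟨ht₄, rfl⟩
  refine (Runs.forUp (by omega) (L := 1) (b := 10) (fun k s' => ∀ t, 1 ≤ t → t < k →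
    s'.arr aA t = s₃.arr aX t) rfl rfl (by decide) (by omega)
    (by omega) (by simp; omega) (fun t h1 h2 => by omega) ?_).mono ?_
  · intro k s' hk1 hk2 hf' hag hk hI
    have h3 : s'.arr aX = s₃.arr aX := (hag.arr aX rfl).trans (by simp)
    refine (Runs.straight (by omega) (Q := fun s' => ∀ t, 1 ≤ t → t < k + 1 →
      s'.arr aA t = s₃.arr aX t) ?_).mono ?_
    · simp only [Com.wp, Expr.Safe, Expr.val, Op.Safe, Op.apply, Store.setReg_reg,
        Store.setReg_arr, Store.setArr_arr, Store.setArr_reg, if_true, if_false, reduceCtorEq,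
        Reg.aux.injEq, Arr.aux.injEq, Nat.reduceEqDiff, hk, h3, true_and, and_true]
      intro t ht1 ht2
      rw [Function.update_apply]
      split
      · next h => rw [h]
      · exact hI t ht1 (by omega)
    · rintro t s'' - - ⟨ht, h⟩
      exact ⟨ht.trans (by decide), h⟩
  rintro t₅ s₅ - hag₅ ⟨ht₅, -, hI⟩
  simp only [Store.setReg_reg, reduceCtorEq, Reg.aux.injEq, Nat.reduceEqDiff, if_false, hM₃]
    at ht₅ hI
  simp only [Com.cost, Expr.cost] at ht₁ ht₂ ht₄
  have hE := hX₃.congr fun k h1 h2 => hI k h1 (by omega)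
  refine ⟨by omega, (hag₅.reg rV rfl).trans (by simp), hE, fun t t' h1 h2 h3 => ?_⟩
  have h4 := hE.mem t h1 (by omega)
  have h5 := hE.mem t' (by omega) h3
  refine sub_lt_sub_of_le (hsub h4) (hsub h5) (hE.inj t t' h1 h2 h3) ?_
  rw [← hf.lt_iff _ _ (.inl h5) (.inl h4), hI t h1 (by omega), hI t' (by omega) (by omega)]
  have := e₃ t t' h1 h2 h3
  omega

/-- Lists the dropped positions of the current level and sorts them by their suffixes, using the
ranks of the windows at the current level and the ranks of the suffixes of the next level. -/
def ascendDropped : Com :=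
  .seq (.assign rM (.lit 0))
  (.seq (forUp rI (.lit 1) (.reg rC)
    (.seq (.assign rT (.get aPos (.bin .add (.reg rO) (.reg rI))))
    (.cond (.bin .mod (.bin .div (.bin .sub (.reg .n) (.reg rT)) (.reg rH)) (.lit 3))
      .skip
      (.seq (.assign rM (.bin .add (.reg rM) (.lit 1)))
        (.put aX (.reg rM) (.reg rT))))))
  (.seq (.assign rK (.reg rC))
  (.seq (.assign rD (.reg rH))
  (.seq (sortBy aRk)
  (.seq (.assign rD (.lit 0))
  (sortBy aNm))))))

/-- The suffix at a dropped position consists of a window and a suffix at the level below, whose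
rank is known. Two passes of the sort suffice. -/
theorem ascendDropped_runs {N n j : ℕ} {X : ℕ → ℕ} {s : Store} (hN : 4 * n + 20 < N)
    (hjn : 3 ^ j ≤ n)
    (hrn : s.reg .n = n) (hrO : s.reg rO = sampleOffset n j) (hrC : s.reg rC = (sample n j).card)
    (hrH : s.reg rH = 3 ^ j)
    (hpos : Enum (sample n j).card (fun k => s.arr aPos (sampleOffset n j + k)) (sample n j))
    (hf : Ranks n (sample n j) (window n X (3 ^ j)) (s.arr aNm))
    (hg : Ranks n (sample n (j + 1)) (fun p => sub X p n) (s.arr aRk)) :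
    Runs N ascendDropped s fun t s' => t ≤ 500 * ((sample n j).card + 1) ∧
      s'.reg rM = (dropped n j).card ∧
      SuffixSorted n X (dropped n j).card (s'.arr aX) (dropped n j) := by
  have ho := sampleOffset_le n j
  have hm' := card_sample_succ n j
  have hsub := sample_subset n j
  have hdc : (dropped n j).card ≤ (sample n j).card := Finset.card_filter_le _ _
  have hdS : dropped n j ⊆ sample n j := Finset.filter_subset _ _
  have hin : ∀ p ∈ dropped n j, p ≤ n := fun p hp => (Finset.mem_Icc.mp (hsub (hdS hp))).2
  set m := (sample n j).card with hm
  set O := sampleOffset n j with hO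
  set d := (dropped n j).card with hd
  refine Runs.seq ((Runs.straight (by omega) (Q := fun s' => s' = s.setReg rM 0)
    (by simp [Com.wp, Expr.Safe, Expr.val]; omega)).mono ?_)
  rintro t₁ s₁ - - ⟨ht₁, rfl⟩
  let I : ℕ → Store → Prop := fun k s' => s'.reg rM ≤ k - 1 ∧
    Enum (s'.reg rM) (s'.arr aX)
      (((Finset.Icc 1 (k - 1)).image (fun k => s.arr aPos (O + k))).filter
      (fun p => (n - p) / 3 ^ j % 3 = 0))
  refine Runs.seq ?_
  refine (Runs.forUp (by omega) (L := 1) (b := 25) I rfl rfl (by decide) (by omega)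
    (by omega) (by simp [hrC]; omega) ?_ ?_).mono ?_
  · exact ⟨by simp, by simpa using Enum.nil⟩
  · rintro k s' hk1 hk2 hf hag hk ⟨hI1, hI2⟩
    have hk2' : k ≤ m := by simpa [hrC] using hk2
    have h1 : s'.reg .n = n := (hag.reg .n rfl).trans (by simp [hrn])
    have h2 : s'.reg rO = O := (hag.reg rO rfl).trans (by simp [hrO])
    have h3 : s'.reg rH = 3 ^ j := (hag.reg rH rfl).trans (by simp [hrH])
    have h5 : s'.arr aPos = s.arr aPos := (hag.arr aPos rfl).trans (by simp)
    have h6 := filter_image_Icc (l := fun k => s.arr aPos (O + k))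
      (P := fun p => (n - p) / 3 ^ j % 3 = 0) hk1
    have h7 := hpos.notMem_prefix (P := fun p => (n - p) / 3 ^ j % 3 = 0) hk1 hk2'
    refine (Runs.straight (by omega) (Q := I (k + 1)) ?_).mono ?_
    · simp only [Com.wp, Expr.Safe, Expr.val, Op.Safe, Op.apply, Store.setReg_reg,
        Store.setReg_arr, Store.setArr_arr, Store.setArr_reg, if_true, if_false, reduceCtorEq,
        Reg.aux.injEq, Arr.aux.injEq, Nat.reduceEqDiff, hk, h1, h2, h3, h5, true_and, and_true]
      refine ⟨by omega, by omega, fun hv => ?_, fun hv => ?_⟩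
      · rw [if_neg hv] at h6
        refine ⟨?_, ?_⟩
        · show s'.reg rM ≤ _
          omega
        · rw [Nat.add_sub_cancel, h6]
          exact hI2
      · rw [if_pos hv] at h6
        refine ⟨⟨by omega, by omega⟩, ?_, ?_⟩ <;> simp only [Store.setReg_reg,
          Store.setReg_arr, Store.setArr_arr, Store.setArr_reg, if_true, if_false, reduceCtorEq,
          Reg.aux.injEq, Arr.aux.injEq, Nat.reduceEqDiff, OfNat.ofNat_ne_zero]
        · omega
        · rw [Nat.add_sub_cancel, h6]
          refine hI2.filter_step h7 (fun i hi1 hi2 => ?_) ?_ rfl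
          · rw [Function.update_of_ne (by omega)]
          · simp
    · rintro t s'' - - ⟨ht, h⟩
      exact ⟨ht.trans (by decide), h⟩
  rintro t₂ s₂ - hag₂ ⟨ht₂, -, hI1, hI2⟩
  simp only [Store.setReg_reg, reduceCtorEq, Reg.aux.injEq, Nat.reduceEqDiff, if_false, hrC,
    Nat.add_sub_cancel, hpos.image_eq] at ht₂ hI2
  change Enum _ _ (dropped n j) at hI2
  have hM₂ : s₂.reg rM = d := hI2.card_eq
  rw [hM₂] at hI2
  have hC₂ : s₂.reg rC = m := (hag₂.reg rC rfl).trans (by simpa using hrC)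
  have hH₂ : s₂.reg rH = 3 ^ j := (hag₂.reg rH rfl).trans (by simpa using hrH)
  have hN₂ : s₂.arr aNm = s.arr aNm := (hag₂.arr aNm rfl).trans (by simp)
  have hR₂ : s₂.arr aRk = s.arr aRk := (hag₂.arr aRk rfl).trans (by simp)
  refine Runs.seq ((Runs.straight (by omega) (Q := fun s' => s' = s₂.setReg rK m)
    (by simp [Com.wp, Expr.Safe, Expr.val, hC₂])).mono ?_)
  rintro t₃ s₃ - - ⟨ht₃, rfl⟩
  refine Runs.seq
    ((Runs.straight (by omega) (Q := fun s' => s' = (s₂.setReg rK m).setReg rD (3 ^ j))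
    (by simp [Com.wp, Expr.Safe, Expr.val, hH₂])).mono ?_)
  rintro t₄ s₄ - - ⟨ht₄, rfl⟩
  refine Runs.seq ((sortBy_runs (m := d) (K := m) (D := 3 ^ j) (by decide) (by decide)
    (by omega) (by omega) (by omega) (by simpa using hM₂) (by simp) (by simp)
    (fun i h1 h2 => ?_) (fun i h1 h2 => ?_)).mono ?_)
  · have := hin _ (hI2.mem i h1 h2)
    simp only [Store.setReg_arr]; omega
  · simp only [Store.setReg_arr, hR₂]
    have := hg.le_card (add_mem_of_dropped (hI2.mem i h1 h2))
    omega
  rintro t₅ s₅ - hag₅ ⟨ht₅, hs₅⟩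
  simp only [Store.setReg_arr, hR₂] at hs₅
  have hX₅ := hI2.of_stablySorted hs₅
  have hM₅ : s₅.reg rM = d := (hag₅.reg rM rfl).trans (by simpa using hM₂)
  have hK₅ : s₅.reg rK = m := (hag₅.reg rK rfl).trans (by simp)
  have hN₅ : s₅.arr aNm = s.arr aNm := (hag₅.arr aNm rfl).trans (by simpa using hN₂)
  refine Runs.seq ((Runs.straight (by omega) (Q := fun s' => s' = s₅.setReg rD 0)
    (by simp [Com.wp, Expr.Safe, Expr.val]; omega)).mono ?_)
  rintro t₆ s₆ - - ⟨ht₆, rfl⟩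
  refine (sortBy_runs (m := d) (K := m) (D := 0) (by decide) (by decide)
    (by omega) (by omega) (by omega) (by simpa using hM₅) (by simpa using hK₅) (by simp)
    (fun i h1 h2 => ?_) (fun i h1 h2 => ?_)).mono ?_
  · have := hin _ (hX₅.mem i h1 h2)
    simp only [Store.setReg_arr]; omega
  · simp only [Store.setReg_arr, hN₅]
    exact hf.le_card (.inl (hdS (hX₅.mem i h1 h2)))
  rintro t₇ s₇ - hag₇ ⟨ht₇, hs₇⟩
  simp only [Store.setReg_arr, hN₅, Nat.add_zero] at hs₇
  have hX₇ := hX₅.of_stablySorted hs₇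
  have e₅ := hs₅.sorted (fun _ _ => True) (fun _ _ _ _ _ => trivial)
  have e₇ := hs₇.sorted (fun p q => s.arr aRk (p + 3 ^ j) < s.arr aRk (q + 3 ^ j) ∨
    (s.arr aRk (p + 3 ^ j) = s.arr aRk (q + 3 ^ j) ∧ True)) e₅
  simp only [Com.cost, Expr.cost] at ht₁ ht₃ ht₄ ht₆
  refine ⟨by omega, (hag₇.reg rM rfl).trans (by simpa using hM₅), hX₇, fun t t' h1 h2 h3 => ?_⟩
  have h4 := hX₇.mem t h1 (by omega)
  have h5 := hX₇.mem t' (by omega) h3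
  refine sub_lt_sub_of_le (hsub (hdS h4)) (hsub (hdS h5)) (hX₇.inj t t' h1 h2 h3) ?_
  rw [suffix_lt_iff (a := 3 ^ j), ← hf.lt_iff _ _ (.inl (hdS h5)) (.inl (hdS h4)),
    ← hf.eq_iff (.inl (hdS h5)) (.inl (hdS h4)),
    ← hg.lt_iff _ _ (add_mem_of_dropped h5) (add_mem_of_dropped h4)]
  have := e₇ t t' h1 h2 h3
  omega

/-! ### Merging -/

/-- The sorted lists `A[1, v]` and `B[1, m]` have been merged into `out`, up to their entries
before `a` and `b`. The entries are elements of `S`, which are compared by their images under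
`W`. -/
structure Merged (W : ℕ → List ℕ) (S : Finset ℕ) (A B out : ℕ → ℕ) (v m a b : ℕ) : Prop where
  le_a : 1 ≤ a ∧ a ≤ v + 1
  le_b : 1 ≤ b ∧ b ≤ m + 1
  mem : ∀ t, 1 ≤ t → t + 1 < a + b → out t ∈ S
  cov_a : ∀ i, 1 ≤ i → i < a → ∃ t, 1 ≤ t ∧ t + 1 < a + b ∧ out t = A i
  cov_b : ∀ i, 1 ≤ i → i < b → ∃ t, 1 ≤ t ∧ t + 1 < a + b ∧ out t = B i
  sorted : ∀ t t', 1 ≤ t → t < t' → t' + 1 < a + b → W (out t) < W (out t')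
  lt_a : ∀ t i, 1 ≤ t → t + 1 < a + b → a ≤ i → i ≤ v → W (out t) < W (A i)
  lt_b : ∀ t i, 1 ≤ t → t + 1 < a + b → b ≤ i → i ≤ m → W (out t) < W (B i)

section Merge

variable {W : ℕ → List ℕ} {S : Finset ℕ} {A B out out' : ℕ → ℕ} {v m a b : ℕ}

theorem Merged.swap (h : Merged W S A B out v m a b) : Merged W S B A out m v b a where
  le_a := h.le_b
  le_b := h.le_a
  mem t h1 h2 := h.mem t h1 (by omega)
  cov_a i h1 h2 := by
    obtain ⟨t, h3, h4, h5⟩ := h.cov_b i h1 h2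
    exact ⟨t, h3, by omega, h5⟩
  cov_b i h1 h2 := by
    obtain ⟨t, h3, h4, h5⟩ := h.cov_a i h1 h2
    exact ⟨t, h3, by omega, h5⟩
  sorted t t' h1 h2 h3 := h.sorted t t' h1 h2 (by omega)
  lt_a t i h1 h2 h3 h4 := h.lt_b t i h1 (by omega) h3 h4
  lt_b t i h1 h2 h3 h4 := h.lt_a t i h1 (by omega) h3 h4

theorem Merged.start : Merged W S A B out v m 1 1 where
  le_a := by omega
  le_b := by omega
  mem t h1 h2 := by omega
  cov_a i h1 h2 := by omega
  cov_b i h1 h2 := by omega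
  sorted t t' h1 h2 h3 := by omega
  lt_a t i h1 h2 h3 h4 := by omega
  lt_b t i h1 h2 h3 h4 := by omega

/-- Taking the next entry from the first list. -/
theorem Merged.take (h : Merged W S A B out v m a b) (ha : a ≤ v) (hS : A a ∈ S)
    (hA : ∀ t t', 1 ≤ t → t < t' → t' ≤ v → W (A t) < W (A t'))
    (hB : ∀ t t', 1 ≤ t → t < t' → t' ≤ m → W (B t) < W (B t'))
    (hab : b ≤ m → W (A a) < W (B b)) (hout : ∀ t, t + 1 < a + b → out' t = out t)
    (hk : out' (a + b - 1) = A a) : Merged W S A B out' v m (a + 1) b := by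
  obtain ⟨ha1, ha2⟩ := h.le_a
  obtain ⟨hb1, hb2⟩ := h.le_b
  refine ⟨by omega, by omega, fun t h1 h2 => ?_, fun i h1 h2 => ?_, fun i h1 h2 => ?_,
    fun t t' h1 h2 h3 => ?_, fun t i h1 h2 h3 h4 => ?_, fun t i h1 h2 h3 h4 => ?_⟩
  · rcases Nat.lt_or_ge (t + 1) (a + b) with h5 | h5
    · rw [hout t h5]; exact h.mem t h1 h5
    · rw [show t = a + b - 1 by omega, hk]; exact hS
  · rcases Nat.lt_or_ge i a with h5 | h5
    · obtain ⟨t, h6, h7, h8⟩ := h.cov_a i h1 h5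
      exact ⟨t, h6, by omega, by rw [hout t h7, h8]⟩
    · exact ⟨a + b - 1, by omega, by omega, by rw [hk, show i = a by omega]⟩
  · obtain ⟨t, h6, h7, h8⟩ := h.cov_b i h1 h2
    exact ⟨t, h6, by omega, by rw [hout t h7, h8]⟩
  · rw [hout t (by omega)]
    rcases Nat.lt_or_ge (t' + 1) (a + b) with h5 | h5
    · rw [hout t' h5]; exact h.sorted t t' h1 h2 h5
    · rw [show t' = a + b - 1 by omega, hk]
      exact h.lt_a t a h1 (by omega) le_rfl ha
  · rcases Nat.lt_or_ge (t + 1) (a + b) with h5 | h5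
    · rw [hout t h5]; exact h.lt_a t i h1 h5 (by omega) h4
    · rw [show t = a + b - 1 by omega, hk]
      exact hA a i ha1 (by omega) h4
  · rcases Nat.lt_or_ge (t + 1) (a + b) with h5 | h5
    · rw [hout t h5]; exact h.lt_b t i h1 h5 h3 h4
    · rw [show t = a + b - 1 by omega, hk]
      rcases h3.eq_or_lt with rfl | h3
      · exact hab h4
      · exact (hab (by omega)).trans (hB b i hb1 h3 h4)

end Merge

/-- The comparison of a position of the next level with a dropped one. After one or two steps
both positions belong to the next level or lie beyond the end. -/
theorem merge_compare {n j : ℕ} {X f g : ℕ → ℕ} {p q : ℕ}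
    (hf : Ranks n (sample n j) (window n X (3 ^ j)) f)
    (hg : Ranks n (sample n (j + 1)) (fun p => sub X p n) g)
    (hq : q ∈ sample n (j + 1)) (hp : p ∈ dropped n j) :
    (sub X q n < sub X p n ↔ if f q = f p then
      (if (n - q) / 3 ^ j % 3 = 2 then g (q + 3 ^ j) < g (p + 3 ^ j)
      else if f (q + 3 ^ j) = f (p + 3 ^ j) then
        g (q + 3 ^ j + 3 ^ j) < g (p + 3 ^ j + 3 ^ j)
      else f (q + 3 ^ j) < f (p + 3 ^ j)) else f q < f p) := by
  have hp1 := add_mem_of_dropped hp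
  rw [mem_sample_succ] at hq
  rw [mem_dropped] at hp
  rw [suffix_lt_iff (a := 3 ^ j), ← hf.lt_iff q p (.inl hq.1) (.inl hp.1),
    ← hf.eq_iff (.inl hq.1) (.inl hp.1)]
  split
  · next h =>
    simp only [h, lt_self_iff_false, true_and, false_or]
    have hq' := sample_div_step hq.1
    split
    · next h2 =>
      rw [hg.lt_iff _ _ _ hp1]
      rcases hq' with h3 | h3
      · exact .inr h3.1
      · exact .inl (mem_sample_succ.mpr ⟨h3.1, by omega⟩)
    · next h2 =>
      have h3 : q + 3 ^ j ∈ sample n j ∧ (n - (q + 3 ^ j)) / 3 ^ j % 3 = 0 := by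
        rcases hq' with h3 | h3
        · omega
        · exact ⟨h3.1, by omega⟩
      have h4 := add_mem_of_dropped (mem_dropped.mpr h3)
      have h5 : p + 3 ^ j ∈ sample n j ∨ n < p + 3 ^ j := sample_add n (.inl hp.1)
      have h6 : p + 3 ^ j + 3 ^ j ∈ sample n (j + 1) ∨ n < p + 3 ^ j + 3 ^ j := by
        rcases hp1 with h6 | h6
        · have h7 := sample_div_step (mem_sample_succ.mp h6).1
          have h8 := sample_div_step hp.1
          rcases h7 with h7 | h7
          · exact .inr h7.1
          · have h9 : n < p + 3 ^ j ∨ p + 3 ^ j ≤ n := lt_or_ge _ _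
            have h10 := Finset.mem_Icc.mp (sample_subset _ _ h6)
            exact .inl (mem_sample_succ.mpr ⟨h7.1, by omega⟩)
        · exact .inr (Nat.lt_add_right _ h6)
      rw [suffix_lt_iff (a := 3 ^ j), ← hf.lt_iff _ _ (.inl h3.1) h5, ← hf.eq_iff (.inl h3.1) h5,
        ← hg.lt_iff _ _ h4 h6]
      split <;> omega
  · next h => simp [h]

/-- Decides which list the next entry is taken from. -/
def mergeChoose : Com :=
  .cond (.bin .le (.reg rA) (.reg rV))
    (.cond (.bin .le (.reg rB) (.reg rM))
      (.seq (.assign rT (.get aA (.reg rA)))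
      (.seq (.assign rU (.get aX (.reg rB)))
      (.cond (.bin .eq (.get aNm (.reg rT)) (.get aNm (.reg rU)))
        (.cond (.bin .eq (.bin .mod (.bin .div (.bin .sub (.reg .n) (.reg rT)) (.reg rH)) (.lit 3))
            (.lit 2))
          (.assign rF (.bin .lt (.get aRk (.bin .add (.reg rT) (.reg rH)))
            (.get aRk (.bin .add (.reg rU) (.reg rH)))))
          (.cond (.bin .eq (.get aNm (.bin .add (.reg rT) (.reg rH)))
              (.get aNm (.bin .add (.reg rU) (.reg rH))))
            (.assign rF (.bin .lt (.get aRk (.bin .add (.bin .add (.reg rT) (.reg rH)) (.reg rH)))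
              (.get aRk (.bin .add (.bin .add (.reg rU) (.reg rH)) (.reg rH)))))
            (.assign rF (.bin .lt (.get aNm (.bin .add (.reg rT) (.reg rH)))
              (.get aNm (.bin .add (.reg rU) (.reg rH)))))))
        (.assign rF (.bin .lt (.get aNm (.reg rT)) (.get aNm (.reg rU)))))))
      (.assign rF (.lit 1)))
    (.assign rF (.lit 0))

/-- Takes the next entry. -/
def mergeTake : Com :=
  .cond (.reg rF)
    (.seq (.put aOut (.reg rI) (.get aA (.reg rA)))
      (.assign rA (.bin .add (.reg rA) (.lit 1))))
    (.seq (.put aOut (.reg rI) (.get aX (.reg rB)))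
      (.assign rB (.bin .add (.reg rB) (.lit 1))))

/-- Merges the positions of the level below with the others and ranks all of them. -/
def ascendMerge : Com :=
  .seq (.assign rA (.lit 1))
  (.seq (.assign rB (.lit 1))
  (.seq (forUp rI (.lit 1) (.reg rC) (.seq mergeChoose mergeTake))
  (forUp rI (.lit 1) (.reg rC) (.put aRk (.get aOut (.reg rI)) (.reg rI)))))

/-- The first list is chosen only if its next entry exists and is smaller than that of the other
list, or the latter is used up, and likewise for the second list. -/
theorem mergeChoose_runs {N n j a b : ℕ} {X : ℕ → ℕ} {s : Store} (hN : 4 * n + 20 < N)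
    (hjn : 3 ^ j ≤ n)
    (hrn : s.reg .n = n) (hrH : s.reg rH = 3 ^ j) (hrV : s.reg rV = (sample n (j + 1)).card)
    (hrM : s.reg rM = (dropped n j).card) (hrA : s.reg rA = a) (hrB : s.reg rB = b)
    (ha1 : 1 ≤ a) (hb1 : 1 ≤ b) (hab : a ≤ (sample n (j + 1)).card ∨ b ≤ (dropped n j).card)
    (hA : SuffixSorted n X (sample n (j + 1)).card (s.arr aA) (sample n (j + 1)))
    (hB : SuffixSorted n X (dropped n j).card (s.arr aX) (dropped n j))
    (hf : Ranks n (sample n j) (window n X (3 ^ j)) (s.arr aNm))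
    (hg : Ranks n (sample n (j + 1)) (fun p => sub X p n) (s.arr aRk)) :
    Runs N mergeChoose s fun t s' => t ≤ 60 ∧
      (s'.reg rF ≠ 0 → a ≤ (sample n (j + 1)).card ∧
        (b ≤ (dropped n j).card → sub X (s.arr aA a) n < sub X (s.arr aX b) n)) ∧
      (s'.reg rF = 0 → b ≤ (dropped n j).card ∧
        (a ≤ (sample n (j + 1)).card → sub X (s.arr aX b) n < sub X (s.arr aA a) n)) := by
  set v := (sample n (j + 1)).card with hv
  set d := (dropped n j).card with hd
  set q := s.arr aA a with hq
  set p := s.arr aX b with hp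
  have hval : ∀ r : ℕ, a ≤ v → b ≤ d → (r ≠ 0 ↔ sub X q n < sub X p n) →
      (r ≠ 0 → a ≤ v ∧ (b ≤ d → sub X q n < sub X p n)) ∧
      (r = 0 → b ≤ d ∧ (a ≤ v → sub X p n < sub X q n)) := by
    intro r h1 h2 h3
    refine ⟨fun h4 => ⟨h1, fun _ => h3.mp h4⟩, fun h4 => ⟨h2, fun _ => ?_⟩⟩
    have hqS := hA.enum.mem a ha1 h1
    have hpS := hB.enum.mem b hb1 h2
    refine sub_lt_sub_of_le (sample_subset _ _ (mem_dropped.mp hpS).1) (sample_subset _ _ hqS) ?_ ?_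
    · intro h5
      rw [← hq, mem_sample_succ] at hqS
      rw [← hp, mem_dropped, h5] at hpS
      exact hqS.2 hpS.2
    · exact fun h5 => (h3.mpr h5) h4
  refine (Runs.straight (by omega) (Q := fun s' =>
    (s'.reg rF ≠ 0 → a ≤ v ∧ (b ≤ d → sub X q n < sub X p n)) ∧
    (s'.reg rF = 0 → b ≤ d ∧ (a ≤ v → sub X p n < sub X q n))) ?_).mono ?_
  · simp only [mergeChoose, Com.wp, Expr.Safe, Expr.val, Op.Safe, Op.apply, Store.setReg_reg,
      Store.setReg_arr, Store.setArr_reg, if_true, if_false, reduceCtorEq,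
      Reg.aux.injEq, Arr.aux.injEq, Nat.reduceEqDiff, hrn, hrH, hrV, hrM, hrA, hrB, ← hq, ← hp,
      true_and, and_true]
    refine ⟨fun h1 => ⟨fun h2 => ?_, fun h2 => ?_⟩, fun h1 => ?_⟩
    · have h1' : a ≤ v := by by_contra h; simp [h] at h1
      have h2' : b ≤ d := by by_contra h; simp [h] at h2
      have hqS := hA.enum.mem a ha1 h1'
      have hpS := hB.enum.mem b hb1 h2'
      rw [← hq] at hqS
      rw [← hp] at hpS
      have hcmp := merge_compare hf hg hqS hpS
      have hqn := Finset.mem_Icc.mp (sample_subset _ _ hqS)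
      have hpn := Finset.mem_Icc.mp (sample_subset _ _ (mem_dropped.mp hpS).1)
      refine ⟨fun h3 => ⟨⟨by omega, by omega⟩, fun h4 => ⟨by omega, ?_⟩, fun h4 =>
        ⟨by omega, fun h5 => ⟨by omega, ?_⟩, fun h5 => ⟨by omega, ?_⟩⟩⟩, fun h3 => ?_⟩
      · have h3' : s.arr aNm q = s.arr aNm p := by by_contra h; simp [h] at h3
        have h4' : (n - q) / 3 ^ j % 3 = 2 := by by_contra h; simp [h] at h4
        rw [if_pos h3', if_pos h4'] at hcmp
        exact hval _ h1' h2' (by rw [hcmp]; split <;> simp_all)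
      · have h3' : s.arr aNm q = s.arr aNm p := by by_contra h; simp [h] at h3
        have h4' : (n - q) / 3 ^ j % 3 ≠ 2 := by intro h; simp [h] at h4
        have h5' : s.arr aNm (q + 3 ^ j) = s.arr aNm (p + 3 ^ j) := by
          by_contra h; simp [h] at h5
        rw [if_pos h3', if_neg h4', if_pos h5'] at hcmp
        exact hval _ h1' h2' (by rw [hcmp]; split <;> simp_all)
      · have h3' : s.arr aNm q = s.arr aNm p := by by_contra h; simp [h] at h3
        have h4' : (n - q) / 3 ^ j % 3 ≠ 2 := by intro h; simp [h] at h4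
        have h5' : s.arr aNm (q + 3 ^ j) ≠ s.arr aNm (p + 3 ^ j) := by
          intro h; simp [h] at h5
        rw [if_pos h3', if_neg h4', if_neg h5'] at hcmp
        exact hval _ h1' h2' (by rw [hcmp]; split <;> simp_all)
      · have h3' : s.arr aNm q ≠ s.arr aNm p := by intro h; simp [h] at h3
        rw [if_neg h3'] at hcmp
        exact hval _ h1' h2' (by rw [hcmp]; split <;> simp_all)
    · have h1' : a ≤ v := by by_contra h; simp [h] at h1
      have h2' : ¬ b ≤ d := by intro h; simp [h] at h2
      refine ⟨by omega, fun _ => ⟨h1', fun h => absurd h h2'⟩, fun h => h.elim⟩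
    · have h1' : ¬ a ≤ v := by intro h; simp [h] at h1
      refine ⟨by omega, fun h => absurd rfl h, fun _ =>
        ⟨hab.resolve_left h1', fun h => absurd h h1'⟩⟩
  · rintro t s'' - - ⟨ht, h⟩
    exact ⟨ht.trans (by decide), h⟩

theorem sample_eq_union (n j : ℕ) : sample n j = sample n (j + 1) ∪ dropped n j := by
  ext p
  rw [Finset.mem_union, mem_sample_succ, mem_dropped, ← and_or_left]
  exact ⟨fun h => ⟨h, (ne_or_eq _ _)⟩, fun h => h.1⟩

theorem card_dropped (n j : ℕ) :
    (sample n (j + 1)).card + (dropped n j).card = (sample n j).card := by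
  rw [sample_eq_union n j, Finset.card_union_of_disjoint]
  rw [Finset.disjoint_left]
  intro p hp hp'
  exact (mem_sample_succ.mp hp).2 (mem_dropped.mp hp').2

/-- The places of the positions in the merged list are the ranks of their suffixes. -/
theorem Merged.ranks {n v d : ℕ} {X A B out f : ℕ → ℕ} {S S₁ S₂ : Finset ℕ}
    (h : Merged (fun p => sub X p n) S A B out v d (v + 1) (d + 1)) (hA : Enum v A S₁)
    (hB : Enum d B S₂) (hS : S = S₁ ∪ S₂) (hc : v + d = S.card) (hSn : S ⊆ Finset.Icc 1 n)
    (hf : ∀ t, 1 ≤ t → t ≤ v + d → f (out t) = t) (hz : ∀ p, n < p → f p = 0) :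
    Ranks n S (fun p => sub X p n) f := by
  have hsurj : ∀ p ∈ S, ∃ t, 1 ≤ t ∧ t ≤ v + d ∧ out t = p := by
    intro p hp
    rcases Finset.mem_union.mp (hS ▸ hp) with hp | hp
    · obtain ⟨i, h1, h2, rfl⟩ := hA.surj p hp
      obtain ⟨t, h3, h4, h5⟩ := h.cov_a i h1 (by omega)
      exact ⟨t, h3, by omega, h5⟩
    · obtain ⟨i, h1, h2, rfl⟩ := hB.surj p hp
      obtain ⟨t, h3, h4, h5⟩ := h.cov_b i h1 (by omega)
      exact ⟨t, h3, by omega, h5⟩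
  refine Ranks.of_mem (fun p hp => sub_eq_nil X hp) (fun p hp => ?_) hz (fun p hp => ?_)
    (fun p hp => ?_) (fun p hp q hq => ?_)
  · have := Finset.mem_Icc.mp (hSn hp)
    rw [Ne, ← List.length_eq_zero_iff, length_sub]
    omega
  · obtain ⟨t, h1, h2, rfl⟩ := hsurj p hp
    rw [hf t h1 h2]; exact h1
  · obtain ⟨t, h1, h2, rfl⟩ := hsurj p hp
    rw [hf t h1 h2]; omega
  · obtain ⟨t, h1, h2, rfl⟩ := hsurj p hp
    obtain ⟨t', h3, h4, rfl⟩ := hsurj q hq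
    rw [hf t h1 h2, hf t' h3 h4]
    rcases Nat.lt_trichotomy t t' with h5 | h5 | h5
    · exact iff_of_true h5 (h.sorted t t' h1 h5 (by omega))
    · subst h5; simp
    · exact iff_of_false (by omega) (lt_asymm (h.sorted t' t h3 h5 (by omega)))

theorem ascendMerge_runs {N n j : ℕ} {X : ℕ → ℕ} {s : Store} (hN : 4 * n + 20 < N)
    (hjn : 3 ^ j ≤ n)
    (hrn : s.reg .n = n) (hrH : s.reg rH = 3 ^ j) (hrV : s.reg rV = (sample n (j + 1)).card)
    (hrM : s.reg rM = (dropped n j).card) (hrC : s.reg rC = (sample n j).card)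
    (hA : SuffixSorted n X (sample n (j + 1)).card (s.arr aA) (sample n (j + 1)))
    (hB : SuffixSorted n X (dropped n j).card (s.arr aX) (dropped n j))
    (hf : Ranks n (sample n j) (window n X (3 ^ j)) (s.arr aNm))
    (hg : Ranks n (sample n (j + 1)) (fun p => sub X p n) (s.arr aRk)) :
    Runs N ascendMerge s fun t s' => t ≤ 200 * ((sample n j).card + 1) ∧
      Ranks n (sample n j) (fun p => sub X p n) (s'.arr aRk) := by
  have ho := sampleOffset_le n j
  have hc := card_dropped n j
  have hU := sample_eq_union n j
  set v := (sample n (j + 1)).card with hv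
  set d := (dropped n j).card with hd
  set m := (sample n j).card with hm
  refine Runs.seq ((Runs.straight (by omega) (Q := fun s' => s' = s.setReg rA 1)
    (by simp [Com.wp, Expr.Safe, Expr.val]; omega)).mono ?_)
  rintro t₁ s₁ - - ⟨ht₁, rfl⟩
  refine Runs.seq ((Runs.straight (by omega) (Q := fun s' => s' = (s.setReg rA 1).setReg rB 1)
    (by simp [Com.wp, Expr.Safe, Expr.val]; omega)).mono ?_)
  rintro t₂ s₂ - - ⟨ht₂, rfl⟩
  let A := s.arr aA
  let B := s.arr aX
  let W : ℕ → List ℕ := fun p => sub X p n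
  let I : ℕ → Store → Prop := fun k s' => k + 1 = s'.reg rA + s'.reg rB ∧
    Merged W (sample n j) A B (s'.arr aOut) v d (s'.reg rA) (s'.reg rB)
  refine Runs.seq ?_
  refine (Runs.forUp (by omega) (L := 1) (b := 80) I rfl rfl (by decide) (by omega)
    (by omega) (by simp [hrC]; omega) ?_ ?_).mono ?_
  · exact ⟨by simp, Merged.start⟩
  · rintro k s' hk1 hk2 hf' hag hk ⟨hI1, hI2⟩
    have hk2' : k ≤ m := by simpa [hrC] using hk2
    have h1 : s'.reg .n = n := (hag.reg .n rfl).trans (by simp [hrn])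
    have h2 : s'.reg rH = 3 ^ j := (hag.reg rH rfl).trans (by simp [hrH])
    have h3 : s'.reg rV = v := (hag.reg rV rfl).trans (by simp [hrV])
    have h4 : s'.reg rM = d := (hag.reg rM rfl).trans (by simp [hrM])
    have h5 : s'.arr aA = A := (hag.arr aA rfl).trans (by simp [A])
    have h6 : s'.arr aX = B := (hag.arr aX rfl).trans (by simp [B])
    have h7 : s'.arr aNm = s.arr aNm := (hag.arr aNm rfl).trans (by simp)
    have h8 : s'.arr aRk = s.arr aRk := (hag.arr aRk rfl).trans (by simp)
    obtain ⟨ha1, ha2⟩ := hI2.le_a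
    obtain ⟨hb1, hb2⟩ := hI2.le_b
    refine Runs.seq ((mergeChoose_runs hN hjn h1 h2 h3 h4 rfl rfl ha1 hb1 (by omega)
      (by rw [h5]; exact hA) (by rw [h6]; exact hB) (by rw [h7]; exact hf)
      (by rw [h8]; exact hg)).mono ?_)
    rintro t s₃ - hag₃ ⟨ht, hF1, hF2⟩
    rw [h5, h6] at hF1 hF2
    have h9 : s₃.reg rA = s'.reg rA := hag₃.reg rA rfl
    have h10 : s₃.reg rB = s'.reg rB := hag₃.reg rB rfl
    have h11 : s₃.reg rI = k := (hag₃.reg rI rfl).trans hk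
    have h12 : s₃.arr aA = A := (hag₃.arr aA rfl).trans h5
    have h13 : s₃.arr aX = B := (hag₃.arr aX rfl).trans h6
    have h14 : s₃.arr aOut = s'.arr aOut := hag₃.arr aOut rfl
    refine (Runs.straight (by omega) (Q := I (k + 1)) ?_).mono ?_
    · simp only [mergeTake, Com.wp, Expr.Safe, Expr.val, Op.Safe, Op.apply, Store.setReg_reg,
        Store.setReg_arr, Store.setArr_arr, Store.setArr_reg, if_true, if_false, reduceCtorEq,
        Reg.aux.injEq, Arr.aux.injEq, Nat.reduceEqDiff, h9, h10, h11, h12, h13, true_and, and_true]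
      refine ⟨fun hF => ?_, fun hF => ?_⟩
      · obtain ⟨h15, h16⟩ := hF1 hF
        refine ⟨⟨by omega, by omega⟩, ?_, ?_⟩ <;> simp only [Store.setReg_reg,
          Store.setReg_arr, Store.setArr_arr, Store.setArr_reg, if_true, if_false, reduceCtorEq,
          Reg.aux.injEq, Arr.aux.injEq, Nat.reduceEqDiff, h9, h10, h14]
        · omega
        · refine hI2.take h15 ?_ hA.lt hB.lt h16 (fun t ht => ?_) ?_
          · rw [hU]; exact Finset.mem_union_left _ (hA.enum.mem _ ha1 h15)
          · rw [Function.update_of_ne (by omega)]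
          · rw [show s'.reg rA + s'.reg rB - 1 = k by omega, Function.update_self]
      · obtain ⟨h15, h16⟩ := hF2 hF
        refine ⟨⟨by omega, by omega⟩, ?_, ?_⟩ <;> simp only [Store.setReg_reg,
          Store.setReg_arr, Store.setArr_arr, Store.setArr_reg, if_true, if_false, reduceCtorEq,
          Reg.aux.injEq, Arr.aux.injEq, Nat.reduceEqDiff, h9, h10, h14]
        · omega
        · refine (hI2.swap.take h15 ?_ hB.lt hA.lt h16 (fun t ht => ?_) ?_).swap
          · rw [hU]; exact Finset.mem_union_right _ (hB.enum.mem _ hb1 h15)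
          · rw [Function.update_of_ne (by omega)]
          · rw [show s'.reg rB + s'.reg rA - 1 = k by omega, Function.update_self]
    · rintro t' s'' - - ⟨ht', h⟩
      simp only [mergeTake, Com.cost, Expr.cost] at ht'
      exact ⟨by omega, h⟩
  rintro t₃ s₃ - hag₃ ⟨ht₃, -, hI1, hI2⟩
  simp only [Store.setReg_reg, reduceCtorEq, Reg.aux.injEq, Nat.reduceEqDiff, if_false, hrC]
    at ht₃ hI1
  have ha := hI2.le_a
  have hb := hI2.le_b
  rw [show s₃.reg rA = v + 1 by omega, show s₃.reg rB = d + 1 by omega] at hI2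
  have hC₃ : s₃.reg rC = m := (hag₃.reg rC rfl).trans (by simpa using hrC)
  have hR₃ : s₃.arr aRk = s.arr aRk := (hag₃.arr aRk rfl).trans (by simp)
  let O := s₃.arr aOut
  have hin : ∀ t, 1 ≤ t → t ≤ m → O t ≤ n := fun t h1 h2 =>
    (Finset.mem_Icc.mp (sample_subset _ _ (hI2.mem t h1 (by omega)))).2
  have hinj : ∀ t t', 1 ≤ t → t < t' → t' ≤ m → O t ≠ O t' := fun t t' h1 h2 h3 h4 => by
    have := hI2.sorted t t' h1 h2 (by omega)
    change W (O t) < W (O t') at this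
    rw [h4] at this
    exact lt_irrefl _ this
  refine (Runs.forUp (by omega) (L := 1) (b := 10) (fun k s' => (∀ t, 1 ≤ t → t < k →
    s'.arr aRk (O t) = t) ∧ ∀ p, n < p → s'.arr aRk p = 0) rfl rfl (by decide) (by omega)
    (by omega) (by omega) ?_ ?_).mono ?_
  · exact ⟨fun t h1 h2 => by omega, fun p hp => by
      rw [Store.setReg_arr, hR₃]; exact hg.zero p hp⟩
  · rintro k s' hk1 hk2 hf' hag hk ⟨hJ1, hJ2⟩
    have h3 : s'.arr aOut = O := hag.arr aOut rfl
    have h4 := hin k hk1 (by omega)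
    refine (Runs.straight (by omega) (Q := fun s' => (∀ t, 1 ≤ t → t < k + 1 →
      s'.arr aRk (O t) = t) ∧ ∀ p, n < p → s'.arr aRk p = 0) ?_).mono ?_
    · simp only [Com.wp, Expr.Safe, Expr.val, Op.Safe, Op.apply, Store.setReg_reg,
        Store.setReg_arr, Store.setArr_arr, Store.setArr_reg, if_true, if_false, reduceCtorEq,
        Reg.aux.injEq, Arr.aux.injEq, Nat.reduceEqDiff, hk, h3, true_and, and_true]
      refine ⟨fun t ht1 ht2 => ?_, fun p hp => ?_⟩
      · rcases Nat.lt_or_ge t k with h5 | h5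
        · rw [Function.update_of_ne (hinj t k ht1 h5 (by omega))]
          exact hJ1 t ht1 h5
        · rw [show t = k by omega, Function.update_self]
      · rw [Function.update_of_ne (by omega)]
        exact hJ2 p hp
    · rintro t s'' - - ⟨ht, h⟩
      exact ⟨ht.trans (by decide), h⟩
  rintro t₄ s₄ - - ⟨ht₄, -, hJ1, hJ2⟩
  rw [hC₃] at ht₄ hJ1
  simp only [Com.cost, Expr.cost] at ht₁ ht₂
  exact ⟨by omega, hI2.ranks hA.enum hB.enum hU hc (sample_subset _ _)
    (fun t h1 h2 => hJ1 t h1 (by omega)) hJ2⟩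

/-- Passes from a level to the level above. -/
def ascendStep : Com :=
  .seq ascendRestore (.seq ascendSamples (.seq ascendDropped ascendMerge))

theorem ascendStep_runs {N n j : ℕ} {X : ℕ → ℕ} {s : Store} (hN : 4 * n + 20 < N)
    (hjn : 3 ^ j ≤ n) (h : Ascending n X (j + 1) s) :
    Runs N ascendStep s fun t s' => t ≤ 1100 * ((sample n j).card + 1) ∧ Ascending n X j s' := by
  have hm' := card_sample_succ n j
  refine Runs.seq ((ascendRestore_runs hN h).mono ?_)
  rintro t₁ s₁ - hag₁ ⟨ht₁, hH₁, hL₁, hO₁, hC₁, hM₁, hX₁, hr₁⟩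
  refine Runs.seq ((ascendSamples_runs hN hM₁ hX₁
    (by rw [hag₁.arr aRk rfl]; exact h.ranks)).mono ?_)
  rintro t₂ s₂ - hag₂ ⟨ht₂, hV₂, hA₂⟩
  have hn₂ : s₂.reg .n = n := (hag₂.reg .n rfl).trans ((hag₁.reg .n rfl).trans h.reg_n)
  have hH₂ : s₂.reg rH = 3 ^ j := (hag₂.reg rH rfl).trans hH₁
  have hO₂ : s₂.reg rO = sampleOffset n j := (hag₂.reg rO rfl).trans hO₁
  have hC₂ : s₂.reg rC = (sample n j).card := (hag₂.reg rC rfl).trans hC₁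
  have hP₂ : s₂.arr aPos = s.arr aPos := (hag₂.arr aPos rfl).trans (hag₁.arr aPos rfl)
  have hN₂ : s₂.arr aNm = s₁.arr aNm := hag₂.arr aNm rfl
  have hR₂ : s₂.arr aRk = s.arr aRk := (hag₂.arr aRk rfl).trans (hag₁.arr aRk rfl)
  refine Runs.seq ((ascendDropped_runs hN hjn hn₂ hO₂ hC₂ hH₂
    (by rw [hP₂]; exact (h.saved j (by omega)).1) (by rw [hN₂]; exact hr₁)
    (by rw [hR₂]; exact h.ranks)).mono ?_)
  rintro t₃ s₃ - hag₃ ⟨ht₃, hM₃, hB₃⟩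
  have hN₃ : s₃.arr aNm = s₁.arr aNm := (hag₃.arr aNm rfl).trans hN₂
  have hR₃ : s₃.arr aRk = s.arr aRk := (hag₃.arr aRk rfl).trans hR₂
  refine (ascendMerge_runs (X := X) hN hjn ((hag₃.reg .n rfl).trans hn₂)
    ((hag₃.reg rH rfl).trans hH₂)
    ((hag₃.reg rV rfl).trans hV₂) hM₃ ((hag₃.reg rC rfl).trans hC₂)
    (by rw [hag₃.arr aA rfl]; exact hA₂) hB₃ (by rw [hN₃]; exact hr₁)
    (by rw [hR₃]; exact h.ranks)).mono ?_
  rintro t₄ s₄ - hag₄ ⟨ht₄, hr₄⟩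
  refine ⟨by omega, (hag₄.reg .n rfl).trans ((hag₃.reg .n rfl).trans hn₂),
    (hag₄.reg rH rfl).trans ((hag₃.reg rH rfl).trans hH₂),
    (hag₄.reg rO rfl).trans ((hag₃.reg rO rfl).trans hO₂),
    (hag₄.reg rC rfl).trans ((hag₃.reg rC rfl).trans hC₂),
    (hag₄.reg rL rfl).trans ((hag₃.reg rL rfl).trans ((hag₂.reg rL rfl).trans hL₁)),
    fun i hi => (h.saved i (by omega)).congr (fun l _ => ?_) (fun l _ => ?_),
    fun i hi => ?_, fun p hp => ?_, hr₄⟩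
  · rw [hag₄.arr aPos rfl, hag₃.arr aPos rfl, hP₂]
  · rw [hag₄.arr aSav rfl, hag₃.arr aSav rfl, hag₂.arr aSav rfl, hag₁.arr aSav rfl]
  · rw [hag₄.arr aMs rfl, hag₃.arr aMs rfl, hag₂.arr aMs rfl, hag₁.arr aMs rfl]
    exact h.counts i (by omega)
  · rw [hag₄.arr aNm rfl, hN₃]
    exact hr₁.zero p hp

/-- Ascends to the level of all positions. -/
def ascend : Com := .loop (.reg rL) ascendStep

/-- The time of a step is proportional to the number of positions of the level that it reaches,
which is larger than that of the level left behind by at least a third of itself. -/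
theorem ascend_runs {N n j : ℕ} {X : ℕ → ℕ} {s : Store} (hN : 4 * n + 20 < N)
    (hjn : 3 ^ j ≤ 3 * n + 1) (h : Ascending n X j s) :
    Runs N ascend s fun t s' => t ≤ 20000 * (n + 1) ∧ Ascending n X 0 s' := by
  -- The positions that are still missing pay for those of the next level, and the level number
  -- pays for the constant cost of a step.
  refine (Runs.loop (by omega) (fun s' => ∃ j, 3 ^ j ≤ 3 * n + 1 ∧ Ascending n X j s')
    (fun s' => 2000 * (3 * n - 3 * s'.reg rC + s'.reg rL)) ⟨j, hjn, h⟩ ?_).mono ?_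
  · rintro s' - - ⟨j, hj3, hj⟩
    refine ⟨by simp [Expr.Safe, Op.Safe], fun hv => ?_⟩
    simp only [Expr.val, hj.reg_L] at hv
    obtain ⟨j, rfl⟩ := Nat.exists_eq_succ_of_ne_zero hv
    have hpow : 3 ^ (j + 1) = 3 ^ j + 3 ^ j + 3 ^ j := by ring
    simp only [Nat.succ_eq_add_one] at hj3 hj
    refine (ascendStep_runs hN (by omega) hj).mono ?_
    rintro t s'' - - ⟨ht, h''⟩
    have hm' := card_sample_succ n j
    have ho := sampleOffset_le n j
    refine ⟨⟨j, by omega, h''⟩, ?_⟩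
    rw [hj.reg_C, hj.reg_L, h''.reg_C, h''.reg_L]
    simp only [Expr.cost]
    omega
  · rintro t s' - - ⟨⟨i, hi3, hi⟩, hv, ht⟩
    simp only [Expr.val, hi.reg_L] at hv
    subst hv
    have hj3 : j < 3 ^ j := Nat.lt_pow_self (by omega)
    rw [h.reg_C, h.reg_L] at ht
    simp only [Expr.cost] at ht
    exact ⟨by omega, hi⟩

/-! ### Sorting the suffixes -/

theorem window_one {n p : ℕ} (X : ℕ → ℕ) (hp : p ≤ n) : window n X 1 p = [X p] := by
  refine List.ext_getElem ?_ fun k h1 h2 => ?_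
  · simp only [window, List.length_take, length_sub, List.length_singleton]; omega
  · simp only [List.length_singleton] at h2
    obtain rfl : k = 0 := by omega
    simp [window, getElem_sub]

/-- Sets up the level of all positions, with the characters as ranks of the windows of
length `1`. -/
def sortInit : Com :=
  .seq (.assign rH (.lit 1))
  (.seq (.assign rO (.lit 0))
  (.seq (.assign rC (.reg .n))
  (.seq (.assign rL (.lit 0))
  (forUp rI (.lit 1) (.reg .n)
    (.seq (.assign rT (.get .T (.bin .sub (.bin .add (.reg .n) (.lit 1)) (.reg rI))))
    (.seq (.put aPos (.reg rI) (.reg rI))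
    (.seq (.put aNm (.reg rI) (.reg rT))
      (.put aSav (.reg rI) (.reg rT)))))))))

theorem sortInit_runs {N n : ℕ} {X : ℕ → ℕ} {s : Store} (hN : 4 * n + 20 < N)
    (hrn : s.reg .n = n) (hT : ∀ p, 1 ≤ p → p ≤ n → s.arr .T (n + 1 - p) = X p)
    (hX : ∀ p, 1 ≤ p → p ≤ n → 1 ≤ X p ∧ X p ≤ n)
    (h1 : ∀ p, s.arr aNm p = 0) (h2 : ∀ p, s.arr aNm2 p = 0) :
    Runs N sortInit s fun t s' => t ≤ 50 * (n + 1) ∧ Descending n X 0 s' := by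
  refine Runs.seq ((Runs.straight (by omega) (Q := fun s' => s' = s.setReg rH 1)
    (by simp [Com.wp, Expr.Safe, Expr.val]; omega)).mono ?_)
  rintro t₁ s₁ - - ⟨ht₁, rfl⟩
  refine Runs.seq ((Runs.straight (by omega) (Q := fun s' => s' = (s.setReg rH 1).setReg rO 0)
    (by simp [Com.wp, Expr.Safe, Expr.val]; omega)).mono ?_)
  rintro t₂ s₂ - - ⟨ht₂, rfl⟩
  refine Runs.seq ((Runs.straight (by omega) (Q := fun s' => s' =
    ((s.setReg rH 1).setReg rO 0).setReg rC n)
    (by simp [Com.wp, Expr.Safe, Expr.val, hrn])).mono ?_)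
  rintro t₃ s₃ - - ⟨ht₃, rfl⟩
  refine Runs.seq ((Runs.straight (by omega) (Q := fun s' => s' =
    (((s.setReg rH 1).setReg rO 0).setReg rC n).setReg rL 0)
    (by simp [Com.wp, Expr.Safe, Expr.val]; omega)).mono ?_)
  rintro t₄ s₄ - - ⟨ht₄, rfl⟩
  let I : ℕ → Store → Prop := fun k s' =>
    (∀ p, 1 ≤ p → p < k → s'.arr aPos p = p ∧ s'.arr aNm p = X p ∧ s'.arr aSav p = X p) ∧
    ∀ p, n < p → s'.arr aNm p = 0
  refine (Runs.forUp (by omega) (L := 1) (b := 20) I rfl rfl (by decide) (by omega)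
    (by omega) (by simp [hrn]; omega) ?_ ?_).mono ?_
  · exact ⟨fun p h1 h2 => by omega, fun p _ => by simpa using h1 p⟩
  · rintro k s' hk1 hk2 hf' hag hk ⟨hI1, hI2⟩
    have hk2' : k ≤ n := by simpa [hrn] using hk2
    have h3 : s'.reg .n = n := (hag.reg .n rfl).trans (by simpa using hrn)
    have h4 : s'.arr .T (n + 1 - k) = X k := by
      rw [hag.arr .T rfl]; simpa using hT k hk1 hk2'
    refine (Runs.straight (by omega) (Q := I (k + 1)) ?_).mono ?_
    · simp only [Com.wp, Expr.Safe, Expr.val, Op.Safe, Op.apply, Store.setReg_reg,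
        Store.setReg_arr, Store.setArr_arr, Store.setArr_reg, if_true, if_false, reduceCtorEq,
        Reg.aux.injEq, Arr.aux.injEq, Nat.reduceEqDiff, hk, h3, h4, true_and, and_true]
      refine ⟨⟨by omega, by omega⟩, fun p hp1 hp2 => ?_, fun p hp => ?_⟩ <;>
        simp only [Store.setReg_reg, Store.setReg_arr, Store.setArr_arr, Store.setArr_reg, if_true,
          if_false, reduceCtorEq, Reg.aux.injEq, Arr.aux.injEq, Nat.reduceEqDiff,
          OfNat.ofNat_ne_zero]
      · rcases Nat.lt_or_ge p k with h5 | h5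
        · rw [Function.update_of_ne (by omega), Function.update_of_ne (by omega),
            Function.update_of_ne (by omega)]
          exact hI1 p hp1 h5
        · obtain rfl : p = k := by omega
          simp
      · rw [Function.update_of_ne (by omega)]
        exact hI2 p hp
    · rintro t s'' - - ⟨ht, h⟩
      exact ⟨ht.trans (by decide), h⟩
  rintro t₅ s₅ - hag₅ ⟨ht₅, -, hI1, hI2⟩
  simp only [Store.setReg_reg, reduceCtorEq, Reg.aux.injEq, Nat.reduceEqDiff, if_false, hrn]
    at ht₅ hI1
  simp only [Com.cost, Expr.cost] at ht₁ ht₂ ht₃ ht₄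
  have hr : Ranks n (sample n 0) (window n X (3 ^ 0)) (s₅.arr aNm) := by
    have hmem : ∀ p ∈ sample n 0, 1 ≤ p ∧ p ≤ n := fun p hp => Finset.mem_Icc.mp hp
    have hval : ∀ p ∈ sample n 0, s₅.arr aNm p = X p := fun p hp =>
      (hI1 p (hmem p hp).1 (by have := (hmem p hp).2; omega)).2.1
    refine Ranks.of_mem (fun p hp => window_of_lt hp)
      (fun p hp => window_ne_nil (by positivity) (hmem p hp).2) hI2 (fun p hp => ?_)
      (fun p hp => ?_) (fun p hp q hq => ?_)
    · rw [hval p hp]; exact (hX p (hmem p hp).1 (hmem p hp).2).1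
    · rw [hval p hp, card_sample_zero]; exact (hX p (hmem p hp).1 (hmem p hp).2).2
    · rw [hval p hp, hval q hq, pow_zero, window_one X (hmem p hp).2, window_one X (hmem q hq).2]
      rw [List.cons_lt_cons_iff]; simp
  have hO : ∀ k, sampleOffset n 0 + k = k := fun k => by simp [sampleOffset]
  refine ⟨by omega, (hag₅.reg .n rfl).trans (by simpa using hrn),
    (hag₅.reg rH rfl).trans (by simp), (hag₅.reg rO rfl).trans (by simp [sampleOffset]),
    (hag₅.reg rC rfl).trans (by simp [card_sample_zero]), (hag₅.reg rL rfl).trans (by simp),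
    fun i hi => ?_, fun i hi => by omega, hr, fun p _ => ?_⟩
  · obtain rfl : i = 0 := by omega
    simp only [LevelSaved, hO, card_sample_zero]
    refine ⟨⟨fun k h1 h2 => ?_, fun p hp => ?_, fun k k' h1 h2 h3 => ?_⟩, _, hr, fun k h1 h2 => ?_⟩
    · rw [(hI1 k h1 (by omega)).1]; exact Finset.mem_Icc.mpr ⟨h1, h2⟩
    · obtain ⟨h1, h2⟩ := Finset.mem_Icc.mp hp
      exact ⟨p, h1, h2, (hI1 p h1 (by omega)).1⟩
    · rw [(hI1 k h1 (by omega)).1, (hI1 k' (by omega) (by omega)).1]; omega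
    · obtain ⟨e1, e2, e3⟩ := hI1 k h1 (by omega)
      rw [e1, e2, e3]
  · rw [hag₅.arr aNm2 rfl]; simpa using h2 p

/-- Computes the inverse suffix array of the reversed text in `aRk`. -/
def suffixSort : Com := .seq sortInit (.seq descend (.seq turn ascend))

/-- At the level `0`, which consists of all positions, the ranks are the inverse suffix array. The
initial zeros of the arrays serve as the ranks of the empty strings beyond the end. -/
theorem suffixSort_runs {N n : ℕ} {X : ℕ → ℕ} {s : Store} (hN : 4 * n + 20 < N)
    (hrn : s.reg .n = n) (hT : ∀ p, 1 ≤ p → p ≤ n → s.arr .T (n + 1 - p) = X p)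
    (hX : ∀ p, 1 ≤ p → p ≤ n → 1 ≤ X p ∧ X p ≤ n)
    (h1 : ∀ p, s.arr aNm p = 0) (h2 : ∀ p, s.arr aNm2 p = 0) (h3 : ∀ p, s.arr aRk p = 0) :
    Runs N suffixSort s fun t s' => t ≤ 30000 * (n + 1) ∧
      ∀ p ∈ Finset.Icc 1 n, s'.arr aRk p = ISA n X p := by
  refine Runs.seq ((sortInit_runs hN hrn hT hX h1 h2).mono ?_)
  rintro t₁ s₁ - hag₁ ⟨ht₁, hD₁⟩
  refine Runs.seq ((descend_runs hN hD₁).mono ?_)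
  rintro t₂ s₂ - hag₂ ⟨ht₂, j, hj1, hj2, hD₂⟩
  refine Runs.seq ((turn_runs hN hj1 hD₂ fun p _ => ?_).mono ?_)
  · rw [hag₂.arr aRk rfl, hag₁.arr aRk rfl]; exact h3 p
  rintro t₃ s₃ - - ⟨ht₃, hA₃⟩
  refine (ascend_runs hN hj2 hA₃).mono ?_
  rintro t₄ s₄ - - ⟨ht₄, hA₄⟩
  refine ⟨by omega, fun p hp => ?_⟩
  have hr := hA₄.ranks
  have hnil : ∀ p ∈ Finset.Icc 1 n, sub X p n ≠ [] := fun p hp => by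
    rw [Finset.mem_Icc] at hp
    rw [Ne, ← List.length_eq_zero_iff, length_sub]
    omega
  refine eq_ISA X (fun p hp => ?_) (fun p hp q hq => hr.lt_iff p q (.inl hp) (.inl hq)) hp
  rw [Finset.mem_Icc]
  refine ⟨hr.pos (sub_eq_nil X (by omega)) hp (hnil p hp), ?_⟩
  have := hr.le p hp
  rwa [card_sample_zero] at this

/-! ### The suffix array and the Burrows-Wheeler transform -/

/-- The length of the current match. -/
abbrev rE : Reg := .aux 16

/-- The suffix array. -/
abbrev aSA : Arr := .aux 12

/-- Computes the suffix array and the Burrows-Wheeler transform from the inverse suffix array. -/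
def fillSA : Com :=
  forUp rI (.lit 1) (.reg .n)
    (.seq (.assign rT (.get aRk (.reg rI)))
    (.seq (.put .ISA (.reg rI) (.reg rT))
    (.seq (.put aSA (.reg rT) (.reg rI))
      (.cond (.bin .eq (.reg rI) (.lit 1))
        (.put .BWT (.reg rT) (.get .T (.lit 1)))
        (.put .BWT (.reg rT) (.get .T (.bin .sub (.bin .add (.reg .n) (.lit 2)) (.reg rI))))))))

theorem ISA_inj {n : ℕ} (X : ℕ → ℕ) {p q : ℕ} (hp : p ∈ Finset.Icc 1 n) (hq : q ∈ Finset.Icc 1 n)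
    (h : ISA n X p = ISA n X q) : p = q := by
  rw [← SA_ISA X hp, h, SA_ISA X hq]

/-- What holds for the place of every position in the suffix array holds for every index. -/
theorem forall_of_ISA {n : ℕ} (X : ℕ → ℕ) {P : ℕ → Prop}
    (h : ∀ p, 1 ≤ p → p < n + 1 → P (ISA n X p)) : ∀ i ∈ Finset.Icc 1 n, P i := by
  intro i hi
  have h1 := Finset.mem_Icc.mp (SA_mem X hi)
  have h2 := h (SA n X i) h1.1 (by omega)
  rwa [ISA_SA X hi] at h2

theorem fillSA_runs {N n : ℕ} {T : ℕ → ℕ} {s : Store} (hN : 4 * n + 20 < N)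
    (hrn : s.reg .n = n) (hT : ∀ p, 1 ≤ p → p ≤ n → s.arr .T p = T p)
    (hR : ∀ p ∈ Finset.Icc 1 n, s.arr aRk p = ISA n (rev n T) p) :
    Runs N fillSA s fun t s' => t ≤ 50 * (n + 1) ∧
      (∀ p ∈ Finset.Icc 1 n, s'.arr .ISA p = ISA n (rev n T) p) ∧
      (∀ i ∈ Finset.Icc 1 n, s'.arr aSA i = SA n (rev n T) i) ∧
      ∀ i ∈ Finset.Icc 1 n, s'.arr .BWT i = BWTr n T i := by
  set X := rev n T with hX
  let R : ℕ → ℕ := ISA n X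
  have hB : ∀ p, 1 ≤ p → p ≤ n → BWTr n T (R p) = if p = 1 then T 1 else T (n + 2 - p) := by
    intro p h1 h2
    rw [BWTr, ← hX, BWT, SA_ISA X (by simp; omega)]
    simp only [hX, rev]
    split
    · rw [show n + 1 - n = 1 by omega]
    · rw [show n + 1 - (p - 1) = n + 2 - p by omega]
  let I : ℕ → Store → Prop := fun k s' =>
    (∀ p, 1 ≤ p → p < k → s'.arr .ISA p = R p) ∧
    (∀ p, 1 ≤ p → p < k → s'.arr aSA (R p) = p) ∧
    ∀ p, 1 ≤ p → p < k → s'.arr .BWT (R p) = BWTr n T (R p)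
  refine (Runs.forUp (by omega) (L := 1) (b := 30) I rfl rfl (by decide) (by omega)
    (by omega) (by omega) ?_ ?_).mono ?_
  · exact ⟨fun p _ _ => by omega, fun p _ _ => by omega, fun p _ _ => by omega⟩
  · rintro k s' hk1 hk2 hf' hag hk ⟨hI1, hI2, hI3⟩
    rw [hrn] at hk2
    have h3 : s'.reg .n = n := (hag.reg .n rfl).trans hrn
    have h4 : s'.arr aRk k = R k := by
      rw [hag.arr aRk rfl]; exact hR k (by simp; omega)
    have h5 : ∀ p, 1 ≤ p → p ≤ n → s'.arr .T p = T p := by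
      intro p; rw [hag.arr .T rfl]; exact hT p
    have hinj : ∀ p, 1 ≤ p → p < k → R p ≠ R k := fun p h1 h2 h => by
      have := ISA_inj X (by simp; omega) (by simp; omega) h
      omega
    have hBk := hB k hk1 hk2
    have hstep : ∀ v, v = BWTr n T (R k) →
        I (k + 1) (((((s'.setReg rT (R k)).setArr .ISA k (R k)).setArr aSA (R k) k).setArr .BWT
          (R k) v).setReg rI (k + 1)) := by
      rintro v rfl
      refine ⟨fun p hp1 hp2 => ?_, fun p hp1 hp2 => ?_, fun p hp1 hp2 => ?_⟩ <;>
        simp only [Store.setReg_reg, Store.setReg_arr, Store.setArr_arr, Store.setArr_reg, if_true,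
          if_false, reduceCtorEq] <;>
        rcases Nat.lt_or_ge p k with h5 | h5
      · rw [Function.update_of_ne (by omega)]; exact hI1 p hp1 h5
      · rw [show p = k by omega, Function.update_self]
      · rw [Function.update_of_ne (hinj p hp1 h5)]; exact hI2 p hp1 h5
      · rw [show p = k by omega, Function.update_self]
      · rw [Function.update_of_ne (hinj p hp1 h5)]; exact hI3 p hp1 h5
      · rw [show p = k by omega, Function.update_self]
    refine (Runs.straight (by omega) (Q := fun s' => I (k + 1) (s'.setReg rI (k + 1))) ?_).mono ?_
    · simp only [Com.wp, Expr.Safe, Expr.val, Op.Safe, Op.apply, Store.setReg_reg,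
        Store.setReg_arr, Store.setArr_arr, Store.setArr_reg, if_true, if_false, reduceCtorEq,
        Reg.aux.injEq, Arr.aux.injEq, Nat.reduceEqDiff, hk, h3, h4, true_and, and_true]
      refine ⟨by omega, fun hc => ⟨by omega, hstep _ ?_⟩, fun hc =>
        ⟨⟨by omega, by omega⟩, hstep _ ?_⟩⟩
      · have h6 : k = 1 := by by_contra h; simp [h] at hc
        rw [hBk, if_pos h6]; exact h5 1 (by omega) (by omega)
      · have h6 : k ≠ 1 := by intro h; simp [h] at hc
        rw [hBk, if_neg h6]; exact h5 _ (by omega) (by omega)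
    · rintro t s'' - - ⟨ht, h⟩
      exact ⟨ht.trans (by decide), h⟩
  rintro t s' - - ⟨ht, -, hI1, hI2, hI3⟩
  rw [hrn] at ht hI1 hI2 hI3
  refine ⟨by omega, fun p hp => ?_, forall_of_ISA X fun p h1 h2 => ?_,
    forall_of_ISA X fun p h1 h2 => hI3 p h1 h2⟩
  · rw [Finset.mem_Icc] at hp
    exact hI1 p hp.1 (by omega)
  · rw [SA_ISA X (by simp; omega)]
    exact hI2 p h1 h2

/-! ### The longest common prefix array -/

theorem LCP_ISA {n p : ℕ} (X : ℕ → ℕ) (hp : p ∈ Finset.Icc 1 n) (h : 1 < ISA n X p) :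
    LCP n X (ISA n X p) = lcp (sub X (SA n X (ISA n X p - 1)) n) (sub X p n) := by
  rw [LCP, if_neg (by omega), SA_ISA X hp]

/-- When the first character of a suffix is removed, the longest common prefix with its
predecessor loses at most one character. -/
theorem LCP_ISA_succ {n p : ℕ} (X : ℕ → ℕ) (hp : 1 ≤ p) (hpn : p + 1 ≤ n) :
    LCP n X (ISA n X p) ≤ LCP n X (ISA n X (p + 1)) + 1 := by
  have hpm : p ∈ Finset.Icc 1 n := by simp; omega
  have hpm' : p + 1 ∈ Finset.Icc 1 n := by simp; omega
  have hi := Finset.mem_Icc.mp (ISA_mem X hpm)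
  rcases Nat.lt_or_ge (LCP n X (ISA n X p)) 2 with h | h
  · omega
  have h1 : 1 < ISA n X p := by
    by_contra hc
    rw [show ISA n X p = 1 by omega, LCP_one] at h
    omega
  have hlt := sub_SA_lt X (i := ISA n X p - 1) (j := ISA n X p) (n := n) (by omega) (by omega) hi.2
  have hq := Finset.mem_Icc.mp (SA_mem X (i := ISA n X p - 1) (n := n) (by simp; omega))
  rw [LCP_ISA X hpm h1] at h ⊢
  rw [SA_ISA X hpm] at hlt
  set q := SA n X (ISA n X p - 1) with hqd
  set k := lcp (sub X q n) (sub X p n) with hk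
  obtain ⟨k1, k2, k3⟩ := le_lcp_sub_iff.mp hk.le
  have hqm' : q + 1 ∈ Finset.Icc 1 n := by simp; omega
  have hlt' : sub X (q + 1) n < sub X (p + 1) n := by
    have h2 := k3 0 (by omega)
    simp only [Nat.add_zero] at h2
    rw [suffix_lt_iff (a := 1), window_one X hq.2, window_one X (by omega), h2] at hlt
    rcases hlt with h3 | h3
    · exact absurd h3 (lt_irrefl _)
    · exact h3.2
  have hle : k - 1 ≤ lcp (sub X (q + 1) n) (sub X (p + 1) n) := by
    refine le_lcp_sub_iff.mpr ⟨by omega, by omega, fun l hl => ?_⟩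
    have := k3 (l + 1) (by omega)
    rwa [show q + 1 + l = q + (l + 1) by omega, show p + 1 + l = p + (l + 1) by omega]
  have hi' := Finset.mem_Icc.mp (ISA_mem X hpm')
  have hj' := Finset.mem_Icc.mp (ISA_mem X hqm')
  have hji : ISA n X (q + 1) < ISA n X (p + 1) := by
    rcases Nat.lt_trichotomy (ISA n X (q + 1)) (ISA n X (p + 1)) with h2 | h2 | h2
    · exact h2
    · rw [ISA_inj X hqm' hpm' h2] at hlt'
      exact absurd hlt' (lt_irrefl _)
    · have := sub_SA_lt X hi'.1 h2 hj'.2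
      rw [SA_ISA X hqm', SA_ISA X hpm'] at this
      exact absurd this (lt_asymm hlt')
  have h3 := le_lcp_SA_iff X hj'.1 hji hi'.2 (k := k - 1)
  rw [SA_ISA X hqm', SA_ISA X hpm'] at h3
  have := h3.mp hle (ISA n X (p + 1)) (by simp; omega)
  omega

/-- The next characters decide whether a common prefix can be extended, if the string is followed
by characters that do not occur in it. -/
theorem next_char_eq_iff {n p q l : ℕ} {X Y : ℕ → ℕ} (hp : p ∈ Finset.Icc 1 n)
    (hq : q ∈ Finset.Icc 1 n) (hne : q ≠ p) (hX : ∀ p, 1 ≤ p → p ≤ n → Y p = X p ∧ 1 ≤ X p)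
    (hY : ∀ p, n < p → Y p = 0) (hl : l ≤ lcp (sub X q n) (sub X p n)) :
    Y (q + l) = Y (p + l) ↔ l + 1 ≤ lcp (sub X q n) (sub X p n) := by
  rw [Finset.mem_Icc] at hp hq
  obtain ⟨h1, h2, h3⟩ := le_lcp_sub_iff.mp hl
  rw [le_lcp_sub_iff]
  constructor
  · intro h
    rcases Nat.lt_or_ge n (q + l) with h4 | h4 <;> rcases Nat.lt_or_ge n (p + l) with h5 | h5
    · omega
    · have := hX (p + l) (by omega) h5
      have := hY (q + l) h4
      omega
    · have := hX (q + l) (by omega) h4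
      have := hY (p + l) h5
      omega
    · refine ⟨by omega, by omega, fun i hi => ?_⟩
      rcases Nat.lt_or_ge i l with h6 | h6
      · exact h3 i h6
      · rw [show i = l by omega, ← (hX (q + l) (by omega) h4).1, ← (hX (p + l) (by omega) h5).1, h]
  · rintro ⟨h4, h5, h6⟩
    rw [(hX (q + l) (by omega) (by omega)).1, (hX (p + l) (by omega) (by omega)).1, h6 l (by omega)]

/-- Computes the longest common prefix array, in the order of the positions. -/
def fillLCP : Com :=
  .seq (.assign rI (.lit 1))
  (.seq (.assign rE (.lit 0))
  (.loop (.bin .le (.reg rI) (.reg .n))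
    (.cond (.bin .lt (.lit 1) (.get .ISA (.reg rI)))
      (.seq (.assign rT (.get aSA (.bin .sub (.get .ISA (.reg rI)) (.lit 1))))
        (.cond (.bin .eq
            (.get .T (.bin .sub (.bin .add (.reg .n) (.lit 1)) (.bin .add (.reg rT) (.reg rE))))
            (.get .T (.bin .sub (.bin .add (.reg .n) (.lit 1)) (.bin .add (.reg rI) (.reg rE)))))
          (.assign rE (.bin .add (.reg rE) (.lit 1)))
          (.seq (.put .LCP (.get .ISA (.reg rI)) (.reg rE))
          (.seq (.assign rE (.bin .sub (.reg rE) (.lit 1)))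
            (.assign rI (.bin .add (.reg rI) (.lit 1)))))))
      (.seq (.put .LCP (.get .ISA (.reg rI)) (.lit 0))
        (.assign rI (.bin .add (.reg rI) (.lit 1)))))))

/-- The match in `rE` is a lower bound of the LCP value of the current position, and it is extended
as long as the next characters agree. Beyond the end of the reversed text the program reads the
cell `0` of the text, because subtraction is truncated, and finds there a number that is not a
character. -/
theorem fillLCP_runs {N n : ℕ} {X : ℕ → ℕ} {s : Store} (hN : 4 * n + 20 < N)
    (hrn : s.reg .n = n) (hT : ∀ p, 1 ≤ p → p ≤ n → s.arr .T (n + 1 - p) = X p ∧ 1 ≤ X p)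
    (hT0 : s.arr .T 0 = 0) (hR : ∀ p ∈ Finset.Icc 1 n, s.arr .ISA p = ISA n X p)
    (hA : ∀ i ∈ Finset.Icc 1 n, s.arr aSA i = SA n X i) :
    Runs N fillLCP s fun t s' => t ≤ 200 * (n + 1) ∧
      ∀ i ∈ Finset.Icc 1 n, s'.arr .LCP i = LCP n X i := by
  let R : ℕ → ℕ := ISA n X
  refine Runs.seq ((Runs.straight (by omega) (Q := fun s' => s' = s.setReg rI 1)
    (by simp [Com.wp, Expr.Safe, Expr.val]; omega)).mono ?_)
  rintro t₁ s₁ - - ⟨ht₁, rfl⟩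
  refine Runs.seq ((Runs.straight (by omega) (Q := fun s' => s' = (s.setReg rI 1).setReg rE 0)
    (by simp [Com.wp, Expr.Safe, Expr.val]; omega)).mono ?_)
  rintro t₂ s₂ - - ⟨ht₂, rfl⟩
  let I : ℕ → ℕ → (ℕ → ℕ) → Prop := fun p l A => 1 ≤ p ∧ p ≤ n + 1 ∧ l ≤ n ∧
    (∀ p', 1 ≤ p' → p' < p → A (R p') = LCP n X (R p')) ∧ (p ≤ n → l ≤ LCP n X (R p))
  let J : Store → Prop := fun s' => I (s'.reg rI) (s'.reg rE) (s'.arr .LCP)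
  -- A longer match decreases the second summand. The next position decreases the first one by two,
  -- while the match gets shorter by at most one.
  let Φ : Store → ℕ := fun s' => 60 * (2 * (n + 1 - s'.reg rI) + (n - s'.reg rE))
  refine (Runs.loop (by omega) J Φ ?_ ?_).mono ?_
  · simp only [J, I, Store.setReg_reg, if_true, if_false, reduceCtorEq, Reg.aux.injEq,
      Nat.reduceEqDiff]
    exact ⟨le_rfl, by omega, by omega, fun p' h1 h2 => by omega, fun _ => Nat.zero_le _⟩
  · rintro s' - hag hJ
    have h1 : s'.reg .n = n := (hag.reg .n rfl).trans (by simpa using hrn)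
    have h2 : s'.arr .T = s.arr .T := (hag.arr .T rfl).trans (by simp)
    refine ⟨by simp [Expr.Safe, Op.Safe], fun hv => ?_⟩
    simp only [Expr.val, Op.apply, h1] at hv
    obtain ⟨p, hp⟩ : ∃ p, s'.reg rI = p := ⟨_, rfl⟩
    obtain ⟨l, hl⟩ : ∃ l, s'.reg rE = l := ⟨_, rfl⟩
    simp only [J, hp, hl] at hJ
    obtain ⟨hp1, -, hln, hJ1, hJ2⟩ := hJ
    rw [hp] at hv
    have hpn : p ≤ n := by by_contra h; simp [h] at hv
    have hpm : p ∈ Finset.Icc 1 n := by simp; omega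
    have hi := Finset.mem_Icc.mp (ISA_mem X hpm)
    have h3 : s'.arr .ISA p = R p := by
      rw [hag.arr .ISA rfl]; simpa using hR p hpm
    have hJ2 := hJ2 hpn
    have hnext : ∀ (l' v : ℕ), l' ≤ l → l ≤ l' + 1 → v = LCP n X (R p) → l' ≤ v - 1 →
        I (p + 1) l' (Function.update (s'.arr .LCP) (R p) v) := by
      rintro l' v h4 h4' rfl h5
      refine ⟨by omega, by omega, by omega, fun p' h6 h7 => ?_, fun h6 => ?_⟩
      · rcases Nat.lt_or_ge p' p with h8 | h8
        · rw [Function.update_of_ne]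
          · exact hJ1 p' h6 h8
          · intro h9
            have := ISA_inj X (by simp; omega) hpm h9
            omega
        · rw [show p' = p by omega, Function.update_self]
      · have := LCP_ISA_succ X hp1 h6
        change LCP n X (R p) ≤ LCP n X (R (p + 1)) + 1 at this
        omega
    refine (Runs.straight (by omega) (Q := fun s'' => J s'' ∧ 50 + Φ s'' ≤ Φ s') ?_).mono ?_
    · simp only [Com.wp, Expr.Safe, Expr.val, Op.Safe, Op.apply, Store.setReg_reg,
        Store.setReg_arr, Store.setArr_arr, Store.setArr_reg, if_true, if_false, reduceCtorEq,
        Reg.aux.injEq, Arr.aux.injEq, Nat.reduceEqDiff, hp, hl, h1, h2, h3, true_and, and_true, J,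
          Φ]
      refine ⟨by omega, fun hc => ?_, fun hc => ?_⟩
      · have hc' : 1 < ISA n X p := by by_contra h; simp [R, h] at hc
        have h4 : s'.arr aSA (R p - 1) = SA n X (R p - 1) := by
          rw [hag.arr aSA rfl]; simpa using hA (R p - 1) (by simp [R]; omega)
        have hqm := SA_mem X (i := R p - 1) (n := n) (by simp [R]; omega)
        rw [h4]
        have hq := Finset.mem_Icc.mp hqm
        have hlcp : LCP n X (R p) = _ := LCP_ISA X hpm hc'
        change _ = lcp (sub X (SA n X (R p - 1)) n) _ at hlcp
        have hlt := sub_SA_lt X (i := R p - 1) (j := R p) (n := n) (by simp [R]; omega)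
          (by simp [R]; omega) hi.2
        rw [show SA n X (R p) = p from SA_ISA X hpm] at hlt
        have hne : SA n X (R p - 1) ≠ p := fun h => by
          rw [h] at hlt; exact lt_irrefl _ hlt
        have hchar := next_char_eq_iff (Y := fun p => s.arr .T (n + 1 - p)) hpm hqm hne hT
          (fun p hp => by rw [show n + 1 - p = 0 by omega, hT0]) (hlcp ▸ hJ2)
        rw [← hlcp] at hchar
        set q := SA n X (R p - 1) with hqd
        refine ⟨by omega, ⟨⟨by omega, by omega⟩, ⟨by omega, by omega⟩⟩, fun he => ?_, fun he => ?_⟩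
        · have he' : s.arr .T (n + 1 - (q + l)) = s.arr .T (n + 1 - (p + l)) := by
            by_contra h; simp [h] at he
          have h5 := hchar.mp he'
          have h6 : l + 1 ≤ n := by
            rw [hlcp] at h5
            have := (le_lcp_sub_iff.mp h5).1
            omega
          exact ⟨⟨by omega, by omega⟩, ⟨hp1, by omega, h6, hJ1, fun _ => h5⟩, by omega⟩
        · have he' : ¬ s.arr .T (n + 1 - (q + l)) = s.arr .T (n + 1 - (p + l)) := by
            intro h; simp [h] at he
          rw [hchar] at he'
          exact ⟨by omega, ⟨by omega, by omega⟩, hnext (l - 1) l (by omega) (by omega)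
            (by omega) le_rfl,
            by omega⟩
      · have hc' : R p = 1 := by
          by_contra h
          have : 1 < R p := by simp only [R] at *; omega
          simp [this] at hc
        have h4 : LCP n X (R p) = 0 := by rw [hc']; exact LCP_one X
        exact ⟨by omega, ⟨by omega, by omega⟩, hnext l 0 le_rfl (by omega) h4.symm (by omega),
          by omega⟩
    · rintro t s'' - - ⟨ht, hJ', hΦ⟩
      simp only [Com.cost, Expr.cost] at ht ⊢
      exact ⟨hJ', by omega⟩
  · rintro t s' - hag ⟨hJ, hv, ht⟩
    have h1 : s'.reg .n = n := (hag.reg .n rfl).trans (by simpa using hrn)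
    simp only [Expr.val, Op.apply, h1] at hv
    obtain ⟨hp1, hp2, -, hJ1, -⟩ := hJ
    have hpn : s'.reg rI = n + 1 := by
      by_contra h
      rw [if_pos (by omega)] at hv
      omega
    rw [hpn] at hJ1
    simp only [Φ, Store.setReg_reg, if_true, if_false, reduceCtorEq, Reg.aux.injEq,
      Nat.reduceEqDiff, Expr.cost] at ht
    simp only [Com.cost, Expr.cost] at ht₁ ht₂
    exact ⟨by omega, forall_of_ISA X fun p h2 h3 => hJ1 p h2 h3⟩

/-! ### Previous and next smaller values -/

/-- The number of times that the previous smaller value can be taken before `0` is reached. -/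
def psvDepth (A : ℕ → ℕ) (i : ℕ) : ℕ :=
  if h : i = 0 then 0 else psvDepth A (PSV A i) + 1
termination_by i
decreasing_by exact PSV_lt (by omega)

theorem psvDepth_pos (A : ℕ → ℕ) {i : ℕ} (hi : 1 ≤ i) :
    psvDepth A i = psvDepth A (PSV A i) + 1 := by
  rw [psvDepth, dif_neg (by omega)]

/-- The number of times that the next smaller value can be taken before `n + 1` is reached. -/
def nsvDepth (n : ℕ) (A : ℕ → ℕ) (i : ℕ) : ℕ :=
  if h : n < i then 0 else nsvDepth n A (NSV n A i) + 1
termination_by n + 1 - i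
decreasing_by
  have := lt_NSV (A := A) (not_lt.mp h)
  omega

theorem nsvDepth_pos {n : ℕ} (A : ℕ → ℕ) {i : ℕ} (hi : i ≤ n) :
    nsvDepth n A i = nsvDepth n A (NSV n A i) + 1 := by
  rw [nsvDepth, dif_neg (by omega)]

/-- Computes the previous smaller values; candidates are found by following those that are
already known. -/
def fillPSV : Com :=
  .seq (.assign rI (.lit 1))
  (.seq (.assign rT (.lit 0))
  (.loop (.bin .le (.reg rI) (.reg .n))
    (.cond (.bin .mul (.bin .lt (.lit 0) (.reg rT))
      (.bin .le (.get .LCP (.reg rI)) (.get .LCP (.reg rT))))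
      (.assign rT (.get .PSV (.reg rT)))
      (.seq (.put .PSV (.reg rI) (.reg rT))
      (.seq (.assign rT (.reg rI))
        (.assign rI (.bin .add (.reg rI) (.lit 1))))))))

theorem fillPSV_runs {N n : ℕ} {A : ℕ → ℕ} {s : Store} (hN : 4 * n + 20 < N)
    (hrn : s.reg .n = n) (hA : ∀ i ∈ Finset.Icc 1 n, s.arr .LCP i = A i) :
    Runs N fillPSV s fun t s' => t ≤ 100 * (n + 1) ∧
      ∀ i ∈ Finset.Icc 1 n, s'.arr .PSV i = PSV A i := by
  refine Runs.seq ((Runs.straight (by omega) (Q := fun s' => s' = s.setReg rI 1)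
    (by simp [Com.wp, Expr.Safe, Expr.val]; omega)).mono ?_)
  rintro t₁ s₁ - - ⟨ht₁, rfl⟩
  refine Runs.seq ((Runs.straight (by omega) (Q := fun s' => s' = (s.setReg rI 1).setReg rT 0)
    (by simp [Com.wp, Expr.Safe, Expr.val]; omega)).mono ?_)
  rintro t₂ s₂ - - ⟨ht₂, rfl⟩
  -- The candidate `j` for the index `i`: all values strictly between them are at least the value
  -- at `i`.
  let I : ℕ → ℕ → (ℕ → ℕ) → Prop := fun i j P => 1 ≤ i ∧ i ≤ n + 1 ∧ j < i ∧
    (∀ i', 1 ≤ i' → i' < i → P i' = PSV A i') ∧ (i ≤ n → ∀ h, j < h → h < i → A i ≤ A h)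
  let J : Store → Prop := fun s' => I (s'.reg rI) (s'.reg rT) (s'.arr .PSV)
  -- Following a known value decreases the depth of the candidate. The next index decreases the
  -- first summand by two and becomes a candidate, whose depth is larger by one.
  let Φ : Store → ℕ := fun s' => 30 * (2 * (n + 1 - s'.reg rI) + psvDepth A (s'.reg rT))
  refine (Runs.loop (by omega) J Φ ?_ ?_).mono ?_
  · simp only [J, I, Store.setReg_reg, if_true, if_false, reduceCtorEq, Reg.aux.injEq,
      Nat.reduceEqDiff]
    exact ⟨le_rfl, by omega, by omega, fun p' h1 h2 => by omega, fun _ h h1 h2 => by omega⟩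
  · rintro s' - hag hJ
    have h1 : s'.reg .n = n := (hag.reg .n rfl).trans (by simpa using hrn)
    have h2 : s'.arr .LCP = s.arr .LCP := (hag.arr .LCP rfl).trans (by simp)
    refine ⟨by simp [Expr.Safe, Op.Safe], fun hv => ?_⟩
    simp only [Expr.val, Op.apply, h1] at hv
    obtain ⟨i, hi⟩ : ∃ i, s'.reg rI = i := ⟨_, rfl⟩
    obtain ⟨j, hj⟩ : ∃ j, s'.reg rT = j := ⟨_, rfl⟩
    simp only [J, hi, hj] at hJ
    obtain ⟨hi1, -, hji, hJ1, hJ2⟩ := hJ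
    rw [hi] at hv
    have hin : i ≤ n := by by_contra h; simp [h] at hv
    have hJ2 := hJ2 hin
    have h3 : s.arr .LCP i = A i := hA i (by simp; omega)
    refine (Runs.straight (by omega) (Q := fun s'' => J s'' ∧ 30 + Φ s'' ≤ Φ s') ?_).mono ?_
    · simp only [Com.wp, Expr.Safe, Expr.val, Op.Safe, Op.apply, Store.setReg_reg,
        Store.setReg_arr, Store.setArr_arr, Store.setArr_reg, if_true, if_false, reduceCtorEq,
        Reg.aux.injEq, Arr.aux.injEq, Nat.reduceEqDiff, hi, hj, h1, h2, h3, true_and, and_true, J,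
          Φ]
      refine ⟨⟨by omega, ?_⟩, fun hc => ?_, fun hc => ?_⟩
      · split_ifs <;> omega
      · have hj0 : 0 < j := by by_contra h; simp [h] at hc
        have h4 : s.arr .LCP j = A j := hA j (by simp; omega)
        rw [h4] at hc
        have hle : A i ≤ A j := by by_contra h; simp [h] at hc
        rw [hJ1 j hj0 hji, psvDepth_pos A hj0]
        have h5 := PSV_lt (A := A) hj0
        refine ⟨⟨hi1, by omega, by omega, hJ1, fun _ h h6 h7 => ?_⟩, by omega⟩
        rcases Nat.lt_or_ge j h with h8 | h8
        · exact hJ2 h h8 h7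
        · exact hle.trans (le_of_PSV_lt h6 h8)
      · have h5 : PSV A i = j := by
          refine PSV_eq hji (fun hj0 => ?_) hJ2
          rw [hA j (by simp; omega)] at hc
          by_contra h
          simp [show A i ≤ A j by omega, show 0 < j by omega] at hc
        refine ⟨by omega,
          ⟨by omega, by omega, by omega, fun i' h6 h7 => ?_, fun _ h h6 h7 => by omega⟩, ?_⟩
        · rw [Function.update_apply]
          split
          · next h => rw [h, h5]
          · exact hJ1 i' h6 (by omega)
        · rw [psvDepth_pos A hi1, h5]
          omega
    · rintro t s'' - - ⟨ht, hJ', hΦ⟩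
      simp only [Com.cost, Expr.cost] at ht ⊢
      exact ⟨hJ', by omega⟩
  · rintro t s' - hag ⟨hJ, hv, ht⟩
    have h1 : s'.reg .n = n := (hag.reg .n rfl).trans (by simpa using hrn)
    simp only [Expr.val, Op.apply, h1] at hv
    obtain ⟨hp1, hp2, -, hJ1, -⟩ := hJ
    have hpn : s'.reg rI = n + 1 := by
      by_contra h
      rw [if_pos (by omega)] at hv
      omega
    rw [hpn] at hJ1
    have h0 : psvDepth A 0 = 0 := by rw [psvDepth, dif_pos rfl]
    simp only [Φ, Store.setReg_reg, if_true, if_false, reduceCtorEq, Reg.aux.injEq,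
      Nat.reduceEqDiff, Expr.cost, h0] at ht
    simp only [Com.cost, Expr.cost] at ht₁ ht₂
    refine ⟨by omega, fun i hi => ?_⟩
    rw [Finset.mem_Icc] at hi
    exact hJ1 i hi.1 (by omega)

/-- Computes the next smaller values, from right to left. -/
def fillNSV : Com :=
  .seq (.assign rI (.reg .n))
  (.seq (.assign rT (.bin .add (.reg .n) (.lit 1)))
  (.loop (.reg rI)
    (.cond (.bin .mul (.bin .le (.reg rT) (.reg .n))
      (.bin .le (.get .LCP (.reg rI)) (.get .LCP (.reg rT))))
      (.assign rT (.get .NSV (.reg rT)))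
      (.seq (.put .NSV (.reg rI) (.reg rT))
      (.seq (.assign rT (.reg rI))
        (.assign rI (.bin .sub (.reg rI) (.lit 1))))))))

theorem fillNSV_runs {N n : ℕ} {A : ℕ → ℕ} {s : Store} (hN : 4 * n + 20 < N)
    (hrn : s.reg .n = n) (hA : ∀ i ∈ Finset.Icc 1 n, s.arr .LCP i = A i) :
    Runs N fillNSV s fun t s' => t ≤ 100 * (n + 1) ∧
      ∀ i ∈ Finset.Icc 1 n, s'.arr .NSV i = NSV n A i := by
  refine Runs.seq ((Runs.straight (by omega) (Q := fun s' => s' = s.setReg rI n)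
    (by simp [Com.wp, Expr.Safe, Expr.val, hrn])).mono ?_)
  rintro t₁ s₁ - - ⟨ht₁, rfl⟩
  refine Runs.seq ((Runs.straight (by omega) (Q := fun s' => s' = (s.setReg rI n).setReg rT (n + 1))
    (by simp [Com.wp, Expr.Safe, Expr.val, Op.Safe, Op.apply, hrn]; omega)).mono ?_)
  rintro t₂ s₂ - - ⟨ht₂, rfl⟩
  let I : ℕ → ℕ → (ℕ → ℕ) → Prop := fun i j P => i ≤ n ∧ j ≤ n + 1 ∧ i < j ∧
    (∀ i', i < i' → i' ≤ n → P i' = NSV n A i') ∧ (1 ≤ i → ∀ h, i < h → h < j → A i ≤ A h)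
  let J : Store → Prop := fun s' => I (s'.reg rI) (s'.reg rT) (s'.arr .NSV)
  -- The same potential as for the previous smaller values, from right to left.
  let Φ : Store → ℕ := fun s' => 30 * (2 * s'.reg rI + nsvDepth n A (s'.reg rT))
  refine (Runs.loop (by omega) J Φ ?_ ?_).mono ?_
  · simp only [J, I, Store.setReg_reg, if_true, if_false, reduceCtorEq, Reg.aux.injEq,
      Nat.reduceEqDiff]
    exact ⟨le_rfl, by omega, by omega, fun p' h1 h2 => by omega, fun _ h h1 h2 => by omega⟩
  · rintro s' - hag hJ
    have h1 : s'.reg .n = n := (hag.reg .n rfl).trans (by simpa using hrn)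
    have h2 : s'.arr .LCP = s.arr .LCP := (hag.arr .LCP rfl).trans (by simp)
    refine ⟨by simp [Expr.Safe], fun hv => ?_⟩
    simp only [Expr.val] at hv
    obtain ⟨i, hi⟩ : ∃ i, s'.reg rI = i := ⟨_, rfl⟩
    obtain ⟨j, hj⟩ : ∃ j, s'.reg rT = j := ⟨_, rfl⟩
    simp only [J, hi, hj] at hJ
    obtain ⟨hin, hjn, hji, hJ1, hJ2⟩ := hJ
    rw [hi] at hv
    have hi1 : 1 ≤ i := by omega
    have hJ2 := hJ2 hi1
    have h3 : s.arr .LCP i = A i := hA i (by simp; omega)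
    refine (Runs.straight (by omega) (Q := fun s'' => J s'' ∧ 30 + Φ s'' ≤ Φ s') ?_).mono ?_
    · simp only [Com.wp, Expr.Safe, Expr.val, Op.Safe, Op.apply, Store.setReg_reg,
        Store.setReg_arr, Store.setArr_arr, Store.setArr_reg, if_true, if_false, reduceCtorEq,
        Reg.aux.injEq, Arr.aux.injEq, Nat.reduceEqDiff, hi, hj, h1, h2, h3, true_and, and_true, J,
          Φ]
      refine ⟨?_, fun hc => ?_, fun hc => ?_⟩
      · split_ifs <;> omega
      · have hj0 : j ≤ n := by by_contra h; simp [h] at hc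
        have h4 : s.arr .LCP j = A j := hA j (by simp; omega)
        rw [h4] at hc
        have hle : A i ≤ A j := by by_contra h; simp [h] at hc
        rw [hJ1 j hji hj0, nsvDepth_pos A hj0]
        have h5 := lt_NSV (A := A) hj0
        refine ⟨⟨hin, NSV_le, by omega, hJ1, fun _ h h6 h7 => ?_⟩, by omega⟩
        rcases Nat.lt_or_ge h j with h8 | h8
        · exact hJ2 h h6 h8
        · exact hle.trans (le_of_lt_NSV h7 h8)
      · have h5 : NSV n A i = j := by
          refine NSV_eq hji hjn (fun hj0 => ?_) hJ2
          rw [hA j (by simp; omega)] at hc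
          by_contra h
          simp [show A i ≤ A j by omega, show j ≤ n by omega] at hc
        refine ⟨by omega,
          ⟨by omega, by omega, by omega, fun i' h6 h7 => ?_, fun _ h h6 h7 => by omega⟩, ?_⟩
        · rw [Function.update_apply]
          split
          · next h => rw [h, h5]
          · exact hJ1 i' (by omega) h7
        · rw [nsvDepth_pos A hin, h5]
          omega
    · rintro t s'' - - ⟨ht, hJ', hΦ⟩
      simp only [Com.cost, Expr.cost] at ht ⊢
      exact ⟨hJ', by omega⟩
  · rintro t s' - hag ⟨hJ, hv, ht⟩
    simp only [Expr.val] at hv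
    obtain ⟨-, -, -, hJ1, -⟩ := hJ
    rw [hv] at hJ1
    have h0 : nsvDepth n A (n + 1) = 0 := by rw [nsvDepth, dif_pos (by omega)]
    simp only [Φ, Store.setReg_reg, if_true, if_false, reduceCtorEq, Reg.aux.injEq,
      Nat.reduceEqDiff, Expr.cost, h0] at ht
    simp only [Com.cost, Expr.cost] at ht₁ ht₂
    refine ⟨by omega, fun i hi => ?_⟩
    rw [Finset.mem_Icc] at hi
    exact hJ1 i (by omega) hi.2

/-! ### The arrays `SBPR`, `SAPR` and `SLPR` by scanning -/

section Scan

variable {n : ℕ} {T : ℕ → ℕ}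

theorem maxArgmin_singleton (A : ℕ → ℕ) (a : ℕ) : maxArgmin A {a} = a :=
  Finset.mem_singleton.mp (maxArgmin_mem (Finset.singleton_nonempty a))

theorem SBPR_first : SBPR n T 1 = 1 := SBPR_of_first fun h hh => by
  rw [show h = 1 by simpa using hh]

theorem SBPR_of_ne {i : ℕ} (hi : 2 ≤ i) (hne : BWTr n T (i - 1) ≠ BWTr n T i) :
    SBPR n T i = i := by
  rw [SBPR_of_run hi le_rfl hne (fun h hh => by rw [show h = i by simpa using hh]), Finset.Icc_self,
    maxArgmin_singleton]

/-- Within a run, `SBPR` moves to the new index if the minimum is attained there. The value `1`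
says that the run is the first one. -/
theorem SBPR_of_eq {i : ℕ} (hi : 2 ≤ i) (heq : BWTr n T (i - 1) = BWTr n T i) :
    SBPR n T i = if SBPR n T (i - 1) = 1 then 1
      else if LCPr n T i ≤ LCPr n T (SBPR n T (i - 1)) then i else SBPR n T (i - 1) := by
  rcases exists_run_start (A := BWTr n T) (i := i - 1) (by omega) with h1 | ⟨s, h1, h2, h3, h4⟩
  · rw [SBPR_of_first h1, if_pos rfl]
    refine SBPR_of_first fun h hh => ?_
    rw [Finset.mem_Icc] at hh
    rcases Nat.lt_or_ge h i with h2 | h2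
    · rw [h1 h (by simp; omega), heq]
    · rw [show h = i by omega]
  · have h5 : ∀ h ∈ Finset.Icc s i, BWTr n T h = BWTr n T i := by
      intro h hh
      rw [Finset.mem_Icc] at hh
      rcases Nat.lt_or_ge h i with h5 | h5
      · rw [h4 h (by simp; omega), heq]
      · rw [show h = i by omega]
    rw [SBPR_of_run h1 h2 h3 h4, SBPR_of_run h1 (by omega) (by rwa [heq] at h3) h5]
    have hm := Finset.mem_Icc.mp (maxArgmin_mem (A := LCPr n T) (s := Finset.Icc s (i - 1))
      ⟨s, by simp; omega⟩)
    have hle := fun b hb => maxArgmin_le (A := LCPr n T) (s := Finset.Icc s (i - 1)) (b := b) hb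
    have hge := fun a ha h => le_maxArgmin (A := LCPr n T) (s := Finset.Icc s (i - 1)) (a := a) ha h
    generalize maxArgmin (LCPr n T) (Finset.Icc s (i - 1)) = p at *
    rw [if_neg (by omega)]
    split
    · next h6 =>
      refine maxArgmin_eq (by simp; omega) (fun b hb => ?_) (fun b hb hlt => ?_)
      · rw [Finset.mem_Icc] at hb
        rcases Nat.lt_or_ge b i with h7 | h7
        · exact h6.trans (hle b (by simp; omega))
        · rw [show b = i by omega]
      · rw [Finset.mem_Icc] at hb; omega
    · next h6 =>
      refine maxArgmin_eq (by simp; omega) (fun b hb => ?_) (fun b hb hlt => ?_) <;>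
        rw [Finset.mem_Icc] at hb <;> rcases Nat.lt_or_ge b i with h7 | h7
      · exact hle b (by simp; omega)
      · rw [show b = i by omega]; omega
      · refine lt_of_le_of_ne (hle b (by simp; omega)) fun h8 => ?_
        have := hge b (by simp; omega) fun c hc => h8 ▸ hle c hc
        omega
      · rw [show b = i by omega]; omega

theorem SAPR_last : SAPR n T n = 1 := SAPR_of_last fun h hh => by
  rw [show h = n by simpa using hh]

theorem SAPR_of_ne {i : ℕ} (hi : i + 1 ≤ n) (hne : BWTr n T (i + 1) ≠ BWTr n T i) :
    SAPR n T i = i + 1 := by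
  rw [SAPR_of_run hi le_rfl hne (fun h hh => by rw [show h = i by simpa using hh]), Finset.Icc_self,
    maxArgmin_singleton]

/-- Within a run, `SAPR[i]` is found from `SAPR[i + 1]` and the LCP value at `i + 1`. The value `1`
says that the run is the last one. -/
theorem SAPR_of_eq {i : ℕ} (hi1 : 1 ≤ i) (hi : i + 1 ≤ n) (heq : BWTr n T (i + 1) = BWTr n T i) :
    SAPR n T i = if SAPR n T (i + 1) = 1 then 1
      else if LCPr n T (SAPR n T (i + 1)) ≤ LCPr n T (i + 1) then SAPR n T (i + 1)
      else i + 1 := by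
  rcases exists_run_end (A := BWTr n T) hi with h1 | ⟨e, h1, h2, h3, h4⟩
  · rw [SAPR_of_last h1, if_pos rfl]
    refine SAPR_of_last fun h hh => ?_
    rw [Finset.mem_Icc] at hh
    rcases Nat.lt_or_ge i h with h2 | h2
    · rw [h1 h (by simp; omega), heq]
    · rw [show h = i by omega]
  · have h5 : ∀ h ∈ Finset.Icc i e, BWTr n T h = BWTr n T i := by
      intro h hh
      rw [Finset.mem_Icc] at hh
      rcases Nat.lt_or_ge i h with h5 | h5
      · rw [h4 h (by simp; omega), heq]
      · rw [show h = i by omega]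
    rw [SAPR_of_run h2 h1 h3 h4, SAPR_of_run h2 (by omega) (by rwa [heq] at h3) h5]
    have hm := Finset.mem_Icc.mp (maxArgmin_mem (A := LCPr n T)
      (s := Finset.Icc (i + 1 + 1) (e + 1)) ⟨e + 1, by simp; omega⟩)
    have hle := fun b hb => maxArgmin_le (A := LCPr n T)
      (s := Finset.Icc (i + 1 + 1) (e + 1)) (b := b) hb
    have hge := fun a ha h => le_maxArgmin (A := LCPr n T)
      (s := Finset.Icc (i + 1 + 1) (e + 1)) (a := a) ha h
    generalize maxArgmin (LCPr n T) (Finset.Icc (i + 1 + 1) (e + 1)) = p at *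
    rw [if_neg (by omega)]
    split
    · next h6 =>
      refine maxArgmin_eq (by simp; omega) (fun b hb => ?_) (fun b hb hlt => ?_) <;>
        rw [Finset.mem_Icc] at hb <;> rcases Nat.lt_or_ge (i + 1) b with h7 | h7
      · exact hle b (by simp; omega)
      · rwa [show b = i + 1 by omega]
      · refine lt_of_le_of_ne (hle b (by simp; omega)) fun h8 => ?_
        have := hge b (by simp; omega) fun c hc => h8 ▸ hle c hc
        omega
      · omega
    · next h6 =>
      refine maxArgmin_eq (by simp; omega) (fun b hb => ?_) (fun b hb hlt => ?_) <;>
        rw [Finset.mem_Icc] at hb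
      · rcases Nat.lt_or_ge (i + 1) b with h7 | h7
        · have := hle b (by simp; omega)
          omega
        · rw [show b = i + 1 by omega]
      · have := hle b (by simp; omega)
        omega

end Scan

/-- The array `SBPR`. -/
abbrev aSb : Arr := .aux 13
/-- The array `SAPR`. -/
abbrev aSa : Arr := .aux 14

/-- Computes `SBPR` from left to right. -/
def fillSBPR : Com :=
  forUp rI (.lit 1) (.reg .n)
    (.seq (.assign rT (.get aSb (.bin .sub (.reg rI) (.lit 1))))
    (.cond (.bin .eq (.reg rI) (.lit 1))
      (.put aSb (.reg rI) (.lit 1))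
      (.cond (.bin .eq (.get .BWT (.bin .sub (.reg rI) (.lit 1))) (.get .BWT (.reg rI)))
        (.cond (.bin .eq (.reg rT) (.lit 1))
          (.put aSb (.reg rI) (.lit 1))
          (.cond (.bin .le (.get .LCP (.reg rI)) (.get .LCP (.reg rT)))
            (.put aSb (.reg rI) (.reg rI))
            (.put aSb (.reg rI) (.reg rT))))
        (.put aSb (.reg rI) (.reg rI)))))

/-- Computes `SAPR` from right to left. -/
def fillSAPR : Com :=
  forUp rI (.lit 1) (.reg .n)
    (.seq (.assign rU (.bin .sub (.bin .add (.reg .n) (.lit 1)) (.reg rI)))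
    (.seq (.assign rT (.get aSa (.bin .add (.reg rU) (.lit 1))))
    (.cond (.bin .eq (.reg rI) (.lit 1))
      (.put aSa (.reg rU) (.lit 1))
      (.cond (.bin .eq (.get .BWT (.bin .add (.reg rU) (.lit 1))) (.get .BWT (.reg rU)))
        (.cond (.bin .eq (.reg rT) (.lit 1))
          (.put aSa (.reg rU) (.lit 1))
          (.cond (.bin .le (.get .LCP (.reg rT)) (.get .LCP (.bin .add (.reg rU) (.lit 1))))
            (.put aSa (.reg rU) (.reg rT))
            (.put aSa (.reg rU) (.bin .add (.reg rU) (.lit 1)))))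
        (.put aSa (.reg rU) (.bin .add (.reg rU) (.lit 1)))))))

/-- Computes `SLPR`. -/
def fillSLPR : Com :=
  forUp rI (.lit 1) (.reg .n)
    (.seq (.assign rT (.get aSb (.reg rI)))
    (.seq (.assign rU (.get aSa (.reg rI)))
    (.cond (.bin .lt (.get .LCP (.reg rT)) (.get .LCP (.reg rU)))
      (.put .SLPR (.reg rI) (.reg rU))
      (.cond (.bin .lt (.get .LCP (.reg rU)) (.get .LCP (.reg rT)))
        (.put .SLPR (.reg rI) (.reg rT))
        (.cond (.bin .le (.reg rT) (.reg rU))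
          (.put .SLPR (.reg rI) (.reg rU))
          (.put .SLPR (.reg rI) (.reg rT)))))))

theorem forall_update_of_lt {P : ℕ → ℕ} {A : ℕ → ℕ} {k v : ℕ} (h : ∀ i, 1 ≤ i → i < k → A i = P i)
    (hv : v = P k) : ∀ i, 1 ≤ i → i < k + 1 → Function.update A k v i = P i := by
  intro i h1 h2
  rw [Function.update_apply]
  split
  · next h3 => rw [h3, hv]
  · exact h i h1 (by omega)

theorem SBPR_mem {n : ℕ} {T : ℕ → ℕ} {i : ℕ} (hi : 1 ≤ i) (hin : i ≤ n) :
    SBPR n T i ∈ Finset.Icc 1 n := by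
  rw [Finset.mem_Icc]
  rcases SBPR_cases (T := T) hi hin with ⟨h, -⟩ | ⟨h1, h2, -⟩ <;> omega

theorem SAPR_mem {n : ℕ} {T : ℕ → ℕ} {i : ℕ} (hi : 1 ≤ i) (hin : i ≤ n) :
    SAPR n T i ∈ Finset.Icc 1 n := by
  rw [Finset.mem_Icc]
  rcases SAPR_cases (T := T) hi hin with ⟨h, -⟩ | ⟨h1, h2, -⟩ <;> omega

theorem fillSBPR_runs {N n : ℕ} {T : ℕ → ℕ} {s : Store} (hN : 4 * n + 20 < N)
    (hrn : s.reg .n = n) (hB : ∀ i ∈ Finset.Icc 1 n, s.arr .BWT i = BWTr n T i)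
    (hL : ∀ i ∈ Finset.Icc 1 n, s.arr .LCP i = LCPr n T i) :
    Runs N fillSBPR s fun t s' => t ≤ 60 * (n + 1) ∧
      ∀ i ∈ Finset.Icc 1 n, s'.arr aSb i = SBPR n T i := by
  refine (Runs.forUp (by omega) (L := 1) (b := 40) (fun k s' => ∀ i, 1 ≤ i → i < k →
    s'.arr aSb i = SBPR n T i) rfl rfl (by decide) (by omega)
    (by omega) (by omega) (fun i h1 h2 => by omega) ?_).mono ?_
  · intro k s' hk1 hk2 hf hag hk hI
    rw [hrn] at hk2
    have h1 : s'.arr .BWT = s.arr .BWT := hag.arr .BWT rfl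
    have h2 : s'.arr .LCP = s.arr .LCP := hag.arr .LCP rfl
    refine (Runs.straight (by omega) (Q := fun s' => ∀ i, 1 ≤ i → i < k + 1 →
      s'.arr aSb i = SBPR n T i) ?_).mono ?_
    · simp only [Com.wp, Expr.Safe, Expr.val, Op.Safe, Op.apply, Store.setReg_reg,
        Store.setReg_arr, Store.setArr_arr, Store.setArr_reg, if_true, if_false, reduceCtorEq,
        Reg.aux.injEq, Arr.aux.injEq, Nat.reduceEqDiff, hk, h1, h2, true_and, and_true]
      refine ⟨by omega, by omega, fun hc1 => ⟨by omega, forall_update_of_lt hI ?_⟩, fun hc1 => ?_⟩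
      · have e1 : k = 1 := by by_contra h; simp [h] at hc1
        rw [e1, SBPR_first]
      have e1 : k ≠ 1 := by intro h; simp [h] at hc1
      rw [hB k (by simp; omega), hB (k - 1) (by simp; omega), hI (k - 1) (by omega) (by omega)]
      refine ⟨by omega, fun hc2 => ⟨by omega, fun hc3 => ⟨by omega, forall_update_of_lt hI ?_⟩,
        fun hc3 => ?_⟩, fun hc2 => forall_update_of_lt hI ?_⟩
      · have e2 : BWTr n T (k - 1) = BWTr n T k := by by_contra h; simp [h] at hc2
        have e3 : SBPR n T (k - 1) = 1 := by by_contra h; simp [h] at hc3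
        rw [SBPR_of_eq (by omega) e2, if_pos e3]
      · have e2 : BWTr n T (k - 1) = BWTr n T k := by by_contra h; simp [h] at hc2
        have e3 : SBPR n T (k - 1) ≠ 1 := by intro h; simp [h] at hc3
        rw [hL k (by simp; omega), hL _ (SBPR_mem (by omega) (by omega))]
        have e4 := SBPR_of_eq (by omega) e2
        rw [if_neg e3] at e4
        refine ⟨fun hc4 => forall_update_of_lt hI ?_, fun hc4 => forall_update_of_lt hI ?_⟩
        · rw [e4, if_pos]
          by_contra h; simp [h] at hc4
        · rw [e4, if_neg]
          intro h; simp [h] at hc4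
      · have e2 : BWTr n T (k - 1) ≠ BWTr n T k := by intro h; simp [h] at hc2
        rw [SBPR_of_ne (by omega) e2]
    · rintro t s'' - - ⟨ht, h⟩
      exact ⟨ht.trans (by decide), h⟩
  · rintro t s' - - ⟨ht, -, hI⟩
    rw [hrn] at ht hI
    refine ⟨by omega, fun i hi => ?_⟩
    rw [Finset.mem_Icc] at hi
    exact hI i hi.1 (by omega)

theorem fillSAPR_runs {N n : ℕ} {T : ℕ → ℕ} {s : Store} (hN : 4 * n + 20 < N)
    (hrn : s.reg .n = n) (hB : ∀ i ∈ Finset.Icc 1 n, s.arr .BWT i = BWTr n T i)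
    (hL : ∀ i ∈ Finset.Icc 1 n, s.arr .LCP i = LCPr n T i) :
    Runs N fillSAPR s fun t s' => t ≤ 60 * (n + 1) ∧
      ∀ i ∈ Finset.Icc 1 n, s'.arr aSa i = SAPR n T i := by
  refine (Runs.forUp (by omega) (L := 1) (b := 50) (fun k s' => ∀ i, n + 1 < i + k → i ≤ n →
    s'.arr aSa i = SAPR n T i) rfl rfl (by decide) (by omega)
    (by omega) (by omega) (fun i h1 h2 => by omega) ?_).mono ?_
  · intro k s' hk1 hk2 hf hag hk hI
    rw [hrn] at hk2
    have h0 : s'.reg .n = n := (hag.reg .n rfl).trans hrn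
    have h1 : s'.arr .BWT = s.arr .BWT := hag.arr .BWT rfl
    have h2 : s'.arr .LCP = s.arr .LCP := hag.arr .LCP rfl
    obtain ⟨u, hu⟩ : ∃ u, u = n + 1 - k := ⟨_, rfl⟩
    have hstep : ∀ v, v = SAPR n T u → ∀ i, n + 1 < i + (k + 1) → i ≤ n →
        Function.update (s'.arr aSa) u v i = SAPR n T i := by
      rintro v rfl i h3 h4
      rw [Function.update_apply]
      split
      · next h5 => rw [h5]
      · exact hI i (by omega) h4
    refine (Runs.straight (by omega) (Q := fun s' => ∀ i, n + 1 < i + (k + 1) → i ≤ n →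
      s'.arr aSa i = SAPR n T i) ?_).mono ?_
    · simp only [Com.wp, Expr.Safe, Expr.val, Op.Safe, Op.apply, Store.setReg_reg,
        Store.setReg_arr, Store.setArr_arr, Store.setArr_reg, if_true, if_false, reduceCtorEq,
        Reg.aux.injEq, Arr.aux.injEq, Nat.reduceEqDiff, hk, h0, h1, h2, true_and, and_true, ← hu]
      refine ⟨⟨by omega, by omega⟩, ⟨by omega, by omega⟩, by omega, fun hc1 =>
        ⟨by omega, hstep _ ?_⟩,
        fun hc1 => ?_⟩
      · have e1 : k = 1 := by by_contra h; simp [h] at hc1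
        rw [show u = n by omega, SAPR_last]
      have e1 : k ≠ 1 := by intro h; simp [h] at hc1
      rw [hB u (by simp; omega), hB (u + 1) (by simp; omega), hI (u + 1) (by omega) (by omega)]
      refine ⟨⟨by omega, by omega⟩, fun hc2 => ⟨by omega, fun hc3 => ⟨by omega, hstep _ ?_⟩,
        fun hc3 => ?_⟩, fun hc2 => ⟨⟨by omega, by omega⟩, hstep _ ?_⟩⟩
      · have e2 : BWTr n T (u + 1) = BWTr n T u := by by_contra h; simp [h] at hc2
        have e3 : SAPR n T (u + 1) = 1 := by by_contra h; simp [h] at hc3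
        rw [SAPR_of_eq (by omega) (by omega) e2, if_pos e3]
      · have e2 : BWTr n T (u + 1) = BWTr n T u := by by_contra h; simp [h] at hc2
        have e3 : SAPR n T (u + 1) ≠ 1 := by intro h; simp [h] at hc3
        rw [hL (u + 1) (by simp; omega), hL _ (SAPR_mem (by omega) (by omega))]
        have e4 := SAPR_of_eq (by omega) (by omega) e2
        rw [if_neg e3] at e4
        refine ⟨⟨by omega, by omega⟩, fun hc4 => hstep _ ?_, fun hc4 => ⟨⟨by omega, by omega⟩,
          hstep _ ?_⟩⟩
        · rw [e4, if_pos]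
          by_contra h; simp [h] at hc4
        · rw [e4, if_neg]
          intro h; simp [h] at hc4
      · have e2 : BWTr n T (u + 1) ≠ BWTr n T u := by intro h; simp [h] at hc2
        rw [SAPR_of_ne (by omega) e2]
    · rintro t s'' - - ⟨ht, h⟩
      exact ⟨ht.trans (by decide), h⟩
  · rintro t s' - - ⟨ht, -, hI⟩
    rw [hrn] at ht hI
    refine ⟨by omega, fun i hi => ?_⟩
    rw [Finset.mem_Icc] at hi
    exact hI i (by omega) hi.2

theorem fillSLPR_runs {N n : ℕ} {T : ℕ → ℕ} {s : Store} (hN : 4 * n + 20 < N)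
    (hrn : s.reg .n = n) (hL : ∀ i ∈ Finset.Icc 1 n, s.arr .LCP i = LCPr n T i)
    (hb : ∀ i ∈ Finset.Icc 1 n, s.arr aSb i = SBPR n T i)
    (ha : ∀ i ∈ Finset.Icc 1 n, s.arr aSa i = SAPR n T i) :
    Runs N fillSLPR s fun t s' => t ≤ 60 * (n + 1) ∧
      ∀ i ∈ Finset.Icc 1 n, s'.arr .SLPR i = SLPR n T i := by
  refine (Runs.forUp (by omega) (L := 1) (b := 40) (fun k s' => ∀ i, 1 ≤ i → i < k →
    s'.arr .SLPR i = SLPR n T i) rfl rfl (by decide) (by omega)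
    (by omega) (by omega) (fun i h1 h2 => by omega) ?_).mono ?_
  · intro k s' hk1 hk2 hf hag hk hI
    rw [hrn] at hk2
    have h1 : s'.arr aSb = s.arr aSb := hag.arr aSb rfl
    have h2 : s'.arr aSa = s.arr aSa := hag.arr aSa rfl
    have h3 : s'.arr .LCP = s.arr .LCP := hag.arr .LCP rfl
    have hS := maxArgmax_pair (LCPr n T) (SBPR n T k) (SAPR n T k)
    change SLPR n T k = _ at hS
    refine (Runs.straight (by omega) (Q := fun s' => ∀ i, 1 ≤ i → i < k + 1 →
      s'.arr .SLPR i = SLPR n T i) ?_).mono ?_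
    · simp only [Com.wp, Expr.Safe, Expr.val, Op.Safe, Op.apply, Store.setReg_reg,
        Store.setReg_arr, Store.setArr_arr, Store.setArr_reg, if_true, if_false, reduceCtorEq,
        Reg.aux.injEq, Arr.aux.injEq, Nat.reduceEqDiff, hk, h1, h2, h3, true_and, and_true]
      rw [hb k (by simp; omega), ha k (by simp; omega), hL _ (SBPR_mem hk1 hk2),
        hL _ (SAPR_mem hk1 hk2)]
      refine ⟨fun hc1 => forall_update_of_lt hI ?_, fun hc1 =>
        ⟨fun hc2 => forall_update_of_lt hI ?_,
        fun hc2 => ⟨fun hc3 => forall_update_of_lt hI ?_,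
          fun hc3 => forall_update_of_lt hI ?_⟩⟩⟩ <;>
        (rw [hS]; split_ifs at * <;> simp_all; try omega)
    · rintro t s'' - - ⟨ht, h⟩
      exact ⟨ht.trans (by decide), h⟩
  · rintro t s' - - ⟨ht, -, hI⟩
    rw [hrn] at ht hI
    refine ⟨by omega, fun i hi => ?_⟩
    rw [Finset.mem_Icc] at hi
    exact hI i hi.1 (by omega)

/-! ### The whole program -/

/-- Computes all arrays of the reversed text. -/
def prepare : Com :=
  .seq suffixSort (.seq fillSA (.seq fillLCP (.seq fillPSV (.seq fillNSV
    (.seq fillSBPR (.seq fillSAPR fillSLPR))))))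

theorem IsText.mem_Icc {n σ : ℕ} {T : ℕ → ℕ} (hT : IsText n σ T) {p : ℕ} (h1 : 1 ≤ p)
    (h2 : p ≤ n) : 1 ≤ T p ∧ T p ≤ n := by
  have h3 := Finset.mem_Icc.mp (hT.mem_alphabet p (Finset.mem_Icc.mpr ⟨h1, h2⟩))
  have h4 := hT.sigma_le
  omega

theorem prepare_runs {N n σ : ℕ} {T : ℕ → ℕ} {L : List ℕ} (hN : 4 * n + 20 < N)
    (hT : IsText n σ T) :
    Runs N prepare (input n σ T L) fun t s' => t ≤ 31000 * (n + 1) ∧ Prepared n σ T L s' := by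
  set s := input n σ T L with hs
  have hsT : ∀ p, 1 ≤ p → p ≤ n → s.arr .T p = T p := fun p h1 h2 => by
    simp [hs, input, h1, h2]
  have hrev : ∀ p, 1 ≤ p → p ≤ n → s.arr .T (n + 1 - p) = rev n T p ∧ 1 ≤ rev n T p := by
    intro p h1 h2
    rw [hsT _ (by omega) (by omega)]
    exact ⟨rfl, (hT.mem_Icc (p := n + 1 - p) (by omega) (by omega)).1⟩
  refine Runs.seq ((suffixSort_runs (X := rev n T) hN rfl (fun p h1 h2 => (hrev p h1 h2).1)
    (fun p h1 h2 => hT.mem_Icc (by omega) (by omega)) (fun _ => rfl) (fun _ => rfl)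
    (fun _ => rfl)).mono ?_)
  rintro t₁ s₁ - a₁ ⟨ht₁, hR⟩
  have n₁ : s₁.reg .n = n := a₁.reg .n rfl
  have T₁ : s₁.arr .T = s.arr .T := a₁.arr .T rfl
  refine Runs.seq ((fillSA_runs hN n₁ (by rw [T₁]; exact hsT) hR).mono ?_)
  rintro t₂ s₂ - a₂ ⟨ht₂, hI₂, hS₂, hB₂⟩
  have n₂ : s₂.reg .n = n := (a₂.reg .n rfl).trans n₁
  have T₂ : s₂.arr .T = s.arr .T := (a₂.arr .T rfl).trans T₁
  refine Runs.seq ((fillLCP_runs (X := rev n T) hN n₂ (by rw [T₂]; exact hrev)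
    (by rw [T₂]; rfl) hI₂ hS₂).mono ?_)
  rintro t₃ s₃ - a₃ ⟨ht₃, hL₃⟩
  change ∀ i ∈ Finset.Icc 1 n, s₃.arr .LCP i = LCPr n T i at hL₃
  have n₃ : s₃.reg .n = n := (a₃.reg .n rfl).trans n₂
  refine Runs.seq ((fillPSV_runs hN n₃ hL₃).mono ?_)
  rintro t₄ s₄ - a₄ ⟨ht₄, hP₄⟩
  have n₄ : s₄.reg .n = n := (a₄.reg .n rfl).trans n₃
  have hL₄ : s₄.arr .LCP = s₃.arr .LCP := a₄.arr .LCP rfl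
  refine Runs.seq ((fillNSV_runs hN n₄ (by rw [hL₄]; exact hL₃)).mono ?_)
  rintro t₅ s₅ - a₅ ⟨ht₅, hN₅⟩
  have n₅ : s₅.reg .n = n := (a₅.reg .n rfl).trans n₄
  have hL₅ : s₅.arr .LCP = s₃.arr .LCP := (a₅.arr .LCP rfl).trans hL₄
  have hB₅ : s₅.arr .BWT = s₂.arr .BWT :=
    (a₅.arr .BWT rfl).trans ((a₄.arr .BWT rfl).trans (a₃.arr .BWT rfl))
  refine Runs.seq ((fillSBPR_runs (T := T) hN n₅ (by rw [hB₅]; exact hB₂)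
    (by rw [hL₅]; exact hL₃)).mono ?_)
  rintro t₆ s₆ - a₆ ⟨ht₆, hb₆⟩
  have n₆ : s₆.reg .n = n := (a₆.reg .n rfl).trans n₅
  have hL₆ : s₆.arr .LCP = s₃.arr .LCP := (a₆.arr .LCP rfl).trans hL₅
  have hB₆ : s₆.arr .BWT = s₂.arr .BWT := (a₆.arr .BWT rfl).trans hB₅
  refine Runs.seq ((fillSAPR_runs (T := T) hN n₆ (by rw [hB₆]; exact hB₂)
    (by rw [hL₆]; exact hL₃)).mono ?_)
  rintro t₇ s₇ - a₇ ⟨ht₇, ha₇⟩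
  have n₇ : s₇.reg .n = n := (a₇.reg .n rfl).trans n₆
  have hL₇ : s₇.arr .LCP = s₃.arr .LCP := (a₇.arr .LCP rfl).trans hL₆
  have hb₇ : s₇.arr aSb = s₆.arr aSb := a₇.arr aSb rfl
  refine (fillSLPR_runs (T := T) hN n₇ (by rw [hL₇]; exact hL₃)
    (by rw [hb₇]; exact hb₆) ha₇).mono ?_
  rintro t₈ s₈ - a₈ ⟨ht₈, hS₈⟩
  have arr_eq : ∀ a, a = .T ∨ a = .S → s₈.arr a = s.arr a := by
    rintro a (rfl | rfl) <;>
    exact (a₈.arr _ rfl).trans ((a₇.arr _ rfl).trans ((a₆.arr _ rfl).trans ((a₅.arr _ rfl).trans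
      ((a₄.arr _ rfl).trans ((a₃.arr _ rfl).trans ((a₂.arr _ rfl).trans (a₁.arr _ rfl)))))))
  have reg_eq : ∀ r, r = .n ∨ r = .sigma ∨ r = .m → s₈.reg r = s.reg r := by
    rintro r (rfl | rfl | rfl) <;>
    exact (a₈.reg _ rfl).trans ((a₇.reg _ rfl).trans ((a₆.reg _ rfl).trans ((a₅.reg _ rfl).trans
      ((a₄.reg _ rfl).trans ((a₃.reg _ rfl).trans ((a₂.reg _ rfl).trans (a₁.reg _ rfl)))))))
  refine ⟨by omega, ?_, ?_, ?_, ?_, ?_, hS₈, reg_eq _ (by simp), reg_eq _ (by simp),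
    reg_eq _ (by simp), ?_, ?_⟩
  · rw [a₈.arr .BWT rfl, a₇.arr .BWT rfl, hB₆]; exact hB₂
  · rw [a₈.arr .ISA rfl, a₇.arr .ISA rfl, a₆.arr .ISA rfl, a₅.arr .ISA rfl, a₄.arr .ISA rfl,
      a₃.arr .ISA rfl]
    exact hI₂
  · rw [a₈.arr .LCP rfl, hL₇]; exact hL₃
  · rw [a₈.arr .PSV rfl, a₇.arr .PSV rfl, a₆.arr .PSV rfl, a₅.arr .PSV rfl]; exact hP₄
  · rw [a₈.arr .NSV rfl, a₇.arr .NSV rfl, a₆.arr .NSV rfl]; exact hN₅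
  · rw [arr_eq _ (.inl rfl)]
    intro j hj
    rw [Finset.mem_Icc] at hj
    exact hsT j hj.1 hj.2
  · rw [arr_eq _ (.inr rfl)]
    intro j hj
    rw [Finset.mem_Icc] at hj
    simp [hs, input, hj.1, hj.2]

/-- The input consists of words. -/
theorem input_fits {N n σ : ℕ} {T : ℕ → ℕ} {L : List ℕ} (hN : n < N) (hT : IsText n σ T)
    (hL : L.Nodup) (hmem : ∀ x ∈ L, x ∈ Finset.Icc 1 n) : Fits N (input n σ T L) := by
  have hσ := hT.sigma_le
  have hm := nodup_length_le hL hmem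
  constructor
  · intro r
    cases r <;> simp only [input] <;> omega
  · intro a j
    cases a <;> simp only [input] <;> try omega
    · split
      · next h => exact (hT.mem_Icc h.1 h.2).2.trans_lt hN
      · omega
    · split
      · next h =>
        have := Finset.mem_Icc.mp (hmem _ (getD_mem_iff.mpr ⟨j, Finset.mem_Icc.mpr h, rfl⟩))
        omega
      · omega

end SuffixientSets

theorem mainTheorem2 :
    ∃ (pre : Com) (B C : ℕ), ∀ (n σ : ℕ) (T : ℕ → ℕ), IsText n σ T →
      (minimalityTest pre).space (B * n) ≤ C * n ∧
      ∀ L : List ℕ, L.Nodup → (∀ x ∈ L, x ∈ Finset.Icc 1 n) →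
        (∃ (t : ℕ) (s : Store),
          Exec (B * n) pre (input n σ T L) t s ∧ Prepared n σ T L s) ∧
        ∃ (t : ℕ) (s : Store),
          Exec (B * n) (minimalityTest pre) (input n σ T L) t s ∧ t ≤ C * n ∧
          (s.reg .res = 0 ∨ s.reg .res = 1) ∧
          (s.reg .res = 0 ↔ ConsecutiveOverlap n σ T L.toFinset) ∧
          (IsSuffixient n T L.toFinset →
            (s.reg .res = 1 ↔ IsMinSuffixient n T L.toFinset)) := by
  -- The number of arrays and registers of the program is a constant. As `2 ≤ n`, words below
  -- `20 * n` can hold all numbers and addresses that occur, and `n + 1 ≤ 2 * n` absorbs the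
  -- additive constants of the time bounds.
  refine ⟨prepare, 20, (minimalityTest prepare).arrs.card * 20 +
    (minimalityTest prepare).regs.card + 63000, fun n σ T hT => ⟨?_, fun L hL hmem => ?_⟩⟩
  · have hn := hT.two_le
    have h1 : (minimalityTest prepare).regs.card ≤ (minimalityTest prepare).regs.card * n :=
      Nat.le_mul_of_pos_right _ (by omega)
    rw [Com.space, Nat.add_mul, Nat.add_mul, Nat.mul_assoc]
    omega
  · have hn := hT.two_le
    have hfits : Fits (20 * n) (input n σ T L) := input_fits (by omega) hT hL hmem
    have hpre := prepare_runs (N := 20 * n) (L := L) (by omega) hT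
    refine ⟨?_, ?_⟩
    · obtain ⟨t, s, he, -, hp⟩ := hpre hfits
      exact ⟨t, s, he, hp⟩
    · have htest : Runs (20 * n) (minimalityTest prepare) (input n σ T L) fun t s' =>
          t ≤ 63000 * n ∧ (s'.reg .res = 0 ∨ s'.reg .res = 1) ∧
            (s'.reg .res = 0 ↔ ConsecutiveOverlap n σ T L.toFinset) := by
        refine Runs.seq (hpre.mono ?_)
        rintro t s - - ⟨ht, hp⟩
        refine (test_runs hT (by omega) hL hmem hp).mono ?_
        rintro t' s' - - ⟨ht', h⟩
        exact ⟨by omega, h⟩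
      obtain ⟨t, s, he, ht, hres, hov⟩ := htest hfits
      refine ⟨t, s, he, ht.trans (Nat.mul_le_mul_right _ (by omega)), hres, hov, fun hsuf => ?_⟩
      have hsub : L.toFinset ⊆ Finset.Icc 1 n := fun x hx => hmem x (List.mem_toFinset.mp hx)
      rw [hT.isMinSuffixient_iff_not_overlap hsub hsuf, ← hov]
      omega
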